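/- Let $\mathbb F_q$ be a finite field of characteristic $p$, let $\gamma$ be a primitive element of $\mathbb F_q$, and put $m=p$, $n=q-1$, $\ell_1(x)=x+1$, $\ell_2(x)=\gamma x$, $\alpha_0=0$, $\beta_0=1$. (For $q>2$, $\ell_1,\ell_2$ are affine permutations of $\mathbb F_q$ of coprime orders $m$ and $n$, and $\alpha_0,\beta_0$ are not fixed points of $\ell_1,\ell_2$, respectively.) For positive integers $s\le m$, $t\le n$, the permuted product code $C_{\mathrm{PPC}}(s,t)\subseteq(\mathbb F_q^m)^n$ over the alphabet $\mathbb F_q^m$ consists of the words whose $j$-th symbol ($0\le j<n$) is the column vector $\big(f(\ell_1^{jm+i}(\alpha_0),\ell_2^{jm+i}(\beta_0))\big)_{0\le i<m}$, where $f$ runs over all polynomials in $\mathbb F_q[x,y]$ with $\deg_x f<s$ and $\deg_y f<t$. The rate of a code $C\subseteq\Sigma^n$ is $\log_{|\Sigma|}|C|/n$. There are absolute constants $c_1,c,K>0$, $d\in\mathbb N$ and one randomized algorithm (a random access machine with unit-cost arithmetic in $\mathbb F_q$ and fair coins; its program does not depend on any of the parameters) such that the following holds. Let $c_2>0$ and $R\in(0,1)$,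 let $\varepsilon>0$ be sufficiently small, let $p$ be a prime with $c_1/\varepsilon^3\le p\le c_2/\varepsilon^3$, let $q$ be any power of $p$, and let $\gamma$ be any primitive element of $\mathbb F_q$. Then there are $s,t$ such that the permuted product code $C=C_{\mathrm{PPC}}(s,t)$, of block length $q-1$, has alphabet size at most $q^{c_2/\varepsilon^3}$ and rate in $[R,R+\frac1{q-1})$, and with $L=(1/\varepsilon)^{c/\varepsilon^2}$: (i) for every received word $r\in(\mathbb F_q^m)^n$, at most $L$ codewords of $C$ disagree with $r$ in at most a fraction $1-R-\varepsilon$ of the coordinates; (ii) for every $\alpha\in(0,1)$ and every received word $r$, the algorithm, given $r$, $\gamma$, $p,q,s,t$, $\lfloor(1-R-\varepsilon)(q-1)\rfloor$, $\lceil1/\varepsilon\rceil$ and $\lceil\log_2(1/\alpha)\rceil$, always halts within $K\,(\log(1/\alpha)+1/\varepsilon+q+L)^d$ steps, and with probability at least $1-\alpha$ it outputs exactly the list of the codewords in (i). -/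

import Mathlib

namespace PPC

/-! ### Permuted product codes -/

/-- The affine polynomial `a x + b` with `a ≠ 0`, as a permutation of the field. The affine group
is the group of these permutations under composition. -/
def affine {F : Type*} [Field F] (a : Fˣ) (b : F) : Equiv.Perm F :=
  (Units.mulLeft a).trans (Equiv.addRight b)

theorem affine_apply {F : Type*} [Field F] (a : Fˣ) (b x : F) : affine a b x = a * x + b := rfl

/-- The requirements on the data of a permuted product code: two affine polynomials of coprime
orders `m` and `n`, and a point that is not fixed for each of them. -/
structure IsInstance {F : Type*} [Field F] (a₁ : Fˣ) (b₁ : F) (a₂ : Fˣ) (b₂ : F) (α β : F)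
    (m n : ℕ) : Prop where
  order₁ : orderOf (affine a₁ b₁) = m
  order₂ : orderOf (affine a₂ b₂) = n
  coprime : Nat.Coprime m n
  not_fixed₁ : affine a₁ b₁ α ≠ α
  not_fixed₂ : affine a₂ b₂ β ≠ β

/-- The encoding `ev(f) ∈ (F^m)^n` of a bivariate polynomial `f`: row `i` of the `j`-th column is
`f(ℓ₁^(jm+i)(α), ℓ₂^(jm+i)(β))`. -/
noncomputable def ev {F : Type*} [Field F] (ℓ₁ ℓ₂ : Equiv.Perm F) (α β : F) (m n : ℕ)
    (f : MvPolynomial (Fin 2) F) : Fin n → Fin m → F :=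
  fun j i => MvPolynomial.eval
    ![(ℓ₁ ^ ((j : ℕ) * m + (i : ℕ))) α, (ℓ₂ ^ ((j : ℕ) * m + (i : ℕ))) β] f

/-- The permuted product code with parameters `s` and `t` (positive integers): all encodings of
polynomials `f(x,y)` with `deg_x f < s` and `deg_y f < t`. -/
def code {F : Type*} [Field F] (ℓ₁ ℓ₂ : Equiv.Perm F) (α β : F) (m n s t : ℕ) :
    Set (Fin n → Fin m → F) :=
  {c | ∃ f : MvPolynomial (Fin 2) F,
    MvPolynomial.degreeOf 0 f < s ∧ MvPolynomial.degreeOf 1 f < t ∧ c = ev ℓ₁ ℓ₂ α β m n f}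

/-! ### Rate and list decodability -/

/-- The rate `k / n` of a code `C ⊆ A^n`, where `|C| = |A|^k`. -/
noncomputable def rate {A : Type*} {n : ℕ} (C : Set (Fin n → A)) : ℝ :=
  Real.logb (Nat.card A) (C.ncard) / n

/-- The codewords that disagree with `r` in at most a fraction `ρ` of the coordinates. -/
def closeWords {A : Type*} [DecidableEq A] {n : ℕ} (C : Set (Fin n → A)) (ρ : ℝ)
    (r : Fin n → A) : Set (Fin n → A) :=
  {c | c ∈ C ∧ (hammingDist c r : ℝ) ≤ ρ * n}

/-- `(ρ, L)`-list decodability over a finite alphabet. -/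
def ListDecodable {A : Type*} [DecidableEq A] [Finite A] {n : ℕ} (C : Set (Fin n → A))
    (ρ L : ℝ) : Prop :=
  ∀ r : Fin n → A, ((closeWords C ρ r).ncard : ℝ) ≤ L

/-! ### Randomized random access machines over a finite field

A machine has a memory `nat` of natural numbers and a memory `fld` of field elements, both with
indirect addressing, and access to fair coins. A program does not depend on the field.
Operations in the field cost one step each. Products and quotients of natural numbers are charged
by the lengths of the operands, so that `T` steps only ever produce numbers of length
polynomial in `T` and in the length of the input numbers. -/

/-- Memory contents, and the number of coins tossed so far. -/
structure State (F : Type*) where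
  nat : ℕ → ℕ
  fld : ℕ → F
  pos : ℕ

/-- The elementary instructions. Arguments are addresses of cells of the memory `nat`; cells of
the memory `fld` are always addressed through the contents of a cell of `nat`. -/
inductive Instr where
  | const (i c : ℕ)
  | copy (i j : ℕ)
  | add (i j k : ℕ)
  | sub (i j k : ℕ)
  | mul (i j k : ℕ)
  | div (i j k : ℕ)
  | mod (i j k : ℕ)
  | load (i j : ℕ)
  | store (i j : ℕ)
  | coin (i : ℕ)
  | fzero (i : ℕ)
  | fone (i : ℕ)
  | fcopy (i j : ℕ)
  | fadd (i j k : ℕ)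
  | fsub (i j k : ℕ)
  | fmul (i j k : ℕ)
  | finv (i j : ℕ)
  | ftest (i j : ℕ)

/-- Write a natural number. -/
def State.setNat {F : Type*} (σ : State F) (i v : ℕ) : State F :=
  { σ with nat := Function.update σ.nat i v }

/-- Write a field element. -/
def State.setFld {F : Type*} (σ : State F) (i : ℕ) (v : F) : State F :=
  { σ with fld := Function.update σ.fld i v }

/-- The effect of an instruction; `ω` is the sequence of coin tosses. -/
def Instr.apply {F : Type*} [Field F] [DecidableEq F] (ω : ℕ → Bool) (σ : State F) :
    Instr → State F
  | .const i c => σ.setNat i c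
  | .copy i j => σ.setNat i (σ.nat j)
  | .add i j k => σ.setNat i (σ.nat j + σ.nat k)
  | .sub i j k => σ.setNat i (σ.nat j - σ.nat k)
  | .mul i j k => σ.setNat i (σ.nat j * σ.nat k)
  | .div i j k => σ.setNat i (σ.nat j / σ.nat k)
  | .mod i j k => σ.setNat i (σ.nat j % σ.nat k)
  | .load i j => σ.setNat i (σ.nat (σ.nat j))
  | .store i j => σ.setNat (σ.nat i) (σ.nat j)
  | .coin i => { σ.setNat i (if ω σ.pos then 1 else 0) with pos := σ.pos + 1 }
  | .fzero i => σ.setFld (σ.nat i) 0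
  | .fone i => σ.setFld (σ.nat i) 1
  | .fcopy i j => σ.setFld (σ.nat i) (σ.fld (σ.nat j))
  | .fadd i j k => σ.setFld (σ.nat i) (σ.fld (σ.nat j) + σ.fld (σ.nat k))
  | .fsub i j k => σ.setFld (σ.nat i) (σ.fld (σ.nat j) - σ.fld (σ.nat k))
  | .fmul i j k => σ.setFld (σ.nat i) (σ.fld (σ.nat j) * σ.fld (σ.nat k))
  | .finv i j => σ.setFld (σ.nat i) (σ.fld (σ.nat j))⁻¹
  | .ftest i j => σ.setNat i (if σ.fld (σ.nat j) = 0 then 0 else 1)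

/-- The number of steps charged for an instruction. -/
def Instr.cost {F : Type*} (σ : State F) : Instr → ℕ
  | .mul _ j k => 1 + Nat.size (σ.nat j) + Nat.size (σ.nat k)
  | .div _ j k => 1 + Nat.size (σ.nat j) + Nat.size (σ.nat k)
  | .mod _ j k => 1 + Nat.size (σ.nat j) + Nat.size (σ.nat k)
  | _ => 1

/-- Programs: instructions, sequencing, and branching and loops on whether a cell of the memory
`nat` is nonzero. -/
inductive Program where
  | skip
  | instr (a : Instr)
  | seq (P Q : Program)
  | ite (i : ℕ) (P Q : Program)
  | while (i : ℕ) (P : Program)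

/-- `Exec ω P σ T τ`: with coin tosses `ω`, the program `P` started in state `σ` halts in state `τ`
after exactly `T` steps. -/
inductive Exec {F : Type*} [Field F] [DecidableEq F] (ω : ℕ → Bool) :
    Program → State F → ℕ → State F → Prop where
  | skip (σ : State F) : Exec ω .skip σ 0 σ
  | instr (a : Instr) (σ : State F) : Exec ω (.instr a) σ (a.cost σ) (a.apply ω σ)
  | seq {P Q : Program} {σ τ υ : State F} {T U : ℕ} (hP : Exec ω P σ T τ)
      (hQ : Exec ω Q τ U υ) : Exec ω (.seq P Q) σ (T + U) υ
  | ite_true {i : ℕ} {P Q : Program} {σ τ : State F} {T : ℕ} (hi : σ.nat i ≠ 0)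
      (hP : Exec ω P σ T τ) : Exec ω (.ite i P Q) σ (T + 1) τ
  | ite_false {i : ℕ} {P Q : Program} {σ τ : State F} {T : ℕ} (hi : σ.nat i = 0)
      (hQ : Exec ω Q σ T τ) : Exec ω (.ite i P Q) σ (T + 1) τ
  | while_true {i : ℕ} {P : Program} {σ τ υ : State F} {T U : ℕ} (hi : σ.nat i ≠ 0)
      (hP : Exec ω P σ T τ) (hW : Exec ω (.while i P) τ U υ) :
      Exec ω (.while i P) σ (T + U + 1) υ
  | while_false {i : ℕ} {P : Program} {σ : State F} (hi : σ.nat i = 0) :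
      Exec ω (.while i P) σ 1 σ

/-- The initial state of a decoder: a list of numbers in the cells `0, 1, 2, …` of `nat`; in `fld`,
the element `γ` in cell `0` and entry `(i, j)` of the received `m × n` matrix in cell
`1 + j m + i`; zeros elsewhere. -/
def State.input {F : Type*} [Field F] (params : List ℕ) (γ : F) {m n : ℕ}
    (r : Fin n → Fin m → F) : State F where
  nat := fun a => params.getD a 0
  fld := fun a =>
    if a = 0 then γ
    else if h : (a - 1) / m < n ∧ (a - 1) % m < m then r ⟨_, h.1⟩ ⟨_, h.2⟩ else 0
  pos := 0

/-- The list of words which a halted machine outputs: cell `0` of `nat` holds its length, cell `1`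
the address in `fld` from which on the words are stored one after another, column by column. -/
def State.output {F : Type*} (σ : State F) (m n : ℕ) : List (Fin n → Fin m → F) :=
  (List.range (σ.nat 0)).map fun k j i =>
    σ.fld (σ.nat 1 + k * (n * m) + (j : ℕ) * m + (i : ℕ))

/-- `T` coin tosses, as the beginning of an infinite sequence. -/
def tape {T : ℕ} (b : Fin T → Bool) : ℕ → Bool := fun k => if h : k < T then b ⟨k, h⟩ else false

/-- On the given input numbers, `γ`, and any received word `r`, the program halts within `T` steps
whatever the coins show (in particular it tosses at most `T` coins), and with probability at least
`1 - α` over `T` independent fair coin tosses it outputs, without repetitions, exactly the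
codewords of `C` that disagree with `r` in at most a fraction `ρ` of the coordinates. -/
def ListDecodesWithin {F : Type*} [Field F] [DecidableEq F] (P : Program) (params : List ℕ)
    (γ : F) {m n : ℕ} (C : Set (Fin n → Fin m → F)) (ρ α : ℝ) (T : ℕ) : Prop :=
  ∀ r : Fin n → Fin m → F,
    (∀ b : Fin T → Bool, ∃ τ, ∃ U ≤ T, Exec (tape b) P (State.input params γ r) U τ) ∧
    (1 - α) * 2 ^ T ≤
      (Nat.card {b : Fin T → Bool // ∃ τ U, Exec (tape b) P (State.input params γ r) U τ ∧
        (τ.output m n).Nodup ∧ ∀ c, c ∈ τ.output m n ↔ c ∈ closeWords C ρ r} : ℝ)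

end PPC

/-!
A word of length `n p` is read along the orbit of the point `(0, 1)` under `(x, y) ↦ (x + 1, γ y)`, and
so the symbol of a codeword at position `k + b` is `f(x + b, γ ^ b y)`, where `(x, y)` is the point of
position `k`. Decoding is linear-algebraic.

*Interpolation* (`exists_interpolation`). Counting dimensions, there are polynomials
`A, A_0, …, A_(w-1)` of small degrees, not all of the `A_b` zero, such that
`A(x, y) + ∑ A_b(x, y) r(k + b) = 0` at each position `k` whose window `k, …, k + w - 1` stays inside
one column. For a codeword `f` that agrees with the received word `r` in `T₀` columns, the polynomial
`A(x, y) + ∑ A_b(x, y) f(x + b, γ ^ b y)` has so many zeros that it vanishes, and `f - r` satisfies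
`∑ A_b (f - r)(k + b) = 0` in all windows (`IsRecurrence.apply_close`). These are linear equations.

*Dimension* (`card_recurrence_le`, `IsRecurrence.finrank_le`). Over the algebraic closure there is a
point `(ξ, η)` with `ξ ^ q = ξ + 1` and `η ^ q = γ η`. At this point, `f(x + b, γ ^ b y)` takes the
value `f(ξ, η) ^ (q ^ b)`, so for each solution `f` of the homogeneous recurrence the value `f(ξ, η)`,
which determines `f`, is a root of the nonzero polynomial `∑ A_b(ξ, η) Z ^ (q ^ b)`. Hence the
solutions form a space of dimension at most `w - 1`, and the pairs of a scalar `z` and a word `f` for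
which `f - z r` satisfies the recurrence form one of dimension at most `w`.

*Pruning* (`pow_le_card_prune`, `card_columns_lt`). A close codeword agrees with `r` in at least `T₀`
columns, and fewer than `t` of these fail to cut down a given space of pairs that contains the
codeword and is not yet a line. Imposing agreement in `w` random columns therefore singles out a
given close codeword with probability at least `(D' / n) ^ w`, where `D' = T₀ - t` is at least
`ε n / 2`. The events for different codewords are disjoint, which bounds the list size by
`(n / D') ^ w` (`IsRecurrence.card_mul_le`). The decoder repeats the random choice, and collects the
close codewords it meets (`le_card_trials`, `listDecodesWithin_decoder`).

*The machine* (`Cmd.sound`, `decoder_runs`). The decoder is written in a small structured language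
with variables and a matrix of field elements. Its commands are compiled to machine programs, a
predicate transformer `wp` describes their effect and keeps all numbers below a bound `Z`, and the
time is a polynomial in `Z`. The degree bounds are chosen in `exists_design`.
-/

set_option linter.unusedSectionVars false

namespace PPC

/-! ### A structured language on top of the machine -/

/-- The arithmetic operations of the machine on natural numbers. -/
inductive BinOp where
  | add | sub | mul | div | mod

/-- The function computed by an arithmetic operation. -/
def BinOp.eval : BinOp → ℕ → ℕ → ℕ
  | .add, a, b => a + b
  | .sub, a, b => a - b
  | .mul, a, b => a * b
  | .div, a, b => a / b
  | .mod, a, b => a % b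

/-- The machine instruction that performs an arithmetic operation. -/
def BinOp.instr : BinOp → ℕ → ℕ → ℕ → Instr
  | .add => .add
  | .sub => .sub
  | .mul => .mul
  | .div => .div
  | .mod => .mod

/-- Arithmetic expressions in variables. The value of variable `i` is kept in cell `i` of the
memory `nat`. -/
inductive Expr where
  | const (c : ℕ)
  | var (i : ℕ)
  | bin (o : BinOp) (a b : Expr)

namespace Expr

instance (c : ℕ) : OfNat Expr c := ⟨.const c⟩
instance : Add Expr := ⟨.bin .add⟩
instance : Sub Expr := ⟨.bin .sub⟩
instance : Mul Expr := ⟨.bin .mul⟩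
instance : Div Expr := ⟨.bin .div⟩
instance : Mod Expr := ⟨.bin .mod⟩

/-- The value of an expression. -/
def eval (v : ℕ → ℕ) : Expr → ℕ
  | const c => c
  | var i => v i
  | bin o a b => o.eval (a.eval v) (b.eval v)

/-- All variables of the expression have an index below `100`. -/
def wf : Expr → Bool
  | const _ => true
  | var i => decide (i < 100)
  | bin _ a b => a.wf && b.wf

/-- A bound for the value of an expression whose variables are at most `Z`. -/
def valBound (Z : ℕ) : Expr → ℕ
  | const c => c
  | var _ => Z
  | bin .add a b => a.valBound Z + b.valBound Z
  | bin .mul a b => a.valBound Z * b.valBound Z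
  | bin _ a _ => a.valBound Z

/-- A bound for the time needed to evaluate an expression whose variables are at most `Z`. -/
def timeBound (Z : ℕ) : Expr → ℕ
  | const _ => 1
  | var _ => 1
  | bin _ a b => a.timeBound Z + b.timeBound Z + (1 + a.valBound Z + b.valBound Z)

/-- The program that evaluates an expression into cell `d`, using the cells from `d` on. -/
def compile (d : ℕ) : Expr → Program
  | const c => .instr (.const d c)
  | var i => .instr (.copy d i)
  | bin o a b => .seq (a.compile d) (.seq (b.compile (d + 1)) (.instr (o.instr d d (d + 1))))

@[simp] theorem eval_ofNat (v : ℕ → ℕ) (c : ℕ) :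
    eval v (no_index (OfNat.ofNat c)) = OfNat.ofNat c := rfl
@[simp] theorem eval_var (v : ℕ → ℕ) (i : ℕ) : eval v (var i) = v i := rfl
@[simp] theorem eval_add (v : ℕ → ℕ) (a b : Expr) : eval v (a + b) = eval v a + eval v b := rfl
@[simp] theorem eval_sub (v : ℕ → ℕ) (a b : Expr) : eval v (a - b) = eval v a - eval v b := rfl
@[simp] theorem eval_mul (v : ℕ → ℕ) (a b : Expr) : eval v (a * b) = eval v a * eval v b := rfl
@[simp] theorem eval_div (v : ℕ → ℕ) (a b : Expr) : eval v (a / b) = eval v a / eval v b := rfl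
@[simp] theorem eval_mod (v : ℕ → ℕ) (a b : Expr) : eval v (a % b) = eval v a % eval v b := rfl

theorem eval_le_valBound {v : ℕ → ℕ} {Z : ℕ} (hv : ∀ i < 100, v i ≤ Z) (e : Expr)
    (he : e.wf = true) : e.eval v ≤ e.valBound Z := by
  induction e with
  | const c => exact le_rfl
  | var i => exact hv i (by simpa [wf] using he)
  | bin o a b iha ihb =>
    simp only [wf, Bool.and_eq_true] at he
    have ha := iha he.1
    have hb := ihb he.2
    cases o
    · exact Nat.add_le_add ha hb
    · exact (Nat.sub_le _ _).trans ha
    · exact Nat.mul_le_mul ha hb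
    · exact (Nat.div_le_self _ _).trans ha
    · exact (Nat.mod_le _ _).trans ha

end Expr

theorem size_le_self (a : ℕ) : Nat.size a ≤ a := Nat.size_le.2 Nat.lt_two_pow_self

section Machine

variable {F : Type*} [Field F] [DecidableEq F]

theorem BinOp.apply_instr (o : BinOp) (ω : ℕ → Bool) (σ : State F) (i j k : ℕ) :
    (o.instr i j k).apply ω σ = σ.setNat i (o.eval (σ.nat j) (σ.nat k)) := by
  cases o <;> rfl

theorem BinOp.cost_instr (o : BinOp) (σ : State F) (i j k : ℕ) :
    (o.instr i j k).cost σ ≤ 1 + σ.nat j + σ.nat k := by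
  have h1 := size_le_self (σ.nat j)
  have h2 := size_le_self (σ.nat k)
  cases o <;> simp only [BinOp.instr, Instr.cost] <;> omega

/-- The program runs from `σ` to `τ` in at most `T` steps. -/
def Runs (ω : ℕ → Bool) (P : Program) (σ : State F) (T : ℕ) (τ : State F) : Prop :=
  ∃ U ≤ T, Exec ω P σ U τ

theorem Runs.mono {ω : ℕ → Bool} {P : Program} {σ τ : State F} {T T' : ℕ} (h : Runs ω P σ T τ)
    (hT : T ≤ T') : Runs ω P σ T' τ := by
  obtain ⟨U, hU, h⟩ := h
  exact ⟨U, hU.trans hT, h⟩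

theorem Runs.seq {ω : ℕ → Bool} {P Q : Program} {σ τ υ : State F} {T U : ℕ}
    (hP : Runs ω P σ T τ) (hQ : Runs ω Q τ U υ) : Runs ω (.seq P Q) σ (T + U) υ := by
  obtain ⟨T', hT, hP⟩ := hP
  obtain ⟨U', hU, hQ⟩ := hQ
  exact ⟨_, Nat.add_le_add hT hU, Exec.seq hP hQ⟩

theorem Runs.instr {ω : ℕ → Bool} {a : Instr} {σ : State F} {T : ℕ} (h : a.cost σ ≤ T) :
    Runs ω (.instr a) σ T (a.apply ω σ) := ⟨_, h, Exec.instr a σ⟩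

/-- Compiled expressions keep the cells below `d`, and compute the value into cell `d`. -/
theorem Expr.runs_compile (ω : ℕ → Bool) {Z : ℕ} (e : Expr) (he : e.wf = true) :
    ∀ (d : ℕ) (σ : State F), 100 ≤ d → (∀ i < 100, σ.nat i ≤ Z) →
      ∃ τ, Runs ω (e.compile d) σ (e.timeBound Z) τ ∧ τ.nat d = e.eval σ.nat ∧
        (∀ i < d, τ.nat i = σ.nat i) ∧ τ.fld = σ.fld ∧ τ.pos = σ.pos := by
  induction e with
  | const c =>
    intro d σ _ _
    refine ⟨_, Runs.instr le_rfl, ?_, ?_, rfl, rfl⟩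
    · simp [Instr.apply, State.setNat, eval]
    · intro i hi
      simp [Instr.apply, State.setNat, hi.ne]
  | var j =>
    intro d σ _ _
    refine ⟨_, Runs.instr le_rfl, ?_, ?_, rfl, rfl⟩
    · simp [Instr.apply, State.setNat, eval]
    · intro i hi
      simp [Instr.apply, State.setNat, hi.ne]
  | bin o a b iha ihb =>
    intro d σ hd hσ
    simp only [wf, Bool.and_eq_true] at he
    obtain ⟨τ, h1, h2, h3, h4, h5⟩ := iha he.1 d σ hd hσ
    have hτ : ∀ i < 100, τ.nat i ≤ Z := fun i hi => by rw [h3 i (by omega)]; exact hσ i hi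
    obtain ⟨υ, g1, g2, g3, g4, g5⟩ := ihb he.2 (d + 1) τ (by omega) hτ
    have hv : ∀ e : Expr, e.wf = true → e.eval τ.nat = e.eval σ.nat := by
      intro e
      induction e with
      | const c => intro _; rfl
      | var i =>
        intro h
        exact h3 i (by simp only [wf, decide_eq_true_eq] at h; omega)
      | bin o a b iha ihb =>
        intro h
        simp only [wf, Bool.and_eq_true] at h
        simp only [eval, iha h.1, ihb h.2]
    have hd' : υ.nat d = a.eval σ.nat := by rw [g3 d (by omega), h2]
    have hd1 : υ.nat (d + 1) = b.eval σ.nat := by rw [g2, hv b he.2]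
    refine ⟨_, Runs.mono (Runs.seq h1 (Runs.seq g1 (Runs.instr (o.cost_instr υ d d (d + 1)))))
      ?_, ?_, ?_, ?_, ?_⟩
    · rw [hd', hd1]
      have := eval_le_valBound hσ a he.1
      have := eval_le_valBound hσ b he.2
      simp only [timeBound]
      omega
    · rw [BinOp.apply_instr, hd', hd1]
      simp [State.setNat, eval]
    · intro i hi
      rw [BinOp.apply_instr]
      simp only [State.setNat]
      rw [Function.update_of_ne hi.ne, g3 i (by omega), h3 i hi]
    · rw [BinOp.apply_instr]
      simp [State.setNat, g4, h4]
    · rw [BinOp.apply_instr]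
      simp [State.setNat, g5, h5]

/-- The operations of the structured language on field elements. -/
inductive FldOp where
  | zero | one | copy | inv | add | sub | mul

/-- The function computed by a field operation; operations with fewer than two arguments ignore the
others. -/
def FldOp.eval {F : Type*} [Field F] : FldOp → F → F → F
  | .zero, _, _ => 0
  | .one, _, _ => 1
  | .copy, x, _ => x
  | .inv, x, _ => x⁻¹
  | .add, x, y => x + y
  | .sub, x, y => x - y
  | .mul, x, y => x * y

/-- The machine instruction for a field operation. -/
def FldOp.instr : FldOp → ℕ → ℕ → ℕ → Instr
  | .zero, i, _, _ => .fzero i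
  | .one, i, _, _ => .fone i
  | .copy, i, j, _ => .fcopy i j
  | .inv, i, j, _ => .finv i j
  | .add, i, j, k => .fadd i j k
  | .sub, i, j, k => .fsub i j k
  | .mul, i, j, k => .fmul i j k

theorem FldOp.apply_instr (o : FldOp) (ω : ℕ → Bool) (σ : State F) (i j k : ℕ) :
    (o.instr i j k).apply ω σ =
      σ.setFld (σ.nat i) (o.eval (σ.fld (σ.nat j)) (σ.fld (σ.nat k))) := by
  cases o <;> rfl

theorem FldOp.cost_instr (o : FldOp) (σ : State F) (i j k : ℕ) : (o.instr i j k).cost σ = 1 := by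
  cases o <;> rfl

/-- Commands. The memory `fld` is addressed as a matrix, by a row and a column. `loop i n c` runs `c`
for `i = 0, …, n - 1`, where `n` is evaluated once, before the loop. -/
inductive Cmd where
  | skip
  | assign (i : ℕ) (e : Expr)
  | coin (i : ℕ)
  | fop (o : FldOp) (r₁ c₁ r₂ c₂ r₃ c₃ : Expr)
  | ftest (i : ℕ) (r c : Expr)
  | seq (a b : Cmd)
  | ite (i : ℕ) (a b : Cmd)
  | loop (i : ℕ) (n : Expr) (a : Cmd)

namespace Cmd

/-- All variables have an index below `100`. -/
def wf : Cmd → Bool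
  | skip => true
  | assign i e => decide (i < 100) && e.wf
  | coin i => decide (i < 100)
  | fop _ r₁ c₁ r₂ c₂ r₃ c₃ => r₁.wf && c₁.wf && (r₂.wf && c₂.wf) && (r₃.wf && c₃.wf)
  | ftest i r c => decide (i < 100) && (r.wf && c.wf)
  | seq a b => a.wf && b.wf
  | ite i a b => decide (i < 100) && (a.wf && b.wf)
  | loop i n a => decide (i < 100) && (n.wf && a.wf)

/-- The program that computes the address of entry `(r, c)` of the matrix into cell `d`. Cell `100`
holds the number of columns. -/
def compileAddr (d : ℕ) (r c : Expr) : Program :=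
  .seq (r.compile d) (.seq (.instr (.mul d d 100)) (.seq (c.compile (d + 1))
    (.instr (.add d d (d + 1)))))

/-- The program of a command, using the cells from `d` on for auxiliary values. -/
def compile (d : ℕ) : Cmd → Program
  | skip => .skip
  | assign i e => .seq (e.compile d) (.instr (.copy i d))
  | coin i => .instr (.coin i)
  | fop o r₁ c₁ r₂ c₂ r₃ c₃ =>
    .seq (compileAddr d r₁ c₁) (.seq (compileAddr (d + 1) r₂ c₂)
      (.seq (compileAddr (d + 2) r₃ c₃) (.instr (o.instr d (d + 1) (d + 2)))))
  | ftest i r c => .seq (compileAddr d r c) (.instr (.ftest i d))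
  | seq a b => .seq (a.compile d) (b.compile d)
  | ite i a b => .ite i (a.compile d) (b.compile d)
  | loop i n a =>
    .seq (n.compile d) (.seq (.instr (.const (d + 1) 0))
      (.while d (.seq (.instr (.copy i (d + 1))) (.seq (a.compile (d + 2))
        (.seq (.instr (.const (d + 2) 1)) (.seq (.instr (.add (d + 1) (d + 1) (d + 2)))
          (.instr (.sub d d (d + 2)))))))))

/-- A bound for the time needed to compute an address, where variables and the number of columns are
at most `Z`. -/
def addrTime (Z : ℕ) (r c : Expr) : ℕ :=
  r.timeBound Z + (1 + r.valBound Z + Z) + c.timeBound Z + 1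

/-- A bound for the running time of a command, where variables and the number of columns are at
most `Z`. -/
def timeBound (Z : ℕ) : Cmd → ℕ
  | skip => 0
  | assign _ e => e.timeBound Z + 1
  | coin _ => 1
  | fop _ r₁ c₁ r₂ c₂ r₃ c₃ => addrTime Z r₁ c₁ + addrTime Z r₂ c₂ + addrTime Z r₃ c₃ + 1
  | ftest _ r c => addrTime Z r c + 1
  | seq a b => a.timeBound Z + b.timeBound Z
  | ite _ a b => a.timeBound Z + b.timeBound Z + 1
  | loop _ n a => n.timeBound Z + 2 + Z * (a.timeBound Z + 5)

end Cmd

/-- The state of a computation in the structured language. -/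
structure Env (F : Type*) where
  nat : ℕ → ℕ
  mem : ℕ → ℕ → F
  pos : ℕ

namespace Env

variable {F : Type*}

/-- Assign a variable. -/
def set (E : Env F) (i v : ℕ) : Env F := { E with nat := Function.update E.nat i v }

/-- Write an entry of the matrix. -/
def write (E : Env F) (r c : ℕ) (x : F) : Env F :=
  { E with mem := fun r' c' => if r' = r ∧ c' = c then x else E.mem r' c' }

/-- Advance the position on the tape of coin tosses. -/
def step (E : Env F) : Env F := { E with pos := E.pos + 1 }

theorem nat_set (E : Env F) (i v j : ℕ) : (E.set i v).nat j = if j = i then v else E.nat j := by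
  simp [set, Function.update_apply]
@[simp] theorem nat_write (E : Env F) (r c : ℕ) (x : F) : (E.write r c x).nat = E.nat := rfl
@[simp] theorem nat_step (E : Env F) : E.step.nat = E.nat := rfl
@[simp] theorem mem_set (E : Env F) (i v : ℕ) : (E.set i v).mem = E.mem := rfl
@[simp] theorem mem_step (E : Env F) : E.step.mem = E.mem := rfl
theorem mem_write (E : Env F) (r c : ℕ) (x : F) (r' c' : ℕ) :
    (E.write r c x).mem r' c' = if r' = r ∧ c' = c then x else E.mem r' c' := rfl
@[simp] theorem pos_set (E : Env F) (i v : ℕ) : (E.set i v).pos = E.pos := rfl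
@[simp] theorem pos_write (E : Env F) (r c : ℕ) (x : F) : (E.write r c x).pos = E.pos := rfl
@[simp] theorem pos_step (E : Env F) : E.step.pos = E.pos + 1 := rfl

end Env

/-- The predicate transformer of the structured language, for a matrix with `W` columns and a
bound `Z` for the values of variables: started in `E`, the command respects these bounds, and ends
in a state that satisfies `Q`. Loops are described by an invariant. -/
def wp (W Z : ℕ) (ω : ℕ → Bool) : Cmd → (Env F → Prop) → Env F → Prop
  | .skip, Q, E => Q E
  | .assign i e, Q, E => e.eval E.nat ≤ Z ∧ Q (E.set i (e.eval E.nat))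
  | .coin i, Q, E => Q ((E.set i (if ω E.pos then 1 else 0)).step)
  | .fop o r₁ c₁ r₂ c₂ r₃ c₃, Q, E =>
    (c₁.eval E.nat < W ∧ c₂.eval E.nat < W ∧ c₃.eval E.nat < W) ∧
    Q (E.write (r₁.eval E.nat) (c₁.eval E.nat) (o.eval (E.mem (r₂.eval E.nat) (c₂.eval E.nat))
      (E.mem (r₃.eval E.nat) (c₃.eval E.nat))))
  | .ftest i r c, Q, E => c.eval E.nat < W ∧
    Q (E.set i (if E.mem (r.eval E.nat) (c.eval E.nat) = 0 then 0 else 1))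
  | .seq a b, Q, E => wp W Z ω a (wp W Z ω b Q) E
  | .ite i a b, Q, E => (E.nat i ≠ 0 → wp W Z ω a Q E) ∧ (E.nat i = 0 → wp W Z ω b Q E)
  | .loop i n a, Q, E => n.eval E.nat ≤ Z ∧ ∃ I : ℕ → Env F → Prop, I 0 E ∧
    (∀ k < n.eval E.nat, ∀ E', I k E' → wp W Z ω a (I (k + 1)) (E'.set i k)) ∧
    ∀ E', I (n.eval E.nat) E' → Q E'

/-- The machine state `σ` represents the state `E` of the structured language. -/
structure Sim (W Z : ℕ) (σ : State F) (E : Env F) : Prop where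
  nat : ∀ i < 100, σ.nat i = E.nat i
  le : ∀ i < 100, E.nat i ≤ Z
  width : σ.nat 100 = W
  mem : ∀ r, ∀ c < W, σ.fld (r * W + c) = E.mem r c
  pos : σ.pos = E.pos

theorem Expr.eval_congr {u v : ℕ → ℕ} (h : ∀ i < 100, u i = v i) (e : Expr) (he : e.wf = true) :
    e.eval u = e.eval v := by
  induction e with
  | const c => rfl
  | var i => exact h i (by simpa [wf] using he)
  | bin o a b iha ihb =>
    simp only [wf, Bool.and_eq_true] at he
    simp only [eval, iha he.1, ihb he.2]

theorem Sim.eval {W Z : ℕ} {σ : State F} {E : Env F} (h : Sim W Z σ E) (e : Expr)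
    (he : e.wf = true) : e.eval σ.nat = e.eval E.nat := e.eval_congr h.nat he

theorem Sim.nat_le {W Z : ℕ} {σ : State F} {E : Env F} (h : Sim W Z σ E) :
    ∀ i < 100, σ.nat i ≤ Z := fun i hi => (h.nat i hi).trans_le (h.le i hi)

theorem Sim.of_frame {W Z : ℕ} {σ τ : State F} {E : Env F} (h : Sim W Z σ E)
    (hn : ∀ i < 101, τ.nat i = σ.nat i) (hf : τ.fld = σ.fld) (hp : τ.pos = σ.pos) :
    Sim W Z τ E where
  nat i hi := (hn i (by omega)).trans (h.nat i hi)
  le := h.le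
  width := (hn 100 (by omega)).trans h.width
  mem r c hc := by rw [hf]; exact h.mem r c hc
  pos := hp.trans h.pos

theorem Sim.set {W Z : ℕ} {σ τ : State F} {E : Env F} (h : Sim W Z σ E) {i v : ℕ}
    (hi : i < 100) (hv : v ≤ Z) (hn : ∀ j < 101, τ.nat j = if j = i then v else σ.nat j)
    (hf : τ.fld = σ.fld) (hp : τ.pos = σ.pos) : Sim W Z τ (E.set i v) where
  nat j hj := by
    rw [hn j (by omega), Env.nat_set]
    split_ifs
    · rfl
    · exact h.nat j hj
  le j hj := by
    rw [Env.nat_set]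
    split_ifs
    · exact hv
    · exact h.le j hj
  width := by rw [hn 100 (by omega), if_neg (by omega)]; exact h.width
  mem r c hc := by rw [hf]; exact h.mem r c hc
  pos := hp.trans h.pos

theorem Cmd.runs_compileAddr (ω : ℕ → Bool) {W Z : ℕ} (hWZ : W ≤ Z) {r c : Expr}
    (hr : r.wf = true) (hc : c.wf = true) {d : ℕ} (hd : 101 ≤ d) {σ : State F} {E : Env F}
    (h : Sim W Z σ E) :
    ∃ τ, Runs ω (compileAddr d r c) σ (addrTime Z r c) τ ∧
      τ.nat d = r.eval E.nat * W + c.eval E.nat ∧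
      (∀ i < d, τ.nat i = σ.nat i) ∧ τ.fld = σ.fld ∧ τ.pos = σ.pos := by
  obtain ⟨τ, h1, h2, h3, h4, h5⟩ := r.runs_compile ω (Z := Z) hr d σ (by omega) h.nat_le
  rw [h.eval r hr] at h2
  have hτ : Sim W Z τ E := h.of_frame (fun i hi => h3 i (by omega)) h4 h5
  set τ' := (Instr.mul d d 100).apply ω τ with hτ'
  have e1 : τ'.nat = Function.update τ.nat d (r.eval E.nat * W) := by
    simp [hτ', Instr.apply, State.setNat, h2, hτ.width]
  have hτ'' : Sim W Z τ' E := hτ.of_frame (fun i hi => by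
    rw [e1, Function.update_of_ne (by omega)]) rfl rfl
  obtain ⟨υ, g1, g2, g3, g4, g5⟩ := c.runs_compile ω (Z := Z) hc (d + 1) τ' (by omega)
    hτ''.nat_le
  rw [hτ''.eval c hc] at g2
  have e2 : υ.nat d = r.eval E.nat * W := by rw [g3 d (by omega), e1, Function.update_self]
  have hcost : (Instr.mul d d 100).cost τ ≤ 1 + r.valBound Z + Z := by
    have h6 := size_le_self (τ.nat d)
    have h7 := size_le_self (τ.nat 100)
    have h8 := Expr.eval_le_valBound h.le r hr
    have h9 := hτ.width
    simp only [Instr.cost]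
    omega
  refine ⟨_, Runs.mono (Runs.seq h1 (Runs.seq (Runs.instr hcost) (Runs.seq g1
    (Runs.instr le_rfl)))) ?_, ?_, ?_, ?_, ?_⟩
  · simp only [addrTime, Instr.cost]
    omega
  · simp [Instr.apply, State.setNat, e2, g2]
  · intro i hi
    simp only [Instr.apply, State.setNat]
    rw [Function.update_of_ne hi.ne, g3 i (by omega), e1, Function.update_of_ne hi.ne, h3 i hi]
  · simp only [Instr.apply, State.setNat]
    rw [g4]
    exact h4
  · simp only [Instr.apply, State.setNat]
    rw [g5]
    exact h5

/-- The machine executes commands as the predicate transformer says. -/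
theorem Cmd.sound (ω : ℕ → Bool) {W Z : ℕ} (hWZ : W ≤ Z) (hZ : 1 ≤ Z) (a : Cmd) :
    ∀ (_ : a.wf = true) (d : ℕ) (_ : 101 ≤ d) (Q : Env F → Prop) (E : Env F) (σ : State F),
      wp W Z ω a Q E → Sim W Z σ E →
      ∃ τ E', Runs ω (a.compile d) σ (a.timeBound Z) τ ∧ Sim W Z τ E' ∧ Q E' ∧
        ∀ i, 100 ≤ i → i < d → τ.nat i = σ.nat i := by
  induction a with
  | skip =>
    intro _ d _ Q E σ hw hs
    exact ⟨σ, E, ⟨0, le_rfl, Exec.skip σ⟩, hs, hw, fun _ _ _ => rfl⟩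
  | assign i e =>
    intro hwf d hd Q E σ hw hs
    simp only [wf, Bool.and_eq_true, decide_eq_true_eq] at hwf
    obtain ⟨τ, h1, h2, h3, h4, h5⟩ := e.runs_compile ω (Z := Z) hwf.2 d σ (by omega) hs.nat_le
    rw [hs.eval e hwf.2] at h2
    refine ⟨_, _, Runs.seq h1 (Runs.instr le_rfl), ?_, hw.2, ?_⟩
    · refine hs.set hwf.1 hw.1 ?_ h4 h5
      intro j hj
      simp only [Instr.apply, State.setNat, Function.update_apply, h2]
      split_ifs
      · rfl
      · exact h3 j (by omega)
    · intro j h100 hj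
      simp only [Instr.apply, State.setNat]
      rw [Function.update_of_ne (by omega), h3 j hj]
  | coin i =>
    intro hwf d hd Q E σ hw hs
    simp only [wf, decide_eq_true_eq] at hwf
    refine ⟨_, _, Runs.instr le_rfl, ?_, hw, ?_⟩
    · have h0 : Sim W Z (σ.setNat i (if ω E.pos then 1 else 0))
          (E.set i (if ω E.pos then 1 else 0)) := by
        refine hs.set hwf ?_ ?_ rfl rfl
        · split_ifs <;> omega
        · intro j hj
          simp only [State.setNat, Function.update_apply]
      refine ⟨?_, ?_, ?_, ?_, ?_⟩
      · intro j hj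
        have := h0.nat j hj
        simpa [Instr.apply, hs.pos] using this
      · exact h0.le
      · have := h0.width
        simpa [Instr.apply, hs.pos] using this
      · exact h0.mem
      · simp [Instr.apply, hs.pos]
    · intro j h100 hj
      simp only [Instr.apply, State.setNat]
      rw [Function.update_of_ne (by omega)]
  | fop o r₁ c₁ r₂ c₂ r₃ c₃ =>
    intro hwf d hd Q E σ hw hs
    simp only [wf, Bool.and_eq_true] at hwf
    obtain ⟨⟨⟨w1, w2⟩, w3, w4⟩, w5, w6⟩ := hwf
    obtain ⟨τ₁, a1, a2, a3, a4, a5⟩ := runs_compileAddr ω hWZ w1 w2 hd hs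
    have hs₁ := hs.of_frame (fun i hi => a3 i (by omega)) a4 a5
    obtain ⟨τ₂, b1, b2, b3, b4, b5⟩ := runs_compileAddr ω hWZ w3 w4 (by omega : 101 ≤ d + 1) hs₁
    have hs₂ := hs₁.of_frame (fun i hi => b3 i (by omega)) b4 b5
    obtain ⟨τ₃, c1, c2, c3, c4, c5⟩ := runs_compileAddr ω hWZ w5 w6 (by omega : 101 ≤ d + 2) hs₂
    have hs₃ := hs₂.of_frame (fun i hi => c3 i (by omega)) c4 c5
    obtain ⟨⟨v1, v2, v3⟩, hQ⟩ := hw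
    have n1 : τ₃.nat d = r₁.eval E.nat * W + c₁.eval E.nat := by
      rw [c3 d (by omega), b3 d (by omega), a2]
    have n2 : τ₃.nat (d + 1) = r₂.eval E.nat * W + c₂.eval E.nat := by
      rw [c3 (d + 1) (by omega), b2]
    refine ⟨_, _, Runs.mono (Runs.seq a1 (Runs.seq b1 (Runs.seq c1
      (Runs.instr (o.cost_instr _ _ _ _).le)))) ?_, ?_, hQ, ?_⟩
    · simp only [timeBound]
      omega
    · rw [FldOp.apply_instr, n1, n2, c2, hs₃.mem _ _ v2, hs₃.mem _ _ v3]
      refine ⟨hs₃.nat, hs₃.le, hs₃.width, ?_, hs₃.pos⟩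
      intro r c hc
      have key : r * W + c = r₁.eval E.nat * W + c₁.eval E.nat ↔
          r = r₁.eval E.nat ∧ c = c₁.eval E.nat := by
        constructor
        · intro h
          have h1 : (r * W + c) / W = r := by
            rw [mul_comm, Nat.mul_add_div (by omega), Nat.div_eq_of_lt hc, add_zero]
          have h2 : (r₁.eval E.nat * W + c₁.eval E.nat) / W = r₁.eval E.nat := by
            rw [mul_comm, Nat.mul_add_div (by omega), Nat.div_eq_of_lt v1, add_zero]
          have h3 : r = r₁.eval E.nat := by rw [← h1, h, h2]
          refine ⟨h3, ?_⟩
          rw [h3] at h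
          omega
        · rintro ⟨rfl, rfl⟩
          rfl
      simp only [State.setFld, Function.update_apply, Env.mem_write, key]
      split_ifs
      · rfl
      · exact hs₃.mem r c hc
    · intro j h100 hj
      rw [FldOp.apply_instr]
      simp only [State.setFld]
      rw [c3 j (by omega), b3 j (by omega), a3 j hj]
  | ftest i r c =>
    intro hwf d hd Q E σ hw hs
    simp only [wf, Bool.and_eq_true, decide_eq_true_eq] at hwf
    obtain ⟨τ, a1, a2, a3, a4, a5⟩ := runs_compileAddr ω hWZ hwf.2.1 hwf.2.2 hd hs
    have hs₁ := hs.of_frame (fun i hi => a3 i (by omega)) a4 a5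
    refine ⟨_, _, Runs.seq a1 (Runs.instr le_rfl), ?_, hw.2, ?_⟩
    · refine hs₁.set hwf.1 ?_ ?_ rfl rfl
      · split_ifs <;> omega
      · intro j hj
        simp only [Instr.apply, State.setNat, Function.update_apply, a2, hs₁.mem _ _ hw.1]
    · intro j h100 hj
      simp only [Instr.apply, State.setNat]
      rw [Function.update_of_ne (by omega), a3 j hj]
  | seq a b iha ihb =>
    intro hwf d hd Q E σ hw hs
    simp only [wf, Bool.and_eq_true] at hwf
    obtain ⟨τ, E', h1, h2, h3, h4⟩ := iha hwf.1 d hd _ E σ hw hs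
    obtain ⟨υ, E'', g1, g2, g3, g4⟩ := ihb hwf.2 d hd _ E' τ h3 h2
    exact ⟨υ, E'', h1.seq g1, g2, g3, fun i hi hj => (g4 i hi hj).trans (h4 i hi hj)⟩
  | ite i a b iha ihb =>
    intro hwf d hd Q E σ hw hs
    simp only [wf, Bool.and_eq_true, decide_eq_true_eq] at hwf
    by_cases h0 : E.nat i = 0
    · obtain ⟨τ, E', ⟨U, hU, h1⟩, h2, h3, h4⟩ := ihb hwf.2.2 d hd _ E σ (hw.2 h0) hs
      refine ⟨τ, E', ⟨U + 1, ?_, Exec.ite_false (by rw [hs.nat i hwf.1]; exact h0) h1⟩, h2, h3, h4⟩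
      simp only [timeBound]
      omega
    · obtain ⟨τ, E', ⟨U, hU, h1⟩, h2, h3, h4⟩ := iha hwf.2.1 d hd _ E σ (hw.1 h0) hs
      refine ⟨τ, E', ⟨U + 1, ?_, Exec.ite_true (by rw [hs.nat i hwf.1]; exact h0) h1⟩, h2, h3, h4⟩
      simp only [timeBound]
      omega
  | loop i n a iha =>
    intro hwf d hd Q E σ hw hs
    simp only [wf, Bool.and_eq_true, decide_eq_true_eq] at hwf
    obtain ⟨hi, hn, ha⟩ := hwf
    obtain ⟨hN, I, hI0, hIs, hIQ⟩ := hw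
    obtain ⟨τ, h1, h2, h3, h4, h5⟩ := n.runs_compile ω (Z := Z) hn d σ (by omega) hs.nat_le
    rw [hs.eval n hn] at h2
    set N := n.eval E.nat with hNdef
    set τ₀ := (Instr.const (d + 1) 0).apply ω τ with hτ₀
    have n0 : τ₀.nat = Function.update τ.nat (d + 1) 0 := rfl
    have hs₀ : Sim W Z τ₀ E := hs.of_frame (fun j hj => by
      rw [n0, Function.update_of_ne (by omega), h3 j (by omega)]) h4 h5
    -- the loop, started with `M` iterations to go
    have main : ∀ M ≤ N, ∀ (E : Env F) (σ : State F), I (N - M) E → Sim W Z σ E →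
        σ.nat d = M → σ.nat (d + 1) = N - M →
        ∃ τ E', Runs ω (.while d (.seq (.instr (.copy i (d + 1))) (.seq (a.compile (d + 2))
          (.seq (.instr (.const (d + 2) 1)) (.seq (.instr (.add (d + 1) (d + 1) (d + 2)))
            (.instr (.sub d d (d + 2)))))))) σ (1 + M * (a.timeBound Z + 5)) τ ∧ Sim W Z τ E' ∧
          I N E' ∧ ∀ i, 100 ≤ i → i < d → τ.nat i = σ.nat i := by
      intro M
      induction M with
      | zero =>
        intro _ E σ hI hs hσ _
        exact ⟨σ, E, ⟨1, by omega, Exec.while_false hσ⟩, hs, hI, fun _ _ _ => rfl⟩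
      | succ M ih =>
        intro hM E σ hI hs hσ hσ'
        set σ₁ := (Instr.copy i (d + 1)).apply ω σ with hσ₁
        have m1 : σ₁.nat = Function.update σ.nat i (N - (M + 1)) := by
          simp [hσ₁, Instr.apply, State.setNat, hσ']
        have hs₁ : Sim W Z σ₁ (E.set i (N - (M + 1))) := by
          refine hs.set hi (by omega) ?_ rfl rfl
          intro j hj
          rw [m1, Function.update_apply]
        obtain ⟨σ₂, E₂, r2, hs₂, hI₂, f2⟩ := iha ha (d + 2) (by omega) _ _ σ₁
          (hIs (N - (M + 1)) (by omega) E hI) hs₁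
        set σ₃ := (Instr.const (d + 2) 1).apply ω σ₂ with hσ₃
        have m3 : σ₃.nat = Function.update σ₂.nat (d + 2) 1 := rfl
        set σ₄ := (Instr.add (d + 1) (d + 1) (d + 2)).apply ω σ₃ with hσ₄
        have m4 : σ₄.nat = Function.update σ₃.nat (d + 1) (σ₃.nat (d + 1) + σ₃.nat (d + 2)) := rfl
        set σ₅ := (Instr.sub d d (d + 2)).apply ω σ₄ with hσ₅
        have m5 : σ₅.nat = Function.update σ₄.nat d (σ₄.nat d - σ₄.nat (d + 2)) := rfl
        have e0 : σ₂.nat d = M + 1 := by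
          rw [f2 d (by omega) (by omega), m1, Function.update_of_ne (by omega), hσ]
        have e1 : σ₂.nat (d + 1) = N - (M + 1) := by
          rw [f2 (d + 1) (by omega) (by omega), m1, Function.update_of_ne (by omega), hσ']
        have k0 : σ₅.nat d = M := by
          rw [m5, Function.update_self, m4, Function.update_of_ne (by omega),
            Function.update_of_ne (by omega), m3, Function.update_of_ne (by omega),
            Function.update_self, e0]
          omega
        have k1 : σ₅.nat (d + 1) = N - M := by
          rw [m5, Function.update_of_ne (by omega), m4, Function.update_self, m3,
            Function.update_of_ne (by omega), Function.update_self, e1]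
          omega
        have kf : ∀ j < d, σ₅.nat j = σ₂.nat j := by
          intro j hj
          rw [m5, Function.update_of_ne (by omega), m4, Function.update_of_ne (by omega), m3,
            Function.update_of_ne (by omega)]
        have hs₅ : Sim W Z σ₅ E₂ := hs₂.of_frame (fun j hj => kf j (by omega)) rfl rfl
        rw [show N - (M + 1) + 1 = N - M by omega] at hI₂
        obtain ⟨υ, E', ⟨V, hV, g1⟩, g2, g3, g4⟩ := ih (by omega) E₂ σ₅ hI₂ hs₅ k0 k1
        have hbody : Runs ω (.seq (.instr (.copy i (d + 1))) (.seq (a.compile (d + 2))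
            (.seq (.instr (.const (d + 2) 1)) (.seq (.instr (.add (d + 1) (d + 1) (d + 2)))
            (.instr (.sub d d (d + 2))))))) σ (1 + (a.timeBound Z + (1 + (1 + 1)))) σ₅ :=
          Runs.seq (Runs.instr le_rfl) (Runs.seq r2 (Runs.seq (Runs.instr le_rfl)
            (Runs.seq (Runs.instr le_rfl) (Runs.instr le_rfl))))
        obtain ⟨U, hU, hb⟩ := hbody
        refine ⟨υ, E', ⟨U + V + 1, ?_, Exec.while_true (by omega) hb g1⟩, g2, g3, ?_⟩
        · rw [add_mul]
          omega
        · intro j h100 hj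
          rw [g4 j h100 hj, kf j hj, f2 j h100 (by omega), m1, Function.update_of_ne (by omega)]
    obtain ⟨υ, E', g1, g2, g3, g4⟩ := main N le_rfl E τ₀ (by simpa using hI0) hs₀
      (by rw [n0, Function.update_of_ne (by omega), h2]) (by rw [n0, Function.update_self]; omega)
    refine ⟨υ, E', Runs.mono (Runs.seq h1 (Runs.seq (Runs.instr le_rfl) g1)) ?_, g2, hIQ E' g3, ?_⟩
    · have := Nat.mul_le_mul_right (a.timeBound Z + 5) hN
      simp only [timeBound, Instr.cost]
      omega
    · intro j h100 hj
      rw [g4 j h100 hj, n0, Function.update_of_ne (by omega), h3 j hj]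

theorem wp_mono {W Z : ℕ} {ω : ℕ → Bool} (a : Cmd) : ∀ {Q Q' : Env F → Prop} {E : Env F},
    (∀ E, Q E → Q' E) → wp W Z ω a Q E → wp W Z ω a Q' E := by
  induction a with
  | skip => exact fun h hw => h _ hw
  | assign i e => exact fun h hw => ⟨hw.1, h _ hw.2⟩
  | coin i => exact fun h hw => h _ hw
  | fop o r₁ c₁ r₂ c₂ r₃ c₃ => exact fun h hw => ⟨hw.1, h _ hw.2⟩
  | ftest i r c => exact fun h hw => ⟨hw.1, h _ hw.2⟩
  | seq a b iha ihb => exact fun h hw => iha (fun E hE => ihb h hE) hw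
  | ite i a b iha ihb => exact fun h hw => ⟨fun h0 => iha h (hw.1 h0), fun h0 => ihb h (hw.2 h0)⟩
  | loop i n a iha =>
    rintro Q Q' E h ⟨h1, I, h2, h3, h4⟩
    exact ⟨h1, I, h2, h3, fun E' hE' => h _ (h4 E' hE')⟩

end Machine

/-! ### Running times are polynomial -/

/-- `f` is bounded by a polynomial. -/
def PolyBdd (f : ℕ → ℕ) : Prop := ∃ K d : ℕ, ∀ Z, f Z ≤ K * (Z + 1) ^ d

namespace PolyBdd

theorem const (c : ℕ) : PolyBdd fun _ => c := ⟨c, 0, fun Z => by simp⟩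

theorem id : PolyBdd fun Z => Z := ⟨1, 1, fun Z => by simp⟩

theorem add {f g : ℕ → ℕ} (hf : PolyBdd f) (hg : PolyBdd g) : PolyBdd fun Z => f Z + g Z := by
  obtain ⟨K, d, hf⟩ := hf
  obtain ⟨K', d', hg⟩ := hg
  refine ⟨K + K', d + d', fun Z => ?_⟩
  have h1 : (Z + 1) ^ d ≤ (Z + 1) ^ (d + d') := Nat.pow_le_pow_right (by omega) (by omega)
  have h2 : (Z + 1) ^ d' ≤ (Z + 1) ^ (d + d') := Nat.pow_le_pow_right (by omega) (by omega)
  rw [add_mul]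
  exact Nat.add_le_add ((hf Z).trans (Nat.mul_le_mul_left _ h1))
    ((hg Z).trans (Nat.mul_le_mul_left _ h2))

theorem mul {f g : ℕ → ℕ} (hf : PolyBdd f) (hg : PolyBdd g) : PolyBdd fun Z => f Z * g Z := by
  obtain ⟨K, d, hf⟩ := hf
  obtain ⟨K', d', hg⟩ := hg
  refine ⟨K * K', d + d', fun Z => (Nat.mul_le_mul (hf Z) (hg Z)).trans (le_of_eq ?_)⟩
  ring

end PolyBdd

theorem Expr.polyBdd_valBound (e : Expr) : PolyBdd fun Z => e.valBound Z := by
  induction e with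
  | const c => exact .const c
  | var i => exact .id
  | bin o a b iha ihb =>
    cases o
    · exact iha.add ihb
    · exact iha
    · exact iha.mul ihb
    · exact iha
    · exact iha

theorem Expr.polyBdd_timeBound (e : Expr) : PolyBdd fun Z => e.timeBound Z := by
  induction e with
  | const c => exact .const 1
  | var i => exact .const 1
  | bin o a b iha ihb =>
    exact (iha.add ihb).add (((PolyBdd.const 1).add a.polyBdd_valBound).add b.polyBdd_valBound)

theorem Cmd.polyBdd_addrTime (r c : Expr) : PolyBdd fun Z => addrTime Z r c :=
  ((r.polyBdd_timeBound.add (((PolyBdd.const 1).add r.polyBdd_valBound).add .id)).add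
    c.polyBdd_timeBound).add (.const 1)

theorem Cmd.polyBdd_timeBound (a : Cmd) : PolyBdd fun Z => a.timeBound Z := by
  induction a with
  | skip => exact .const 0
  | assign i e => exact e.polyBdd_timeBound.add (.const 1)
  | coin i => exact .const 1
  | fop o r₁ c₁ r₂ c₂ r₃ c₃ =>
    exact (((polyBdd_addrTime r₁ c₁).add (polyBdd_addrTime r₂ c₂)).add
      (polyBdd_addrTime r₃ c₃)).add (.const 1)
  | ftest i r c => exact (polyBdd_addrTime r c).add (.const 1)
  | seq a b iha ihb => exact iha.add ihb
  | ite i a b iha ihb => exact (iha.add ihb).add (.const 1)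
  | loop i n a iha =>
    exact (n.polyBdd_timeBound.add (.const 2)).add (PolyBdd.id.mul (iha.add (.const 5)))

/-! ### Polynomial words and their zeros -/

section PolySpan

variable {F : Type*} [Field F] {A : Type*} [CommRing A] [Algebra F A]

/-- The values at `(x, y)` of the polynomials of degree less than `E` in the first and less than `T`
in the second variable. -/
def polySpan (F : Type*) [Field F] {A : Type*} [CommRing A] [Algebra F A] (x y : A) (E T : ℕ) :
    Submodule F A :=
  Submodule.span F {a | ∃ e < E, ∃ e' < T, a = x ^ e * y ^ e'}

theorem monomial_mem_polySpan (x y : A) {E T e e' : ℕ} (he : e < E) (he' : e' < T) :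
    x ^ e * y ^ e' ∈ polySpan F x y E T :=
  Submodule.subset_span ⟨e, he, e', he', rfl⟩

theorem mul_mem_polySpan {x y a b : A} {E T E' T' : ℕ} (ha : a ∈ polySpan F x y E T)
    (hb : b ∈ polySpan F x y E' T') : a * b ∈ polySpan F x y (E + E') (T + T') := by
  have h := Submodule.mul_mem_mul ha hb
  rw [polySpan, polySpan, Submodule.span_mul_span] at h
  refine Submodule.span_mono ?_ h
  rintro _ ⟨_, ⟨e, he, f, hf, rfl⟩, _, ⟨e', he', f', hf', rfl⟩, rfl⟩
  exact ⟨e + e', by omega, f + f', by omega, by simp only [pow_add]; ring⟩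

theorem map_mem_polySpan {x y a : A} {E T : ℕ} (φ : A →ₐ[F] A) {c d : F}
    (hx : φ x = x + algebraMap F A c) (hy : φ y = d • y) (ha : a ∈ polySpan F x y E T) :
    φ a ∈ polySpan F x y E T := by
  have : (polySpan F x y E T).map φ.toLinearMap ≤ polySpan F x y E T := by
    rw [polySpan, Submodule.map_span_le]
    rintro _ ⟨e, he, e', he', rfl⟩
    simp only [AlgHom.toLinearMap_apply, map_mul, map_pow, hx, hy, smul_pow, mul_smul_comm]
    refine Submodule.smul_mem _ _ ?_
    rw [add_pow, Finset.sum_mul]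
    refine Submodule.sum_mem _ fun i hi => ?_
    have h1 := monomial_mem_polySpan (F := F) x y
      (show i < E by have := Finset.mem_range.1 hi; omega) he'
    have h2 := Submodule.smul_mem _ (c ^ (e - i) * (e.choose i : F)) h1
    have h3 : x ^ i * algebraMap F A c ^ (e - i) * (e.choose i : A) * y ^ e' =
        (c ^ (e - i) * (e.choose i : F)) • (x ^ i * y ^ e') := by
      rw [Algebra.smul_def, map_mul, map_pow, map_natCast]
      ring
    rw [h3]
    exact h2
  exact this (Submodule.mem_map_of_mem ha)

theorem mem_polySpan_iff {x y a : A} {E T : ℕ} : a ∈ polySpan F x y E T ↔ ∃ c : ℕ → ℕ → F,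
    a = ∑ e ∈ Finset.range E, ∑ e' ∈ Finset.range T, c e e' • (x ^ e * y ^ e') := by
  constructor
  · intro ha
    induction ha using Submodule.span_induction with
    | mem a ha =>
      obtain ⟨e, he, e', he', rfl⟩ := ha
      refine ⟨fun i j => if i = e then if j = e' then 1 else 0 else 0, ?_⟩
      rw [Finset.sum_eq_single_of_mem e (Finset.mem_range.2 he),
        Finset.sum_eq_single_of_mem e' (Finset.mem_range.2 he')]
      · simp
      · intro j _ hj
        simp [hj]
      · intro i _ hi
        simp [hi]
    | zero => exact ⟨fun _ _ => 0, by simp⟩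
    | add a b _ _ iha ihb =>
      obtain ⟨c, rfl⟩ := iha
      obtain ⟨d, rfl⟩ := ihb
      exact ⟨fun i j => c i j + d i j, by simp only [add_smul, Finset.sum_add_distrib]⟩
    | smul k a _ iha =>
      obtain ⟨c, rfl⟩ := iha
      exact ⟨fun i j => k * c i j, by simp only [mul_smul, Finset.smul_sum]⟩
  · rintro ⟨c, rfl⟩
    exact Submodule.sum_mem _ fun e he => Submodule.sum_mem _ fun e' he' =>
      Submodule.smul_mem _ _ (monomial_mem_polySpan x y (Finset.mem_range.1 he)
        (Finset.mem_range.1 he'))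

end PolySpan

section Zeros

variable {K : Type*} [Field K]

theorem coeff_eq_zero_of_zeros (c : ℕ → K) (N : ℕ) (s : Finset K) (hs : N ≤ s.card)
    (h : ∀ x ∈ s, ∑ e ∈ Finset.range N, c e * x ^ e = 0) : ∀ e < N, c e = 0 := by
  set f : Polynomial K := ∑ e ∈ Finset.range N, Polynomial.monomial e (c e) with hf
  have hcoeff : ∀ e < N, f.coeff e = c e := by
    intro e he
    simp [hf, Polynomial.coeff_monomial, he]
  have hdeg : f.degree < N := by
    refine (Polynomial.degree_sum_le _ _).trans_lt ?_
    refine (Finset.sup_lt_iff (WithBot.bot_lt_coe N)).2 fun e he => ?_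
    exact (Polynomial.degree_monomial_le e _).trans_lt
      (WithBot.coe_lt_coe.2 (Finset.mem_range.1 he))
  have h0 : f = 0 := by
    refine Polynomial.eq_zero_of_degree_lt_of_eval_finset_eq_zero s
      (hdeg.trans_le (by exact_mod_cast hs)) ?_
    intro x hx
    rw [hf, Polynomial.eval_finsetSum, ← h x hx]
    exact Finset.sum_congr rfl fun e _ => Polynomial.eval_monomial
  intro e he
  rw [← hcoeff e he, h0, Polynomial.coeff_zero]

/-- A polynomial with degrees less than `E` and `T` vanishes if on each of `E` vertical lines it
has `T` zeros. -/
theorem coeff_eq_zero_of_grid (c : ℕ → ℕ → K) {E T : ℕ} (x : ℕ → K) (y : ℕ → ℕ → K)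
    (J : Finset ℕ) (hJ : T ≤ J.card) (hx : Set.InjOn x (Set.Iio E))
    (hy : ∀ i < E, Set.InjOn (y i) J)
    (h : ∀ i < E, ∀ j ∈ J, ∑ e ∈ Finset.range E, ∑ e' ∈ Finset.range T,
      c e e' * (x i ^ e * y i j ^ e') = 0) : ∀ e < E, ∀ e' < T, c e e' = 0 := by
  classical
  have h1 : ∀ i < E, ∀ e' < T, ∑ e ∈ Finset.range E, c e e' * x i ^ e = 0 := by
    intro i hi
    refine coeff_eq_zero_of_zeros (fun e' => ∑ e ∈ Finset.range E, c e e' * x i ^ e) T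
      (J.image (y i)) ?_ ?_
    · rwa [Finset.card_image_of_injOn (hy i hi)]
    · intro z hz
      obtain ⟨j, hj, rfl⟩ := Finset.mem_image.1 hz
      rw [← h i hi j hj, Finset.sum_comm]
      refine Finset.sum_congr rfl fun e' _ => ?_
      rw [Finset.sum_mul]
      refine Finset.sum_congr rfl fun e _ => ?_
      ring
  intro e he e' he'
  refine coeff_eq_zero_of_zeros (fun e => c e e') E ((Finset.range E).image x) ?_ ?_ e he
  · rw [Finset.card_image_of_injOn (by simpa [Set.InjOn] using hx), Finset.card_range]
  · intro z hz
    obtain ⟨i, hi, rfl⟩ := Finset.mem_image.1 hz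
    exact h1 i (Finset.mem_range.1 hi) e' he'

end Zeros

/-! ### Words of polynomials along the orbit -/

section Words

variable {F : Type*} [Field F]

/-- The first coordinates `0, 1, 2, …` of the orbit of `(0, 1)` under `(x + 1, γ y)`. -/
def wordX (F : Type*) [Field F] : ℕ → F := fun k => k

/-- The second coordinates `1, γ, γ², …` of the orbit of `(0, 1)` under `(x + 1, γ y)`. -/
def wordY (γ : Fˣ) : ℕ → F := fun k => (γ : F) ^ k

/-- The values, along the orbit of `(0, 1)`, of the polynomials with `deg_x < E` and `deg_y < T`. -/
def words (γ : Fˣ) (E T : ℕ) : Submodule F (ℕ → F) := polySpan F (wordX F) (wordY γ) E T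

/-- Translation of words by `b` positions. -/
def shift (F : Type*) [Field F] (b : ℕ) : (ℕ → F) →ₐ[F] (ℕ → F) where
  toFun v k := v (k + b)
  map_one' := rfl
  map_mul' _ _ := rfl
  map_zero' := rfl
  map_add' _ _ := rfl
  commutes' _ := rfl

@[simp] theorem shift_apply (b : ℕ) (v : ℕ → F) (k : ℕ) : shift F b v k = v (k + b) := rfl

theorem shift_wordX (b : ℕ) : shift F b (wordX F) = wordX F + algebraMap F (ℕ → F) (b : F) := by
  ext k
  simp [wordX]

theorem shift_wordY (γ : Fˣ) (b : ℕ) : shift F b (wordY γ) = ((γ : F) ^ b) • wordY γ := by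
  ext k
  simp [wordY, pow_add, mul_comm]

theorem shift_mem_words {γ : Fˣ} {E T : ℕ} {v : ℕ → F} (hv : v ∈ words γ E T) (b : ℕ) :
    shift F b v ∈ words γ E T :=
  map_mem_polySpan _ (shift_wordX b) (shift_wordY γ b) hv

theorem pow_injOn {γ : Fˣ} {p n : ℕ} (hγ : orderOf γ = n) (hpn : Nat.Coprime p n) (i : ℕ) :
    Set.InjOn (fun j => (γ : F) ^ (j * p + i)) (Set.Iio n) := by
  intro j hj j' hj' h
  simp only [← Units.val_pow_eq_pow_val, Units.val_inj] at h
  rw [pow_eq_pow_iff_modEq, hγ] at h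
  have h1 : j * p ≡ j' * p [MOD n] := Nat.ModEq.add_right_cancel' i h
  have h2 : j ≡ j' [MOD n] := Nat.ModEq.cancel_right_of_coprime hpn.symm h1
  exact Nat.ModEq.eq_of_lt_of_lt h2 hj hj'

theorem natCast_add_injOn {K : Type*} [Field K] (p : ℕ) [CharP K p] (z : K) {E : ℕ}
    (hE : E ≤ p) : Set.InjOn (fun i : ℕ => z + (i : K)) (Set.Iio E) := by
  intro i hi j hj h
  have h1 : (i : K) = (j : K) := add_left_cancel h
  rw [CharP.natCast_eq_natCast K p] at h1
  exact Nat.ModEq.eq_of_lt_of_lt h1 (lt_of_lt_of_le hi hE) (lt_of_lt_of_le hj hE)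

variable {γ : Fˣ} {p n : ℕ} [CharP F p]

/-- The coefficients of a polynomial vanish if its values vanish at the positions that belong to
`E` rows and to `T` columns. -/
theorem coeff_eq_zero_of_word (hγ : orderOf γ = n) (hpn : Nat.Coprime p n) {E T : ℕ} (hE : E ≤ p)
    {J : Finset ℕ} (hJn : ∀ j ∈ J, j < n) (hJ : T ≤ J.card) {c : ℕ → ℕ → F}
    (h : ∀ j ∈ J, ∀ i < E, (∑ e ∈ Finset.range E, ∑ e' ∈ Finset.range T,
      c e e' • (wordX F ^ e * wordY γ ^ e')) (j * p + i) = 0) :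
    ∀ e < E, ∀ e' < T, c e e' = 0 := by
  refine coeff_eq_zero_of_grid c (fun i => (0 : F) + (i : F)) (fun i j => (γ : F) ^ (j * p + i)) J
    hJ (natCast_add_injOn p 0 hE) ?_ ?_
  · intro i _
    exact (pow_injOn hγ hpn i).mono fun j hj => hJn j hj
  · intro i hi j hj
    refine Eq.trans ?_ (h j hj i hi)
    simp [Finset.sum_apply, wordX, wordY]

/-- A nonzero word of a polynomial with `deg_y < T` vanishes, on the first rows, in less than `T`
columns. -/
theorem words_eq_zero (hγ : orderOf γ = n) (hpn : Nat.Coprime p n) {E T : ℕ} (hE : E ≤ p)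
    {J : Finset ℕ} (hJn : ∀ j ∈ J, j < n) (hJ : T ≤ J.card) {v : ℕ → F} (hv : v ∈ words γ E T)
    (h : ∀ j ∈ J, ∀ i < E, v (j * p + i) = 0) : v = 0 := by
  obtain ⟨c, rfl⟩ := mem_polySpan_iff.1 hv
  have hc := coeff_eq_zero_of_word hγ hpn hE hJn hJ h
  refine Finset.sum_eq_zero fun e he => Finset.sum_eq_zero fun e' he' => ?_
  rw [hc e (Finset.mem_range.1 he) e' (Finset.mem_range.1 he'), zero_smul]

end Words

/-! ### Linear recurrences with polynomial coefficients -/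

section Recurrence

variable {F : Type*} [Field F] [Fintype F] {K : Type*} [Field K] [Algebra F K]

/-- Translation of words, combined with the corresponding power of the Frobenius on `K`. -/
noncomputable def frobShift (F : Type*) [Field F] [Fintype F] (K : Type*) [Field K] [Algebra F K]
    (b : ℕ) : ((ℕ → F) × K) →ₐ[F] ((ℕ → F) × K) :=
  ((shift F b).comp (AlgHom.fst F _ _)).prod
    ((FiniteField.frobeniusAlgHom F K ^ b).comp (AlgHom.snd F _ _))

theorem frobeniusAlgHom_pow_apply (b : ℕ) (z : K) :
    (FiniteField.frobeniusAlgHom F K ^ b) z = z ^ Fintype.card F ^ b := by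
  induction b generalizing z with
  | zero => simp
  | succ b ih =>
    rw [pow_succ, AlgHom.mul_apply, ih, FiniteField.frobeniusAlgHom_apply, ← pow_mul, ← pow_succ']

theorem frobShift_fst (b : ℕ) (a : (ℕ → F) × K) (k : ℕ) :
    (frobShift F K b a).1 k = a.1 (k + b) := rfl

theorem frobShift_snd (b : ℕ) (a : (ℕ → F) × K) :
    (frobShift F K b a).2 = a.2 ^ Fintype.card F ^ b := frobeniusAlgHom_pow_apply b a.2

variable {γ : Fˣ} {ξ η : K}

theorem frob_pow_add (hξ : ξ ^ Fintype.card F = ξ + 1) (b : ℕ) :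
    (FiniteField.frobeniusAlgHom F K ^ b) ξ = ξ + b := by
  induction b with
  | zero => simp
  | succ b ih =>
    rw [pow_succ, AlgHom.mul_apply, FiniteField.frobeniusAlgHom_apply, hξ, map_add, ih, map_one]
    push_cast
    ring

theorem frob_pow_mul (hη : η ^ Fintype.card F = algebraMap F K γ * η) (b : ℕ) :
    (FiniteField.frobeniusAlgHom F K ^ b) η = algebraMap F K (γ ^ b) * η := by
  induction b with
  | zero => simp
  | succ b ih =>
    rw [pow_succ, AlgHom.mul_apply, FiniteField.frobeniusAlgHom_apply, hη, map_mul, ih,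
      AlgHom.commutes, ← mul_assoc, ← map_mul, pow_succ']

variable (γ ξ η)

/-- Pairs of the word and the value at `(ξ, η)` of a polynomial with `deg_x < E`, `deg_y < T`. -/
def liftedWords (E T : ℕ) : Submodule F ((ℕ → F) × K) :=
  polySpan F (wordX F, ξ) (wordY γ, η) E T

variable {γ ξ η}

theorem exists_lift {E T : ℕ} {v : ℕ → F} (hv : v ∈ words γ E T) :
    ∃ z : K, (v, z) ∈ liftedWords γ ξ η E T := by
  obtain ⟨c, rfl⟩ := mem_polySpan_iff.1 hv
  refine ⟨∑ e ∈ Finset.range E, ∑ e' ∈ Finset.range T, c e e' • (ξ ^ e * η ^ e'),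
    mem_polySpan_iff.2 ⟨c, ?_⟩⟩
  ext <;> simp [Prod.fst_sum, Prod.snd_sum]

/-- As the Frobenius acts on `(ξ, η)` as the translation acts on the points of the orbit, the word
and the value of a polynomial are transformed in parallel. -/
theorem frobShift_mem (hξ : ξ ^ Fintype.card F = ξ + 1)
    (hη : η ^ Fintype.card F = algebraMap F K γ * η) {E T : ℕ} {a : (ℕ → F) × K}
    (ha : a ∈ liftedWords γ ξ η E T) (b : ℕ) : frobShift F K b a ∈ liftedWords γ ξ η E T := by
  refine map_mem_polySpan (c := (b : F)) (d := (γ : F) ^ b) _ ?_ ?_ ha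
  · refine Prod.ext (shift_wordX b) ?_
    change (FiniteField.frobeniusAlgHom F K ^ b) ξ = _
    rw [frob_pow_add hξ]
    simp
  · refine Prod.ext (shift_wordY γ b) ?_
    change (FiniteField.frobeniusAlgHom F K ^ b) η = _
    rw [frob_pow_mul hη]
    simp [Algebra.smul_def]

variable {p n : ℕ} [CharP F p]

/-- A polynomial that vanishes along the orbit is zero. -/
theorem lifted_eq_zero_of_fst (hγ : orderOf γ = n) (hpn : Nat.Coprime p n) {E T : ℕ} (hE : E ≤ p)
    (hT : T ≤ n) {a : (ℕ → F) × K} (ha : a ∈ liftedWords γ ξ η E T) (h : a.1 = 0) : a = 0 := by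
  obtain ⟨c, rfl⟩ := mem_polySpan_iff.1 ha
  have hc : ∀ e < E, ∀ e' < T, c e e' = 0 := by
    refine coeff_eq_zero_of_word hγ hpn hE (J := Finset.range n)
      (fun j hj => Finset.mem_range.1 hj) (by simpa using hT) ?_
    intro j _ i _
    have h1 := congrFun h (j * p + i)
    simpa [Prod.fst_sum] using h1
  refine Finset.sum_eq_zero fun e he => Finset.sum_eq_zero fun e' he' => ?_
  rw [hc e (Finset.mem_range.1 he) e' (Finset.mem_range.1 he'), zero_smul]

/-- A polynomial over `F` that vanishes at `(ξ, η)` is zero, as it also vanishes at the conjugates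
`(ξ + k, γ ^ k η)`, which are as many points as the orbit has. -/
theorem lifted_eq_zero_of_snd (hγ : orderOf γ = n) (hpn : Nat.Coprime p n)
    (hξ : ξ ^ Fintype.card F = ξ + 1) (hη : η ^ Fintype.card F = algebraMap F K γ * η)
    (hη0 : η ≠ 0) {E T : ℕ} (hE : E ≤ p)
    (hT : T ≤ n) {a : (ℕ → F) × K} (ha : a ∈ liftedWords γ ξ η E T) (h : a.2 = 0) : a = 0 := by
  obtain ⟨c, rfl⟩ := mem_polySpan_iff.1 ha
  have : CharP K p := charP_of_injective_algebraMap (algebraMap F K).injective p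
  have hc : ∀ e < E, ∀ e' < T, algebraMap F K (c e e') = 0 := by
    refine coeff_eq_zero_of_grid (fun e e' => algebraMap F K (c e e')) (fun i => ξ + (i : K))
      (fun i j => algebraMap F K ((γ : F) ^ (j * p + i)) * η) (Finset.range n) (by simpa using hT)
      (natCast_add_injOn p ξ hE) ?_ ?_
    · intro i _ j hj j' hj' h
      refine pow_injOn hγ hpn i (by simpa using hj) (by simpa using hj') ?_
      exact (algebraMap F K).injective (mul_right_cancel₀ hη0 h)
    · -- apply the Frobenius `j p + i` times to the relation
      intro i _ j _
      have h1 := congrArg (FiniteField.frobeniusAlgHom F K ^ (j * p + i)) h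
      simp only [Prod.snd_sum, Prod.smul_snd, Prod.snd_mul, Prod.pow_snd, map_sum, map_smul,
        map_mul, map_pow (FiniteField.frobeniusAlgHom F K ^ (j * p + i)), map_zero,
        frob_pow_add hξ, frob_pow_mul hη] at h1
      rw [← h1]
      refine Finset.sum_congr rfl fun e _ => Finset.sum_congr rfl fun e' _ => ?_
      rw [Algebra.smul_def]
      simp
  refine Finset.sum_eq_zero fun e he => Finset.sum_eq_zero fun e' he' => ?_
  have h1 := hc e (Finset.mem_range.1 he) e' (Finset.mem_range.1 he')
  rw [map_eq_zero] at h1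
  rw [h1, zero_smul]

/-- In an algebraically closed field there is a point on which the Frobenius acts as
`(x + 1, γ y)`. -/
theorem exists_frobenius_point (γ : Fˣ) (hcard : Fintype.card F = n + 1)
    (hn : 0 < n) : ∃ ξ η : AlgebraicClosure F, ξ ^ Fintype.card F = ξ + 1 ∧
      η ^ Fintype.card F = algebraMap F (AlgebraicClosure F) γ * η ∧ η ≠ 0 := by
  obtain ⟨ξ, hξ⟩ := IsAlgClosed.exists_root
    (Polynomial.X ^ (n + 1) - (Polynomial.X + 1) : Polynomial (AlgebraicClosure F)) (by
      have h : (Polynomial.X + 1 : Polynomial (AlgebraicClosure F)).degree <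
          (Polynomial.X ^ (n + 1) : Polynomial (AlgebraicClosure F)).degree := by
        rw [Polynomial.degree_X_pow, ← Polynomial.C_1, Polynomial.degree_X_add_C]
        exact_mod_cast (by omega : 1 < n + 1)
      rw [Polynomial.degree_sub_eq_left_of_degree_lt h, Polynomial.degree_X_pow]
      exact_mod_cast (by omega : n + 1 ≠ 0))
  obtain ⟨η, hη⟩ := IsAlgClosed.exists_pow_nat_eq (algebraMap F (AlgebraicClosure F) γ) hn
  refine ⟨ξ, η, ?_, ?_, ?_⟩
  · rw [hcard]
    simpa [sub_eq_zero] using hξ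
  · rw [hcard, pow_succ, hη]
  · rintro rfl
    rw [zero_pow hn.ne'] at hη
    have : (γ : F) = 0 := by
      rw [← map_eq_zero (algebraMap F (AlgebraicClosure F)), ← hη]
    exact γ.ne_zero this

/-- A homogeneous linear recurrence of order `w - 1` with polynomial coefficients has at most
`q ^ (w - 1)` polynomial solutions. On the field element `z` that corresponds to a solution,
translation by `b` is the `b`-th power of the Frobenius, so `z` is a root of a nonzero polynomial of
degree at most `q ^ (w - 1)`. -/
theorem card_recurrence_le (hγ : orderOf γ = n) (hcard : Fintype.card F = n + 1) (hn : 0 < n)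
    (hpn : Nat.Coprime p n) {w : ℕ} {D D' s t : ℕ} (hD : D + s ≤ p) (hD' : D' + t ≤ n)
    (a : ℕ → ℕ → F) (ha : ∀ b < w, a b ∈ words γ D D') (ha0 : ∃ b < w, a b ≠ 0)
    (U : Set (ℕ → F)) (hU : ∀ v ∈ U, v ∈ words γ s t ∧
      ∀ k, ∑ b ∈ Finset.range w, a b k * v (k + b) = 0) :
    U.Finite ∧ U.ncard ≤ Fintype.card F ^ (w - 1) := by
  classical
  obtain ⟨ξ, η, hξ, hη, hη0⟩ := exists_frobenius_point γ hcard hn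
  have hA : ∀ b, ∃ z : AlgebraicClosure F, b < w → (a b, z) ∈ liftedWords γ ξ η D D' := by
    intro b
    by_cases hb : b < w
    · obtain ⟨z, hz⟩ := exists_lift (ξ := ξ) (η := η) (ha b hb)
      exact ⟨z, fun _ => hz⟩
    · exact ⟨0, fun h => absurd h hb⟩
  choose α hα using hA
  have hV : ∀ v : ℕ → F, ∃ z : AlgebraicClosure F, v ∈ U → (v, z) ∈ liftedWords γ ξ η s t := by
    intro v
    by_cases hv : v ∈ U
    · obtain ⟨z, hz⟩ := exists_lift (ξ := ξ) (η := η) (hU v hv).1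
      exact ⟨z, fun _ => hz⟩
    · exact ⟨0, fun h => absurd h hv⟩
  choose z hz using hV
  set P : Polynomial (AlgebraicClosure F) :=
    ∑ b ∈ Finset.range w, Polynomial.monomial (Fintype.card F ^ b) (α b) with hP
  have hq : 1 < Fintype.card F := by omega
  have hP0 : P ≠ 0 := by
    obtain ⟨b, hb, hab⟩ := ha0
    intro h
    have h1 : P.coeff (Fintype.card F ^ b) = α b := by
      rw [hP, Polynomial.finsetSum_coeff, Finset.sum_eq_single_of_mem b (Finset.mem_range.2 hb)]
      · simp
      · intro b' _ hb'
        rw [Polynomial.coeff_monomial, if_neg]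
        exact fun h => hb' (Nat.pow_right_injective hq h)
    rw [h, Polynomial.coeff_zero] at h1
    have h2 := lifted_eq_zero_of_snd hγ hpn hξ hη hη0 (by omega) (by omega) (hα b hb) h1.symm
    exact hab (congrArg Prod.fst h2)
  have hdeg : P.natDegree ≤ Fintype.card F ^ (w - 1) := by
    refine Polynomial.natDegree_sum_le_of_forall_le _ _ fun b hb => ?_
    refine (Polynomial.natDegree_monomial_le _).trans ?_
    exact Nat.pow_le_pow_right (by omega) (by have := Finset.mem_range.1 hb; omega)
  have hroot : ∀ v ∈ U, z v ∈ P.roots.toFinset := by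
    intro v hv
    rw [Multiset.mem_toFinset, Polynomial.mem_roots hP0, Polynomial.IsRoot.def, hP,
      Polynomial.eval_finsetSum]
    have h1 : (∑ b ∈ Finset.range w, (a b, α b) * frobShift F (AlgebraicClosure F) b (v, z v)) ∈
        liftedWords γ ξ η (D + s) (D' + t) :=
      Submodule.sum_mem _ fun b hb => mul_mem_polySpan (hα b (Finset.mem_range.1 hb))
        (frobShift_mem hξ hη (hz v hv) b)
    have h2 := lifted_eq_zero_of_fst hγ hpn hD hD' h1 (by
      ext k
      have := (hU v hv).2 k
      simpa [Prod.fst_sum, frobShift_fst] using this)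
    have h3 := congrArg Prod.snd h2
    simpa [Prod.snd_sum, frobShift_snd] using h3
  have hinj : Set.InjOn z U := by
    intro v hv v' hv' h
    have h1 := Submodule.sub_mem _ (hz v hv) (hz v' hv')
    have h2 := lifted_eq_zero_of_snd hγ hpn hξ hη hη0 (by omega) (by omega) h1 (by
      simp [h])
    have h3 := congrArg Prod.fst h2
    simpa [sub_eq_zero] using h3
  have hfin : U.Finite := Set.Finite.of_finite_image
    (P.roots.toFinset.finite_toSet.subset (by rintro _ ⟨v, hv, rfl⟩; exact hroot v hv)) hinj
  refine ⟨hfin, ?_⟩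
  calc U.ncard = (z '' U).ncard := hinj.ncard_image.symm
    _ ≤ (P.roots.toFinset : Set (AlgebraicClosure F)).ncard :=
      Set.ncard_le_ncard (by rintro _ ⟨v, hv, rfl⟩; exact hroot v hv) (Finset.finite_toSet _)
    _ = P.roots.toFinset.card := Set.ncard_coe_finset _
    _ ≤ P.roots.card := Multiset.toFinset_card_le _
    _ ≤ P.natDegree := Polynomial.card_roots' P
    _ ≤ _ := hdeg

end Recurrence

/-! ### Elimination and pruning in vector spaces -/

section LinearAlgebra

variable {F V : Type*} [Field F] [AddCommGroup V] [Module F V]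

/-- Subtracting multiples of a pivot turns a spanning family of a space into a spanning family of
the kernel of a functional on it. -/
theorem span_eliminate (v v' : ℕ → V) (N : ℕ) (φ : V →ₗ[F] F) {ρ : ℕ} (hρ : ρ < N)
    (h0 : φ (v ρ) ≠ 0) (hv' : ∀ k < N, v' k = v k - φ (v k) • (φ (v ρ))⁻¹ • v ρ) :
    Submodule.span F (v' '' Set.Iio N) = Submodule.span F (v '' Set.Iio N) ⊓ LinearMap.ker φ := by
  apply le_antisymm
  · rw [Submodule.span_le]
    rintro _ ⟨k, hk, rfl⟩
    rw [hv' k hk]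
    refine ⟨Submodule.sub_mem _ (Submodule.subset_span ⟨k, hk, rfl⟩) (Submodule.smul_mem _ _
      (Submodule.smul_mem _ _ (Submodule.subset_span ⟨ρ, hρ, rfl⟩))), ?_⟩
    simp [h0]
  · rintro x ⟨hx, hφ⟩
    -- the projection along the pivot fixes `x`
    set π : V →ₗ[F] V := LinearMap.id - φ.smulRight ((φ (v ρ))⁻¹ • v ρ) with hπ
    have h1 : (Submodule.span F (v '' Set.Iio N)).map π ≤
        Submodule.span F (v' '' Set.Iio N) := by
      rw [Submodule.map_span_le]
      rintro _ ⟨k, hk, rfl⟩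
      have : π (v k) = v' k := by rw [hv' k hk]; simp [hπ]
      rw [this]
      exact Submodule.subset_span ⟨k, hk, rfl⟩
    have h2 : π x = x := by
      have h3 : φ x = 0 := hφ
      simp [hπ, h3]
    rw [← h2]
    exact h1 (Submodule.mem_map_of_mem hx)

/-- If for each space that contains `x` and is not yet reduced to the line of `x` there are `g`
choices of a subspace `Z b` through `x` that cut it down, then at least `g ^ k` sequences of
`k` choices cut down a space of dimension `k + 1` to the line of `x`. -/
theorem pow_le_card_prune {B : Type*} [Fintype B] (Z : B → Submodule F V) (x : V) (hx : x ≠ 0)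
    (S : Submodule F V) [FiniteDimensional F S] (g : ℕ)
    (hg : ∀ U ≤ S, x ∈ U → g ≤ Nat.card {b // x ∈ Z b ∧ (U ≤ Submodule.span F {x} ∨ ¬ U ≤ Z b)})
    (k : ℕ) : ∀ U ≤ S, x ∈ U → Module.finrank F U ≤ k + 1 →
      g ^ k ≤ Nat.card {bs : Fin k → B // (∀ i, x ∈ Z (bs i)) ∧
        U ⊓ ⨅ i, Z (bs i) ≤ Submodule.span F {x}} := by
  classical
  induction k with
  | zero =>
    intro U hU hxU hdim
    have : FiniteDimensional F U := Submodule.finiteDimensional_of_le hU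
    have hle : U ≤ Submodule.span F {x} := by
      have h1 : Submodule.span F {x} ≤ U := by simpa using hxU
      refine (Submodule.eq_of_le_of_finrank_le h1 ?_).ge
      rw [finrank_span_singleton hx]
      exact hdim
    rw [pow_zero, Nat.one_le_iff_ne_zero, Nat.card_ne_zero]
    exact ⟨⟨⟨Fin.elim0, fun i => i.elim0, inf_le_left.trans hle⟩⟩, inferInstance⟩
  | succ k ih =>
    intro U hU hxU hdim
    have : FiniteDimensional F U := Submodule.finiteDimensional_of_le hU
    set G := {b // x ∈ Z b ∧ (U ≤ Submodule.span F {x} ∨ ¬ U ≤ Z b)} with hG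
    set G' : G → Type _ := fun b => {bs : Fin k → B // (∀ i, x ∈ Z (bs i)) ∧
        (U ⊓ Z b.1) ⊓ ⨅ i, Z (bs i) ≤ Submodule.span F {x}} with hG'
    have h1 : ∀ b : G, g ^ k ≤ Nat.card (G' b) := by
      rintro ⟨b, hb, hb'⟩
      refine ih (U ⊓ Z b) (inf_le_left.trans hU) ⟨hxU, hb⟩ ?_
      rcases hb' with hb' | hb'
      · have h3 := Submodule.finrank_mono (inf_le_left.trans hb' : U ⊓ Z b ≤ _)
        rw [finrank_span_singleton hx] at h3
        omega
      · have h3 : U ⊓ Z b < U := lt_of_le_of_ne inf_le_left fun h => hb' (inf_eq_left.1 h)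
        have := Submodule.finrank_lt_finrank_of_lt h3
        omega
    have h2 : Nat.card (Σ b, G' b) ≤ Nat.card {bs : Fin (k + 1) → B // (∀ i, x ∈ Z (bs i)) ∧
        U ⊓ ⨅ i, Z (bs i) ≤ Submodule.span F {x}} := by
      refine Nat.card_le_card_of_injective (fun y => ⟨Fin.cons y.1.1 y.2.1, ?_, ?_⟩) ?_
      · intro i
        refine Fin.cases ?_ (fun i => ?_) i
        · simpa using y.1.2.1
        · simpa using y.2.2.1 i
      · refine le_trans (le_inf (le_inf inf_le_left ?_) (le_iInf fun i => ?_)) y.2.2.2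
        · exact inf_le_right.trans ((iInf_le _ 0).trans (by simp))
        · exact inf_le_right.trans ((iInf_le _ i.succ).trans (by simp))
      · rintro ⟨⟨b, hb⟩, ⟨bs, hbs⟩⟩ ⟨⟨b', hb'⟩, ⟨bs', hbs'⟩⟩ h
        simp only [Subtype.mk.injEq, Fin.cons_inj] at h
        obtain ⟨rfl, rfl⟩ := h
        rfl
    refine le_trans ?_ h2
    rw [Nat.card_eq_fintype_card, Fintype.card_sigma, pow_succ']
    calc g * g ^ k ≤ Fintype.card G * g ^ k :=
          Nat.mul_le_mul_right _ (by rw [← Nat.card_eq_fintype_card]; exact hg U hU hxU)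
      _ = ∑ _b : G, g ^ k := by simp
      _ ≤ _ := Finset.sum_le_sum fun b _ => by rw [← Nat.card_eq_fintype_card]; exact h1 b

end LinearAlgebra

/-! ### Coin tosses -/

/-- The number in binary with the given bits, reduced modulo `n` after each bit. -/
def sample (n : ℕ) (ω : ℕ → Bool) : ℕ → ℕ
  | 0 => 0
  | l + 1 => (sample n ω l + sample n ω l + if ω l then 1 else 0) % n

theorem sample_congr {n : ℕ} {ω ω' : ℕ → Bool} {q : ℕ} (h : ∀ l < q, ω l = ω' l) :
    sample n ω q = sample n ω' q := by
  induction q with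
  | zero => rfl
  | succ q ih => rw [sample, sample, ih fun l hl => h l (by omega), h q (by omega)]

theorem sample_lt {n : ℕ} (hn : 0 < n) (ω : ℕ → Bool) (l : ℕ) : sample n ω l < n := by
  cases l with
  | zero => exact hn
  | succ l => exact Nat.mod_lt _ hn

theorem tape_apply {T : ℕ} (b : Fin T → Bool) {k : ℕ} (hk : k < T) : tape b k = b ⟨k, hk⟩ :=
  dif_pos hk

/-- Among the `2 ^ q` numbers with `q` bits at least `2 ^ q / n` have a given remainder. -/
theorem le_card_sample (n q : ℕ) (j : Fin n) :
    2 ^ q / n ≤ Nat.card {b : Fin q → Bool // sample n (tape b) q = j} := by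
  classical
  have hn : 0 < n := j.pos
  -- the leading bits of `y`
  have key : ∀ y : ℕ, ∀ l ≤ q, sample n (fun l => y.testBit (q - 1 - l)) l = y / 2 ^ (q - l) % 2 ^ l % n := by
    intro y l hl
    induction l with
    | zero => simp [sample, Nat.mod_one]
    | succ l ih =>
      rw [sample, ih (by omega)]
      have e1 : q - l = (q - 1 - l) + 1 := by omega
      have e2 : q - (l + 1) = q - 1 - l := by omega
      rw [e1, e2, pow_succ 2 (q - 1 - l), ← Nat.div_div_eq_div_mul]
      set z := y / 2 ^ (q - 1 - l) with hz
      have e3 : (if y.testBit (q - 1 - l) = true then 1 else 0) = z % 2 := by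
        rw [Nat.testBit_eq_decide_div_mod_eq, ← hz]
        simp only [decide_eq_true_eq]
        split_ifs <;> omega
      rw [e3]
      have e4 : z % 2 ^ (l + 1) = 2 * (z / 2 % 2 ^ l) + z % 2 := by
        rw [pow_succ', Nat.mod_mul]
        ring
      rw [e4]
      have e5 := Nat.mod_add_div (z / 2 % 2 ^ l) n
      set A := z / 2 % 2 ^ l
      conv_rhs => rw [← e5]
      rw [show 2 * (A % n + n * (A / n)) + z % 2 = A % n + A % n + z % 2 + n * (2 * (A / n)) by ring,
        Nat.add_mul_mod_self_left]
  have key' : ∀ y < 2 ^ q, sample n (tape fun l : Fin q => y.testBit (q - 1 - l)) q = y % n := by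
    intro y hy
    have h1 := key y q le_rfl
    rw [Nat.sub_self, pow_zero, Nat.div_one, Nat.mod_eq_of_lt hy] at h1
    rw [← h1]
    exact sample_congr fun l hl => tape_apply _ hl
  have hlt : ∀ i : Fin (2 ^ q / n), i * n + j < 2 ^ q := by
    intro i
    have h1 : (i + 1) * n ≤ 2 ^ q / n * n := Nat.mul_le_mul_right _ i.2
    have h2 := Nat.div_mul_le_self (2 ^ q) n
    have h3 := j.2
    have h4 : ((i : ℕ) + 1) * n = i * n + n := by ring
    omega
  have hinj : Function.Injective fun i : Fin (2 ^ q / n) =>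
      (⟨fun l : Fin q => ((i : ℕ) * n + j).testBit (q - 1 - l), by
        rw [key' _ (hlt i), mul_comm, Nat.mul_add_mod, Nat.mod_eq_of_lt j.2]⟩ :
        {b : Fin q → Bool // sample n (tape b) q = j}) := by
    intro i i' h
    simp only [Subtype.mk.injEq] at h
    have h1 : (i : ℕ) * n + j = i' * n + j := by
      refine Nat.eq_of_testBit_eq fun l => ?_
      by_cases hl : l < q
      · have := congrFun h ⟨q - 1 - l, by omega⟩
        simpa [show q - 1 - (q - 1 - l) = l by omega] using this
      · have hq : 2 ^ q ≤ 2 ^ l := Nat.pow_le_pow_right (by omega) (by omega)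
        rw [Nat.testBit_lt_two_pow ((hlt i).trans_le hq),
          Nat.testBit_lt_two_pow ((hlt i').trans_le hq)]
    have h2 : (i : ℕ) * n = i' * n := by omega
    exact Fin.ext (Nat.eq_of_mul_eq_mul_right hn h2)
  simpa using Nat.card_le_card_of_injective _ hinj

/-- The coins of the `τ`-th of a sequence of trials, each of which tosses `w` times `q` coins. -/
def trialCoins {T : ℕ} (w q : ℕ) (b : Fin T → Bool) (τ : ℕ) (i : Fin w) (l : Fin q) : Bool :=
  tape b ((τ * w + i) * q + l)

/-- Events that depend on different coins are independent. -/
theorem card_forall_trial {T M w q : ℕ} (hT : M * w * q ≤ T)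
    (G : Set (Fin w → Fin q → Bool)) :
    Nat.card {b : Fin T → Bool // ∀ τ < M, trialCoins w q b τ ∈ G} =
      Nat.card G ^ M * 2 ^ (T - M * w * q) := by
  classical
  have hlt : ∀ x : Fin M × Fin w × Fin q, ((x.1 : ℕ) * w + x.2.1) * q + x.2.2 < T := by
    rintro ⟨τ, i, l⟩
    have h1 : ((τ : ℕ) + 1) * w ≤ M * w := Nat.mul_le_mul_right _ τ.2
    have h2 : ((τ : ℕ) * w + i + 1) * q ≤ M * w * q := Nat.mul_le_mul_right _ (by
      have := i.2; rw [add_mul] at h1; omega)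
    have := l.2
    rw [add_mul _ 1] at h2
    simp only
    omega
  set ι : Fin M × Fin w × Fin q → Fin T := fun x => ⟨_, hlt x⟩ with hι
  have hinj : Function.Injective ι := by
    rintro ⟨τ, i, l⟩ ⟨τ', i', l'⟩ h
    simp only [hι, Fin.mk.injEq] at h
    have hdiv : ∀ (a b c d Q : ℕ), b < Q → d < Q → a * Q + b = c * Q + d → a = c ∧ b = d := by
      intro a b c d Q hb hd h
      have h1 : (a * Q + b) / Q = a := by
        rw [mul_comm, Nat.mul_add_div (by omega), Nat.div_eq_of_lt hb, add_zero]
      have h2 : (c * Q + d) / Q = c := by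
        rw [mul_comm, Nat.mul_add_div (by omega), Nat.div_eq_of_lt hd, add_zero]
      have h3 : a = c := by rw [← h1, h, h2]
      subst h3
      exact ⟨rfl, by omega⟩
    obtain ⟨h1, h2⟩ := hdiv _ _ _ _ q l.2 l'.2 h
    obtain ⟨h3, h4⟩ := hdiv _ _ _ _ w i.2 i'.2 h1
    rw [Fin.ext h2, Fin.ext h3, Fin.ext h4]
  set R := {x : Fin T // ¬ ∃ y, ι y = x}
  have hR : Fintype.card R = T - M * w * q := by
    rw [Fintype.card_subtype_compl]
    have : Fintype.card {x // ∃ y, ι y = x} = M * w * q := by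
      have h := Nat.card_congr (Equiv.ofInjective ι hinj)
      rw [Nat.card_eq_fintype_card] at h
      rw [← Nat.card_eq_fintype_card]
      refine Eq.trans h.symm ?_
      simp [mul_assoc]
    rw [this, Fintype.card_fin]
  have e : {b : Fin T → Bool // ∀ τ < M, trialCoins w q b τ ∈ G} ≃ (Fin M → G) × (R → Bool) :=
    { toFun := fun b => ⟨fun τ => ⟨_, b.2 τ τ.2⟩, fun x => b.1 x.1⟩
      invFun := fun y => ⟨fun x => if h : ∃ z, ι z = x then
          (y.1 h.choose.1).1 h.choose.2.1 h.choose.2.2 else y.2 ⟨x, h⟩, by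
        intro τ hτ
        have : trialCoins w q (fun x => if h : ∃ z, ι z = x then
            (y.1 h.choose.1).1 h.choose.2.1 h.choose.2.2 else y.2 ⟨x, h⟩) τ =
            (y.1 ⟨τ, hτ⟩).1 := by
          funext i l
          rw [trialCoins, tape_apply _ (hlt (⟨τ, hτ⟩, i, l))]
          have h : ∃ z, ι z = ⟨_, hlt (⟨τ, hτ⟩, i, l)⟩ := ⟨(⟨τ, hτ⟩, i, l), rfl⟩
          have h' : h.choose = (⟨τ, hτ⟩, i, l) := hinj h.choose_spec
          rw [dif_pos h, h']
        rw [this]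
        exact (y.1 ⟨τ, hτ⟩).2⟩
      left_inv := by
        rintro ⟨b, hb⟩
        refine Subtype.ext (funext fun x => ?_)
        by_cases h : ∃ z, ι z = x
        · simp only [dif_pos h]
          have h1 := h.choose_spec
          rw [trialCoins, tape_apply _ (hlt h.choose)]
          exact congrArg b h1
        · simp only [dif_neg h]
      right_inv := by
        rintro ⟨y, z⟩
        refine Prod.ext (funext fun τ => Subtype.ext (funext fun i => funext fun l => ?_))
          (funext fun x => ?_)
        · change trialCoins w q _ τ i l = _
          rw [trialCoins, tape_apply _ (hlt (τ, i, l))]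
          have h : ∃ z, ι z = ⟨_, hlt (τ, i, l)⟩ := ⟨(τ, i, l), rfl⟩
          have h' : h.choose = (τ, i, l) := hinj h.choose_spec
          simp only [dif_pos h, h']
        · simp only [dif_neg x.2]
          rfl }
  rw [Nat.card_congr e, Nat.card_prod, Nat.card_fun, Nat.card_fun, Nat.card_eq_fintype_card (α := R),
    hR]
  simp

/-- If each of finitely many events has probability at least `δ` in one trial, then with
probability at least `1 - N (1 - δ) ^ M` each of them occurs in one of `M` independent trials. -/
theorem le_card_trials {T M w q : ℕ} (hT : M * w * q ≤ T) {X : Type*} (L : Finset X)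
    (G : X → Set (Fin w → Fin q → Bool)) (δ : ℝ)
    (hG : ∀ x ∈ L, δ * 2 ^ (w * q) ≤ Nat.card (G x)) :
    (1 - L.card * (1 - δ) ^ M) * 2 ^ T ≤
      (Nat.card {b : Fin T → Bool // ∀ x ∈ L, ∃ τ < M, trialCoins w q b τ ∈ G x} : ℝ) := by
  classical
  set bad : X → Finset (Fin T → Bool) := fun x =>
    {b | ∀ τ < M, trialCoins w q b τ ∈ (G x)ᶜ} with hbad
  set good : Finset (Fin T → Bool) :=
    {b | ∀ x ∈ L, ∃ τ < M, trialCoins w q b τ ∈ G x} with hgood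
  have h1 : Nat.card {b : Fin T → Bool // ∀ x ∈ L, ∃ τ < M, trialCoins w q b τ ∈ G x} =
      good.card := by
    rw [Nat.card_eq_fintype_card, Fintype.card_subtype]
  have h2 : (Finset.univ : Finset (Fin T → Bool)) ⊆ good ∪ L.biUnion bad := by
    intro b _
    by_cases hb : b ∈ good
    · exact Finset.mem_union_left _ hb
    · refine Finset.mem_union_right _ ?_
      simp only [hgood, Finset.mem_filter, Finset.mem_univ, true_and] at hb
      push Not at hb
      obtain ⟨x, hx, h⟩ := hb
      exact Finset.mem_biUnion.2 ⟨x, hx, by simpa [hbad] using h⟩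
  have h3 : (2 : ℝ) ^ T ≤ good.card + ∑ x ∈ L, ((bad x).card : ℝ) := by
    have h4 := (Finset.card_le_card h2).trans ((Finset.card_union_le _ _).trans
      (Nat.add_le_add_left Finset.card_biUnion_le _))
    rw [Finset.card_univ, Fintype.card_fun, Fintype.card_bool, Fintype.card_fin] at h4
    exact_mod_cast h4
  have h5 : ∀ x ∈ L, ((bad x).card : ℝ) ≤ (1 - δ) ^ M * 2 ^ T := by
    intro x hx
    have h6 : (bad x).card = Nat.card ((G x)ᶜ : Set (Fin w → Fin q → Bool)) ^ M *
        2 ^ (T - M * w * q) := by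
      rw [← card_forall_trial hT, Nat.card_eq_fintype_card, Fintype.card_subtype]
    have h7 : Nat.card (G x) + Nat.card ((G x)ᶜ : Set (Fin w → Fin q → Bool)) = 2 ^ (w * q) := by
      have h8 := Set.ncard_add_ncard_compl (G x)
      rw [Nat.card_coe_set_eq, Nat.card_coe_set_eq, h8]
      simp [← pow_mul, mul_comm]
    have h8 : (Nat.card ((G x)ᶜ : Set (Fin w → Fin q → Bool)) : ℝ) ≤
        (1 - δ) * 2 ^ (w * q) := by
      have h9 : (Nat.card (G x) : ℝ) + Nat.card ((G x)ᶜ : Set (Fin w → Fin q → Bool)) =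
        2 ^ (w * q) := by exact_mod_cast h7
      have := hG x hx
      linarith
    rw [h6]
    push_cast
    calc (Nat.card ((G x)ᶜ : Set (Fin w → Fin q → Bool)) : ℝ) ^ M * 2 ^ (T - M * w * q)
        ≤ ((1 - δ) * 2 ^ (w * q)) ^ M * 2 ^ (T - M * w * q) :=
          mul_le_mul_of_nonneg_right (pow_le_pow_left₀ (Nat.cast_nonneg _) h8 _) (by positivity)
      _ = (1 - δ) ^ M * 2 ^ T := by
          rw [mul_pow, mul_assoc, ← pow_mul, ← pow_add]
          congr 2
          have : w * q * M = M * w * q := by ring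
          omega
  have h6 : ∑ x ∈ L, ((bad x).card : ℝ) ≤ L.card * ((1 - δ) ^ M * 2 ^ T) := by
    rw [← nsmul_eq_mul]
    exact Finset.sum_le_card_nsmul _ _ _ h5
  rw [h1]
  linarith

/-! ### Interpolation -/

section Interpolation

variable {F : Type*} [Field F]

/-- The word of the monomial `x ^ e * y ^ e'`. -/
def monoWord (γ : Fˣ) (e e' : ℕ) : ℕ → F := wordX F ^ e * wordY γ ^ e'

theorem monoWord_apply (γ : Fˣ) (e e' k : ℕ) :
    monoWord γ e e' k = (k : F) ^ e * ((γ : F) ^ k) ^ e' := rfl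

theorem monoWord_mem (γ : Fˣ) {E T e e' : ℕ} (he : e < E) (he' : e' < T) :
    monoWord γ e e' ∈ words γ E T := monomial_mem_polySpan _ _ he he'

theorem words_le {γ : Fˣ} {E T : ℕ} {S : Submodule F (ℕ → F)}
    (h : ∀ e < E, ∀ e' < T, monoWord γ e e' ∈ S) : words γ E T ≤ S := by
  rw [words, polySpan, Submodule.span_le]
  rintro _ ⟨e, he, e', he', rfl⟩
  exact h e he e' he'

instance (γ : Fˣ) (E T : ℕ) : FiniteDimensional F (words γ E T) := by
  have : {a | ∃ e < E, ∃ e' < T, a = wordX F ^ e * wordY γ ^ e'} =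
      (fun x : ℕ × ℕ => monoWord γ x.1 x.2) '' (Set.Iio E ×ˢ Set.Iio T) := by
    ext a
    constructor
    · rintro ⟨e, he, e', he', rfl⟩
      exact ⟨(e, e'), ⟨he, he'⟩, rfl⟩
    · rintro ⟨⟨e, e'⟩, ⟨he, he'⟩, rfl⟩
      exact ⟨e, he, e', he', rfl⟩
  rw [words, polySpan, this]
  exact FiniteDimensional.span_of_finite F (((Set.finite_Iio E).prod (Set.finite_Iio T)).image _)

theorem finrank_words {γ : Fˣ} {p n : ℕ} [CharP F p] (hγ : orderOf γ = n)
    (hpn : Nat.Coprime p n) {E T : ℕ} (hE : E ≤ p) (hT : T ≤ n) :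
    Module.finrank F (words γ E T) = E * T := by
  have hspan : words γ E T =
      Submodule.span F (Set.range fun x : Fin E × Fin T => monoWord γ x.1 x.2) := by
    apply le_antisymm
    · exact words_le fun e he e' he' =>
        Submodule.subset_span ⟨(⟨e, he⟩, ⟨e', he'⟩), rfl⟩
    · rw [Submodule.span_le]
      rintro _ ⟨x, rfl⟩
      exact monoWord_mem γ x.1.2 x.2.2
  have hli : LinearIndependent F fun x : Fin E × Fin T => monoWord γ (x.1 : ℕ) (x.2 : ℕ) := by
    rw [Fintype.linearIndependent_iff]
    intro c hc
    have h1 := coeff_eq_zero_of_word hγ hpn hE (J := Finset.range n)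
      (fun j hj => Finset.mem_range.1 hj) (by simpa using hT)
      (c := fun e e' => if h : e < E ∧ e' < T then c (⟨e, h.1⟩, ⟨e', h.2⟩) else 0) (by
        intro j _ i _
        rw [← show (0 : ℕ → F) (j * p + i) = 0 from rfl, ← hc]
        simp only [Finset.sum_range, Fintype.sum_prod_type, Fin.is_lt, and_self, dif_pos, Fin.eta]
        rfl)
    rintro ⟨e, e'⟩
    have := h1 e e.2 e' e'.2
    rwa [dif_pos ⟨e.2, e'.2⟩] at this
  rw [hspan, finrank_span_eq_card hli]
  simp

/-- The relations between the degree bounds in the interpolation: `p × n` is the size of a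
received word, `s` and `t` are the degree bounds of the code, `T₀` is the number of columns in which a
codeword agrees with the received word, `w` is the order of the recurrence, and `D`, `D'` are the
degree bounds of its coefficients. -/
structure Design (p n s t w E₀ T₀ D D' : ℕ) : Prop where
  s_pos : 0 < s
  t_pos : 0 < t
  w_pos : 0 < w
  rows : E₀ = D + s
  window : E₀ + w = p + 1
  cols : T₀ = D' + t
  cols_le : T₀ ≤ n
  count : n * E₀ < E₀ * T₀ + w * (D * D')

/-- The vector of `A + ∑ A_b Z_b`: the values of `A(x, y) + ∑ A_b(x, y) r(k + b)` at the positions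
`k < N`, followed by the values of `A_0, A_1, …, A_(w-1)`. -/
def interpVec (r : ℕ → F) (w N : ℕ) : ((ℕ → F) × (Fin w → ℕ → F)) →ₗ[F] (ℕ → F) where
  toFun a c := if c < N then a.1 c + ∑ b : Fin w, a.2 b c * r (c + b)
    else if h : c / N - 1 < w then a.2 ⟨c / N - 1, h⟩ (c % N) else 0
  map_add' a a' := by
    ext c
    simp only [Prod.fst_add, Prod.snd_add, Pi.add_apply, add_mul, Finset.sum_add_distrib]
    split_ifs <;> ring
  map_smul' k a := by
    ext c
    simp only [Prod.smul_fst, Prod.smul_snd, Pi.smul_apply, smul_eq_mul, mul_assoc,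
      ← Finset.mul_sum, RingHom.id_apply]
    split_ifs <;> ring

theorem interpVec_of_lt (r : ℕ → F) {w N c : ℕ} (hc : c < N) (a : (ℕ → F) × (Fin w → ℕ → F)) :
    interpVec r w N a c = a.1 c + ∑ b : Fin w, a.2 b c * r (c + b) := if_pos hc

theorem interpVec_block (r : ℕ → F) {w N k : ℕ} (hk : k < N) (b : Fin w)
    (a : (ℕ → F) × (Fin w → ℕ → F)) : interpVec r w N a ((b + 1) * N + k) = a.2 b k := by
  have h1 : ((b + 1) * N + k) / N = b + 1 := by
    rw [mul_comm, Nat.mul_add_div (by omega), Nat.div_eq_of_lt hk, add_zero]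
  have h2 : ((b + 1) * N + k) % N = k := by
    rw [mul_comm, Nat.mul_add_mod, Nat.mod_eq_of_lt hk]
  have h3 : ¬ (b + 1) * N + k < N := by
    have : (b + 1) * N = b * N + N := by ring
    omega
  change (if _ then _ else _) = _
  rw [if_neg h3]
  simp only [h1, h2, Nat.add_sub_cancel, b.2, dif_pos]

/-- The space of all interpolation vectors with the given degree bounds. -/
def interpSpace (γ : Fˣ) (r : ℕ → F) (w N E₀ T₀ D D' : ℕ) : Submodule F (ℕ → F) :=
  ((words γ E₀ T₀).prod (Submodule.pi Set.univ fun _ => words γ D D')).map (interpVec r w N)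

theorem interpSpace_le {γ : Fˣ} {r : ℕ → F} {w N E₀ T₀ D D' : ℕ} {S : Submodule F (ℕ → F)}
    (h0 : ∀ e < E₀, ∀ e' < T₀, interpVec r w N (monoWord γ e e', 0) ∈ S)
    (h1 : ∀ b : Fin w, ∀ e < D, ∀ e' < D',
      interpVec r w N (0, Pi.single b (monoWord γ e e')) ∈ S) :
    interpSpace γ r w N E₀ T₀ D D' ≤ S := by
  rintro _ ⟨⟨a, A⟩, ⟨ha, hA⟩, rfl⟩
  have e1 : (a, A) = LinearMap.inl F _ _ a +
      ∑ b : Fin w, LinearMap.inr F (ℕ → F) _ (LinearMap.single F _ b (A b)) := by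
    rw [← map_sum]
    refine Prod.ext (by simp [Prod.fst_sum]) ?_
    simp only [LinearMap.inl_apply, LinearMap.inr_apply, Prod.snd_add, zero_add,
      LinearMap.coe_single]
    exact (Finset.univ_sum_single A).symm
  rw [e1, map_add, map_sum]
  refine Submodule.add_mem _ ?_ (Submodule.sum_mem _ fun b _ => ?_)
  · have : words γ E₀ T₀ ≤ S.comap (interpVec r w N ∘ₗ LinearMap.inl F _ _) :=
      words_le fun e he e' he' => h0 e he e' he'
    exact this ha
  · have : words γ D D' ≤ S.comap
        (interpVec r w N ∘ₗ LinearMap.inr F _ _ ∘ₗ LinearMap.single F _ b) :=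
      words_le fun e he e' he' => h1 b e he e' he'
    exact this (hA b (Set.mem_univ b))

variable {γ : Fˣ} {p n s t w E₀ T₀ D D' : ℕ} [CharP F p]

theorem Design.rows_le (hd : Design p n s t w E₀ T₀ D D') : E₀ ≤ p := by
  have := hd.window
  have := hd.w_pos
  omega

theorem pos_lt {n p j i : ℕ} (hj : j < n) (hi : i < p) : j * p + i < n * p := by
  have h1 : (j + 1) * p ≤ n * p := Nat.mul_le_mul_right _ hj
  rw [add_mul] at h1
  omega

theorem pos_mod {p j i : ℕ} (hi : i < p) : (j * p + i) % p = i := by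
  rw [mul_comm, Nat.mul_add_mod, Nat.mod_eq_of_lt hi]

theorem pos_div {p j i : ℕ} (hi : i < p) : (j * p + i) / p = j := by
  rw [mul_comm, Nat.mul_add_div (by omega), Nat.div_eq_of_lt hi, add_zero]

theorem pos_eta (p k : ℕ) : k / p * p + k % p = k := by
  rw [mul_comm]; exact Nat.div_add_mod k p

/-- There is a nonzero interpolation polynomial that vanishes in all windows. -/
theorem exists_interpolation (hγ : orderOf γ = n) (hpn : Nat.Coprime p n)
    (hd : Design p n s t w E₀ T₀ D D') (r : ℕ → F) :
    ∃ u ∈ interpSpace γ r w (n * p) E₀ T₀ D D', (∀ k < n * p, k % p < E₀ → u k = 0) ∧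
      ∃ c, n * p ≤ c ∧ c < (w + 1) * (n * p) ∧ u c ≠ 0 := by
  set M := words γ E₀ T₀ × (Fin w → words γ D D') with hM
  set Ψ : M →ₗ[F] ((ℕ → F) × (Fin w → ℕ → F)) :=
    (words γ E₀ T₀).subtype.prodMap (LinearMap.pi fun b =>
      (words γ D D').subtype ∘ₗ LinearMap.proj b) with hΨ
  set Φ : M →ₗ[F] (Fin n × Fin E₀ → F) :=
    LinearMap.pi fun x => LinearMap.proj ((x.1 : ℕ) * p + (x.2 : ℕ)) ∘ₗ
      interpVec r w (n * p) ∘ₗ Ψ with hΦ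
  have hEp := hd.rows_le
  have hD : D ≤ p := by have := hd.rows; omega
  have hD' : D' ≤ n := by have := hd.cols; have := hd.cols_le; omega
  have hlt : Module.finrank F (Fin n × Fin E₀ → F) < Module.finrank F M := by
    have h1 := Module.finrank_pi_fintype F (M := fun _ : Fin w => words γ D D')
    rw [finrank_words hγ hpn hD hD'] at h1
    rw [Module.finrank_prod, h1, finrank_words hγ hpn hEp hd.cols_le]
    simpa using hd.count
  obtain ⟨x, hx, hx0⟩ := (Submodule.ne_bot_iff _).1 (LinearMap.ker_ne_bot_of_finrank_lt hlt : LinearMap.ker Φ ≠ ⊥)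
  have hwin : ∀ k < n * p, k % p < E₀ → interpVec r w (n * p) (Ψ x) k = 0 := by
    intro k hk hkE
    have h1 := congrFun (show Φ x = 0 from hx) (⟨k / p, Nat.div_lt_of_lt_mul (by linarith)⟩, ⟨k % p, hkE⟩)
    change interpVec r w (n * p) (Ψ x) (k / p * p + k % p) = 0 at h1
    rwa [pos_eta] at h1
  refine ⟨interpVec r w (n * p) (Ψ x), ⟨Ψ x, ⟨x.1.2, fun b _ => (x.2 b).2⟩, rfl⟩, hwin, ?_⟩
  by_contra hcon
  push Not at hcon
  -- all `A_b` vanish, and then so does `A`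
  have hA : ∀ b, x.2 b = 0 := by
    intro b
    refine Subtype.ext (words_eq_zero hγ hpn hD (J := Finset.range n)
      (fun j hj => Finset.mem_range.1 hj) (by simpa using hD') (x.2 b).2 fun j hj i hi => ?_)
    have hk := pos_lt (Finset.mem_range.1 hj) (hi.trans_le hD)
    have h1 := interpVec_block r hk b (Ψ x)
    rw [hcon] at h1
    · exact h1.symm
    · have : (b + 1) * (n * p) = b * (n * p) + n * p := by ring
      omega
    · exact pos_lt (by have := b.2; omega) hk
  have h0 : x.1 = 0 := by
    refine Subtype.ext (words_eq_zero hγ hpn hEp (J := Finset.range n)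
      (fun j hj => Finset.mem_range.1 hj) (by simpa using hd.cols_le) x.1.2 fun j hj i hi => ?_)
    have hk := pos_lt (Finset.mem_range.1 hj) (hi.trans_le hEp)
    have h1 := hwin (j * p + i) hk (by rw [pos_mod (hi.trans_le hEp)]; exact hi)
    rw [interpVec_of_lt r hk] at h1
    have h2 : ∀ b, (Ψ x).2 b = 0 := fun b => congrArg Subtype.val (hA b)
    have h3 : (Ψ x).1 (j * p + i) = 0 := by simpa [h2] using h1
    exact h3
  exact hx0 (Prod.ext h0 (funext hA))

/-- The recurrence given by an interpolation polynomial: the coefficients `a b`, and `a₀` that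
describes its right-hand side on the received word. -/
structure IsRecurrence (γ : Fˣ) (r : ℕ → F) (p n w E₀ T₀ D D' : ℕ) (a₀ : ℕ → F) (a : ℕ → ℕ → F) :
    Prop where
  mem₀ : a₀ ∈ words γ E₀ T₀
  mem : ∀ b < w, a b ∈ words γ D D'
  ne_zero : ∃ b < w, a b ≠ 0
  window : ∀ k < n * p, k % p < E₀ → a₀ k + ∑ b ∈ Finset.range w, a b k * r (k + b) = 0

theorem exists_isRecurrence {r : ℕ → F} {u : ℕ → F}
    (hu : u ∈ interpSpace γ r w (n * p) E₀ T₀ D D')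
    (hwin : ∀ k < n * p, k % p < E₀ → u k = 0)
    {c : ℕ} (hc : n * p ≤ c) (huc : u c ≠ 0) :
    ∃ a₀ a, IsRecurrence γ r p n w E₀ T₀ D D' a₀ a ∧
      ∀ b < w, ∀ k < n * p, u ((b + 1) * (n * p) + k) = a b k := by
  obtain ⟨⟨a₀, A⟩, ⟨ha₀, hA⟩, rfl⟩ := hu
  set a : ℕ → ℕ → F := fun b => if h : b < w then A ⟨b, h⟩ else 0 with ha
  have haA : ∀ b : Fin w, a b = A b := fun b => dif_pos b.2
  refine ⟨a₀, a, ⟨ha₀, fun b hb => ?_, ?_, fun k hk hkE => ?_⟩, fun b hb k hk => ?_⟩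
  · rw [haA ⟨b, hb⟩]
    exact hA _ (Set.mem_univ _)
  · by_contra hcon
    push Not at hcon
    apply huc
    change (if _ then _ else _) = _
    rw [if_neg (by omega)]
    split_ifs with h
    · have := hcon _ h
      rw [haA ⟨_, h⟩] at this
      change A _ _ = 0
      rw [this]
      rfl
    · rfl
  · have := hwin k hk hkE
    rw [interpVec_of_lt r hk] at this
    rw [← this, Finset.sum_range]
    simp only [haA]
  · rw [interpVec_block r hk ⟨b, hb⟩]
    exact (congrFun (haA ⟨b, hb⟩) k).symm

theorem sum_shift_mem (hd : Design p n s t w E₀ T₀ D D') {a : ℕ → ℕ → F}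
    (ha : ∀ b < w, a b ∈ words γ D D') {f : ℕ → F} (hf : f ∈ words γ s t) :
    ∑ b ∈ Finset.range w, a b * shift F b f ∈ words γ E₀ T₀ := by
  refine Submodule.sum_mem _ fun b hb => ?_
  rw [hd.rows, hd.cols]
  exact mul_mem_polySpan (ha b (Finset.mem_range.1 hb)) (shift_mem_words hf b)

theorem sum_shift_apply (w : ℕ) (a : ℕ → ℕ → F) (f : ℕ → F) (k : ℕ) :
    (∑ b ∈ Finset.range w, a b * shift F b f) k = ∑ b ∈ Finset.range w, a b k * f (k + b) := by
  simp [Finset.sum_apply]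

/-- A codeword that agrees with the received word in `T₀` columns satisfies the recurrence. -/
theorem IsRecurrence.apply_close (hγ : orderOf γ = n) (hpn : Nat.Coprime p n)
    (hd : Design p n s t w E₀ T₀ D D') {r a₀ : ℕ → F} {a : ℕ → ℕ → F}
    (hr : IsRecurrence γ r p n w E₀ T₀ D D' a₀ a) {f : ℕ → F} (hf : f ∈ words γ s t)
    {J : Finset ℕ} (hJn : ∀ j ∈ J, j < n) (hJ : T₀ ≤ J.card)
    (hfr : ∀ j ∈ J, ∀ i < p, f (j * p + i) = r (j * p + i)) {k : ℕ} (hk : k < n * p)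
    (hkE : k % p < E₀) : ∑ b ∈ Finset.range w, a b k * (f (k + b) - r (k + b)) = 0 := by
  have h1 : a₀ + ∑ b ∈ Finset.range w, a b * shift F b f = 0 := by
    refine words_eq_zero hγ hpn hd.rows_le hJn hJ
      (Submodule.add_mem _ hr.mem₀ (sum_shift_mem hd hr.mem hf)) fun j hj i hi => ?_
    have hip := hi.trans_le hd.rows_le
    rw [Pi.add_apply, sum_shift_apply, ← hr.window (j * p + i) (pos_lt (hJn j hj) hip)
      (by rwa [pos_mod hip])]
    congr 1
    refine Finset.sum_congr rfl fun b hb => ?_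
    have := hd.window
    have := Finset.mem_range.1 hb
    rw [add_assoc, hfr j hj (i + b) (by omega)]
  have h2 := congrFun h1 k
  rw [Pi.add_apply, sum_shift_apply, Pi.zero_apply] at h2
  have h3 := hr.window k hk hkE
  simp only [mul_sub, Finset.sum_sub_distrib]
  linear_combination h2 - h3

/-- The vector of a multiple `z` and a word `f`: the entry `z`, the word `f - z r`, and the values of
the recurrence on it. -/
def candVec (r : ℕ → F) (a : ℕ → ℕ → F) (p N w E₀ : ℕ) : (F × (ℕ → F)) →ₗ[F] (ℕ → F) where
  toFun x c := if c = 0 then x.1 else if c - 1 < N then x.2 (c - 1) - x.1 * r (c - 1)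
    else if c - 1 - N < N ∧ (c - 1 - N) % p < E₀ then
      ∑ b ∈ Finset.range w, a b (c - 1 - N) *
        (x.2 (c - 1 - N + b) - x.1 * r (c - 1 - N + b))
    else 0
  map_add' x y := by
    ext c
    simp only [Prod.fst_add, Prod.snd_add, Pi.add_apply]
    split_ifs
    · rfl
    · ring
    · rw [← Finset.sum_add_distrib]
      exact Finset.sum_congr rfl fun b _ => by ring
    · simp
  map_smul' k x := by
    ext c
    simp only [Prod.smul_fst, Prod.smul_snd, Pi.smul_apply, smul_eq_mul, RingHom.id_apply]
    split_ifs
    · rfl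
    · ring
    · rw [Finset.mul_sum]
      exact Finset.sum_congr rfl fun b _ => by ring
    · simp

theorem candVec_zero (r : ℕ → F) (a : ℕ → ℕ → F) (p N w E₀ : ℕ) (x : F × (ℕ → F)) :
    candVec r a p N w E₀ x 0 = x.1 := rfl

theorem candVec_word (r : ℕ → F) (a : ℕ → ℕ → F) (p w E₀ : ℕ) {N k : ℕ} (hk : k < N)
    (x : F × (ℕ → F)) : candVec r a p N w E₀ x (1 + k) = x.2 k - x.1 * r k := by
  change (if _ then _ else _) = _
  rw [if_neg (by omega), if_pos (by omega), Nat.add_sub_cancel_left]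

theorem candVec_rec (r : ℕ → F) (a : ℕ → ℕ → F) (p w E₀ : ℕ) {N k : ℕ} (hk : k < N)
    (hkE : k % p < E₀) (x : F × (ℕ → F)) : candVec r a p N w E₀ x (N + 1 + k) =
      ∑ b ∈ Finset.range w, a b k * (x.2 (k + b) - x.1 * r (k + b)) := by
  change (if _ then _ else _) = _
  rw [if_neg (by omega), if_neg (by omega), show N + 1 + k - 1 - N = k by omega, if_pos ⟨hk, hkE⟩]

/-- The space of all pairs of a multiple and a codeword. -/
def candSpace (γ : Fˣ) (r : ℕ → F) (a : ℕ → ℕ → F) (p N w E₀ s t : ℕ) : Submodule F (ℕ → F) :=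
  ((⊤ : Submodule F F).prod (words γ s t)).map (candVec r a p N w E₀)

theorem candSpace_le {r : ℕ → F} {a : ℕ → ℕ → F} {N : ℕ} {S : Submodule F (ℕ → F)}
    (h0 : candVec r a p N w E₀ (1, 0) ∈ S)
    (h1 : ∀ e < s, ∀ e' < t, candVec r a p N w E₀ (0, monoWord γ e e') ∈ S) :
    candSpace γ r a p N w E₀ s t ≤ S := by
  rintro _ ⟨⟨z, f⟩, ⟨_, hf⟩, rfl⟩
  have e1 : (z, f) = z • ((1 : F), (0 : ℕ → F)) + LinearMap.inr F F _ f := by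
    simp
  rw [e1, map_add, map_smul]
  refine Submodule.add_mem _ (Submodule.smul_mem _ _ h0) ?_
  have : words γ s t ≤ S.comap (candVec r a p N w E₀ ∘ₗ LinearMap.inr F _ _) :=
    words_le fun e he e' he' => h1 e he e' he'
  exact this hf

/-- The vectors whose coordinates after the word vanish in all windows. -/
def recZero (F : Type*) [Field F] (p N E₀ : ℕ) : Submodule F (ℕ → F) where
  carrier := {u | ∀ k < N, k % p < E₀ → u (N + 1 + k) = 0}
  add_mem' hu hv k hk hkE := by rw [Pi.add_apply, hu k hk hkE, hv k hk hkE, add_zero]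
  zero_mem' _ _ _ := rfl
  smul_mem' c u hu k hk hkE := by rw [Pi.smul_apply, hu k hk hkE, smul_zero]

instance (r : ℕ → F) (a : ℕ → ℕ → F) (N : ℕ) :
    FiniteDimensional F (candSpace γ r a p N w E₀ s t) := by
  have h : (words γ s t).FG := Module.Finite.iff_fg.1 inferInstance
  exact Module.Finite.iff_fg.2 ((Module.Finite.fg_top.prod h).map _)

/-- The candidates that satisfy the recurrence form a space of dimension at most `w`. -/
theorem IsRecurrence.finrank_le [Fintype F] (hγ : orderOf γ = n) (hcard : Fintype.card F = n + 1)
    (hn : 0 < n) (hpn : Nat.Coprime p n)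
    (hd : Design p n s t w E₀ T₀ D D') {r a₀ : ℕ → F} {a : ℕ → ℕ → F}
    (hr : IsRecurrence γ r p n w E₀ T₀ D D' a₀ a) :
    Module.finrank F ↥(candSpace γ r a p (n * p) w E₀ s t ⊓ recZero F p (n * p) E₀) ≤ w := by
  set S := candSpace γ r a p (n * p) w E₀ s t ⊓ recZero F p (n * p) E₀ with hS
  have : FiniteDimensional F S := Submodule.finiteDimensional_inf_left _ _
  set φ : S →ₗ[F] F := LinearMap.proj 0 ∘ₗ S.subtype with hφ
  obtain ⟨hUfin, hU⟩ := card_recurrence_le hγ hcard hn hpn (s := s) (t := t)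
    (by rw [← hd.rows]; exact hd.rows_le) (by rw [← hd.cols]; exact hd.cols_le) a hr.mem hr.ne_zero
    {v | v ∈ words γ s t ∧ ∀ k, ∑ b ∈ Finset.range w, a b k * v (k + b) = 0} fun v hv => hv
  set U := {v | v ∈ words γ s t ∧ ∀ k, ∑ b ∈ Finset.range w, a b k * v (k + b) = 0} with hUdef
  have hsub : (fun x : LinearMap.ker φ => ((x : S) : ℕ → F)) '' Set.univ ⊆
      (fun v => candVec r a p (n * p) w E₀ (0, v)) '' U := by
    rintro _ ⟨⟨⟨u, ⟨⟨z, f⟩, ⟨_, hf⟩, rfl⟩, hu⟩, hx⟩, _, rfl⟩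
    have hz : z = 0 := hx
    subst hz
    refine ⟨f, ⟨hf, ?_⟩, rfl⟩
    have h1 : ∑ b ∈ Finset.range w, a b * shift F b f = 0 := by
      refine words_eq_zero hγ hpn hd.rows_le (J := Finset.range n)
        (fun j hj => Finset.mem_range.1 hj) (by simpa using hd.cols_le)
        (sum_shift_mem hd hr.mem hf) fun j hj i hi => ?_
      have hip := hi.trans_le hd.rows_le
      have hk := pos_lt (Finset.mem_range.1 hj) hip
      have hkE : (j * p + i) % p < E₀ := by rwa [pos_mod hip]
      have h2 := hu (j * p + i) hk hkE
      rw [candVec_rec r a p w E₀ hk hkE] at h2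
      rw [sum_shift_apply, ← h2]
      simp
    intro k
    rw [← sum_shift_apply, h1]
    rfl
  have hker : Nat.card (LinearMap.ker φ) ≤ Fintype.card F ^ (w - 1) := by
    have hinj : Function.Injective fun x : LinearMap.ker φ => ((x : S) : ℕ → F) :=
      Subtype.val_injective.comp Subtype.val_injective
    rw [← Set.ncard_univ, ← Set.ncard_image_of_injective _ hinj]
    exact (Set.ncard_le_ncard hsub (hUfin.image _)).trans ((Set.ncard_image_le hUfin).trans hU)
  have hker' : Module.finrank F (LinearMap.ker φ) ≤ w - 1 := by
    rw [Module.natCard_eq_pow_finrank (K := F), Nat.card_eq_fintype_card] at hker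
    exact (Nat.pow_le_pow_iff_right (by omega)).1 hker
  have h1 := LinearMap.finrank_range_add_finrank_ker φ
  have h2 : Module.finrank F (LinearMap.range φ) ≤ 1 :=
    (Submodule.finrank_le _).trans (Module.finrank_self F).le
  have := hd.w_pos
  omega

/-- The vectors whose word vanishes in column `j`. -/
def colZero (F : Type*) [Field F] (p j : ℕ) : Submodule F (ℕ → F) where
  carrier := {u | ∀ i < p, u (1 + (j * p + i)) = 0}
  add_mem' hu hv i hi := by rw [Pi.add_apply, hu i hi, hv i hi, add_zero]
  zero_mem' _ _ := rfl
  smul_mem' c u hu i hi := by rw [Pi.smul_apply, hu i hi, smul_zero]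

theorem mem_colZero {p j : ℕ} {u : ℕ → F} :
    u ∈ colZero F p j ↔ ∀ i < p, u (1 + (j * p + i)) = 0 := Iff.rfl

/-- A space of candidates that contains more than the multiples of one word is cut down by all but
fewer than `t` columns. -/
theorem card_columns_lt (hγ : orderOf γ = n) (hpn : Nat.Coprime p n) (hsp : s ≤ p)
    {r : ℕ → F} {a : ℕ → ℕ → F} {U : Submodule F (ℕ → F)}
    (hU : U ≤ candSpace γ r a p (n * p) w E₀ s t) {x : ℕ → F} (hx : x ∈ U) (hx0 : x 0 = 1)
    (hline : ¬ U ≤ Submodule.span F {x}) {J : Finset ℕ} (hJn : ∀ j ∈ J, j < n)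
    (hJ : ∀ j ∈ J, U ≤ colZero F p j) : J.card < t := by
  by_contra hcon
  push Not at hcon
  obtain ⟨y, hy, hyx⟩ := Set.not_subset.1 hline
  have hu : y - y 0 • x ∈ U := Submodule.sub_mem _ hy (Submodule.smul_mem _ _ hx)
  obtain ⟨⟨z, f⟩, ⟨_, hf⟩, hzf⟩ := hU hu
  have hz : z = 0 := by
    have := congrFun hzf 0
    rw [candVec_zero] at this
    simpa [hx0] using this
  subst hz
  have hf0 : f = 0 := by
    refine words_eq_zero hγ hpn hsp hJn hcon hf fun j hj i hi => ?_
    have h1 := hJ j hj hu i (hi.trans_le hsp)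
    rw [← hzf, candVec_word r a p w E₀ (pos_lt (hJn j hj) (hi.trans_le hsp))] at h1
    simpa using h1
  subst hf0
  rw [show ((0 : F), (0 : ℕ → F)) = 0 from rfl, map_zero] at hzf
  apply hyx
  have : y = y 0 • x := (sub_eq_zero.1 hzf.symm)
  rw [this]
  exact Submodule.smul_mem _ _ (Submodule.mem_span_singleton_self x)

end Interpolation

/-! ### Elimination in the matrix -/

/-- Commands in sequence. -/
def Cmd.block : List Cmd → Cmd
  | [] => .skip
  | a :: l => .seq a (Cmd.block l)

section Rules

variable {F : Type*} [Field F] [DecidableEq F] {W Z : ℕ} {ω : ℕ → Bool} {Q : Env F → Prop}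
  {E : Env F}

theorem wp_skip : wp W Z ω .skip Q E ↔ Q E := Iff.rfl

theorem wp_assign {i : ℕ} {e : Expr} : wp W Z ω (.assign i e) Q E ↔
    e.eval E.nat ≤ Z ∧ Q (E.set i (e.eval E.nat)) := Iff.rfl

theorem wp_coin {i : ℕ} : wp W Z ω (.coin i) Q E ↔
    Q ((E.set i (if ω E.pos then 1 else 0)).step) := Iff.rfl

theorem wp_fop {o : FldOp} {r₁ c₁ r₂ c₂ r₃ c₃ : Expr} :
    wp W Z ω (.fop o r₁ c₁ r₂ c₂ r₃ c₃) Q E ↔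
    (c₁.eval E.nat < W ∧ c₂.eval E.nat < W ∧ c₃.eval E.nat < W) ∧
    Q (E.write (r₁.eval E.nat) (c₁.eval E.nat) (o.eval (E.mem (r₂.eval E.nat) (c₂.eval E.nat))
      (E.mem (r₃.eval E.nat) (c₃.eval E.nat)))) := Iff.rfl

theorem wp_ftest {i : ℕ} {r c : Expr} : wp W Z ω (.ftest i r c) Q E ↔ c.eval E.nat < W ∧
    Q (E.set i (if E.mem (r.eval E.nat) (c.eval E.nat) = 0 then 0 else 1)) := Iff.rfl

theorem wp_ite {i : ℕ} {a b : Cmd} : wp W Z ω (.ite i a b) Q E ↔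
    (E.nat i ≠ 0 → wp W Z ω a Q E) ∧ (E.nat i = 0 → wp W Z ω b Q E) := Iff.rfl

theorem wp_block_nil : wp W Z ω (.block []) Q E ↔ Q E := Iff.rfl

theorem wp_block_cons {a : Cmd} {l : List Cmd} : wp W Z ω (.block (a :: l)) Q E ↔
    wp W Z ω a (wp W Z ω (.block l) Q) E := Iff.rfl

theorem wp_loop {i : ℕ} {n : Expr} {a : Cmd} (I : ℕ → Env F → Prop) (hn : n.eval E.nat ≤ Z)
    (h0 : I 0 E) (hs : ∀ k < n.eval E.nat, ∀ E', I k E' → wp W Z ω a (I (k + 1)) (E'.set i k))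
    (hQ : ∀ E', I (n.eval E.nat) E' → Q E') : wp W Z ω (.loop i n a) Q E :=
  ⟨hn, I, h0, hs, hQ⟩

/-- Row `r` of the matrix, with its first `W` entries. -/
def row (W : ℕ) (mem : ℕ → ℕ → F) (r : ℕ) : ℕ → F := fun c => if c < W then mem r c else 0

theorem row_apply (W : ℕ) (mem : ℕ → ℕ → F) (r : ℕ) {c : ℕ} (hc : c < W) :
    row W mem r c = mem r c := if_pos hc

/-- The span of `N` rows of the matrix. -/
def rowSpan (W : ℕ) (mem : ℕ → ℕ → F) (R N : ℕ) : Submodule F (ℕ → F) :=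
  Submodule.span F ((fun ρ => row W mem (R + ρ)) '' Set.Iio N)

theorem row_mem_rowSpan (W : ℕ) (mem : ℕ → ℕ → F) (R : ℕ) {N ρ : ℕ} (hρ : ρ < N) :
    row W mem (R + ρ) ∈ rowSpan W mem R N := Submodule.subset_span ⟨ρ, hρ, rfl⟩

theorem rowSpan_congr {W : ℕ} {mem mem' : ℕ → ℕ → F} {R R' N : ℕ}
    (h : ∀ ρ < N, ∀ c < W, mem (R + ρ) c = mem' (R' + ρ) c) :
    rowSpan W mem R N = rowSpan W mem' R' N := by
  rw [rowSpan, rowSpan]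
  congr 1
  refine Set.image_congr fun ρ hρ => ?_
  ext c
  simp only [row]
  split_ifs with hc
  · exact h ρ hρ c hc
  · rfl

/-- Cell `14` holds the number of columns of the matrix. -/
abbrev vW : Expr := .var 14

/-- Make column `v32` of the matrix zero in the `v31` rows from row `v30` on, by subtracting
multiples of a pivot row. Rows `3` and `4` are used for auxiliary values. -/
def eliminate : Cmd := .block [
  .assign 33 0,
  .loop 35 (.var 31) (.block [
    .ftest 36 (.var 30 + .var 35) (.var 32),
    .ite 36 (.block [.assign 33 1, .assign 34 (.var 35)]) .skip]),
  .ite 33 (.block [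
    .fop .inv 4 0 (.var 30 + .var 34) (.var 32) 0 0,
    .loop 35 vW (.fop .mul 3 (.var 35) (.var 30 + .var 34) (.var 35) 4 0),
    .loop 35 (.var 31) (.block [
      .fop .copy 4 1 (.var 30 + .var 35) (.var 32) 0 0,
      .loop 36 vW (.block [
        .fop .mul 4 2 4 1 3 (.var 36),
        .fop .sub (.var 30 + .var 35) (.var 36) (.var 30 + .var 35) (.var 36) 4 2])])])
    .skip]

/-- Elimination intersects the span of the rows with a coordinate hyperplane, by `span_eliminate`. -/
theorem wp_eliminate (hW : E.nat 14 = W) (hW3 : 3 ≤ W) (hWZ : W ≤ Z) (hN : E.nat 31 ≤ Z)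
    (hR : 8 ≤ E.nat 30) (hc : E.nat 32 < W)
    (hQ : ∀ E', (∀ x < 33, E'.nat x = E.nat x) → E'.pos = E.pos →
      (∀ r c, r ≠ 3 → r ≠ 4 → (r < E.nat 30 ∨ E.nat 30 + E.nat 31 ≤ r) →
        E'.mem r c = E.mem r c) →
      rowSpan W E'.mem (E.nat 30) (E.nat 31) = rowSpan W E.mem (E.nat 30) (E.nat 31) ⊓
        LinearMap.ker (LinearMap.proj (E.nat 32) : (ℕ → F) →ₗ[F] F) → Q E') :
    wp W Z ω eliminate Q E := by
  rw [eliminate, wp_block_cons, wp_assign]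
  refine ⟨by simp, ?_⟩
  rw [wp_block_cons]
  set R := E.nat 30 with hRdef
  set N := E.nat 31 with hNdef
  set col := E.nat 32 with hcol
  refine wp_loop (fun k E' => (∀ x < 33, E'.nat x = E.nat x) ∧ E'.mem = E.mem ∧ E'.pos = E.pos ∧
    ((E'.nat 33 = 0 ∧ ∀ ρ < k, E.mem (R + ρ) col = 0) ∨
      (E'.nat 33 = 1 ∧ E'.nat 34 < N ∧ E.mem (R + E'.nat 34) col ≠ 0))) ?_ ?_ ?_ ?_
  · simpa [Env.nat_set] using hN
  · refine ⟨fun x hx => ?_, rfl, rfl, Or.inl ⟨?_, ?_⟩⟩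
    · rw [Env.nat_set, if_neg (by omega)]
    · simp [Env.nat_set]
    · intro ρ hρ
      omega
  · rintro k hk E' ⟨h1, h2, h3, h4⟩
    have hk' : k < N := by simpa [Env.nat_set] using hk
    have h30 := h1 30 (by omega)
    have h32 := h1 32 (by omega)
    simp only [wp_block_cons, wp_block_nil, wp_ftest, wp_ite, wp_assign, wp_skip, Expr.eval_var,
      Expr.eval_add, Expr.eval_ofNat, Env.nat_set, Env.mem_set, Env.pos_set, h30, h32, h2,
      ← hRdef, ← hcol, Nat.reduceEqDiff, reduceIte]
    refine ⟨by simpa using hc, ?_, ?_⟩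
    · intro h5
      have h5' : E.mem (R + k) col ≠ 0 := by
        simpa using h5
      refine ⟨by omega, by omega, fun x hx => ?_, trivial, h3, Or.inr ?_⟩
      · simp only [show x ≠ 33 by omega, show x ≠ 34 by omega, show x ≠ 35 by omega,
          show x ≠ 36 by omega, if_false, h1 x hx]
      · simpa [hk'] using h5'
    · intro h5
      have h5' : E.mem (R + k) col = 0 := by
        by_contra h
        simp [h] at h5
      refine ⟨fun x hx => ?_, trivial, h3, ?_⟩
      · simp only [show x ≠ 35 by omega, show x ≠ 36 by omega, if_false, h1 x hx]
      · rcases h4 with ⟨h6, h7⟩ | h6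
        · left
          refine ⟨by simpa using h6, fun ρ hρ => ?_⟩
          rcases Nat.lt_succ_iff_lt_or_eq.1 hρ with h | rfl
          · exact h7 ρ h
          · exact h5'
        · right
          simpa using h6
  · rintro E₁ ⟨h1, h2, h3, h4⟩
    rw [wp_block_cons, wp_ite]
    simp only [Env.nat_set, Expr.eval_var] at h4
    rw [if_neg (by omega)] at h4
    have h30 := h1 30 (by omega)
    have h31 := h1 31 (by omega)
    have h32 := h1 32 (by omega)
    have h14 := h1 14 (by omega)
    constructor
    swap
    · -- no pivot: the column is already zero
      intro h5
      rcases h4 with ⟨_, h7⟩ | ⟨h6, _⟩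
      · rw [wp_skip, wp_block_nil]
        refine hQ E₁ h1 h3 (fun r c _ _ _ => by rw [h2]) ?_
        rw [h2, eq_comm, inf_eq_left, rowSpan, Submodule.span_le]
        rintro _ ⟨ρ, hρ, rfl⟩
        change row W E.mem (R + ρ) col = 0
        rw [row_apply _ _ _ hc]
        exact h7 ρ hρ
      · omega
    · intro h5
      rcases h4 with ⟨h6, _⟩ | ⟨_, hpiv, hne⟩
      · omega
      rw [wp_block_cons, wp_fop]
      set piv := E₁.nat 34 with hpivdef
      set u : ℕ → F := fun c => E.mem (R + piv) c * (E.mem (R + piv) col)⁻¹ with hu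
      refine ⟨⟨by simp; omega, by simp only [Expr.eval_var]; omega, by simp; omega⟩, ?_⟩
      rw [wp_block_cons]
      simp only [Expr.eval_var, Expr.eval_add, Expr.eval_ofNat, h30, h32, ← hpivdef, h2, ← hRdef,
        ← hcol, FldOp.eval]
      refine wp_loop (fun k E' => (∀ x < 33, E'.nat x = E.nat x) ∧ E'.nat 34 = piv ∧
        E'.pos = E.pos ∧ (∀ r c, r ≠ 3 → r ≠ 4 → E'.mem r c = E.mem r c) ∧
        E'.mem 4 0 = (E.mem (R + piv) col)⁻¹ ∧ ∀ c < k, E'.mem 3 c = u c) ?_ ?_ ?_ ?_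
      · simp only [Env.nat_write, Expr.eval_var]; omega
      · refine ⟨h1, rfl, h3, fun r c _ h4 => ?_, ?_, fun c hc => by omega⟩
        · rw [Env.mem_write, if_neg (by tauto), h2]
        · rw [Env.mem_write, if_pos ⟨rfl, rfl⟩]
      · rintro k hk E' ⟨g1, g2, g3, g4, g5, g6⟩
        have hk' : k < W := by
          simp only [Env.nat_write, Expr.eval_var] at hk
          omega
        have g30 := g1 30 (by omega)
        rw [wp_fop]
        simp only [Expr.eval_var, Expr.eval_add, Expr.eval_ofNat, Env.nat_set, Env.mem_set, g30,
          FldOp.eval, Nat.reduceEqDiff, reduceIte, ← hRdef]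
        norm_num
        refine ⟨⟨hk', by omega⟩, fun x hx => ?_, g2, g3, fun r c hr3 hr4 => ?_, ?_,
          fun c hck => ?_⟩
        · rw [Env.nat_set, if_neg (by omega), g1 x hx]
        · rw [Env.mem_write, if_neg (by tauto)]
          exact g4 r c hr3 hr4
        · rw [Env.mem_write, if_neg (by omega)]
          exact g5
        · rw [Env.mem_write]
          by_cases hck' : c = k
          · subst hck'
            rw [if_pos ⟨rfl, rfl⟩, g2, g4 _ _ (by omega) (by omega), g5]
          · rw [if_neg (by tauto)]
            exact g6 c (by omega)
      · rintro E₂ ⟨g1, g2, g3, g4, -, g6⟩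
        replace g6 : ∀ c < W, E₂.mem 3 c = u c := fun c hc => g6 c (by
          simp only [Env.nat_write, Expr.eval_var]
          omega)
        rw [wp_block_cons]
        have g31 := g1 31 (by omega)
        refine wp_loop (fun k E' => (∀ x < 33, E'.nat x = E.nat x) ∧ E'.nat 34 = piv ∧
          E'.pos = E.pos ∧ (∀ r c, r ≠ 3 → r ≠ 4 → (r < R ∨ R + k ≤ r) →
            E'.mem r c = E.mem r c) ∧ (∀ c < W, E'.mem 3 c = u c) ∧
          ∀ ρ < k, ∀ c < W, E'.mem (R + ρ) c = E.mem (R + ρ) c - E.mem (R + ρ) col * u c)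
          ?_ ?_ ?_ ?_
        · simp only [Expr.eval_var]; omega
        · exact ⟨g1, g2, g3, fun r c h3 h4 _ => g4 r c h3 h4, g6, fun ρ hρ => by omega⟩
        · rintro k hk E' ⟨f1, f2, f3, f4, f5, f6⟩
          have hk' : k < N := by
            simp only [Expr.eval_var] at hk
            omega
          have f30 := f1 30 (by omega)
          have f32 := f1 32 (by omega)
          have f14 := f1 14 (by omega)
          rw [wp_block_cons, wp_fop]
          simp only [Expr.eval_var, Expr.eval_add, Expr.eval_ofNat, Env.nat_set, Env.mem_set, f30,
            f32, FldOp.eval, Nat.reduceEqDiff, reduceIte, ← hRdef, ← hcol]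
          norm_num
          refine ⟨⟨by omega, hc, by omega⟩, ?_⟩
          rw [wp_block_cons]
          refine wp_loop (fun d E'' => (∀ x < 33, E''.nat x = E.nat x) ∧ E''.nat 34 = piv ∧
            E''.nat 35 = k ∧
            E''.pos = E.pos ∧ (∀ r c, r ≠ 4 → r ≠ R + k → E''.mem r c = E'.mem r c) ∧
            E''.mem 4 1 = E.mem (R + k) col ∧
            (∀ c < d, E''.mem (R + k) c = E.mem (R + k) c - E.mem (R + k) col * u c) ∧
            ∀ c, d ≤ c → E''.mem (R + k) c = E.mem (R + k) c) ?_ ?_ ?_ ?_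
          · simp [Env.nat_set]; omega
          · refine ⟨fun x hx => ?_, ?_, ?_, f3, fun r c h4 _ => ?_, ?_, fun c hc => by omega,
              fun c _ => ?_⟩
            · rw [Env.nat_write, Env.nat_set, if_neg (by omega), f1 x hx]
            · simpa [Env.nat_set] using f2
            · simp [Env.nat_set]
            · rw [Env.mem_write, if_neg (by tauto), Env.mem_set]
            · rw [Env.mem_write, if_pos ⟨rfl, rfl⟩, f4 _ _ (by omega) (by omega) (by omega)]
            · rw [Env.mem_write, if_neg (by omega), Env.mem_set,
                f4 _ _ (by omega) (by omega) (by omega)]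
          · rintro d hd E'' ⟨e1, e2, e3, e4, e5, e6, e7, e8⟩
            have hd' : d < W := by
              simp [Env.nat_set] at hd
              omega
            have e30 := e1 30 (by omega)
            rw [wp_block_cons, wp_fop]
            simp only [Expr.eval_var, Expr.eval_ofNat, Env.nat_set, Env.mem_set,
              FldOp.eval, reduceIte]
            refine ⟨by omega, ?_⟩
            rw [wp_block_cons, wp_fop, wp_block_nil]
            simp only [Expr.eval_var, Expr.eval_add, Expr.eval_ofNat, Env.nat_set, Env.nat_write,
              FldOp.eval, Nat.reduceEqDiff, reduceIte]
            norm_num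
            rw [e30, e3, ← hRdef]
            refine ⟨⟨hd', by omega⟩, fun x hx => ?_, ?_, ?_, e4, fun r c hr4 hrk => ?_, ?_,
              fun c hcd => ?_, fun c hcd => ?_⟩
            · rw [if_neg (by omega), e1 x hx]
            · simpa [Env.nat_set] using e2
            · simp
            · rw [Env.mem_write, if_neg (by tauto), Env.mem_write, if_neg (by tauto), Env.mem_set]
              exact e5 r c hr4 hrk
            · rw [Env.mem_write, if_neg (by omega), Env.mem_write, if_neg (by omega), Env.mem_set]
              exact e6
            · rw [Env.mem_write]
              by_cases hcd' : c = d
              · subst hcd'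
                rw [if_pos ⟨rfl, rfl⟩, Env.mem_write, if_neg (by omega), Env.mem_write,
                  if_pos ⟨rfl, rfl⟩, Env.mem_set, e6, e8 c le_rfl,
                  e5 3 c (by omega) (by omega), f5 c hd']
              · rw [if_neg (by tauto), Env.mem_write, if_neg (by omega), Env.mem_set]
                exact e7 c (by omega)
            · rw [Env.mem_write, if_neg (by omega), Env.mem_write, if_neg (by omega), Env.mem_set]
              exact e8 c (by omega)
          · rintro E'' ⟨e1, e2, e3, e4, e5, e6, e7, -⟩
            rw [wp_block_nil]
            refine ⟨e1, e2, e4, fun r c hr3 hr4 hr => ?_, fun c hc => ?_, fun ρ hρ c hcW => ?_⟩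
            · rw [e5 r c hr4 (by omega)]
              exact f4 r c hr3 hr4 (by omega)
            · rw [e5 3 c (by omega) (by omega)]
              exact f5 c hc
            · by_cases hρk : ρ = k
              · subst hρk
                exact e7 c (by simpa [Env.nat_set] using by omega)
              · rw [e5 _ c (by omega) (by omega)]
                exact f6 ρ (by omega) c hcW
        · rintro E₃ ⟨f1, -, f3, f4, -, f6⟩
          rw [wp_block_nil, wp_block_nil]
          simp only [Expr.eval_var, g31, ← hNdef] at f4 f6
          refine hQ E₃ f1 f3 (fun r c h3 h4 h => f4 r c h3 h4 h) ?_
          refine span_eliminate (fun ρ => row W E.mem (R + ρ)) (fun ρ => row W E₃.mem (R + ρ)) N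
            (LinearMap.proj col) hpiv ?_ ?_
          · simpa [row_apply _ _ _ hc] using hne
          · intro ρ hρ
            ext c
            simp only [LinearMap.proj_apply, row_apply _ _ _ hc, Pi.sub_apply, Pi.smul_apply,
              smul_eq_mul]
            by_cases hcW : c < W
            · rw [row_apply _ _ _ hcW, row_apply _ _ _ hcW, row_apply _ _ _ hcW, f6 ρ hρ c hcW]
              simp only [hu]
              ring
            · simp [row, hcW]

end Rules

/-! ### The parameters of the decoder

The first `21` variables of the decoder hold the input numbers and those derived from them. The matrix has the
rows `0` (`γ`, followed by the received word), `1` and `2` (the points of the orbit), `3`, `4`, `5`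
(auxiliary values), `6` and `7` (a word that is tested, and its difference to the received word), and
from row `8` on the interpolation matrix, the matrix of candidates from row `R₂` on, its working copy
from row `R₃` on, and the output from row `R₄` on, with `w + 3` words to a row. The theorem `wp_c`
about a command `c` says what `c` changes, and which variables and rows it leaves alone. -/

/-- The input numbers of the decoder. -/
structure Params where
  p : ℕ
  q : ℕ
  s : ℕ
  t : ℕ
  thr : ℕ
  e : ℕ
  la : ℕ

namespace Params

variable (P : Params)

/-- The number of columns of a received word. -/
def n : ℕ := P.q - 1
/-- The number of entries of a received word. -/
def N : ℕ := P.n * P.p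
/-- The order of the recurrence. -/
def w : ℕ := 16 * P.e * P.e
/-- The number of rows on which a window can start. -/
def E₀ : ℕ := P.p + 1 - P.w
/-- The bound for the degrees in `x` of the coefficients of the recurrence. -/
def D : ℕ := P.E₀ - P.s
/-- The number of columns in which a codeword has to agree with the received word. -/
def T₀ : ℕ := P.n - P.thr
/-- The bound for the degrees in `y` of the coefficients of the recurrence. -/
def D' : ℕ := P.T₀ - P.t
/-- The number of columns of the matrix. -/
def W : ℕ := (P.w + 3) * P.N
/-- The number of trials. -/
def M : ℕ := (P.la + 4 * P.e * P.w) * (4 * P.e) ^ P.w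
/-- The number of rows of the interpolation matrix, which begins in row `8`. -/
def N₁ : ℕ := (P.w + 1) * P.N
/-- The first row of the matrix of candidates. -/
def R₂ : ℕ := 8 + P.N₁
/-- The number of rows of the matrix of candidates. -/
def N₂ : ℕ := P.N + 1
/-- The first row of the working copy of the matrix of candidates. -/
def R₃ : ℕ := P.R₂ + P.N₂
/-- The first row of the output. -/
def R₄ : ℕ := P.R₃ + P.N₂
/-- A bound for all numbers that the decoder computes. -/
def Z : ℕ := P.R₄ * P.W + P.M + P.q + P.la

/-- What the decoder presupposes of its input numbers. -/
structure Valid : Prop where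
  e_pos : 0 < P.e
  q_gt : 1 < P.q
  design : Design P.p P.n P.s P.t P.w P.E₀ P.T₀ P.D P.D'

end Params

/-! The variables that hold the input numbers and the numbers derived from them. -/

abbrev vP : Expr := .var 0
abbrev vQ : Expr := .var 1
abbrev vS : Expr := .var 2
abbrev vT : Expr := .var 3
abbrev vThr : Expr := .var 4
abbrev vE : Expr := .var 5
abbrev vLa : Expr := .var 6
abbrev vn : Expr := .var 7
abbrev vN : Expr := .var 8
abbrev vw : Expr := .var 9
abbrev vE₀ : Expr := .var 10
abbrev vD : Expr := .var 11
abbrev vT₀ : Expr := .var 12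
abbrev vD' : Expr := .var 13
abbrev vM : Expr := .var 15
abbrev vN₁ : Expr := .var 16
abbrev vR₂ : Expr := .var 17
abbrev vN₂ : Expr := .var 18
abbrev vR₃ : Expr := .var 19
abbrev vR₄ : Expr := .var 20
/-- The row of the interpolation polynomial. -/
abbrev vRow : Expr := .var 21
/-- The number of words found so far. -/
abbrev vCnt : Expr := .var 22

/-- The variables below `21` have the values derived from the input numbers. -/
structure Glob {F : Type*} (P : Params) (E : Env F) : Prop where
  p : E.nat 0 = P.p
  q : E.nat 1 = P.q
  s : E.nat 2 = P.s
  t : E.nat 3 = P.t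
  thr : E.nat 4 = P.thr
  e : E.nat 5 = P.e
  la : E.nat 6 = P.la
  n : E.nat 7 = P.n
  N : E.nat 8 = P.N
  w : E.nat 9 = P.w
  E₀ : E.nat 10 = P.E₀
  D : E.nat 11 = P.D
  T₀ : E.nat 12 = P.T₀
  D' : E.nat 13 = P.D'
  W : E.nat 14 = P.W
  M : E.nat 15 = P.M
  N₁ : E.nat 16 = P.N₁
  R₂ : E.nat 17 = P.R₂
  N₂ : E.nat 18 = P.N₂
  R₃ : E.nat 19 = P.R₃
  R₄ : E.nat 20 = P.R₄

theorem Glob.frame {F : Type*} {P : Params} {E E' : Env F} (h : Glob P E)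
    (hf : ∀ x < 21, E'.nat x = E.nat x) : Glob P E' := by
  constructor
  · rw [hf _ (by omega), h.p]
  · rw [hf _ (by omega), h.q]
  · rw [hf _ (by omega), h.s]
  · rw [hf _ (by omega), h.t]
  · rw [hf _ (by omega), h.thr]
  · rw [hf _ (by omega), h.e]
  · rw [hf _ (by omega), h.la]
  · rw [hf _ (by omega), h.n]
  · rw [hf _ (by omega), h.N]
  · rw [hf _ (by omega), h.w]
  · rw [hf _ (by omega), h.E₀]
  · rw [hf _ (by omega), h.D]
  · rw [hf _ (by omega), h.T₀]
  · rw [hf _ (by omega), h.D']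
  · rw [hf _ (by omega), h.W]
  · rw [hf _ (by omega), h.M]
  · rw [hf _ (by omega), h.N₁]
  · rw [hf _ (by omega), h.R₂]
  · rw [hf _ (by omega), h.N₂]
  · rw [hf _ (by omega), h.R₃]
  · rw [hf _ (by omega), h.R₄]

namespace Params.Valid

variable {P : Params} (hP : P.Valid)
include hP

theorem n_pos : 0 < P.n := by have := hP.q_gt; unfold Params.n; omega
theorem w_ge : 16 ≤ P.w := by have := hP.e_pos; unfold Params.w; nlinarith
theorem p_ge : P.w ≤ P.p := by
  have := hP.design.window
  have := hP.design.rows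
  have := hP.design.s_pos
  omega
theorem N_ge : P.p ≤ P.N := Nat.le_mul_of_pos_left _ hP.n_pos
theorem n_le_N : P.n ≤ P.N := Nat.le_mul_of_pos_right _ (by have := hP.w_ge; have := hP.p_ge; omega)
theorem W_ge : 3 * P.N + P.w * P.N = P.W := by unfold Params.W; ring
theorem wN_ge : P.N ≤ P.w * P.N := Nat.le_mul_of_pos_left _ (by have := hP.w_ge; omega)
theorem w_le_N : P.w ≤ P.N := hP.p_ge.trans hP.N_ge
theorem rows_le : P.R₄ ≤ P.Z := by
  have h : P.R₄ * 1 ≤ P.R₄ * P.W := Nat.mul_le_mul_left _ (by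
    have := hP.W_ge; have := hP.w_le_N; have := hP.w_ge; omega)
  unfold Params.Z
  omega
theorem W_le : P.W ≤ P.Z := by
  have h : 1 * P.W ≤ P.R₄ * P.W := Nat.mul_le_mul_right _ (by
    unfold Params.R₄ Params.R₃ Params.N₂
    omega)
  unfold Params.Z
  omega
theorem mul_le {a b : ℕ} (ha : a ≤ P.R₄) (hb : b ≤ P.W) : a * b ≤ P.Z := by
  have := Nat.mul_le_mul ha hb
  unfold Params.Z
  omega

end Params.Valid

/-- Compute the derived numbers. -/
def setup : Cmd := .block [
  .assign 7 (vQ - 1),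
  .assign 8 (vn * vP),
  .assign 9 (16 * vE * vE),
  .assign 10 (vP + 1 - vw),
  .assign 11 (vE₀ - vS),
  .assign 12 (vn - vThr),
  .assign 13 (vT₀ - vT),
  .assign 14 ((vw + 3) * vN),
  .assign 15 (vLa + 4 * vE * vw),
  .loop 30 vw (.assign 15 (vM * (4 * vE))),
  .assign 16 ((vw + 1) * vN),
  .assign 17 (8 + vN₁),
  .assign 18 (vN + 1),
  .assign 19 (vR₂ + vN₂),
  .assign 20 (vR₃ + vN₂),
  .assign 22 0]

section Wp

variable {F : Type*} [Field F] [DecidableEq F] {ω : ℕ → Bool} {Q : Env F → Prop}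
  {E : Env F} {P : Params}

theorem wp_setup (hP : P.Valid) (h0 : E.nat 0 = P.p) (h1 : E.nat 1 = P.q) (h2 : E.nat 2 = P.s)
    (h3 : E.nat 3 = P.t) (h4 : E.nat 4 = P.thr) (h5 : E.nat 5 = P.e) (h6 : E.nat 6 = P.la)
    (hQ : ∀ E', Glob P E' → E'.nat 22 = 0 → E'.pos = E.pos → E'.mem = E.mem → Q E') :
    wp P.W P.Z ω setup Q E := by
  have hw := hP.w_ge
  have hp := hP.p_ge
  have hN := hP.N_ge
  have hn := hP.n_le_N
  have hW := hP.W_ge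
  have hwN := hP.wN_ge
  have hWZ := hP.W_le
  have hRZ := hP.rows_le
  have hE : P.e ≤ P.w := by unfold Params.w; nlinarith [hP.e_pos]
  have hMZ : P.M ≤ P.Z := by unfold Params.Z; omega
  have hE0 : P.E₀ ≤ P.p := hP.design.rows_le
  have hM : ∀ k ≤ P.w, (P.la + 4 * P.e * P.w) * (4 * P.e) ^ k ≤ P.M := fun k hk =>
    Nat.mul_le_mul_left _ (Nat.pow_le_pow_right (by have := hP.e_pos; omega) hk)
  have hM0 := hM 0 (Nat.zero_le _)
  rw [pow_zero, mul_one] at hM0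
  have e7 : P.q - 1 = P.n := rfl
  have e8 : P.n * P.p = P.N := rfl
  have e9 : 16 * P.e * P.e = P.w := rfl
  have e10 : P.p + 1 - P.w = P.E₀ := rfl
  have e11 : P.E₀ - P.s = P.D := rfl
  have e12 : P.n - P.thr = P.T₀ := rfl
  have e13 : P.T₀ - P.t = P.D' := rfl
  have e14 : (P.w + 3) * P.N = P.W := rfl
  simp only [setup, wp_block_cons, wp_assign, Expr.eval_add, Expr.eval_sub, Expr.eval_mul,
    Expr.eval_var, Expr.eval_ofNat, Env.nat_set, Nat.reduceEqDiff, reduceIte, h0, h1, h2, h3, h4,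
    h5, h6, e7, e8, e9, e10, e11, e12, e13, e14]
  have hD : P.D ≤ P.E₀ := Nat.sub_le _ _
  have hT : P.T₀ ≤ P.n := Nat.sub_le _ _
  have hD' : P.D' ≤ P.T₀ := Nat.sub_le _ _
  refine ⟨by omega, by omega, by omega, by omega, by omega, by omega, by omega, by omega,
    by omega, ?_⟩
  refine wp_loop (fun k E' => (∀ x < 15, E'.nat x = ![P.p, P.q, P.s, P.t, P.thr, P.e, P.la, P.n,
    P.N, P.w, P.E₀, P.D, P.T₀, P.D', P.W] (Fin.ofNat 15 x)) ∧
    E'.nat 15 = (P.la + 4 * P.e * P.w) * (4 * P.e) ^ k ∧ E'.pos = E.pos ∧ E'.mem = E.mem)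
    ?_ ?_ ?_ ?_
  · simp [Env.nat_set]
    omega
  · refine ⟨fun x hx => ?_, ?_, rfl, rfl⟩
    · simp only [Env.nat_set]
      interval_cases x <;> simp [Fin.ofNat, h0, h1, h2, h3, h4, h5, h6]
    · simp [Env.nat_set]
  · rintro k hk E' ⟨g1, g2, g3, g4⟩
    simp [Env.nat_set] at hk
    have g5 : E'.nat 5 = P.e := g1 5 (by omega)
    simp only [wp_assign, Expr.eval_mul, Expr.eval_var, Expr.eval_ofNat, Env.nat_set,
      Nat.reduceEqDiff, reduceIte, g2, g5, Env.pos_set, Env.mem_set, g3, g4, and_true]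
    have e : (P.la + 4 * P.e * P.w) * (4 * P.e) ^ k * (4 * P.e) =
        (P.la + 4 * P.e * P.w) * (4 * P.e) ^ (k + 1) := by ring
    rw [e]
    refine ⟨(hM _ hk).trans hMZ, fun x hx => ?_, rfl⟩
    rw [if_neg (by omega), if_neg (by omega), g1 x hx]
  · rintro E' ⟨g1, g2, g3, g4⟩
    simp [Env.nat_set] at g2
    have g8 : E'.nat 8 = P.N := g1 8 (by omega)
    have g9 : E'.nat 9 = P.w := g1 9 (by omega)
    have e16 : (P.w + 1) * P.N = P.N₁ := rfl
    have e17 : 8 + P.N₁ = P.R₂ := rfl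
    have e18 : P.N + 1 = P.N₂ := rfl
    have e19 : P.R₂ + P.N₂ = P.R₃ := rfl
    have e20 : P.R₃ + P.N₂ = P.R₄ := rfl
    simp only [wp_block_cons, wp_block_nil, wp_assign, Expr.eval_add, Expr.eval_mul,
      Expr.eval_var, Expr.eval_ofNat, Env.nat_set, Nat.reduceEqDiff, reduceIte, g8, g9, e16, e17,
      e18, e19, e20]
    refine ⟨by omega, by omega, by omega, by omega, by omega, by omega, ?_⟩
    refine hQ _ ?_ ?_ g3 g4
    · constructor <;> simp only [Env.nat_set, Nat.reduceEqDiff, reduceIte]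
      · exact g1 0 (by omega)
      · exact g1 1 (by omega)
      · exact g1 2 (by omega)
      · exact g1 3 (by omega)
      · exact g1 4 (by omega)
      · exact g1 5 (by omega)
      · exact g1 6 (by omega)
      · exact g1 7 (by omega)
      · exact g1 8 (by omega)
      · exact g1 9 (by omega)
      · exact g1 10 (by omega)
      · exact g1 11 (by omega)
      · exact g1 12 (by omega)
      · exact g1 13 (by omega)
      · exact g1 14 (by omega)
      · exact g2
    · simp [Env.nat_set]

/-- Store the coordinates of the points of the orbit in the rows `1` and `2`. -/
def points : Cmd := .block [
  .fop .one 5 0 0 0 0 0,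
  .fop .zero 1 0 0 0 0 0,
  .loop 30 vN (.fop .add 1 (.var 30 + 1) 1 (.var 30) 5 0),
  .fop .one 2 0 0 0 0 0,
  .loop 30 vN (.fop .mul 2 (.var 30 + 1) 2 (.var 30) 0 0)]

theorem wp_points (hP : P.Valid) (hg : Glob P E) {γ : F} (hγ : E.mem 0 0 = γ)
    (hQ : ∀ E', (∀ x < 30, E'.nat x = E.nat x) → E'.pos = E.pos →
      (∀ r c, r ≠ 1 → r ≠ 2 → r ≠ 5 → E'.mem r c = E.mem r c) →
      (∀ k ≤ P.N, E'.mem 1 k = (k : F)) → (∀ k ≤ P.N, E'.mem 2 k = γ ^ k) → Q E') :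
    wp P.W P.Z ω points Q E := by
  have hw := hP.w_ge
  have hW := hP.W_ge
  have hwN := hP.w_le_N
  have hWZ := hP.W_le
  simp only [points, wp_block_cons, wp_fop, Expr.eval_ofNat, FldOp.eval]
  refine ⟨by omega, by omega, ?_⟩
  refine wp_loop (fun k E' => (∀ x < 30, E'.nat x = E.nat x) ∧ E'.pos = E.pos ∧
    (∀ r c, r ≠ 1 → r ≠ 5 → E'.mem r c = E.mem r c) ∧ E'.mem 5 0 = 1 ∧
    ∀ j ≤ k, E'.mem 1 j = (j : F)) ?_ ?_ ?_ ?_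
  · simp [hg.N]
    omega
  · refine ⟨fun x hx => rfl, rfl, fun r c h1 h5 => ?_, ?_, fun j hj => ?_⟩
    · rw [Env.mem_write, if_neg (by tauto), Env.mem_write, if_neg (by tauto)]
    · simp [Env.mem_write]
    · obtain rfl : j = 0 := by omega
      simp [Env.mem_write]
  · rintro k hk E' ⟨g1, g2, g3, g4, g5⟩
    have hk' : k < P.N := by simpa [hg.N] using hk
    simp only [wp_fop, FldOp.eval, Expr.eval_var, Expr.eval_add, Expr.eval_ofNat, Env.nat_set,
      reduceIte, Env.mem_set]
    refine ⟨by omega, fun x hx => ?_, g2, fun r c h1 h5 => ?_, ?_, fun j hj => ?_⟩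
    · rw [Env.nat_write, Env.nat_set, if_neg (by omega), g1 x hx]
    · rw [Env.mem_write, if_neg (by tauto), Env.mem_set, g3 r c h1 h5]
    · rw [Env.mem_write, if_neg (by omega), Env.mem_set, g4]
    · rw [Env.mem_write, Env.mem_set, g4, g5 k le_rfl]
      by_cases hjk : j = k + 1
      · rw [if_pos ⟨rfl, hjk⟩, hjk]
        push_cast
        rfl
      · rw [if_neg (by tauto), g5 j (by omega)]
  · rintro E₁ ⟨g1, g2, g3, -, g5⟩
    simp only [Expr.eval_var, Env.nat_write, hg.N] at g5
    simp only [wp_block_cons, wp_fop, Expr.eval_ofNat, FldOp.eval]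
    refine ⟨by omega, ?_⟩
    refine wp_loop (fun k E' => (∀ x < 30, E'.nat x = E.nat x) ∧ E'.pos = E.pos ∧
      (∀ r c, r ≠ 1 → r ≠ 2 → r ≠ 5 → E'.mem r c = E.mem r c) ∧
      (∀ k ≤ P.N, E'.mem 1 k = (k : F)) ∧ ∀ j ≤ k, E'.mem 2 j = γ ^ j) ?_ ?_ ?_ ?_
    · simp [g1 8, hg.N]
      omega
    · refine ⟨g1, g2, fun r c h1 h2 h5 => ?_, fun k hk => ?_, fun j hj => ?_⟩
      · rw [Env.mem_write, if_neg (by tauto), g3 r c h1 h5]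
      · rw [Env.mem_write, if_neg (by omega), g5 k hk]
      · obtain rfl : j = 0 := by omega
        simp [Env.mem_write]
    · rintro k hk E' ⟨f1, f2, f3, f4, f5⟩
      have hk' : k < P.N := by simpa [g1 8, hg.N] using hk
      simp only [wp_fop, FldOp.eval, Expr.eval_var, Expr.eval_add, Expr.eval_ofNat, Env.nat_set,
        reduceIte, Env.mem_set]
      refine ⟨by omega, fun x hx => ?_, f2, fun r c h1 h2 h5 => ?_, fun j hj => ?_, fun j hj => ?_⟩
      · rw [Env.nat_write, Env.nat_set, if_neg (by omega), f1 x hx]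
      · rw [Env.mem_write, if_neg (by tauto), Env.mem_set, f3 r c h1 h2 h5]
      · rw [Env.mem_write, if_neg (by omega), Env.mem_set, f4 j hj]
      · rw [Env.mem_write, Env.mem_set, f5 k le_rfl, f3 0 0 (by omega) (by omega) (by omega), hγ]
        by_cases hjk : j = k + 1
        · rw [if_pos ⟨rfl, hjk⟩, hjk, pow_succ]
        · rw [if_neg (by tauto), f5 j (by omega)]
    · rintro E₂ ⟨f1, f2, f3, f4, f5⟩
      simp only [Expr.eval_var, Env.nat_write, g1 8 (by omega), hg.N] at f5
      exact hQ E₂ f1 f2 f3 f4 f5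

/-- Write the value of the monomial with exponents `v42` and `v43` at the point `v44` into the
entry `(v40, v41)`. -/
def monomial : Cmd := .block [
  .fop .one (.var 40) (.var 41) 0 0 0 0,
  .loop 45 (.var 42) (.fop .mul (.var 40) (.var 41) (.var 40) (.var 41) 1 (.var 44)),
  .loop 45 (.var 43) (.fop .mul (.var 40) (.var 41) (.var 40) (.var 41) 2 (.var 44))]

theorem wp_monomial {W Z : ℕ} (h40 : 3 ≤ E.nat 40) (h41 : E.nat 41 < W) (h42 : E.nat 42 ≤ Z)
    (h43 : E.nat 43 ≤ Z) (h44 : E.nat 44 < W)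
    (hQ : ∀ E', (∀ x < 45, E'.nat x = E.nat x) → E'.pos = E.pos →
      (∀ r c, E'.mem r c = if r = E.nat 40 ∧ c = E.nat 41 then
        E.mem 1 (E.nat 44) ^ E.nat 42 * E.mem 2 (E.nat 44) ^ E.nat 43 else E.mem r c) → Q E') :
    wp W Z ω monomial Q E := by
  simp only [monomial, wp_block_cons, wp_fop, Expr.eval_ofNat, Expr.eval_var,
    FldOp.eval]
  refine ⟨by omega, ?_⟩
  refine wp_loop (fun k E' => (∀ x < 45, E'.nat x = E.nat x) ∧ E'.pos = E.pos ∧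
    (∀ r c, E'.mem r c = if r = E.nat 40 ∧ c = E.nat 41 then
        E.mem 1 (E.nat 44) ^ k else E.mem r c)) (by simpa using h42) ?_ ?_ ?_
  · refine ⟨fun x hx => rfl, rfl, fun r c => ?_⟩
    rw [Env.mem_write, pow_zero]
  · rintro k hk E' ⟨g1, g2, g3⟩
    simp only [wp_fop, FldOp.eval, Expr.eval_var, Expr.eval_ofNat, Env.nat_set, Nat.reduceEqDiff,
      reduceIte, g1 40 (by omega), g1 41 (by omega),
      g1 44 (by omega), Env.mem_set]
    refine ⟨by omega, fun x hx => ?_, g2, fun r c => ?_⟩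
    · rw [Env.nat_write, Env.nat_set, if_neg (by omega), g1 x hx]
    · rw [Env.mem_write]
      simp only [Env.mem_set, g3]
      by_cases h : r = E.nat 40 ∧ c = E.nat 41
      · simp only [h, and_self, if_true]
        rw [if_neg (by omega), pow_succ]
      · rw [if_neg h, if_neg h, if_neg h]
  · rintro E₁ ⟨g1, g2, g3⟩
    simp only [Expr.eval_var, Env.nat_write] at g3
    refine wp_loop (fun k E' => (∀ x < 45, E'.nat x = E.nat x) ∧ E'.pos = E.pos ∧
      (∀ r c, E'.mem r c = if r = E.nat 40 ∧ c = E.nat 41 then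
        E.mem 1 (E.nat 44) ^ E.nat 42 * E.mem 2 (E.nat 44) ^ k else E.mem r c))
        (by simpa [g1 43] using h43) ?_ ?_ ?_
    · refine ⟨g1, g2, fun r c => ?_⟩
      rw [g3, pow_zero, mul_one]
    · rintro k hk E' ⟨f1, f2, f3⟩
      simp only [wp_fop, FldOp.eval, Expr.eval_var, Expr.eval_ofNat, Env.nat_set, Nat.reduceEqDiff,
        reduceIte, f1 40 (by omega), f1 41 (by omega),
        f1 44 (by omega), Env.mem_set]
      refine ⟨by omega, fun x hx => ?_, f2, fun r c => ?_⟩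
      · rw [Env.nat_write, Env.nat_set, if_neg (by omega), f1 x hx]
      · rw [Env.mem_write]
        simp only [Env.mem_set, f3]
        by_cases h : r = E.nat 40 ∧ c = E.nat 41
        · simp only [h, and_self, if_true]
          rw [if_neg (by omega), pow_succ, mul_assoc]
        · rw [if_neg h, if_neg h, if_neg h]
    · rintro E₂ ⟨f1, f2, f3⟩
      simp only [Expr.eval_var, g1 43 (by omega)] at f3
      exact hQ E₂ f1 f2 f3

end Wp

/-! ### The interpolation matrix -/

section Interpolation

variable {F : Type*} [Field F] [DecidableEq F] {ω : ℕ → Bool} {Q : Env F → Prop}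
  {E : Env F} {P : Params}

/-- The interpolation vector of the monomial `f` in the coefficient with index `b`. -/
def interpRow (r : ℕ → F) (N b : ℕ) (f : ℕ → F) (c : ℕ) : F :=
  if c < N then (if b = 0 then f c else f c * r (c + b - 1))
  else if c / N = b then f (c % N) else 0

theorem interpRow_zero (r : ℕ → F) (w : ℕ) {N : ℕ} (hN : 0 < N) (f : ℕ → F) :
    interpRow r N 0 f = interpVec r w N (f, 0) := by
  ext c
  simp only [interpRow, interpVec, LinearMap.coe_mk, AddHom.coe_mk, if_true]
  split_ifs with h1 h2 h3
  · simp
  · have := Nat.div_pos (not_lt.1 h1) hN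
    omega
  · have := Nat.div_pos (not_lt.1 h1) hN
    omega
  · rfl
  · rfl

theorem interpRow_succ (r : ℕ → F) {w N : ℕ} (hN : 0 < N) (b : Fin w) (f : ℕ → F) :
    interpRow r N (b + 1) f = interpVec r w N (0, Pi.single b f) := by
  ext c
  simp only [interpRow, interpVec, LinearMap.coe_mk, AddHom.coe_mk]
  have h0 : ¬ (b : ℕ) + 1 = 0 := by omega
  rw [if_neg h0]
  split_ifs with h1 h3 h4 h5
  · rw [Finset.sum_eq_single b]
    · simp
    · intro b' _ hb'
      simp [Pi.single_eq_of_ne hb']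
    · simp
  · have : (⟨c / N - 1, h4⟩ : Fin w) = b := Fin.ext (by simp; omega)
    rw [this]
    simp
  · have := b.2
    omega
  · have : (⟨c / N - 1, h5⟩ : Fin w) ≠ b := fun h => by
      have h6 := congrArg Fin.val h
      have := Nat.div_pos (not_lt.1 h1) hN
      simp only at h6
      omega
    simp [Pi.single_eq_of_ne this]
  · rfl

/-- Fill row `v40` with the interpolation vector of the monomial with exponents `v42` and `v43` in
the coefficient with index `v29`. -/
def fillInterpRow : Cmd := .loop 30 vN (.block [
  .assign 44 (.var 30),
  .assign 41 (.var 29 * vN + .var 30),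
  monomial,
  .ite 29 (.fop .mul (.var 40) (.var 44) (.var 40) (.var 41) 0 (.var 44 + .var 29)) .skip])

theorem wp_fillInterpRow (hP : P.Valid) (hg : Glob P E) {γ : Fˣ}
    (hx : ∀ k ≤ P.N, E.mem 1 k = (k : F)) (hy : ∀ k ≤ P.N, E.mem 2 k = (γ : F) ^ k)
    (h40 : 8 ≤ E.nat 40) (h29 : E.nat 29 ≤ P.w) (h42 : E.nat 42 ≤ P.p) (h43 : E.nat 43 ≤ P.n)
    (h0 : ∀ c < P.W, E.mem (E.nat 40) c = 0)
    (hQ : ∀ E', (∀ x < 30, E'.nat x = E.nat x) → E'.pos = E.pos →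
      (∀ r c, r ≠ E.nat 40 → E'.mem r c = E.mem r c) →
      (∀ c < P.W, E'.mem (E.nat 40) c = interpRow (fun k => E.mem 0 (k + 1)) P.N (E.nat 29)
        (monoWord γ (E.nat 42) (E.nat 43)) c) → Q E') :
    wp P.W P.Z ω fillInterpRow Q E := by
  have hw := hP.w_ge
  have hp := hP.p_ge
  have hN := hP.N_ge
  have hn := hP.n_le_N
  have hW := hP.W_ge
  have hWZ := hP.W_le
  have hwN := hP.w_le_N
  have hbN : E.nat 29 * P.N ≤ P.w * P.N := Nat.mul_le_mul_right _ h29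
  set b := E.nat 29 with hb
  set R := E.nat 40 with hR
  set f := monoWord γ (E.nat 42) (E.nat 43) with hf
  set g := interpRow (fun k => E.mem 0 (k + 1)) P.N b f with hgdef
  refine wp_loop (fun k E' => (∀ x < 30, E'.nat x = E.nat x) ∧ E'.nat 40 = R ∧
    E'.nat 42 = E.nat 42 ∧ E'.nat 43 = E.nat 43 ∧ E'.pos = E.pos ∧
    (∀ r c, r ≠ R → E'.mem r c = E.mem r c) ∧
    ∀ c < P.W, E'.mem R c = if c % P.N < k then g c else 0) ?_ ?_ ?_ ?_
  · simp only [Expr.eval_var, hg.N]; omega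
  · exact ⟨fun _ _ => rfl, rfl, rfl, rfl, rfl, fun _ _ _ => rfl, fun c hc => by simpa using h0 c hc⟩
  · rintro k hk E' ⟨g1, g2, g3, g4, g5, g6, g7⟩
    have hk' : k < P.N := by simpa [hg.N] using hk
    have gN : E'.nat 8 = P.N := by rw [g1 _ (by omega), hg.N]
    have gb : E'.nat 29 = b := g1 _ (by omega)
    simp only [wp_block_cons, wp_assign, Expr.eval_var, Expr.eval_add, Expr.eval_mul, Env.nat_set,
      Nat.reduceEqDiff, reduceIte, gN, gb]
    refine ⟨by omega, by omega, ?_⟩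
    refine wp_monomial ?_ ?_ ?_ ?_ ?_ ?_ <;>
      try simp only [Env.nat_set, Env.mem_set, Env.pos_set, Nat.reduceEqDiff, reduceIte, g2, g3, g4]
    · omega
    · omega
    · omega
    · omega
    · omega
    intro E₁ e1 e2 e3
    rw [g6 1 k (by omega), g6 2 k (by omega), hx k hk'.le, hy k hk'.le,
      ← monoWord_apply, ← hf] at e3
    have e29 : E₁.nat 29 = b := by simpa [gb] using e1 29 (by omega)
    have e40 : E₁.nat 40 = R := by simpa [g2] using e1 40 (by omega)
    have e41 : E₁.nat 41 = b * P.N + k := by simpa [g2] using e1 41 (by omega)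
    have e42 : E₁.nat 42 = E.nat 42 := by simpa [g3] using e1 42 (by omega)
    have e43 : E₁.nat 43 = E.nat 43 := by simpa [g4] using e1 43 (by omega)
    have e44 : E₁.nat 44 = k := by simpa using e1 44 (by omega)
    have ex : ∀ x < 30, E₁.nat x = E.nat x := fun x hx => by
      rw [e1 x (by omega), if_neg (by omega), if_neg (by omega), if_neg (by omega), g1 x hx]
    have emod : ∀ c, c % P.N = k → c = c / P.N * P.N + k := fun c hc => by
      rw [← hc]; exact (pos_eta P.N c).symm
    have emodk : k % P.N = k := Nat.mod_eq_of_lt hk'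
    have emodb : (b * P.N + k) % P.N = k := pos_mod hk'
    have edivb : (b * P.N + k) / P.N = b := pos_div hk'
    simp only [wp_block_cons, wp_ite, wp_block_nil, wp_fop, wp_skip, FldOp.eval, Expr.eval_var,
      Expr.eval_add, Expr.eval_ofNat, e29, e40, e41, e44]
    constructor
    · intro hb0
      refine ⟨by omega, ex, e40, e42, e43, by rw [Env.pos_write, e2, g5], fun r c hr => ?_,
        fun c hc => ?_⟩
      · rw [Env.mem_write, if_neg (by tauto), e3, if_neg (by tauto), g6 r c hr]
      · have hbN : P.N ≤ b * P.N := Nat.le_mul_of_pos_left _ (by omega)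
        have v1 : E₁.mem R (b * P.N + k) = f k := by rw [e3, if_pos ⟨rfl, rfl⟩]
        have v2 : E₁.mem 0 (k + b) = E.mem 0 (k + b) := by
          rw [e3, if_neg (by omega), g6 0 _ (by omega)]
        rw [Env.mem_write, v1, v2, e3]
        by_cases h1 : c = k
        · subst h1
          rw [if_pos ⟨rfl, rfl⟩, if_pos (by omega), hgdef, interpRow, if_pos hk', if_neg hb0]
          simp only [show c + b - 1 + 1 = c + b by omega]
        · rw [if_neg (by tauto)]
          by_cases h2 : c = b * P.N + k
          · rw [if_pos ⟨rfl, h2⟩, h2, if_pos (by omega), hgdef, interpRow, if_neg (by omega),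
              if_pos edivb, emodb]
          · rw [if_neg (by tauto), g7 c hc]
            by_cases h3 : c % P.N < k
            · rw [if_pos h3, if_pos (by omega)]
            · rw [if_neg h3]
              by_cases h4 : c % P.N < k + 1
              · rw [if_pos h4, hgdef, interpRow, if_neg, if_neg]
                · intro h5
                  have := emod c (by omega)
                  rw [h5] at this
                  omega
                · intro h5
                  rw [Nat.mod_eq_of_lt h5] at h3 h4
                  omega
              · rw [if_neg h4]
    · intro hb0
      refine ⟨ex, trivial, e42, e43, by rw [e2, g5], fun r c hr => ?_, fun c hc => ?_⟩
      · rw [e3, if_neg (by tauto), g6 r c hr]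
      · rw [e3]
        simp only [hb0, Nat.zero_mul, Nat.zero_add, true_and]
        by_cases h1 : c = k
        · subst h1
          rw [if_pos rfl, if_pos (by omega), hgdef, interpRow, if_pos hk', if_pos hb0]
        · rw [if_neg h1, g7 c hc]
          by_cases h3 : c % P.N < k
          · rw [if_pos h3, if_pos (by omega)]
          · rw [if_neg h3]
            by_cases h4 : c % P.N < k + 1
            · rw [if_pos h4, hgdef, interpRow, if_neg, if_neg]
              · intro h5
                have := emod c (by omega)
                rw [h5, hb0] at this
                omega
              · intro h5
                rw [Nat.mod_eq_of_lt h5] at h3 h4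
                omega
            · rw [if_neg h4]
  · rintro E' ⟨g1, -, -, -, g5, g6, g7⟩
    refine hQ E' g1 g5 g6 fun c hc => ?_
    rw [g7 c hc, if_pos]
    simp only [Expr.eval_var, hg.N]
    exact Nat.mod_lt _ (by omega)

/-- The monomial of row `ρ` of the interpolation matrix, as its index, its exponents, and whether
they respect the degree bounds. -/
def Params.interpOk (P : Params) (ρ : ℕ) : Prop :=
  if ρ / P.N = 0 then ρ % P.N / P.n < P.E₀ ∧ ρ % P.N % P.n < P.T₀
  else ρ % P.N / P.n < P.D ∧ ρ % P.N % P.n < P.D'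

/-- Row `ρ` of the interpolation matrix. -/
noncomputable def Params.interpRow (P : Params) (γ : Fˣ) (r : ℕ → F) (ρ : ℕ) : ℕ → F :=
  open Classical in
  if P.interpOk ρ then PPC.interpRow r P.N (ρ / P.N)
    (monoWord γ (ρ % P.N / P.n) (ρ % P.N % P.n)) else 0

/-- Fill the interpolation matrix. -/
def fillInterp : Cmd := .loop 23 vN₁ (.block [
  .assign 40 (8 + .var 23),
  .assign 29 (.var 23 / vN),
  .assign 42 (.var 23 % vN / vn),
  .assign 43 (.var 23 % vN % vn),
  .ite 29 (.assign 24 ((vD - .var 42) * (vD' - .var 43)))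
    (.assign 24 ((vE₀ - .var 42) * (vT₀ - .var 43))),
  .ite 24 fillInterpRow .skip])

theorem wp_fillInterp (hP : P.Valid) (hg : Glob P E) {γ : Fˣ}
    (hx : ∀ k ≤ P.N, E.mem 1 k = (k : F)) (hy : ∀ k ≤ P.N, E.mem 2 k = (γ : F) ^ k)
    (h0 : ∀ ρ c, 8 ≤ ρ → c < P.W → E.mem ρ c = 0)
    (hQ : ∀ E', (∀ x < 23, E'.nat x = E.nat x) → E'.pos = E.pos →
      (∀ r c, r < 8 → E'.mem r c = E.mem r c) →
      (∀ ρ c, P.R₂ ≤ ρ → c < P.W → E'.mem ρ c = 0) →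
      (∀ ρ < P.N₁, ∀ c < P.W, E'.mem (8 + ρ) c = P.interpRow γ (fun k => E.mem 0 (k + 1)) ρ c) →
      Q E') :
    wp P.W P.Z ω fillInterp Q E := by
  have hw := hP.w_ge
  have hp := hP.p_ge
  have hN := hP.N_ge
  have hn := hP.n_le_N
  have hn0 := hP.n_pos
  have hW := hP.W_ge
  have hWZ := hP.W_le
  have hRZ := hP.rows_le
  have e16 : (P.w + 1) * P.N = P.N₁ := rfl
  have e17 : 8 + P.N₁ = P.R₂ := rfl
  have e18 : P.N + 1 = P.N₂ := rfl
  have e19 : P.R₂ + P.N₂ = P.R₃ := rfl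
  have e20 : P.R₃ + P.N₂ = P.R₄ := rfl
  have hNnp : P.N = P.p * P.n := mul_comm _ _
  have hE0 := hP.design.rows_le
  have hD : P.D ≤ P.E₀ := Nat.sub_le _ _
  have hT : P.T₀ ≤ P.n := Nat.sub_le _ _
  have hD' : P.D' ≤ P.T₀ := Nat.sub_le _ _
  refine wp_loop (fun k E' => (∀ x < 23, E'.nat x = E.nat x) ∧ E'.pos = E.pos ∧
    (∀ r c, r < 8 → E'.mem r c = E.mem r c) ∧
    (∀ ρ c, 8 + k ≤ ρ → c < P.W → E'.mem ρ c = 0) ∧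
    (∀ ρ < k, ∀ c < P.W, E'.mem (8 + ρ) c = P.interpRow γ (fun k => E.mem 0 (k + 1)) ρ c))
    ?_ ?_ ?_ ?_
  · simp only [Expr.eval_var, hg.N₁]; omega
  · exact ⟨fun _ _ => rfl, rfl, fun _ _ _ => rfl, h0, fun ρ hρ => by omega⟩
  · rintro ρ hρ E' ⟨g1, g2, g3, g4, g5⟩
    have hρ' : ρ < P.N₁ := by simpa [hg.N₁] using hρ
    have hgE : Glob P (E'.set 23 ρ) := hg.frame fun x hx => by
      rw [Env.nat_set, if_neg (by omega), g1 x (by omega)]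
    have hb : ρ / P.N ≤ P.w := by
      rw [← Nat.lt_succ_iff, Nat.div_lt_iff_lt_mul (by omega)]
      exact hρ'
    have hm : ρ % P.N < P.N := Nat.mod_lt _ (by omega)
    have he : ρ % P.N / P.n < P.p := by
      rw [Nat.div_lt_iff_lt_mul (by omega), ← hNnp]
      exact hm
    have he' : ρ % P.N % P.n < P.n := Nat.mod_lt _ (by omega)
    have h1 : (P.D - ρ % P.N / P.n) * (P.D' - ρ % P.N % P.n) ≤ P.N :=
      ((Nat.mul_le_mul (Nat.sub_le _ _) (Nat.sub_le _ _)).trans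
        (Nat.mul_le_mul (hD.trans hE0) (hD'.trans hT))).trans hNnp.ge
    have h2 : (P.E₀ - ρ % P.N / P.n) * (P.T₀ - ρ % P.N % P.n) ≤ P.N :=
      ((Nat.mul_le_mul (Nat.sub_le _ _) (Nat.sub_le _ _)).trans
        (Nat.mul_le_mul hE0 hT)).trans hNnp.ge
    have key : ∀ v : ℕ, (v ≠ 0 ↔ P.interpOk ρ) → wp P.W P.Z ω (.block [.ite 24 fillInterpRow .skip])
        (fun E' => (∀ x < 23, E'.nat x = E.nat x) ∧ E'.pos = E.pos ∧
          (∀ r c, r < 8 → E'.mem r c = E.mem r c) ∧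
          (∀ ρ' c, 8 + (ρ + 1) ≤ ρ' → c < P.W → E'.mem ρ' c = 0) ∧
          (∀ ρ' < ρ + 1, ∀ c < P.W,
            E'.mem (8 + ρ') c = P.interpRow γ (fun k => E.mem 0 (k + 1)) ρ' c))
        ((((((E'.set 23 ρ).set 40 (8 + ρ)).set 29 (ρ / P.N)).set 42 (ρ % P.N / P.n)).set 43
          (ρ % P.N % P.n)).set 24 v) := by
      intro v hv
      simp only [wp_block_cons, wp_block_nil, wp_ite, wp_skip]
      constructor
      · intro hv0
        have hv0' : v ≠ 0 := by simpa [Env.nat_set] using hv0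
        refine wp_fillInterpRow (γ := γ) hP ?_ ?_ ?_ ?_ ?_ ?_ ?_ ?_ ?_ <;>
          try simp only [Env.nat_set, Env.mem_set, Env.pos_set, Nat.reduceEqDiff, reduceIte]
        · refine hgE.frame fun x hx => ?_
          simp only [Env.nat_set]
          simp only [show x ≠ 24 by omega, show x ≠ 43 by omega, show x ≠ 42 by omega,
            show x ≠ 29 by omega, show x ≠ 40 by omega, if_false]
        · intro k hk
          rw [g3 1 k (by omega), hx k hk]
        · intro k hk
          rw [g3 2 k (by omega), hy k hk]
        · omega
        · exact hb
        · exact he.le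
        · exact he'.le
        · intro c hc
          exact g4 _ _ le_rfl hc
        · intro E₁ f1 f2 f3 f4
          refine ⟨fun x hx => ?_, by rw [f2, g2], fun r c hr => ?_, fun r c hr hc => ?_,
            fun ρ' hρ' c hc => ?_⟩
          · rw [f1 x (by omega), if_neg (by omega), if_neg (by omega), if_neg (by omega),
              if_neg (by omega), if_neg (by omega), if_neg (by omega), g1 x hx]
          · rw [f3 _ _ (by omega), g3 _ _ hr]
          · rw [f3 _ _ (by omega), g4 _ _ (by omega) hc]
          · by_cases h : ρ' = ρ
            · subst h
              rw [f4 c hc, Params.interpRow, if_pos (hv.1 hv0')]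
              simp only [g3 0 _ (show 0 < 8 by omega)]
            · rw [f3 _ _ (by omega), g5 ρ' (by omega) c hc]
      · intro hv0
        have hv0' : v = 0 := by simpa [Env.nat_set] using hv0
        refine ⟨fun x hx => ?_, g2, g3, fun r c hr hc => g4 _ _ (by omega) hc,
            fun ρ' hρ' c hc => ?_⟩
        · simp only [Env.nat_set]
          rw [if_neg (by omega), if_neg (by omega), if_neg (by omega),
              if_neg (by omega), if_neg (by omega), if_neg (by omega), g1 x hx]
        · by_cases h : ρ' = ρ
          · subst h
            rw [Params.interpRow, if_neg (by rw [← hv]; omega)]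
            exact g4 _ _ le_rfl hc
          · exact g5 ρ' (by omega) c hc
    have gD := hgE.D
    have gD' := hgE.D'
    have gE := hgE.E₀
    have gT := hgE.T₀
    have gN := hgE.N
    have gn := hgE.n
    simp only [Env.nat_set, Nat.reduceEqDiff, reduceIte] at gD gD' gE gT gN gn
    rw [wp_block_cons, wp_assign, wp_block_cons, wp_assign, wp_block_cons, wp_assign,
      wp_block_cons, wp_assign, wp_block_cons, wp_ite, wp_assign, wp_assign]
    simp only [Expr.eval_var, Expr.eval_add, Expr.eval_ofNat, Expr.eval_mul, Expr.eval_div,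
      Expr.eval_mod, Expr.eval_sub, Env.nat_set,
      Nat.reduceEqDiff, reduceIte, gN, gn, gD, gD', gE, gT]
    refine ⟨by omega, by omega, by omega, by omega, fun hb0 => ⟨by omega, ?_⟩,
      fun hb0 => ⟨by omega, ?_⟩⟩
    · apply key
      rw [Params.interpOk, if_neg hb0, Nat.mul_ne_zero_iff]
      omega
    · apply key
      rw [Params.interpOk, if_pos hb0, Nat.mul_ne_zero_iff]
      omega
  · rintro E' ⟨g1, g2, g3, g4, g5⟩
    simp only [Expr.eval_var, hg.N₁] at g4 g5
    exact hQ E' g1 g2 g3 (fun ρ c hρ hc => g4 ρ c hρ hc) g5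

/-- Row `8 + b N + e n + e'` of the filled matrix belongs to the monomial `x ^ e * y ^ e'` in the
coefficient `b`; it is zero if the exponents violate the degree bounds. -/
theorem rowSpan_eq_interpSpace (hP : P.Valid) (γ : Fˣ) (r : ℕ → F) {mem : ℕ → ℕ → F}
    (h : ∀ ρ < P.N₁, ∀ c < P.W, mem (8 + ρ) c = P.interpRow γ r ρ c) :
    rowSpan P.W mem 8 P.N₁ = interpSpace γ r P.w P.N P.E₀ P.T₀ P.D P.D' := by
  have hw := hP.w_ge
  have hp := hP.p_ge
  have hN := hP.N_ge
  have hn0 := hP.n_pos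
  have hW := hP.W_ge
  have e16 : P.w * P.N + P.N = P.N₁ := by unfold Params.N₁; ring
  have hE0 := hP.design.rows_le
  have hD : P.D ≤ P.E₀ := Nat.sub_le _ _
  have hT : P.T₀ ≤ P.n := Nat.sub_le _ _
  have hD' : P.D' ≤ P.T₀ := Nat.sub_le _ _
  have hrow : ∀ ρ < P.N₁, row P.W mem (8 + ρ) = P.interpRow γ r ρ := by
    intro ρ hρ
    ext c
    by_cases hc : c < P.W
    · rw [row_apply _ _ _ hc, h ρ hρ c hc]
    · rw [row, if_neg hc, Params.interpRow]
      split_ifs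
      · rw [interpRow, if_neg (by omega), if_neg]
        intro h
        have h1 := pos_eta P.N c
        have h2 := Nat.mod_lt c (show 0 < P.N by omega)
        have h3 : c / P.N * P.N ≤ P.w * P.N := by
          refine Nat.mul_le_mul_right _ ?_
          rw [h, ← Nat.lt_succ_iff, Nat.div_lt_iff_lt_mul (by omega)]
          exact hρ
        omega
      · rfl
  have hidx : ∀ b ≤ P.w, ∀ e < P.p, ∀ e' < P.n, b * P.N + (e * P.n + e') < P.N₁ ∧
      (b * P.N + (e * P.n + e')) / P.N = b ∧ (b * P.N + (e * P.n + e')) % P.N / P.n = e ∧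
      (b * P.N + (e * P.n + e')) % P.N % P.n = e' := by
    intro b hb e he e' he'
    have h1 : e * P.n + e' < P.N := by
      have := pos_lt he he'
      rwa [mul_comm P.p] at this
    rw [pos_mod h1, pos_div h1, pos_mod he', pos_div he']
    refine ⟨?_, rfl, rfl, rfl⟩
    have : b * P.N ≤ P.w * P.N := Nat.mul_le_mul_right _ hb
    omega
  apply le_antisymm
  · rw [rowSpan, Submodule.span_le]
    rintro _ ⟨ρ, hρ, rfl⟩
    simp only
    rw [hrow ρ hρ, Params.interpRow]
    split_ifs with hok
    · rw [Params.interpOk] at hok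
      split_ifs at hok with hb
      · rw [hb, interpRow_zero r P.w (by omega)]
        exact ⟨_, ⟨monoWord_mem γ hok.1 hok.2, Submodule.zero_mem _⟩, rfl⟩
      · have hb' : ρ / P.N - 1 < P.w := by
          have : ρ / P.N < P.w + 1 := by
            rw [Nat.div_lt_iff_lt_mul (by omega)]
            exact hρ
          omega
        have := interpRow_succ r (show 0 < P.N by omega) ⟨ρ / P.N - 1, hb'⟩
          (monoWord γ (ρ % P.N / P.n) (ρ % P.N % P.n))
        simp only [Nat.sub_add_cancel (Nat.pos_of_ne_zero hb)] at this
        rw [this]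
        refine ⟨_, ⟨Submodule.zero_mem _, fun b _ => ?_⟩, rfl⟩
        by_cases hbb : b = ⟨ρ / P.N - 1, hb'⟩
        · subst hbb
          simpa using monoWord_mem γ hok.1 hok.2
        · simp only [Pi.single_eq_of_ne hbb]
          exact Submodule.zero_mem _
    · exact Submodule.zero_mem _
  · refine interpSpace_le (fun e he e' he' => ?_) fun b e he e' he' => ?_
    · obtain ⟨h1, h2, h3, h4⟩ := hidx 0 (Nat.zero_le _) e (by omega) e' (by omega)
      have := row_mem_rowSpan P.W mem 8 h1
      rwa [hrow _ h1, Params.interpRow, if_pos, h2, h3, h4, interpRow_zero r P.w (by omega)] at this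
      rw [Params.interpOk, if_pos h2, h3, h4]
      exact ⟨he, he'⟩
    · obtain ⟨h1, h2, h3, h4⟩ := hidx (b + 1) b.2 e (by omega) e' (by omega)
      have := row_mem_rowSpan P.W mem 8 h1
      rwa [hrow _ h1, Params.interpRow, if_pos, h2, h3, h4, interpRow_succ r (by omega)] at this
      rw [Params.interpOk, if_neg (by omega), h3, h4]
      exact ⟨he, he'⟩

end Interpolation

/-! ### Computing the recurrence -/

section Recurrence

variable {F : Type*} [Field F] [DecidableEq F] {ω : ℕ → Bool} {Q : Env F → Prop}
  {E : Env F} {P : Params}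

/-- Make the entries zero whose columns come from the windows; `o` is the column of the entry at
the position `0`. -/
def eliminateWindows (o : Expr) : Cmd := .loop 24 vN (.block [
  .assign 25 (vE₀ - .var 24 % vP),
  .ite 25 (.block [.assign 32 (o + .var 24), eliminate]) .skip])

theorem wp_eliminateWindows (hP : P.Valid) (hg : Glob P E) {o : Expr} {co : ℕ}
    (ho : ∀ E' : Env F, Glob P E' → o.eval E'.nat = co) (hco : co ≤ P.N + 1)
    (hN : E.nat 31 ≤ P.Z) (hR : 8 ≤ E.nat 30)
    (hQ : ∀ E', (∀ x < 24, E'.nat x = E.nat x) → E'.pos = E.pos →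
      (∀ r c, r ≠ 3 → r ≠ 4 → (r < E.nat 30 ∨ E.nat 30 + E.nat 31 ≤ r) →
        E'.mem r c = E.mem r c) →
      (∀ v, v ∈ rowSpan P.W E'.mem (E.nat 30) (E.nat 31) ↔
        v ∈ rowSpan P.W E.mem (E.nat 30) (E.nat 31) ∧
          ∀ k < P.N, k % P.p < P.E₀ → v (co + k) = 0) → Q E') :
    wp P.W P.Z ω (eliminateWindows o) Q E := by
  have hw := hP.w_ge
  have hp := hP.p_ge
  have hNp := hP.N_ge
  have hW := hP.W_ge
  have hWZ := hP.W_le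
  have hE0 := hP.design.rows_le
  refine wp_loop (fun k E' => (∀ x < 24, E'.nat x = E.nat x) ∧ E'.nat 30 = E.nat 30 ∧
    E'.nat 31 = E.nat 31 ∧ E'.pos = E.pos ∧
    (∀ r c, r ≠ 3 → r ≠ 4 → (r < E.nat 30 ∨ E.nat 30 + E.nat 31 ≤ r) →
      E'.mem r c = E.mem r c) ∧
    (∀ v, v ∈ rowSpan P.W E'.mem (E.nat 30) (E.nat 31) ↔
        v ∈ rowSpan P.W E.mem (E.nat 30) (E.nat 31) ∧
          ∀ j < k, j % P.p < P.E₀ → v (co + j) = 0)) ?_ ?_ ?_ ?_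
  · simp only [Expr.eval_var, hg.N]; omega
  · exact ⟨fun _ _ => rfl, rfl, rfl, rfl, fun _ _ _ _ _ => rfl, fun v => by simp⟩
  · rintro k hk E' ⟨g1, g2, g3, g4, g5, g6⟩
    have hk' : k < P.N := by simpa [hg.N] using hk
    have hgE : Glob P E' := hg.frame fun x hx => g1 x (by omega)
    have ho' : o.eval (((E'.set 24 k).set 25 (P.E₀ - k % P.p)).nat) = co :=
      ho _ (hgE.frame fun x hx => by simp only [Env.nat_set]; rw [if_neg, if_neg] <;> omega)
    simp only [wp_block_cons, wp_block_nil, wp_ite, wp_skip, wp_assign, Expr.eval_var,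
      Expr.eval_add, Expr.eval_sub, Expr.eval_mod, Env.nat_set,
      Nat.reduceEqDiff, reduceIte, hgE.p, hgE.E₀]
    simp only [ho']
    refine ⟨by omega, fun h => ⟨by omega, ?_⟩, fun h => ?_⟩
    · refine wp_eliminate ?_ ?_ ?_ ?_ ?_ ?_ ?_ <;>
        try simp only [Env.nat_set, Env.mem_set, Env.pos_set, Nat.reduceEqDiff, reduceIte, g2, g3,
          hgE.W]
      · omega
      · omega
      · exact hN
      · exact hR
      · have := hP.wN_ge
        have : 16 * P.N ≤ P.w * P.N := Nat.mul_le_mul_right _ hw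
        omega
      intro E₁ e1 e2 e3 e4
      refine ⟨fun x hx => ?_, ?_, ?_, by rw [e2, g4], fun r c h3 h4 hr => ?_, fun v => ?_⟩
      · rw [e1 x (by omega), if_neg (by omega), if_neg (by omega), if_neg (by omega), g1 x hx]
      · simpa [g2] using e1 30 (by omega)
      · simpa [g3] using e1 31 (by omega)
      · rw [e3 r c h3 h4 hr, g5 r c h3 h4 hr]
      · rw [e4, Submodule.mem_inf, g6, LinearMap.mem_ker, LinearMap.proj_apply, and_assoc]
        refine and_congr_right fun _ => ⟨fun ⟨h1, h2⟩ j hj hjE => ?_, fun h1 =>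
          ⟨fun j hj => h1 j (by omega), h1 k (by omega) (by omega)⟩⟩
        rcases Nat.lt_succ_iff_lt_or_eq.1 hj with hj | rfl
        · exact h1 j hj hjE
        · exact h2
    · refine ⟨fun x hx => ?_, g2, g3, g4, g5, fun v => ?_⟩
      · rw [if_neg (by omega), if_neg (by omega), g1 x hx]
      · rw [Env.mem_set, Env.mem_set, g6]
        refine and_congr_right fun _ => ⟨fun h1 j hj hjE => ?_, fun h1 j hj => h1 j (by omega)⟩
        rcases Nat.lt_succ_iff_lt_or_eq.1 hj with hj | rfl
        · exact h1 j hj hjE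
        · omega
  · rintro E' ⟨g1, -, -, g4, g5, g6⟩
    simp only [Expr.eval_var, hg.N] at g6
    exact hQ E' g1 g4 g5 g6

/-- Find a row of the interpolation matrix with a nonzero coefficient of positive index. -/
def findRow : Cmd := .block [
  .assign 21 0,
  .loop 24 (vN₁ * (vw * vN)) (.block [
    .assign 25 (.var 24 / (vw * vN)),
    .assign 26 (vN + .var 24 % (vw * vN)),
    .ftest 27 (8 + .var 25) (.var 26),
    .ite 27 (.assign 21 (8 + .var 25)) .skip])]

theorem wp_findRow (hP : P.Valid) (hg : Glob P E)
    (hex : ∃ ρ < P.N₁, ∃ c, P.N ≤ c ∧ c < (P.w + 1) * P.N ∧ E.mem (8 + ρ) c ≠ 0)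
    (hQ : ∀ E', (∀ x < 21, E'.nat x = E.nat x) → E'.nat 22 = E.nat 22 → E'.pos = E.pos →
      E'.mem = E.mem → (∃ ρ < P.N₁, E'.nat 21 = 8 + ρ ∧ ∃ c, P.N ≤ c ∧ c < (P.w + 1) * P.N ∧
        E.mem (8 + ρ) c ≠ 0) → Q E') :
    wp P.W P.Z ω findRow Q E := by
  have hw := hP.w_ge
  have hp := hP.p_ge
  have hNp := hP.N_ge
  have hW := hP.W_ge
  have hWZ := hP.W_le
  have hRZ := hP.rows_le
  have hwN := hP.wN_ge
  have e16 : P.w * P.N + P.N = P.N₁ := by unfold Params.N₁; ring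
  have e16' : (P.w + 1) * P.N = P.N₁ := rfl
  have e17 : 8 + P.N₁ = P.R₂ := rfl
  have e19 : P.R₂ + P.N₂ = P.R₃ := rfl
  have e20 : P.R₃ + P.N₂ = P.R₄ := rfl
  rw [findRow, wp_block_cons, wp_assign, wp_block_cons]
  refine ⟨by simp, ?_⟩
  refine wp_loop (fun k E' => (∀ x < 21, E'.nat x = E.nat x) ∧ E'.nat 22 = E.nat 22 ∧
    E'.pos = E.pos ∧ E'.mem = E.mem ∧
    ((∃ ρ < P.N₁, E'.nat 21 = 8 + ρ ∧ ∃ c, P.N ≤ c ∧ c < (P.w + 1) * P.N ∧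
      E.mem (8 + ρ) c ≠ 0) ∨ ∀ i < k, E.mem (8 + i / (P.w * P.N)) (P.N + i % (P.w * P.N)) = 0))
    ?_ ?_ ?_ ?_
  · simp only [Expr.eval_var, Expr.eval_mul, Env.nat_set, Nat.reduceEqDiff, reduceIte, hg.N₁,
      hg.w, hg.N]
    exact hP.mul_le (by omega) (by omega)
  · refine ⟨fun x hx => ?_, by simp [Env.nat_set], rfl, rfl, Or.inr fun i hi => by omega⟩
    rw [Env.nat_set, if_neg (by omega)]
  · rintro k hk E' ⟨g1, g2, g3, g4, g5⟩
    have hk' : k < P.N₁ * (P.w * P.N) := by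
      simpa [Env.nat_set, hg.N₁, hg.w, hg.N] using hk
    have hgE : Glob P E' := hg.frame fun x hx => g1 x (by omega)
    have hdiv : k / (P.w * P.N) < P.N₁ := by rwa [Nat.div_lt_iff_lt_mul (by omega)]
    have hmod : k % (P.w * P.N) < P.w * P.N := Nat.mod_lt _ (by omega)
    simp only [wp_block_cons, wp_block_nil, wp_ite, wp_skip, wp_assign, wp_ftest, Expr.eval_var,
      Expr.eval_add, Expr.eval_mul, Expr.eval_div, Expr.eval_mod, Expr.eval_ofNat, Env.nat_set,
      Env.mem_set, Env.pos_set, Nat.reduceEqDiff, reduceIte, hgE.w, hgE.N, g4]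
    refine ⟨by omega, by omega, by omega, fun h => ⟨by omega, fun x hx => ?_, g2, g3, trivial,
      Or.inl ⟨_, hdiv, rfl, P.N + k % (P.w * P.N), Nat.le_add_right _ _, by omega, ?_⟩⟩, fun h => ⟨fun x hx => ?_, g2,
        g3, trivial, ?_⟩⟩
    · rw [if_neg (by omega), if_neg (by omega), if_neg (by omega), if_neg (by omega),
        if_neg (by omega), g1 x hx]
    · simpa using h
    · rw [if_neg (by omega), if_neg (by omega), if_neg (by omega), if_neg (by omega), g1 x hx]
    · rcases g5 with g5 | g5
      · exact Or.inl g5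
      · refine Or.inr fun i hi => ?_
        rcases Nat.lt_succ_iff_lt_or_eq.1 hi with hi | rfl
        · exact g5 i hi
        · by_contra h'
          simp [h'] at h
  · rintro E' ⟨g1, g2, g3, g4, g5⟩
    rw [wp_block_nil]
    refine hQ E' g1 g2 g3 g4 ?_
    rcases g5 with g5 | g5
    · exact g5
    · simp only [Expr.eval_var, Expr.eval_mul, Env.nat_set, Nat.reduceEqDiff, reduceIte, hg.N₁,
        hg.w, hg.N] at g5
      obtain ⟨ρ, hρ, c, hc1, hc2, hne⟩ := hex
      refine absurd ?_ hne
      have h1 : c - P.N < P.w * P.N := by omega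
      have := g5 (ρ * (P.w * P.N) + (c - P.N)) (pos_lt hρ h1)
      rwa [pos_mod h1, pos_div h1, show P.N + (c - P.N) = c by omega] at this

/-- Compute a recurrence for the received word. -/
def recurrence : Cmd := .block [
  points,
  fillInterp,
  .assign 30 8,
  .assign 31 vN₁,
  eliminateWindows 0,
  findRow]

theorem wp_recurrence (hP : P.Valid) (hg : Glob P E) {γ : Fˣ} [CharP F P.p]
    (hγ : orderOf γ = P.n) (hpn : Nat.Coprime P.p P.n) (hγ0 : E.mem 0 0 = γ)
    (h0 : ∀ ρ c, 8 ≤ ρ → c < P.W → E.mem ρ c = 0)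
    (hQ : ∀ E', (∀ x < 21, E'.nat x = E.nat x) → E'.nat 22 = E.nat 22 → E'.pos = E.pos →
      (∀ c, E'.mem 0 c = E.mem 0 c) → (∀ k ≤ P.N, E'.mem 1 k = (k : F)) →
      (∀ k ≤ P.N, E'.mem 2 k = (γ : F) ^ k) → (∀ ρ c, P.R₂ ≤ ρ → c < P.W → E'.mem ρ c = 0) →
      8 ≤ E'.nat 21 → E'.nat 21 < P.R₂ →
      (∃ a₀ a, IsRecurrence γ (fun k => E.mem 0 (k + 1)) P.p P.n P.w P.E₀ P.T₀ P.D P.D' a₀ a ∧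
        ∀ b < P.w, ∀ k < P.N, E'.mem (E'.nat 21) ((b + 1) * P.N + k) = a b k) → Q E') :
    wp P.W P.Z ω recurrence Q E := by
  have hw := hP.w_ge
  have hW := hP.W_ge
  have hRZ := hP.rows_le
  have e17 : 8 + P.N₁ = P.R₂ := rfl
  have e16 : (P.w + 1) * P.N = P.w * P.N + P.N := by ring
  have e19 : P.R₂ + P.N₂ = P.R₃ := rfl
  have e20 : P.R₃ + P.N₂ = P.R₄ := rfl
  simp only [recurrence, wp_block_cons]
  refine wp_points hP hg hγ0 fun E₁ a1 a2 a3 a4 a5 => ?_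
  have hg1 : Glob P E₁ := hg.frame fun x hx => a1 x (by omega)
  refine wp_fillInterp hP hg1 a4 a5 (fun ρ c hρ hc => ?_) fun E₂ b1 b2 b3 b4 b5 => ?_
  · rw [a3 _ _ (by omega) (by omega) (by omega), h0 ρ c hρ hc]
  have hg2 : Glob P E₂ := hg1.frame fun x hx => b1 x (by omega)
  simp only [wp_block_cons, wp_assign, Expr.eval_ofNat, Expr.eval_var, Env.nat_set,
    Nat.reduceEqDiff, reduceIte, hg2.N₁]
  refine ⟨by omega, by omega, ?_⟩
  refine wp_eliminateWindows (co := 0) hP (hg2.frame fun x hx => ?_) (fun E' _ => rfl) (by omega)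
    ?_ ?_ ?_ <;> try simp only [Env.nat_set, Env.mem_set, Env.pos_set, Nat.reduceEqDiff, reduceIte]
  · rw [if_neg (by omega), if_neg (by omega)]
  · omega
  · omega
  intro E₃ c1 c2 c3 c4
  have hr : (fun k => E₁.mem 0 (k + 1)) = fun k => E.mem 0 (k + 1) := by
    ext k
    rw [a3 _ _ (by omega) (by omega) (by omega)]
  rw [hr] at b5
  rw [rowSpan_eq_interpSpace hP γ _ b5] at c4
  simp only [Nat.zero_add] at c4
  have hg3 : Glob P E₃ := hg2.frame fun x hx => by
    rw [c1 x (by omega), if_neg (by omega), if_neg (by omega)]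
  refine wp_findRow hP hg3 ?_ fun E₄ d1 d2 d3 d4 d5 => ?_
  · obtain ⟨u, hu, hu0, c, hc1, hc2, huc⟩ := exists_interpolation hγ hpn hP.design
      (fun k => E.mem 0 (k + 1))
    have h1 := (c4 u).2 ⟨hu, hu0⟩
    by_contra hcon
    push Not at hcon
    refine huc ?_
    have h2 : rowSpan P.W E₃.mem 8 P.N₁ ≤
        LinearMap.ker (LinearMap.proj c : (ℕ → F) →ₗ[F] F) := by
      rw [rowSpan, Submodule.span_le]
      rintro _ ⟨ρ, hρ, rfl⟩
      change row _ _ _ c = 0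
      rw [row_apply _ _ _ (by change c < (P.w + 1) * P.N at hc2; omega)]
      exact hcon ρ hρ c hc1 hc2
    exact h2 h1
  · obtain ⟨ρ, hρ, d6, c, hc1, hc2, hne⟩ := d5
    refine hQ E₄ (fun x hx => ?_) ?_ ?_ (fun c => ?_) (fun k hk => ?_) (fun k hk => ?_)
      (fun ρ c hρ hc => ?_) ?_ ?_ ?_
    · rw [d1 x hx, c1 x (by omega), if_neg (by omega), if_neg (by omega), b1 x (by omega),
        a1 x (by omega)]
    · rw [d2, c1 22 (by omega), if_neg (by omega), if_neg (by omega), b1 22 (by omega),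
        a1 22 (by omega)]
    · rw [d3, c2, b2, a2]
    · rw [d4, c3 _ _ (by omega) (by omega) (by omega), b3 _ _ (by omega),
        a3 _ _ (by omega) (by omega) (by omega)]
    · rw [d4, c3 _ _ (by omega) (by omega) (by omega), b3 _ _ (by omega), a4 k hk]
    · rw [d4, c3 _ _ (by omega) (by omega) (by omega), b3 _ _ (by omega), a5 k hk]
    · rw [d4, c3 _ _ (by omega) (by omega) (by omega), b4 _ _ (by omega) hc]
    · omega
    · omega
    · have h1 := row_mem_rowSpan P.W E₃.mem 8 hρ
      obtain ⟨h2, h3⟩ := (c4 _).1 h1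
      obtain ⟨a₀, a, ha, hA⟩ := exists_isRecurrence h2 h3 hc1
        (by rwa [row_apply _ _ _ (by omega)])
      refine ⟨a₀, a, ha, fun b hb k hk => ?_⟩
      rw [← hA b hb k hk, d4, d6, row_apply _ _ _ ?_]
      · rfl
      have : (b + 1) * P.N ≤ P.w * P.N := Nat.mul_le_mul_right _ hb
      change (b + 1) * P.N + k < P.W
      omega

end Recurrence

/-! ### The candidates -/

section Candidates

variable {F : Type*} [Field F] [DecidableEq F] {ω : ℕ → Bool} {Q : Env F → Prop}
  {E : Env F} {P : Params}

/-- Fill row `v40`, from column `1` on, with the word of the monomial with exponents `v42` and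
`v43`. -/
def fillWord : Cmd := .loop 30 vN (.block [
  .assign 44 (.var 30),
  .assign 41 (1 + .var 30),
  monomial])

theorem wp_fillWord (hP : P.Valid) (hg : Glob P E) {γ : Fˣ}
    (hx : ∀ k ≤ P.N, E.mem 1 k = (k : F)) (hy : ∀ k ≤ P.N, E.mem 2 k = (γ : F) ^ k)
    (h40 : 8 ≤ E.nat 40) (h42 : E.nat 42 ≤ P.p) (h43 : E.nat 43 ≤ P.n)
    (hQ : ∀ E', (∀ x < 30, E'.nat x = E.nat x) → E'.pos = E.pos →
      (∀ r c, r ≠ E.nat 40 → E'.mem r c = E.mem r c) →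
      (∀ c, E'.mem (E.nat 40) c = if 1 ≤ c ∧ c ≤ P.N then
        monoWord γ (E.nat 42) (E.nat 43) (c - 1) else E.mem (E.nat 40) c) → Q E') :
    wp P.W P.Z ω fillWord Q E := by
  have hw := hP.w_ge
  have hp := hP.p_ge
  have hN := hP.N_ge
  have hn := hP.n_le_N
  have hW := hP.W_ge
  have hWZ := hP.W_le
  set R := E.nat 40 with hR
  set f := monoWord γ (E.nat 42) (E.nat 43) with hf
  refine wp_loop (fun k E' => (∀ x < 30, E'.nat x = E.nat x) ∧ E'.nat 40 = R ∧
    E'.nat 42 = E.nat 42 ∧ E'.nat 43 = E.nat 43 ∧ E'.pos = E.pos ∧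
    (∀ r c, r ≠ R → E'.mem r c = E.mem r c) ∧
    ∀ c, E'.mem R c = if 1 ≤ c ∧ c ≤ k then f (c - 1) else E.mem R c) ?_ ?_ ?_ ?_
  · simp only [Expr.eval_var, hg.N]; omega
  · refine ⟨fun _ _ => rfl, rfl, rfl, rfl, rfl, fun _ _ _ => rfl, fun c => ?_⟩
    rw [if_neg (by omega)]
  · rintro k hk E' ⟨g1, g2, g3, g4, g5, g6, g7⟩
    have hk' : k < P.N := by simpa [hg.N] using hk
    simp only [wp_block_cons, wp_assign, Expr.eval_var, Expr.eval_add,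
      Expr.eval_ofNat, Env.nat_set, Nat.reduceEqDiff, reduceIte]
    refine ⟨by omega, by omega, ?_⟩
    refine wp_monomial ?_ ?_ ?_ ?_ ?_ ?_ <;>
      try simp only [Env.nat_set, Env.mem_set, Env.pos_set, Nat.reduceEqDiff, reduceIte, g2, g3, g4]
    · omega
    · omega
    · omega
    · omega
    · omega
    intro E₁ e1 e2 e3
    rw [g6 1 k (by omega), g6 2 k (by omega), hx k hk'.le, hy k hk'.le,
      ← monoWord_apply, ← hf] at e3
    refine ⟨fun x hx => ?_, by simpa [g2] using e1 40 (by omega),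
      by simpa [g3] using e1 42 (by omega), by simpa [g4] using e1 43 (by omega), by rw [e2, g5],
      fun r c hr => ?_, fun c => ?_⟩
    · rw [e1 x (by omega), if_neg (by omega), if_neg (by omega), if_neg (by omega), g1 x hx]
    · rw [e3, if_neg (by tauto), g6 r c hr]
    · rw [e3]
      by_cases h : c = 1 + k
      · rw [if_pos ⟨rfl, h⟩, if_pos (by omega), h, Nat.add_sub_cancel_left]
      · rw [if_neg (by tauto), g7]
        by_cases h1 : 1 ≤ c ∧ c ≤ k
        · rw [if_pos h1, if_pos (by omega)]
        · rw [if_neg h1, if_neg (by omega)]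
  · rintro E' ⟨g1, -, -, -, g5, g6, g7⟩
    simp only [Expr.eval_var, hg.N] at g7
    exact hQ E' g1 g5 g6 g7

/-- The values of the recurrence on the vector `x`, after its first `N + 1` entries. -/
def recRow (a : ℕ → ℕ → F) (p N w E₀ K : ℕ) (x : ℕ → F) (c : ℕ) : F :=
  if c ≤ N then x c else if c - 1 - N < K ∧ (c - 1 - N) % p < E₀ then
    ∑ b ∈ Finset.range w, a b (c - 1 - N) * x (1 + (c - 1 - N) + b) else 0

/-- Append the values of the recurrence to row `v25`. -/
def fillRec : Cmd := .loop 26 vN (.block [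
  .assign 27 (vE₀ - .var 26 % vP),
  .ite 27 (.loop 28 vw (.block [
    .fop .mul 5 2 vRow ((.var 28 + 1) * vN + .var 26) (.var 25) (1 + .var 26 + .var 28),
    .fop .add (.var 25) (vN + 1 + .var 26) (.var 25) (vN + 1 + .var 26) 5 2])) .skip])

theorem pos_window (hP : P.Valid) {k b : ℕ} (hk : k < P.N) (hkE : k % P.p < P.E₀) (hb : b < P.w) :
    k + b < P.N := by
  have h1 := pos_eta P.p k
  have hw := hP.design.window
  have h2 : k / P.p < P.n := by
    rw [Nat.div_lt_iff_lt_mul (by omega)]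
    exact hk
  have h3 : k / P.p * P.p + (k % P.p + b) < P.n * P.p := pos_lt h2 (by omega)
  change k + b < P.n * P.p
  omega

theorem wp_fillRec (hP : P.Valid) (hg : Glob P E) {a : ℕ → ℕ → F} (h25 : P.R₂ ≤ E.nat 25)
    (h21 : 8 ≤ E.nat 21) (h21' : E.nat 21 < P.R₂)
    (ha : ∀ b < P.w, ∀ k < P.N, E.mem (E.nat 21) ((b + 1) * P.N + k) = a b k)
    (h0 : ∀ c < P.W, P.N < c → E.mem (E.nat 25) c = 0)
    (hQ : ∀ E', (∀ x < 26, E'.nat x = E.nat x) → E'.pos = E.pos →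
      (∀ r c, r ≠ 5 → r ≠ E.nat 25 → E'.mem r c = E.mem r c) →
      (∀ c < P.W, E'.mem (E.nat 25) c =
        recRow a P.p P.N P.w P.E₀ P.N (E.mem (E.nat 25)) c) → Q E') :
    wp P.W P.Z ω fillRec Q E := by
  have hw := hP.w_ge
  have hp := hP.p_ge
  have hN := hP.N_ge
  have hW := hP.W_ge
  have hWZ := hP.W_le
  have hwN := hP.w_le_N
  have hwN' := hP.wN_ge
  have hE0 := hP.design.rows_le
  set R := E.nat 25 with hR
  set R1 := E.nat 21 with hR1
  refine wp_loop (fun k E' => (∀ x < 26, E'.nat x = E.nat x) ∧ E'.pos = E.pos ∧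
    (∀ r c, r ≠ 5 → r ≠ R → E'.mem r c = E.mem r c) ∧
    ∀ c < P.W, E'.mem R c = recRow a P.p P.N P.w P.E₀ k (E.mem R) c) ?_ ?_ ?_ ?_
  · simp only [Expr.eval_var, hg.N]; omega
  · refine ⟨fun _ _ => rfl, rfl, fun _ _ _ _ => rfl, fun c hc => ?_⟩
    rw [recRow, if_neg (show ¬ (c - 1 - P.N < 0 ∧ _) by omega)]
    split_ifs with h
    · rfl
    · exact h0 c hc (by omega)
  · rintro k hk E' ⟨g1, g2, g3, g4⟩
    have hk' : k < P.N := by simpa [hg.N] using hk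
    have hgE : Glob P E' := hg.frame fun x hx => g1 x (by omega)
    simp only [wp_block_cons, wp_block_nil, wp_ite, wp_skip, wp_assign, Expr.eval_var,
      Expr.eval_sub, Expr.eval_mod, Env.nat_set,
      Nat.reduceEqDiff, reduceIte, hgE.p, hgE.E₀]
    have hstep : ∀ c < P.W, c ≠ P.N + 1 + k → recRow a P.p P.N P.w P.E₀ (k + 1) (E.mem R) c =
        recRow a P.p P.N P.w P.E₀ k (E.mem R) c := by
      intro c hc hne
      simp only [recRow]
      by_cases h1 : c ≤ P.N
      · rw [if_pos h1, if_pos h1]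
      · rw [if_neg h1, if_neg h1]
        have : c - 1 - P.N < k + 1 ↔ c - 1 - P.N < k := by omega
        simp only [this]
    refine ⟨by omega, fun h => ?_, fun h => ?_⟩
    · have hkE : k % P.p < P.E₀ := by omega
      refine wp_loop (fun d E'' => (∀ x < 26, E''.nat x = E.nat x) ∧ E''.nat 26 = k ∧
        E''.pos = E.pos ∧ (∀ r c, r ≠ 5 → r ≠ R → E''.mem r c = E.mem r c) ∧
        (∀ c, c ≠ P.N + 1 + k → E''.mem R c = E'.mem R c) ∧
        E''.mem R (P.N + 1 + k) = ∑ b ∈ Finset.range d, a b k * E.mem R (1 + k + b)) ?_ ?_ ?_ ?_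
      · simp only [Expr.eval_var, Env.nat_set, Nat.reduceEqDiff, reduceIte, hgE.w]; omega
      · refine ⟨fun x hx => ?_, by simp [Env.nat_set], g2, g3, fun c hc => rfl, ?_⟩
        · rw [Env.nat_set, Env.nat_set, if_neg (by omega), if_neg (by omega), g1 x hx]
        · rw [Env.mem_set, Env.mem_set, g4 _ (by omega), recRow, if_neg (by omega),
            if_neg (by omega), Finset.sum_range_zero]
      · rintro d hd E'' ⟨f1, f2, f3, f4, f5, f6⟩
        have hd' : d < P.w := by simpa [Env.nat_set, hgE.w] using hd
        have hgE'' : Glob P E'' := hg.frame fun x hx => f1 x (by omega)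
        have f21 : E''.nat 21 = R1 := f1 21 (by omega)
        have f25 : E''.nat 25 = R := f1 25 (by omega)
        have hdN : (d + 1) * P.N ≤ P.w * P.N := Nat.mul_le_mul_right _ hd'
        have hkd := pos_window hP hk' hkE hd'
        simp only [wp_block_cons, wp_block_nil, wp_fop, FldOp.eval, Expr.eval_var, Expr.eval_add,
          Expr.eval_mul, Expr.eval_ofNat, Env.nat_set, Env.nat_write, Nat.reduceEqDiff, reduceIte,
          hgE''.N, f2, f21, f25, Env.mem_set]
        have v1 : E''.mem R1 ((d + 1) * P.N + k) = a d k := by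
          rw [f4 _ _ (by omega) (by omega), ha d hd' k hk']
        have v2 : E''.mem R (1 + k + d) = E.mem R (1 + k + d) := by
          rw [f5 _ (by omega), g4 _ (by omega), recRow, if_pos (by omega)]
        refine ⟨by omega, by omega, fun x hx => ?_, trivial, f3, fun r c hr5 hrR => ?_,
          fun c hc => ?_, ?_⟩
        · rw [if_neg (by omega), f1 x hx]
        · rw [Env.mem_write, if_neg (by tauto), Env.mem_write, if_neg (by tauto), Env.mem_set,
            f4 r c hr5 hrR]
        · rw [Env.mem_write, if_neg (by tauto), Env.mem_write, if_neg (by omega), Env.mem_set,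
            f5 c hc]
        · rw [Env.mem_write, if_pos ⟨rfl, rfl⟩, Env.mem_write, if_neg (by omega), Env.mem_write,
            if_pos ⟨rfl, rfl⟩, Env.mem_set, v1, v2, f6, Finset.sum_range_succ]
      · rintro E'' ⟨f1, f2, f3, f4, f5, f6⟩
        simp only [Expr.eval_var, Env.nat_set, Nat.reduceEqDiff, reduceIte, hgE.w] at f6
        refine ⟨f1, f3, f4, fun c hc => ?_⟩
        by_cases hck : c = P.N + 1 + k
        · rw [hck, f6, recRow, if_neg (by omega), show P.N + 1 + k - 1 - P.N = k by omega,
            if_pos ⟨by omega, hkE⟩]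
        · rw [f5 c hck, g4 c hc, hstep c hc hck]
    · refine ⟨fun x hx => ?_, g2, g3, fun c hc => ?_⟩
      · rw [if_neg (by omega), if_neg (by omega), g1 x hx]
      · rw [Env.mem_set, Env.mem_set, g4 c hc]
        by_cases hck : c = P.N + 1 + k
        · rw [hck, recRow, recRow, if_neg (by omega), if_neg (by omega),
            show P.N + 1 + k - 1 - P.N = k by omega, if_neg (by omega), if_neg (by omega)]
        · rw [hstep c hc hck]
  · rintro E' ⟨g1, g2, g3, g4⟩
    simp only [Expr.eval_var, hg.N] at g4
    exact hQ E' g1 g2 g3 g4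

/-- The pair of row `ρ` of the matrix of candidates. -/
def Params.cand (P : Params) (γ : Fˣ) (ρ : ℕ) : F × (ℕ → F) :=
  if ρ = 0 then (1, 0)
  else if (ρ - 1) / P.n < P.s ∧ (ρ - 1) % P.n < P.t then
    (0, monoWord γ ((ρ - 1) / P.n) ((ρ - 1) % P.n)) else 0

theorem recRow_candVec (hP : P.Valid) (r : ℕ → F) (a : ℕ → ℕ → F) {x : ℕ → F} (y : F × (ℕ → F))
    (h : ∀ c ≤ P.N, x c = candVec r a P.p P.N P.w P.E₀ y c) (c : ℕ) :
    recRow a P.p P.N P.w P.E₀ P.N x c = candVec r a P.p P.N P.w P.E₀ y c := by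
  rw [recRow]
  split_ifs with h1 h2
  · exact h c h1
  · obtain ⟨k, rfl⟩ : ∃ k, c = P.N + 1 + k := ⟨c - 1 - P.N, by omega⟩
    rw [show P.N + 1 + k - 1 - P.N = k by omega] at h2 ⊢
    rw [candVec_rec _ _ _ _ _ h2.1 h2.2]
    refine Finset.sum_congr rfl fun b hb => ?_
    have := pos_window hP h2.1 h2.2 (Finset.mem_range.1 hb)
    rw [h _ (by omega), show 1 + k + b = 1 + (k + b) by ring, candVec_word _ _ _ _ _ this]
  · change _ = if _ then _ else _
    rw [if_neg (by omega), if_neg (by omega), if_neg h2]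

/-- Fill the matrix of candidates. -/
def fillCand : Cmd := .block [
  .fop .one vR₂ 0 0 0 0 0,
  .fop .zero 5 1 0 0 0 0,
  .loop 30 vN (.fop .sub vR₂ (1 + .var 30) 5 1 0 (.var 30 + 1)),
  .loop 23 vN (.block [
    .assign 40 (vR₂ + 1 + .var 23),
    .assign 42 (.var 23 / vn),
    .assign 43 (.var 23 % vn),
    .assign 24 ((vS - .var 42) * (vT - .var 43)),
    .ite 24 fillWord .skip]),
  .loop 23 vN₂ (.block [
    .assign 25 (vR₂ + .var 23),
    fillRec])]

theorem wp_fillCand (hP : P.Valid) (hg : Glob P E) {γ : Fˣ} {a : ℕ → ℕ → F}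
    (hx : ∀ k ≤ P.N, E.mem 1 k = (k : F)) (hy : ∀ k ≤ P.N, E.mem 2 k = (γ : F) ^ k)
    (h21 : 8 ≤ E.nat 21) (h21' : E.nat 21 < P.R₂)
    (ha : ∀ b < P.w, ∀ k < P.N, E.mem (E.nat 21) ((b + 1) * P.N + k) = a b k)
    (h0 : ∀ ρ c, P.R₂ ≤ ρ → c < P.W → E.mem ρ c = 0)
    (hQ : ∀ E', (∀ x < 23, E'.nat x = E.nat x) → E'.pos = E.pos →
      (∀ r c, r < P.R₂ → r ≠ 5 → E'.mem r c = E.mem r c) →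
      (∀ ρ < P.N₂, ∀ c < P.W, E'.mem (P.R₂ + ρ) c =
        candVec (fun k => E.mem 0 (k + 1)) a P.p P.N P.w P.E₀ (P.cand γ ρ) c) →
      Q E') :
    wp P.W P.Z ω fillCand Q E := by
  have hw := hP.w_ge
  have hp := hP.p_ge
  have hN := hP.N_ge
  have hn := hP.n_le_N
  have hn0 := hP.n_pos
  have hW := hP.W_ge
  have hWZ := hP.W_le
  have hRZ := hP.rows_le
  have hwN := hP.w_le_N
  have e17 : 8 + P.N₁ = P.R₂ := rfl
  have e18 : P.N + 1 = P.N₂ := rfl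
  have e19 : P.R₂ + P.N₂ = P.R₃ := rfl
  have e20 : P.R₃ + P.N₂ = P.R₄ := rfl
  have hNnp : P.N = P.p * P.n := mul_comm _ _
  have hs : P.s ≤ P.p := by
    have := hP.design.rows
    have := hP.design.rows_le
    omega
  have ht : P.t ≤ P.n := by
    have := hP.design.cols
    have := hP.design.cols_le
    omega
  set r : ℕ → F := fun k => E.mem 0 (k + 1) with hr
  set y : ℕ → ℕ → F := fun ρ => candVec r a P.p P.N P.w P.E₀ (P.cand γ ρ) with hydef
  have hy0 : ∀ k < P.N, y 0 (1 + k) = 0 - r k := fun k hk => by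
    simp only [hydef, Params.cand, if_true]
    rw [candVec_word _ _ _ _ _ hk]
    simp
  simp only [fillCand, wp_block_cons, wp_fop, FldOp.eval, Expr.eval_ofNat,
    Expr.eval_var, Env.nat_write, hg.R₂]
  refine ⟨by omega, by omega, ?_⟩
  refine wp_loop (fun k E' => (∀ x < 23, E'.nat x = E.nat x) ∧ E'.pos = E.pos ∧
    (∀ r c, r ≠ P.R₂ → r ≠ 5 → E'.mem r c = E.mem r c) ∧ E'.mem 5 1 = 0 ∧
    ∀ c < P.W, E'.mem P.R₂ c = if c ≤ k then y 0 c else 0) ?_ ?_ ?_ ?_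
  · simp only [Expr.eval_var, Env.nat_write, hg.N]; omega
  · refine ⟨fun _ _ => rfl, rfl, fun r c h1 h5 => ?_, ?_, fun c hc => ?_⟩
    · rw [Env.mem_write, if_neg (by tauto), Env.mem_write, if_neg (by tauto)]
    · rw [Env.mem_write, if_pos ⟨rfl, rfl⟩]
    · rw [Env.mem_write, if_neg (by omega), Env.mem_write]
      by_cases hc0 : c = 0
      · rw [if_pos ⟨rfl, hc0⟩, hc0, if_pos le_rfl]
        simp [hydef, Params.cand, candVec_zero]
      · rw [if_neg (by tauto), if_neg (by omega), h0 _ _ le_rfl hc]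
  · rintro k hk E' ⟨g1, g2, g3, g4, g5⟩
    have hk' : k < P.N := by simpa [hg.N] using hk
    have hgE : Glob P E' := hg.frame fun x hx => g1 x (by omega)
    simp only [wp_fop, FldOp.eval, Expr.eval_var, Expr.eval_add, Expr.eval_ofNat, Env.nat_set,
      Nat.reduceEqDiff, reduceIte, hgE.R₂, Env.mem_set]
    refine ⟨by omega, fun x hx => ?_, g2, fun r c h1 h5 => ?_, ?_, fun c hc => ?_⟩
    · rw [Env.nat_write, Env.nat_set, if_neg (by omega), g1 x hx]
    · rw [Env.mem_write, if_neg (by tauto), Env.mem_set, g3 r c h1 h5]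
    · rw [Env.mem_write, if_neg (by omega), Env.mem_set, g4]
    · rw [Env.mem_write, g4, g3 0 _ (by omega) (by omega)]
      by_cases hck : c = 1 + k
      · rw [if_pos ⟨rfl, hck⟩, hck, if_pos (by omega), hy0 k hk']
      · rw [if_neg (by tauto), Env.mem_set, g5 c hc]
        by_cases h : c ≤ k
        · rw [if_pos h, if_pos (by omega)]
        · rw [if_neg h, if_neg (by omega)]
  rintro E₁ ⟨a1, a2, a3, -, a5⟩
  simp only [Expr.eval_var, Env.nat_write, hg.N] at a5
  refine wp_loop (fun k E' => (∀ x < 23, E'.nat x = E.nat x) ∧ E'.pos = E.pos ∧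
    (∀ r c, r < P.R₂ → r ≠ 5 → E'.mem r c = E.mem r c) ∧
    (∀ ρ c, P.R₂ + k < ρ → c < P.W → E'.mem ρ c = 0) ∧
    ∀ ρ ≤ k, ∀ c < P.W, E'.mem (P.R₂ + ρ) c = if c ≤ P.N then y ρ c else 0) ?_ ?_ ?_ ?_
  · simp only [Expr.eval_var, a1 8 (by omega), hg.N]; omega
  · refine ⟨a1, a2, fun r c h1 h5 => a3 r c (by omega) h5, fun ρ c h1 hc => ?_,
      fun ρ hρ c hc => ?_⟩
    · rw [a3 _ _ (by omega) (by omega), h0 _ _ (by omega) hc]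
    · obtain rfl : ρ = 0 := by omega
      exact a5 c hc
  · rintro κ hκ E' ⟨g1, g2, g3, g4, g5⟩
    have hκ' : κ < P.N := by simpa [a1 8, hg.N] using hκ
    have hgE : Glob P E' := hg.frame fun x hx => g1 x (by omega)
    have he : κ / P.n < P.p := by
      rw [Nat.div_lt_iff_lt_mul hn0, ← hNnp]
      exact hκ'
    have he' : κ % P.n < P.n := Nat.mod_lt _ hn0
    have hm : (P.s - κ / P.n) * (P.t - κ % P.n) ≤ P.N :=
      ((Nat.mul_le_mul (Nat.sub_le _ _) (Nat.sub_le _ _)).trans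
        (Nat.mul_le_mul hs ht)).trans hNnp.ge
    simp only [wp_block_cons, wp_block_nil, wp_ite, wp_skip, wp_assign, Expr.eval_var,
      Expr.eval_add, Expr.eval_sub, Expr.eval_mul, Expr.eval_div, Expr.eval_mod, Expr.eval_ofNat,
      Env.nat_set, Nat.reduceEqDiff, reduceIte, hgE.R₂, hgE.n, hgE.s, hgE.t]
    refine ⟨by omega, by omega, by omega, by omega, fun h => ?_, fun h => ?_⟩
    · rw [Nat.mul_ne_zero_iff] at h
      have hcand : P.cand γ (κ + 1) = (0, monoWord γ (κ / P.n) (κ % P.n)) := by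
        rw [Params.cand, if_neg (by omega), Nat.add_sub_cancel, if_pos (by omega)]
      refine wp_fillWord (γ := γ) hP ?_ ?_ ?_ ?_ ?_ ?_ ?_ <;>
        try simp only [Env.nat_set, Env.mem_set, Env.pos_set, Nat.reduceEqDiff, reduceIte]
      · refine hgE.frame fun x hx => ?_
        simp only [Env.nat_set]
        simp only [show x ≠ 24 by omega, show x ≠ 43 by omega, show x ≠ 42 by omega,
          show x ≠ 40 by omega, show x ≠ 23 by omega, if_false]
      · intro k hk
        rw [g3 1 k (by omega) (by omega), hx k hk]
      · intro k hk
        rw [g3 2 k (by omega) (by omega), hy k hk]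
      · omega
      · omega
      · omega
      intro E₂ f1 f2 f3 f4
      refine ⟨fun x hx => ?_, by rw [f2, g2], fun r c hr h5 => ?_, fun ρ c hρ hc => ?_,
        fun ρ hρ c hc => ?_⟩
      · rw [f1 x (by omega)]
        simp only [show x ≠ 24 by omega, show x ≠ 43 by omega, show x ≠ 42 by omega,
          show x ≠ 40 by omega, show x ≠ 23 by omega, if_false, g1 x hx]
      · rw [f3 _ _ (by omega), g3 _ _ hr h5]
      · rw [f3 _ _ (by omega), g4 _ _ (by omega) hc]
      · by_cases h1 : ρ = κ + 1
        · rw [h1, show P.R₂ + (κ + 1) = P.R₂ + 1 + κ by ring, f4, g4 _ _ (by omega) hc]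
          simp only [hydef, hcand]
          by_cases h2 : c ≤ P.N
          · rw [if_pos h2]
            by_cases h3 : c = 0
            · rw [h3, if_neg (by omega), candVec_zero]
            · obtain ⟨k, rfl⟩ : ∃ k, c = 1 + k := ⟨c - 1, by omega⟩
              rw [if_pos (by omega), candVec_word _ _ _ _ _ (by omega), Nat.add_sub_cancel_left]
              simp
          · rw [if_neg (by omega), if_neg h2]
        · rw [f3 _ _ (by omega), g5 ρ (by omega) c hc]
    · have hcand : P.cand γ (κ + 1) = 0 := by
        rw [Params.cand, if_neg (by omega), Nat.add_sub_cancel, if_neg]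
        have := Nat.mul_eq_zero.1 h
        omega
      refine ⟨fun x hx => ?_, g2, g3, fun ρ c hρ hc => g4 ρ c (by omega) hc, fun ρ hρ c hc => ?_⟩
      · simp only [show x ≠ 24 by omega, show x ≠ 43 by omega, show x ≠ 42 by omega,
          show x ≠ 40 by omega, show x ≠ 23 by omega, if_false, g1 x hx]
      · by_cases h1 : ρ = κ + 1
        · simp only [hydef, Env.mem_set]
          rw [h1, hcand, g4 _ _ (by omega) hc, map_zero]
          simp
        · exact g5 ρ (by omega) c hc
  rintro E₂ ⟨b1, b2, b3, -, b5⟩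
  simp only [Expr.eval_var, a1 8 (by omega), hg.N] at b5
  refine wp_loop (fun k E' => (∀ x < 23, E'.nat x = E.nat x) ∧ E'.pos = E.pos ∧
    (∀ r c, r < P.R₂ → r ≠ 5 → E'.mem r c = E.mem r c) ∧
    (∀ ρ < P.N₂, k ≤ ρ → ∀ c, E'.mem (P.R₂ + ρ) c = E₂.mem (P.R₂ + ρ) c) ∧
    ∀ ρ < k, ∀ c < P.W, E'.mem (P.R₂ + ρ) c = y ρ c) ?_ ?_ ?_ ?_
  · simp only [Expr.eval_var, b1 18 (by omega), hg.N₂]; omega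
  · exact ⟨b1, b2, b3, fun _ _ _ _ => rfl, fun ρ hρ => by omega⟩
  · rintro κ hκ E' ⟨g1, g2, g3, g4, g5⟩
    have hκ' : κ < P.N₂ := by simpa [b1 18, hg.N₂] using hκ
    have hgE : Glob P E' := hg.frame fun x hx => g1 x (by omega)
    simp only [wp_block_cons, wp_assign, Expr.eval_var,
      Expr.eval_add, Env.nat_set, Nat.reduceEqDiff, reduceIte, hgE.R₂]
    refine ⟨by omega, ?_⟩
    have g21 := g1 21 (by omega)
    refine wp_fillRec (a := a) hP ?_ ?_ ?_ ?_ ?_ ?_ ?_ <;>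
      try simp only [Env.nat_set, Env.mem_set, Env.pos_set, Nat.reduceEqDiff, reduceIte, g21]
    · refine hgE.frame fun x hx => ?_
      simp only [Env.nat_set]
      rw [if_neg (by omega), if_neg (by omega)]
    · omega
    · omega
    · omega
    · intro b hb k hk
      rw [g3 _ _ h21' (by omega), ha b hb k hk]
    · intro c hc hNc
      rw [g4 κ hκ' le_rfl, b5 κ (by omega) c hc, if_neg (by omega)]
    intro E₃ f1 f2 f3 f4
    refine ⟨fun x hx => ?_, by rw [f2, g2], fun r c hr h5 => ?_, fun ρ hρ hκρ c => ?_,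
      fun ρ hρ c hc => ?_⟩
    · rw [f1 x (by omega), if_neg (by omega), if_neg (by omega), g1 x hx]
    · rw [f3 _ _ h5 (by omega), g3 _ _ hr h5]
    · rw [f3 _ _ (by omega) (by omega), g4 ρ hρ (by omega)]
    · by_cases h1 : ρ = κ
      · subst h1
        rw [f4 c hc]
        refine recRow_candVec hP r a _ (fun c hc => ?_) c
        rw [g4 ρ hκ' le_rfl, b5 ρ (by omega) c (by omega), if_pos hc]
      · rw [f3 _ _ (by omega) (by omega), g5 ρ (by omega) c hc]
  · rintro E' ⟨g1, g2, g3, -, g5⟩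
    simp only [Expr.eval_var, b1 18 (by omega), hg.N₂] at g5
    exact hQ E' g1 g2 g3 g5

theorem rowSpan_eq_candSpace [CharP F P.p] (hP : P.Valid) (γ : Fˣ) (r : ℕ → F) (a : ℕ → ℕ → F)
    {mem : ℕ → ℕ → F} {R : ℕ} (h : ∀ ρ < P.N₂, ∀ c < P.W, mem (R + ρ) c =
      candVec r a P.p P.N P.w P.E₀ (P.cand γ ρ) c) :
    rowSpan P.W mem R P.N₂ = candSpace γ r a P.p P.N P.w P.E₀ P.s P.t := by
  have hw := hP.w_ge
  have hp := hP.p_ge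
  have hN := hP.N_ge
  have hn0 := hP.n_pos
  have hW := hP.W_ge
  have hwN := hP.wN_ge
  have e18 : P.N + 1 = P.N₂ := rfl
  have hs : P.s ≤ P.p := by
    have := hP.design.rows
    have := hP.design.rows_le
    omega
  have ht : P.t ≤ P.n := by
    have := hP.design.cols
    have := hP.design.cols_le
    omega
  have hrow : ∀ ρ < P.N₂, row P.W mem (R + ρ) =
      candVec r a P.p P.N P.w P.E₀ (P.cand γ ρ) := by
    intro ρ hρ
    ext c
    by_cases hc : c < P.W
    · rw [row_apply _ _ _ hc, h ρ hρ c hc]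
    · rw [row, if_neg hc]
      change _ = if _ then _ else _
      rw [if_neg (by omega), if_neg (by omega), if_neg (by omega)]
  apply le_antisymm
  · rw [rowSpan, Submodule.span_le]
    rintro _ ⟨ρ, hρ, rfl⟩
    simp only
    rw [hrow ρ hρ]
    refine ⟨_, ⟨Submodule.mem_top, ?_⟩, rfl⟩
    rw [Params.cand]
    split_ifs with h1 h2
    · exact Submodule.zero_mem _
    · exact monoWord_mem γ h2.1 h2.2
    · exact Submodule.zero_mem _
  · refine candSpace_le ?_ fun e he e' he' => ?_
    · have := row_mem_rowSpan P.W mem R (show 0 < P.N₂ by omega)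
      rwa [hrow 0 (by omega), Params.cand, if_pos rfl] at this
    · have h1 : e * P.n + e' < P.N := by
        have := pos_lt (show e < P.p by omega) (show e' < P.n by omega)
        rwa [mul_comm P.p] at this
      have h2 : e * P.n + e' + 1 < P.N₂ := by omega
      have := row_mem_rowSpan P.W mem R h2
      rwa [hrow _ h2, Params.cand, if_neg (by omega), Nat.add_sub_cancel, pos_div (by omega),
        pos_mod (by omega), if_pos ⟨he, he'⟩] at this

/-- Compute a spanning family of the candidates that satisfy the recurrence. -/
def candidates : Cmd := .block [
  fillCand,
  .assign 30 vR₂,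
  .assign 31 vN₂,
  eliminateWindows (vN + 1)]

theorem wp_candidates [CharP F P.p] (hP : P.Valid) (hg : Glob P E) {γ : Fˣ} {a : ℕ → ℕ → F}
    (hx : ∀ k ≤ P.N, E.mem 1 k = (k : F)) (hy : ∀ k ≤ P.N, E.mem 2 k = (γ : F) ^ k)
    (h21 : 8 ≤ E.nat 21) (h21' : E.nat 21 < P.R₂)
    (ha : ∀ b < P.w, ∀ k < P.N, E.mem (E.nat 21) ((b + 1) * P.N + k) = a b k)
    (h0 : ∀ ρ c, P.R₂ ≤ ρ → c < P.W → E.mem ρ c = 0)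
    (hQ : ∀ E', (∀ x < 23, E'.nat x = E.nat x) → E'.pos = E.pos →
      (∀ c, E'.mem 0 c = E.mem 0 c) →
      rowSpan P.W E'.mem P.R₂ P.N₂ = candSpace γ (fun k => E.mem 0 (k + 1)) a P.p P.N P.w P.E₀
        P.s P.t ⊓ recZero F P.p P.N P.E₀ → Q E') :
    wp P.W P.Z ω candidates Q E := by
  have hRZ := hP.rows_le
  have e17 : 8 + P.N₁ = P.R₂ := rfl
  have e18 : P.N + 1 = P.N₂ := rfl
  have e19 : P.R₂ + P.N₂ = P.R₃ := rfl
  have e20 : P.R₃ + P.N₂ = P.R₄ := rfl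
  rw [candidates, wp_block_cons]
  refine wp_fillCand hP hg hx hy h21 h21' ha h0 fun E₁ a1 a2 a3 a4 => ?_
  have hg1 : Glob P E₁ := hg.frame fun x hx => a1 x (by omega)
  simp only [wp_block_cons, wp_assign, Expr.eval_var, Env.nat_set,
    Nat.reduceEqDiff, reduceIte, hg1.N₂, hg1.R₂]
  refine ⟨by omega, by omega, ?_⟩
  refine wp_eliminateWindows (co := P.N + 1) hP (hg1.frame fun x hx => ?_)
    (fun E' h => ?_) le_rfl ?_ ?_ ?_ <;>
    try simp only [Env.nat_set, Env.mem_set, Env.pos_set, Nat.reduceEqDiff, reduceIte]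
  · rw [if_neg (by omega), if_neg (by omega)]
  · simp only [Expr.eval_var, Expr.eval_add, Expr.eval_ofNat, h.N]
  · omega
  · omega
  intro E₂ b1 b2 b3 b4
  refine hQ E₂ (fun x hx => ?_) (by rw [b2, a2]) (fun c => ?_) ?_
  · rw [b1 x (by omega), if_neg (by omega), if_neg (by omega), a1 x hx]
  · rw [b3 _ _ (by omega) (by omega) (by omega), a3 _ _ (by omega) (by omega)]
  · ext v
    rw [b4, rowSpan_eq_candSpace hP γ _ a a4, Submodule.mem_inf]
    rfl

end Candidates

/-! ### Random pruning -/

section Trial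

variable {F : Type*} [Field F] [DecidableEq F] {ω : ℕ → Bool} {Q : Env F → Prop}
  {E : Env F} {P : Params}

/-- Copy the matrix of candidates. -/
def copyCand : Cmd := .loop 24 (vN₂ * vW)
  (.fop .copy (vR₃ + .var 24 / vW) (.var 24 % vW) (vR₂ + .var 24 / vW) (.var 24 % vW) 0 0)

theorem wp_copyCand (hP : P.Valid) (hg : Glob P E)
    (hQ : ∀ E', (∀ x < 24, E'.nat x = E.nat x) → E'.pos = E.pos →
      (∀ r c, (r < P.R₃ ∨ P.R₄ ≤ r) → E'.mem r c = E.mem r c) →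
      (∀ ρ < P.N₂, ∀ c < P.W, E'.mem (P.R₃ + ρ) c = E.mem (P.R₂ + ρ) c) → Q E') :
    wp P.W P.Z ω copyCand Q E := by
  have hw := hP.w_ge
  have hp := hP.p_ge
  have hN := hP.N_ge
  have hW := hP.W_ge
  have e19 : P.R₂ + P.N₂ = P.R₃ := rfl
  have e20 : P.R₃ + P.N₂ = P.R₄ := rfl
  refine wp_loop (fun k E' => (∀ x < 24, E'.nat x = E.nat x) ∧ E'.pos = E.pos ∧
    (∀ r c, (r < P.R₃ ∨ P.R₄ ≤ r) → E'.mem r c = E.mem r c) ∧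
    ∀ i < k, E'.mem (P.R₃ + i / P.W) (i % P.W) = E.mem (P.R₂ + i / P.W) (i % P.W)) ?_ ?_ ?_ ?_
  · simp only [Expr.eval_var, Expr.eval_mul, hg.N₂, hg.W]
    exact hP.mul_le (by omega) le_rfl
  · exact ⟨fun _ _ => rfl, rfl, fun _ _ _ => rfl, fun i hi => by omega⟩
  · rintro k hk E' ⟨g1, g2, g3, g4⟩
    have hk' : k < P.N₂ * P.W := by simpa [hg.N₂, hg.W] using hk
    have hgE : Glob P E' := hg.frame fun x hx => g1 x (by omega)
    have h1 : k / P.W < P.N₂ := by rwa [Nat.div_lt_iff_lt_mul (by omega)]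
    have h2 : k % P.W < P.W := Nat.mod_lt _ (by omega)
    simp only [wp_fop, FldOp.eval, Expr.eval_var, Expr.eval_add, Expr.eval_div, Expr.eval_mod,
      Expr.eval_ofNat, Env.nat_set, Nat.reduceEqDiff, reduceIte, hgE.R₂, hgE.R₃, hgE.W,
      Env.mem_set]
    refine ⟨by omega, fun x hx => ?_, g2, fun r c hr => ?_, fun i hi => ?_⟩
    · rw [Env.nat_write, Env.nat_set, if_neg (by omega), g1 x hx]
    · have h4 := Nat.le_add_right P.R₃ (k / P.W)
      have h5 := Nat.add_lt_add_left h1 P.R₃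
      rw [Env.mem_write, if_neg (by omega), Env.mem_set, g3 r c hr]
    · have h3 := Nat.add_lt_add_left h1 P.R₂
      rw [Env.mem_write, g3 (P.R₂ + k / P.W) _ (Or.inl h3), Env.mem_set]
      by_cases h : i / P.W = k / P.W ∧ i % P.W = k % P.W
      · rw [if_pos ⟨by rw [h.1], h.2⟩, h.1, h.2]
      · rw [if_neg fun h' => h ⟨Nat.add_left_cancel h'.1, h'.2⟩]
        refine g4 i ?_
        rcases Nat.lt_succ_iff_lt_or_eq.1 hi with hi | rfl
        · exact hi
        · tauto
  · rintro E' ⟨g1, g2, g3, g4⟩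
    simp only [Expr.eval_var, Expr.eval_mul, hg.N₂, hg.W] at g4
    refine hQ E' g1 g2 g3 fun ρ hρ c hc => ?_
    have := g4 (ρ * P.W + c) (pos_lt hρ hc)
    rwa [pos_mod hc, pos_div hc] at this

/-- Make the entries of a random column of the word zero. -/
def pruneOnce : Cmd := .block [
  .assign 25 0,
  .loop 26 vQ (.block [.coin 27, .assign 25 ((.var 25 + .var 25 + .var 27) % vn)]),
  .loop 26 vP (.block [.assign 32 (1 + (.var 25 * vP + .var 26)), eliminate])]

theorem wp_pruneOnce (hP : P.Valid) (hg : Glob P E) (h30 : E.nat 30 = P.R₃) (h31 : E.nat 31 = P.N₂)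
    (hQ : ∀ E', (∀ x < 25, E'.nat x = E.nat x) → E'.nat 30 = P.R₃ → E'.nat 31 = P.N₂ →
      E'.pos = E.pos + P.q →
      (∀ r c, r ≠ 3 → r ≠ 4 → (r < P.R₃ ∨ P.R₄ ≤ r) → E'.mem r c = E.mem r c) →
      (rowSpan P.W E'.mem P.R₃ P.N₂ = rowSpan P.W E.mem P.R₃ P.N₂ ⊓
        colZero F P.p (sample P.n (fun l => ω (E.pos + l)) P.q)) → Q E') :
    wp P.W P.Z ω pruneOnce Q E := by
  have hw := hP.w_ge
  have hp := hP.p_ge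
  have hN := hP.N_ge
  have hn := hP.n_le_N
  have hn0 := hP.n_pos
  have hW := hP.W_ge
  have hWZ := hP.W_le
  have hwN := hP.wN_ge
  have hRZ := hP.rows_le
  have e17 : 8 + P.N₁ = P.R₂ := rfl
  have e18 : P.N + 1 = P.N₂ := rfl
  have e19 : P.R₂ + P.N₂ = P.R₃ := rfl
  have e20 : P.R₃ + P.N₂ = P.R₄ := rfl
  have hqZ : P.q ≤ P.Z := by unfold Params.Z; omega
  rw [pruneOnce, wp_block_cons, wp_assign, wp_block_cons]
  refine ⟨by simp, ?_⟩
  refine wp_loop (fun k E' => (∀ x, x < 25 ∨ x = 30 ∨ x = 31 → E'.nat x = E.nat x) ∧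
    E'.mem = E.mem ∧ E'.pos = E.pos + k ∧
    E'.nat 25 = sample P.n (fun l => ω (E.pos + l)) k) ?_ ?_ ?_ ?_
  · simp only [Expr.eval_var, Env.nat_set, Nat.reduceEqDiff, reduceIte, hg.q]; omega
  · refine ⟨fun x hx => ?_, rfl, rfl, by simp [Env.nat_set, sample]⟩
    rw [Env.nat_set, if_neg (by omega)]
  · rintro k hk E' ⟨g1, g2, g3, g4⟩
    have hgE : Glob P E' := hg.frame fun x hx => g1 x (by omega)
    have hmod : ∀ x, x % P.n ≤ P.Z := fun x => (Nat.mod_lt _ hn0).le.trans (by omega)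
    simp only [wp_block_cons, wp_block_nil, wp_coin, wp_assign, Expr.eval_var, Expr.eval_add,
      Expr.eval_mod, Env.nat_set, Env.nat_step, Env.mem_step, Env.pos_step, Env.mem_set,
      Env.pos_set, Nat.reduceEqDiff, reduceIte, hgE.n]
    refine ⟨hmod _, fun x hx => ?_, g2, by omega, ?_⟩
    · rw [if_neg (by omega), if_neg (by omega), if_neg (by omega), g1 x hx]
    · by_cases hb : ω (E.pos + k) = true <;> simp [sample, g4, g3, hb]
  rintro E₁ ⟨a1, a2, a3, a4⟩
  simp only [Expr.eval_var, Env.nat_set, Nat.reduceEqDiff, reduceIte, hg.q] at a3 a4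
  set j := sample P.n (fun l => ω (E.pos + l)) P.q with hj
  have hjn : j < P.n := sample_lt hn0 _ _
  rw [wp_block_cons]
  refine wp_loop (fun k E' => (∀ x, x < 25 ∨ x = 30 ∨ x = 31 → E'.nat x = E.nat x) ∧
    E'.nat 25 = j ∧ E'.pos = E.pos + P.q ∧
    (∀ r c, r ≠ 3 → r ≠ 4 → (r < P.R₃ ∨ P.R₄ ≤ r) → E'.mem r c = E.mem r c) ∧
    ∀ v, v ∈ rowSpan P.W E'.mem P.R₃ P.N₂ ↔ v ∈ rowSpan P.W E.mem P.R₃ P.N₂ ∧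
        ∀ i < k, v (1 + (j * P.p + i)) = 0) ?_ ?_ ?_ ?_
  · simp only [Expr.eval_var, a1 0 (by omega), hg.p]; omega
  · refine ⟨a1, a4, a3, fun _ _ _ _ _ => by rw [a2], fun v => ?_⟩
    rw [a2]
    simp
  · rintro k hk E' ⟨g1, g2, g3, g4, g5⟩
    have hk' : k < P.p := by simpa [a1 0, hg.p] using hk
    have hgE : Glob P E' := hg.frame fun x hx => g1 x (by omega)
    have hjk : j * P.p + k < P.N := pos_lt hjn hk'
    simp only [wp_block_cons, wp_assign, Expr.eval_var, Expr.eval_add,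
      Expr.eval_mul, Expr.eval_ofNat, Env.nat_set, Nat.reduceEqDiff, reduceIte, hgE.p, g2]
    refine ⟨by omega, ?_⟩
    have g30 := g1 30 (by omega)
    have g31 := g1 31 (by omega)
    refine wp_eliminate ?_ ?_ ?_ ?_ ?_ ?_ ?_ <;>
      try simp only [Env.nat_set, Env.mem_set, Env.pos_set, Nat.reduceEqDiff, reduceIte, g30, g31,
        h30, h31, hgE.W]
    · omega
    · omega
    · omega
    · omega
    · omega
    intro E₂ f1 f2 f3 f4
    refine ⟨fun x hx => ?_, by simpa [g2] using f1 25 (by omega), by rw [f2, g3],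
      fun r c h3 h4 hr => ?_, fun v => ?_⟩
    · rw [f1 x (by omega), if_neg (by omega), if_neg (by omega), g1 x hx]
    · rw [f3 r c h3 h4 (by omega), g4 r c h3 h4 hr]
    · rw [f4, Submodule.mem_inf, g5, LinearMap.mem_ker, LinearMap.proj_apply, and_assoc]
      refine and_congr_right fun _ => ⟨fun ⟨h1, h2⟩ i hi => ?_, fun h1 =>
        ⟨fun i hi => h1 i (by omega), h1 k (by omega)⟩⟩
      rcases Nat.lt_succ_iff_lt_or_eq.1 hi with hi | rfl
      · exact h1 i hi
      · exact h2
  · rintro E₂ ⟨g1, -, g3, g4, g5⟩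
    simp only [Expr.eval_var, a1 0 (by omega), hg.p] at g5
    rw [wp_block_nil]
    refine hQ E₂ (fun x hx => g1 x (by omega)) (by rw [g1 30 (by omega), h30])
      (by rw [g1 31 (by omega), h31]) g3 g4 ?_
    ext v
    rw [g5, Submodule.mem_inf, mem_colZero]

/-- Reduce a copy of the matrix of candidates with random columns. -/
def prune : Cmd := .block [
  copyCand,
  .assign 30 vR₃,
  .assign 31 vN₂,
  .loop 24 vw pruneOnce]

theorem wp_prune (hP : P.Valid) (hg : Glob P E)
    (hQ : ∀ E', (∀ x < 24, E'.nat x = E.nat x) → E'.pos = E.pos + P.w * P.q →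
      (∀ r c, r ≠ 3 → r ≠ 4 → (r < P.R₃ ∨ P.R₄ ≤ r) → E'.mem r c = E.mem r c) →
      (∀ v, v ∈ rowSpan P.W E'.mem P.R₃ P.N₂ ↔ v ∈ rowSpan P.W E.mem P.R₂ P.N₂ ∧
        ∀ i < P.w, v ∈ colZero F P.p (sample P.n (fun l => ω (E.pos + (i * P.q + l))) P.q)) →
      Q E') :
    wp P.W P.Z ω prune Q E := by
  have hWZ := hP.W_le
  have hRZ := hP.rows_le
  have hW := hP.W_ge
  have hwN := hP.w_le_N
  have e17 : 8 + P.N₁ = P.R₂ := rfl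
  have e18 : P.N + 1 = P.N₂ := rfl
  have e19 : P.R₂ + P.N₂ = P.R₃ := rfl
  have e20 : P.R₃ + P.N₂ = P.R₄ := rfl
  rw [prune, wp_block_cons]
  refine wp_copyCand hP hg fun E₁ a1 a2 a3 a4 => ?_
  have hg1 : Glob P E₁ := hg.frame fun x hx => a1 x (by omega)
  simp only [wp_block_cons, wp_assign, Expr.eval_var, Env.nat_set,
    Nat.reduceEqDiff, reduceIte, hg1.N₂, hg1.R₃]
  refine ⟨by omega, by omega, ?_⟩
  refine wp_loop (fun k E' => (∀ x < 24, E'.nat x = E.nat x) ∧ E'.nat 30 = P.R₃ ∧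
    E'.nat 31 = P.N₂ ∧ E'.pos = E.pos + k * P.q ∧
    (∀ r c, r ≠ 3 → r ≠ 4 → (r < P.R₃ ∨ P.R₄ ≤ r) → E'.mem r c = E.mem r c) ∧
    (∀ v, v ∈ rowSpan P.W E'.mem P.R₃ P.N₂ ↔ v ∈ rowSpan P.W E.mem P.R₂ P.N₂ ∧
      ∀ i < k, v ∈ colZero F P.p (sample P.n (fun l => ω (E.pos + (i * P.q + l))) P.q)))
    ?_ ?_ ?_ ?_
  · simp only [Expr.eval_var, Env.nat_set, Nat.reduceEqDiff, reduceIte, hg1.w]; omega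
  · refine ⟨fun x hx => ?_, by simp [Env.nat_set], by simp [Env.nat_set], by simp [a2],
      fun r c _ _ hr => a3 r c hr, fun v => ?_⟩
    · rw [Env.nat_set, Env.nat_set, if_neg (by omega), if_neg (by omega), a1 x hx]
    · rw [Env.mem_set, Env.mem_set, rowSpan_congr a4]
      simp
  · rintro k hk E' ⟨g1, g2, g3, g4, g5, g6⟩
    refine wp_pruneOnce hP ?_ ?_ ?_ ?_ <;>
      try simp only [Env.nat_set, Env.mem_set, Env.pos_set, Nat.reduceEqDiff, reduceIte]
    · refine hg.frame fun x hx => ?_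
      rw [Env.nat_set, if_neg (by omega), g1 x (by omega)]
    · exact g2
    · exact g3
    intro E₂ f1 f2 f3 f4 f5 f6
    refine ⟨fun x hx => ?_, f2, f3, by rw [f4, g4]; ring, fun r c h3 h4 hr => ?_, fun v => ?_⟩
    · rw [f1 x (by omega), if_neg (by omega), g1 x hx]
    · rw [f5 r c h3 h4 hr, g5 r c h3 h4 hr]
    · rw [f6, Submodule.mem_inf, g6, and_assoc, g4]
      simp only [add_assoc]
      refine and_congr_right fun _ => ⟨fun ⟨h1, h2⟩ i hi => ?_, fun h1 =>
        ⟨fun i hi => h1 i (by omega), h1 k (by omega)⟩⟩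
      rcases Nat.lt_succ_iff_lt_or_eq.1 hi with hi | rfl
      · exact h1 i hi
      · exact h2
  · rintro E₂ ⟨g1, -, -, g4, g5, g6⟩
    simp only [Expr.eval_var, Env.nat_set, Nat.reduceEqDiff, reduceIte, hg1.w] at g4 g6
    exact hQ E₂ g1 g4 g5 g6

/-- The number of columns in which a word is not zero. -/
noncomputable def colWeight (p n : ℕ) (d : ℕ → F) : ℕ :=
  open Classical in ((Finset.range n).filter fun j => ∃ i < p, d (j * p + i) ≠ 0).card

/-- Word `k` of the output. -/
def Params.out (P : Params) (mem : ℕ → ℕ → F) (k c : ℕ) : F :=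
  mem (P.R₄ + k / (P.w + 3)) (k % (P.w + 3) * P.N + c)

/-- Compute the word of row `v25`, in row `7`, and its difference to the received word, in
row `6`. -/
def normalize : Cmd := .block [
  .fop .inv 5 0 (.var 25) 0 0 0,
  .loop 24 vN (.block [
    .fop .mul 6 (.var 24) (.var 25) (1 + .var 24) 5 0,
    .fop .add 7 (.var 24) 6 (.var 24) 0 (.var 24 + 1)])]

theorem wp_normalize (hP : P.Valid) (hg : Glob P E) (h25 : 8 ≤ E.nat 25)
    (hQ : ∀ E', (∀ x < 24, E'.nat x = E.nat x) → E'.pos = E.pos →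
      (∀ r c, r ≠ 5 → r ≠ 6 → r ≠ 7 → E'.mem r c = E.mem r c) →
      (∀ c < P.N, E'.mem 6 c = E.mem (E.nat 25) (1 + c) * (E.mem (E.nat 25) 0)⁻¹) →
      (∀ c < P.N, E'.mem 7 c = E.mem (E.nat 25) (1 + c) * (E.mem (E.nat 25) 0)⁻¹ +
        E.mem 0 (c + 1)) → Q E') :
    wp P.W P.Z ω normalize Q E := by
  have hWZ := hP.W_le
  have hW := hP.W_ge
  have hw := hP.w_le_N
  have hw' := hP.w_ge
  set R := E.nat 25 with hR
  simp only [normalize, wp_block_cons, wp_fop, FldOp.eval, Expr.eval_ofNat,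
    Expr.eval_var, ← hR]
  refine ⟨by omega, ?_⟩
  refine wp_loop (fun k E' => (∀ x < 24, E'.nat x = E.nat x) ∧ E'.nat 25 = R ∧ E'.pos = E.pos ∧
    (∀ r c, r ≠ 5 → r ≠ 6 → r ≠ 7 → E'.mem r c = E.mem r c) ∧
    E'.mem 5 0 = (E.mem R 0)⁻¹ ∧
    (∀ c < k, E'.mem 6 c = E.mem R (1 + c) * (E.mem R 0)⁻¹) ∧
    (∀ c < k, E'.mem 7 c = E.mem R (1 + c) * (E.mem R 0)⁻¹ + E.mem 0 (c + 1))) ?_ ?_ ?_ ?_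
  · simp only [Expr.eval_var, Env.nat_write, hg.N]; omega
  · refine ⟨fun _ _ => rfl, rfl, rfl, fun r c h5 _ _ => ?_, ?_, fun c hc => by omega,
      fun c hc => by omega⟩
    · rw [Env.mem_write, if_neg (by tauto)]
    · rw [Env.mem_write, if_pos ⟨rfl, rfl⟩]
  · rintro k hk E' ⟨g1, g2, g3, g4, g5, g6, g7⟩
    have hk' : k < P.N := by simpa [hg.N] using hk
    simp only [wp_block_cons, wp_block_nil, wp_fop, FldOp.eval, Expr.eval_ofNat,
      Expr.eval_var, Expr.eval_add, Env.nat_set, Env.nat_write, Nat.reduceEqDiff, reduceIte,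
      Env.mem_set, g2]
    have v1 : E'.mem R (1 + k) = E.mem R (1 + k) := g4 _ _ (by omega) (by omega) (by omega)
    have v2 : E'.mem 0 (k + 1) = E.mem 0 (k + 1) := g4 _ _ (by omega) (by omega) (by omega)
    refine ⟨by omega, by omega, fun x hx => ?_, trivial, g3, fun r c h5 h6 h7 => ?_, ?_,
      fun c hc => ?_, fun c hc => ?_⟩
    · rw [if_neg (by omega), g1 x hx]
    · rw [Env.mem_write, if_neg (by tauto), Env.mem_write, if_neg (by tauto), Env.mem_set,
        g4 r c h5 h6 h7]
    · rw [Env.mem_write, if_neg (by omega), Env.mem_write, if_neg (by omega), Env.mem_set, g5]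
    · rw [Env.mem_write, if_neg (by omega), Env.mem_write, Env.mem_set]
      by_cases h : c = k
      · rw [if_pos ⟨rfl, h⟩, h, v1, g5]
      · rw [if_neg (by tauto), g6 c (by omega)]
    · rw [Env.mem_write]
      by_cases h : c = k
      · rw [if_pos ⟨rfl, h⟩, h, Env.mem_write, if_pos ⟨rfl, rfl⟩, Env.mem_write,
          if_neg (by omega), Env.mem_set, v1, v2, g5]
      · rw [if_neg (by tauto), Env.mem_write, if_neg (by omega), Env.mem_set, g7 c (by omega)]
  · rintro E₂ ⟨g1, -, g3, g4, -, g6, g7⟩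
    simp only [Expr.eval_var, Env.nat_write, hg.N] at g6 g7
    exact hQ E₂ g1 g3 g4 g6 g7

/-- Compute, in `v26`, by how much the number of nonzero columns of row `6` exceeds the
threshold. -/
def weigh : Cmd := .block [
  .assign 26 0,
  .loop 24 vn (.block [
    .assign 27 0,
    .loop 28 vP (.block [.ftest 29 6 (.var 24 * vP + .var 28), .ite 29 (.assign 27 1) .skip]),
    .assign 26 (.var 26 + .var 27)]),
  .assign 26 (.var 26 - vThr)]

theorem wp_weigh (hP : P.Valid) (hg : Glob P E)
    (hQ : ∀ E', (∀ x < 24, E'.nat x = E.nat x) → E'.pos = E.pos → E'.mem = E.mem →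
      E'.nat 26 = colWeight P.p P.n (E.mem 6) - P.thr → Q E') :
    wp P.W P.Z ω weigh Q E := by
  have hWZ := hP.W_le
  have hW := hP.W_ge
  have hn := hP.n_le_N
  have hw := hP.w_le_N
  have hw' := hP.w_ge
  have hN := hP.N_ge
  have hle : ∀ k, colWeight P.p k (E.mem 6) ≤ k := fun k => by
    have := Finset.card_filter_le (Finset.range k)
      (fun j => ∃ i < P.p, E.mem 6 (j * P.p + i) ≠ 0)
    rwa [Finset.card_range] at this
  have hsucc : ∀ k, colWeight P.p (k + 1) (E.mem 6) = colWeight P.p k (E.mem 6) +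
      if ∃ i < P.p, E.mem 6 (k * P.p + i) ≠ 0 then 1 else 0 := fun k => by
    rw [colWeight, colWeight, Finset.range_add_one, Finset.filter_insert]
    split_ifs with h
    · rw [Finset.card_insert_of_notMem (by simp)]
    · rfl
  rw [weigh, wp_block_cons, wp_assign, wp_block_cons]
  refine ⟨by simp, ?_⟩
  refine wp_loop (fun k E' => (∀ x < 24, E'.nat x = E.nat x) ∧ E'.pos = E.pos ∧ E'.mem = E.mem ∧
    E'.nat 26 = colWeight P.p k (E.mem 6)) ?_ ?_ ?_ ?_
  · simp only [Expr.eval_var, Env.nat_set, Nat.reduceEqDiff, reduceIte, hg.n]; omega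
  · refine ⟨fun x hx => ?_, rfl, rfl, by simp [Env.nat_set, colWeight]⟩
    rw [Env.nat_set, if_neg (by omega)]
  · rintro k hk E' ⟨g1, g2, g3, g4⟩
    have hk' : k < P.n := by simpa [Env.nat_set, hg.n] using hk
    have hgE : Glob P E' := hg.frame fun x hx => g1 x (by omega)
    rw [wp_block_cons, wp_assign, wp_block_cons]
    refine ⟨by simp, ?_⟩
    refine wp_loop (fun d E'' => (∀ x < 24, E''.nat x = E.nat x) ∧ E''.pos = E.pos ∧
      E''.mem = E.mem ∧ E''.nat 26 = colWeight P.p k (E.mem 6) ∧ E''.nat 24 = k ∧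
      E''.nat 27 = if ∃ i < d, E.mem 6 (k * P.p + i) ≠ 0 then 1 else 0) ?_ ?_ ?_ ?_
    · simp only [Expr.eval_var, Env.nat_set, Nat.reduceEqDiff, reduceIte, hgE.p]; omega
    · refine ⟨fun x hx => ?_, g2, g3, by simp [Env.nat_set, g4], by simp [Env.nat_set],
        by simp [Env.nat_set]⟩
      rw [Env.nat_set, Env.nat_set, if_neg (by omega), if_neg (by omega), g1 x hx]
    · rintro d hd E'' ⟨f1, f2, f3, f4, f5, f6⟩
      have hd' : d < P.p := by simpa [Env.nat_set, hgE.p] using hd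
      have hgE'' : Glob P E'' := hg.frame fun x hx => f1 x (by omega)
      have hlt : k * P.p + d < P.N := pos_lt hk' hd'
      simp only [wp_block_cons, wp_block_nil, wp_ite, wp_skip, wp_assign, wp_ftest, Expr.eval_var,
        Expr.eval_add, Expr.eval_mul, Expr.eval_ofNat, Env.nat_set, Env.mem_set, Env.pos_set,
        Nat.reduceEqDiff, reduceIte, hgE''.p, f5, f3, f4]
      refine ⟨by omega, fun h => ⟨by omega, fun x hx => ?_, f2, trivial, trivial, trivial, ?_⟩,
        fun h => ⟨fun x hx => ?_, f2, trivial, trivial, trivial, ?_⟩⟩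
      · rw [if_neg (by omega), if_neg (by omega), if_neg (by omega), f1 x hx]
      · rw [if_pos]
        refine ⟨d, by omega, ?_⟩
        simpa using h
      · rw [if_neg (by omega), if_neg (by omega), f1 x hx]
      · have h0 : E.mem 6 (k * P.p + d) = 0 := by
          by_contra h'
          simp [h'] at h
        rw [f6]
        have : (∃ i < d, E.mem 6 (k * P.p + i) ≠ 0) ↔
            ∃ i < d + 1, E.mem 6 (k * P.p + i) ≠ 0 := by
          constructor
          · rintro ⟨i, hi, h⟩
            exact ⟨i, by omega, h⟩
          · rintro ⟨i, hi, hne⟩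
            refine ⟨i, ?_, hne⟩
            rcases Nat.lt_succ_iff_lt_or_eq.1 hi with hi | rfl
            · exact hi
            · exact absurd h0 hne
        simp only [this]
    · rintro E'' ⟨f1, f2, f3, f4, f5, f6⟩
      simp only [Expr.eval_var, Env.nat_set, Nat.reduceEqDiff, reduceIte, hgE.p] at f6
      have h1 := hsucc k
      have h2 := hle (k + 1)
      simp only [wp_block_cons, wp_block_nil, wp_assign, Expr.eval_var,
        Expr.eval_add, Env.nat_set, Env.mem_set, Env.pos_set,
        reduceIte, f4, f6, ← h1]
      refine ⟨by omega, fun x hx => ?_, f2, f3, trivial⟩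
      rw [if_neg (by omega), f1 x hx]
  · rintro E' ⟨g1, g2, g3, g4⟩
    simp only [Expr.eval_var, Env.nat_set, Nat.reduceEqDiff, reduceIte, hg.n] at g4
    have hgE : Glob P E' := hg.frame fun x hx => g1 x (by omega)
    have := hle P.n
    simp only [wp_block_cons, wp_block_nil, wp_assign, Expr.eval_var,
        Expr.eval_sub, hgE.thr, g4]
    refine ⟨by omega, hQ _ (fun x hx => ?_) g2 g3 (by simp [Env.nat_set])⟩
    rw [Env.nat_set, if_neg (by omega), g1 x hx]

end Trial

/-! ### Collecting the output -/

section Output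

variable {F : Type*} [Field F] [DecidableEq F] {ω : ℕ → Bool} {Q : Env F → Prop}
  {E : Env F} {P : Params}

theorem out_column_lt (k : ℕ) {c : ℕ} (hc : c < P.N) :
    k % (P.w + 3) * P.N + c < P.W := pos_lt (Nat.mod_lt _ (by omega)) hc

/-- Test, in `v27`, whether the word of row `7` is among the words of the output. -/
def isKnown : Cmd := .block [
  .assign 27 0,
  .loop 24 vCnt (.block [
    .assign 28 0,
    .loop 29 vN (.block [
      .fop .sub 5 3 7 (.var 29) (vR₄ + .var 24 / (vw + 3))
        (.var 24 % (vw + 3) * vN + .var 29),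
      .ftest 33 5 3,
      .ite 33 (.assign 28 1) .skip]),
    .ite 28 .skip (.assign 27 1)])]

theorem wp_isKnown (hP : P.Valid) (hg : Glob P E) (hcnt : E.nat 22 ≤ P.Z)
    (hQ : ∀ E', (∀ x < 24, E'.nat x = E.nat x) → E'.pos = E.pos →
      (∀ r c, r ≠ 5 → E'.mem r c = E.mem r c) →
      (E'.nat 27 ≠ 0 ↔ ∃ k < E.nat 22, ∀ c < P.N, P.out E.mem k c = E.mem 7 c) → Q E') :
    wp P.W P.Z ω isKnown Q E := by
  have hWZ := hP.W_le
  have hW := hP.W_ge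
  have hw := hP.w_le_N
  have hw' := hP.w_ge
  have hRZ := hP.rows_le
  have e17 : 8 + P.N₁ = P.R₂ := rfl
  have e19 : P.R₂ + P.N₂ = P.R₃ := rfl
  have e20 : P.R₃ + P.N₂ = P.R₄ := rfl
  rw [isKnown, wp_block_cons, wp_assign, wp_block_cons]
  refine ⟨by simp, ?_⟩
  refine wp_loop (fun k E' => (∀ x < 24, E'.nat x = E.nat x) ∧ E'.pos = E.pos ∧
    (∀ r c, r ≠ 5 → E'.mem r c = E.mem r c) ∧
    (E'.nat 27 ≠ 0 ↔ ∃ j < k, ∀ c < P.N, P.out E.mem j c = E.mem 7 c)) ?_ ?_ ?_ ?_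
  · simpa only [Expr.eval_var, Env.nat_set, Nat.reduceEqDiff, reduceIte] using hcnt
  · refine ⟨fun x hx => ?_, rfl, fun _ _ _ => rfl, by simp [Env.nat_set]⟩
    rw [Env.nat_set, if_neg (by omega)]
  · rintro k hk E' ⟨g1, g2, g3, g4⟩
    have hgE : Glob P E' := hg.frame fun x hx => g1 x (by omega)
    rw [wp_block_cons, wp_assign, wp_block_cons]
    refine ⟨by simp, ?_⟩
    refine wp_loop (fun d E'' => (∀ x < 24, E''.nat x = E.nat x) ∧ E''.pos = E.pos ∧
      (∀ r c, r ≠ 5 → E''.mem r c = E.mem r c) ∧ E''.nat 24 = k ∧ E''.nat 27 = E'.nat 27 ∧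
      (E''.nat 28 = 0 ↔ ∀ c < d, P.out E.mem k c = E.mem 7 c)) ?_ ?_ ?_ ?_
    · simp only [Expr.eval_var, Env.nat_set, Nat.reduceEqDiff, reduceIte, hgE.N]; omega
    · refine ⟨fun x hx => ?_, g2, g3, by simp [Env.nat_set], by simp [Env.nat_set],
        by simp [Env.nat_set]⟩
      rw [Env.nat_set, Env.nat_set, if_neg (by omega), if_neg (by omega), g1 x hx]
    · rintro d hd E'' ⟨f1, f2, f3, f4, f5, f6⟩
      have hd' : d < P.N := by simpa [Env.nat_set, hgE.N] using hd
      have hgE'' : Glob P E'' := hg.frame fun x hx => f1 x (by omega)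
      have hcol := out_column_lt k hd'
      have v1 : E''.mem 7 d = E.mem 7 d := f3 _ _ (by omega)
      have v2 : E''.mem (P.R₄ + k / (P.w + 3)) (k % (P.w + 3) * P.N + d) = P.out E.mem k d := by
        have := Nat.le_add_right P.R₄ (k / (P.w + 3))
        rw [f3 _ _ (by omega)]
        rfl
      have hall : (∀ c < d + 1, P.out E.mem k c = E.mem 7 c) ↔
          (∀ c < d, P.out E.mem k c = E.mem 7 c) ∧ P.out E.mem k d = E.mem 7 d := by
        refine ⟨fun h => ⟨fun c hc => h c (by omega), h d (by omega)⟩, fun ⟨h1, h2⟩ c hc => ?_⟩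
        rcases Nat.lt_succ_iff_lt_or_eq.1 hc with hc | rfl
        · exact h1 c hc
        · exact h2
      simp only [wp_block_cons, wp_block_nil, wp_ite, wp_skip, wp_assign, wp_ftest, wp_fop,
        FldOp.eval, Expr.eval_var,
        Expr.eval_add, Expr.eval_mul, Expr.eval_div, Expr.eval_mod, Expr.eval_ofNat, Env.nat_set,
        Env.nat_write, Env.mem_set, Env.pos_set, Env.pos_write,
        Nat.reduceEqDiff, reduceIte, hgE''.w, hgE''.N, hgE''.R₄, f4, f5, v1, v2]
      have hframe : ∀ r c, r ≠ 5 → ((E''.set 29 d).write 5 3 (E.mem 7 d - P.out E.mem k d)).mem r c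
          = E.mem r c := fun r c hr => by
        rw [Env.mem_write, if_neg (by tauto), Env.mem_set, f3 r c hr]
      have hcell : ((E''.set 29 d).write 5 3 (E.mem 7 d - P.out E.mem k d)).mem 5 3 = 0 ↔
          P.out E.mem k d = E.mem 7 d := by
        rw [Env.mem_write, if_pos ⟨rfl, rfl⟩, sub_eq_zero, eq_comm]
      refine ⟨⟨by omega, by omega, hcol⟩, by omega, fun h => ⟨by omega, fun x hx => ?_, f2, hframe, trivial,
        trivial, ?_⟩, fun h => ⟨fun x hx => ?_, f2, hframe, trivial, trivial, ?_⟩⟩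
      · rw [if_neg (by omega), if_neg (by omega), if_neg (by omega), f1 x hx]
      · have h' : ¬ P.out E.mem k d = E.mem 7 d := by
          rw [← hcell]
          intro h0
          simp [h0] at h
        rw [hall]
        simp [h']
      · rw [if_neg (by omega), if_neg (by omega), f1 x hx]
      · have h' : P.out E.mem k d = E.mem 7 d := by
          rw [← hcell]
          by_contra h0
          simp [h0] at h
        rw [hall, f6]
        simp [h']
    · rintro E'' ⟨f1, f2, f3, f4, f5, f6⟩
      simp only [Expr.eval_var, Env.nat_set, Nat.reduceEqDiff, reduceIte, hgE.N] at f6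
      have hex : (∃ j < k + 1, ∀ c < P.N, P.out E.mem j c = E.mem 7 c) ↔
          (∃ j < k, ∀ c < P.N, P.out E.mem j c = E.mem 7 c) ∨
            ∀ c < P.N, P.out E.mem k c = E.mem 7 c := by
        constructor
        · rintro ⟨j, hj, h⟩
          rcases Nat.lt_succ_iff_lt_or_eq.1 hj with hj | rfl
          · exact Or.inl ⟨j, hj, h⟩
          · exact Or.inr h
        · rintro (⟨j, hj, h⟩ | h)
          · exact ⟨j, by omega, h⟩
          · exact ⟨k, by omega, h⟩
      simp only [wp_block_cons, wp_block_nil, wp_ite, wp_skip, wp_assign, Expr.eval_ofNat,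
        Env.nat_set, Env.mem_set, Env.pos_set, reduceIte]
      refine ⟨fun h => ⟨f1, f2, f3, ?_⟩, fun h => ⟨by omega, fun x hx => ?_, f2, f3, ?_⟩⟩
      · rw [hex, f5, g4, ← f6]
        simp [h]
      · rw [if_neg (by omega), f1 x hx]
      · rw [hex, ← f6]
        simp [h]
  · rintro E' ⟨g1, g2, g3, g4⟩
    simp only [Expr.eval_var, Env.nat_set, Nat.reduceEqDiff, reduceIte] at g4
    exact hQ E' g1 g2 g3 g4

/-- Append the word of row `7` to the output. -/
def append : Cmd := .block [
  .loop 24 vN (.fop .copy (vR₄ + vCnt / (vw + 3)) (vCnt % (vw + 3) * vN + .var 24)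
    7 (.var 24) 0 0),
  .assign 22 (vCnt + 1)]

theorem wp_append (hP : P.Valid) (hg : Glob P E) (hcnt : E.nat 22 + 1 ≤ P.Z)
    (hQ : ∀ E', (∀ x < 24, x ≠ 22 → E'.nat x = E.nat x) → E'.nat 22 = E.nat 22 + 1 →
      E'.pos = E.pos → (∀ r c, r < P.R₄ → E'.mem r c = E.mem r c) →
      (∀ k < E.nat 22, ∀ c < P.N, P.out E'.mem k c = P.out E.mem k c) →
      (∀ c < P.N, P.out E'.mem (E.nat 22) c = E.mem 7 c) → Q E') :
    wp P.W P.Z ω append Q E := by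
  have hWZ := hP.W_le
  have hW := hP.W_ge
  have hw := hP.w_le_N
  have hw' := hP.w_ge
  have e17 : 8 + P.N₁ = P.R₂ := rfl
  have e19 : P.R₂ + P.N₂ = P.R₃ := rfl
  have e20 : P.R₃ + P.N₂ = P.R₄ := rfl
  set m := E.nat 22 with hm
  -- different positions in the output are different entries of the matrix
  have hinj : ∀ k c k' c', c < P.N → c' < P.N → P.R₄ + k / (P.w + 3) = P.R₄ + k' / (P.w + 3) →
      k % (P.w + 3) * P.N + c = k' % (P.w + 3) * P.N + c' → k = k' ∧ c = c' := by
    intro k c k' c' hc hc' h1 h2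
    have h3 : k % (P.w + 3) = k' % (P.w + 3) := by
      rw [← pos_div (j := k % (P.w + 3)) hc, h2, pos_div hc']
    have h4 : c = c' := by
      rw [← pos_mod (j := k % (P.w + 3)) hc, h2, pos_mod hc']
    refine ⟨?_, h4⟩
    rw [← pos_eta (P.w + 3) k, ← pos_eta (P.w + 3) k', h3, Nat.add_left_cancel h1]
  rw [append, wp_block_cons]
  refine wp_loop (fun d E' => (∀ x < 24, E'.nat x = E.nat x) ∧ E'.pos = E.pos ∧
    (∀ r c, r < P.R₄ → E'.mem r c = E.mem r c) ∧
    (∀ k < m, ∀ c < P.N, P.out E'.mem k c = P.out E.mem k c) ∧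
    (∀ c < d, P.out E'.mem m c = E.mem 7 c)) ?_ ?_ ?_ ?_
  · simp only [Expr.eval_var, hg.N]; omega
  · exact ⟨fun _ _ => rfl, rfl, fun _ _ _ => rfl, fun _ _ _ _ => rfl, fun c hc => by omega⟩
  · rintro d hd E' ⟨g1, g2, g3, g4, g5⟩
    have hd' : d < P.N := by simpa [hg.N] using hd
    have hgE : Glob P E' := hg.frame fun x hx => g1 x (by omega)
    have g22 : E'.nat 22 = m := g1 22 (by omega)
    simp only [wp_fop, FldOp.eval, Expr.eval_var, Expr.eval_add, Expr.eval_mul, Expr.eval_div,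
      Expr.eval_mod, Expr.eval_ofNat, Env.nat_set, Nat.reduceEqDiff, reduceIte, hgE.w, hgE.N,
      hgE.R₄, g22, Env.mem_set]
    refine ⟨⟨out_column_lt m hd', by omega, by omega⟩, fun x hx => ?_, g2, fun r c hr => ?_,
      fun k hk c hc => ?_, fun c hc => ?_⟩
    · rw [Env.nat_write, Env.nat_set, if_neg (by omega), g1 x hx]
    · have := Nat.le_add_right P.R₄ (m / (P.w + 3))
      rw [Env.mem_write, if_neg (by omega), Env.mem_set, g3 r c hr]
    · rw [Params.out, Env.mem_write, if_neg, Env.mem_set]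
      · exact g4 k hk c hc
      · rintro ⟨h1, h2⟩
        have := (hinj k c m d hc hd' h1 h2).1
        omega
    · rw [Params.out, Env.mem_write]
      by_cases h : c = d
      · rw [if_pos ⟨rfl, by rw [h]⟩, h, g3 _ _ (by omega)]
      · rw [if_neg, Env.mem_set]
        · exact g5 c (by omega)
        · rintro ⟨h1, h2⟩
          exact h (hinj m c m d (by omega) hd' h1 h2).2
  · rintro E' ⟨g1, g2, g3, g4, g5⟩
    simp only [Expr.eval_var, hg.N] at g5
    have g22 : E'.nat 22 = m := g1 22 (by omega)
    simp only [wp_block_cons, wp_block_nil, wp_assign, Expr.eval_var, Expr.eval_add,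
      Expr.eval_ofNat, g22]
    refine ⟨hcnt, hQ _ (fun x hx hx' => ?_) (by simp [Env.nat_set]) g2 g3 g4 g5⟩
    rw [Env.nat_set, if_neg hx', g1 x hx]

/-- Append the word of row `v25` to the output, if it is close to the received word and new. -/
def record : Cmd := .block [
  normalize,
  weigh,
  .ite 26 .skip (.block [isKnown, .ite 27 .skip append])]

theorem wp_record (hP : P.Valid) (hg : Glob P E) (hcnt : E.nat 22 + 1 ≤ P.Z)
    (h25 : 8 ≤ E.nat 25) {v : ℕ → F} (hv : ∀ c < P.W, E.mem (E.nat 25) c = v c)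
    (hQ : ∀ E', (∀ x < 24, x ≠ 22 → E'.nat x = E.nat x) → E'.pos = E.pos →
      (∀ r c, r < P.R₄ → r ≠ 5 → r ≠ 6 → r ≠ 7 → E'.mem r c = E.mem r c) →
      (∀ k < E.nat 22, ∀ c < P.N, P.out E'.mem k c = P.out E.mem k c) →
      (E'.nat 22 = E.nat 22 ∧ (P.thr < colWeight P.p P.n (fun k => v (1 + k) * (v 0)⁻¹) ∨
        ∃ k < E.nat 22, ∀ c < P.N, P.out E.mem k c = v (1 + c) * (v 0)⁻¹ + E.mem 0 (c + 1)) ∨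
      E'.nat 22 = E.nat 22 + 1 ∧ colWeight P.p P.n (fun k => v (1 + k) * (v 0)⁻¹) ≤ P.thr ∧
        (∀ k < E.nat 22, ¬ ∀ c < P.N, P.out E.mem k c = v (1 + c) * (v 0)⁻¹ + E.mem 0 (c + 1)) ∧
        ∀ c < P.N, P.out E'.mem (E.nat 22) c = v (1 + c) * (v 0)⁻¹ + E.mem 0 (c + 1)) → Q E') :
    wp P.W P.Z ω record Q E := by
  have hW := hP.W_ge
  have hw := hP.w_le_N
  have hw' := hP.w_ge
  have e17 : 8 + P.N₁ = P.R₂ := rfl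
  have e19 : P.R₂ + P.N₂ = P.R₃ := rfl
  have e20 : P.R₃ + P.N₂ = P.R₄ := rfl
  have hout : ∀ mem mem' : ℕ → ℕ → F, (∀ r c, P.R₄ ≤ r → mem' r c = mem r c) →
      ∀ k c, P.out mem' k c = P.out mem k c := fun mem mem' h k c => h _ _ (Nat.le_add_right _ _)
  rw [record, wp_block_cons]
  refine wp_normalize hP hg h25 fun E₁ a1 a2 a3 a4 a5 => ?_
  have hg1 : Glob P E₁ := hg.frame fun x hx => a1 x (by omega)
  have a22 := a1 22 (by omega)
  rw [wp_block_cons]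
  refine wp_weigh hP hg1 fun E₂ b1 b2 b3 b4 => ?_
  have hg2 : Glob P E₂ := hg1.frame fun x hx => b1 x (by omega)
  have b22 := b1 22 (by omega)
  have hwt : colWeight P.p P.n (E₁.mem 6) =
      colWeight P.p P.n (fun k => v (1 + k) * (v 0)⁻¹) := by
    rw [colWeight, colWeight]
    congr 1
    refine Finset.filter_congr fun j hj => exists_congr fun i => and_congr_right fun hi => ?_
    have : j * P.p + i < P.N := pos_lt (Finset.mem_range.1 hj) hi
    rw [a4 _ this, hv _ (by omega), hv _ (by omega)]
  have h7 : ∀ c < P.N, E₂.mem 7 c = v (1 + c) * (v 0)⁻¹ + E.mem 0 (c + 1) := fun c hc => by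
    rw [b3, a5 c hc, hv _ (by omega), hv _ (by omega)]
  rw [hwt] at b4
  have ho2 : ∀ k c, P.out E₂.mem k c = P.out E.mem k c := hout _ _ fun r c hr => by
    rw [b3, a3 _ _ (by omega) (by omega) (by omega)]
  rw [wp_block_cons, wp_ite, wp_skip, wp_block_nil, wp_block_cons]
  constructor
  · intro h
    refine hQ E₂ (fun x hx _ => by rw [b1 x hx, a1 x hx]) (by rw [b2, a2])
      (fun r c _ h5 h6 h7 => by rw [b3, a3 r c h5 h6 h7]) (fun k _ c _ => ho2 k c)
      (Or.inl ⟨by rw [b22, a22], Or.inl (by omega)⟩)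
  · intro h
    refine wp_isKnown hP hg2 (by omega) fun E₃ c1 c2 c3 c4 => ?_
    have hg3 : Glob P E₃ := hg2.frame fun x hx => c1 x (by omega)
    have c22 := c1 22 (by omega)
    have ho3 : ∀ k c, P.out E₃.mem k c = P.out E.mem k c := fun k c => by
      rw [← ho2]
      exact hout _ _ (fun r c hr => c3 _ _ (by omega)) k c
    have hknown : E₃.nat 27 ≠ 0 ↔ ∃ k < E.nat 22, ∀ c < P.N,
        P.out E.mem k c = v (1 + c) * (v 0)⁻¹ + E.mem 0 (c + 1) := by
      rw [c4, b22, a22]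
      refine exists_congr fun k => and_congr_right fun _ =>
        forall_congr' fun c => forall_congr' fun hc => ?_
      rw [ho2, h7 c hc]
    rw [wp_block_cons, wp_ite, wp_skip, wp_block_nil]
    constructor
    · intro h27
      refine hQ E₃ (fun x hx _ => by rw [c1 x hx, b1 x hx, a1 x hx]) (by rw [c2, b2, a2])
        (fun r c _ h5 h6 h7 => by rw [c3 r c h5, b3, a3 r c h5 h6 h7]) (fun k _ c _ => ho3 k c)
        (Or.inl ⟨by rw [c22, b22, a22], Or.inr (hknown.1 h27)⟩)
    · intro h27
      refine wp_append hP hg3 (by omega) fun E₄ d1 d2 d3 d4 d5 d6 => ?_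
      have e22 : E₃.nat 22 = E.nat 22 := by rw [c22, b22, a22]
      rw [e22] at d2 d5 d6
      refine hQ E₄ (fun x hx hx' => by rw [d1 x hx hx', c1 x hx, b1 x hx, a1 x hx])
        (by rw [d3, c2, b2, a2])
        (fun r c hr h5 h6 h7 => by rw [d4 r c hr, c3 r c h5, b3, a3 r c h5 h6 h7])
        (fun k hk c hc => by rw [d5 k hk c hc, ho3])
        (Or.inr ⟨d2, by omega, fun k hk hcon => ?_, fun c hc => ?_⟩)
      · exact hknown.2 ⟨k, hk, hcon⟩ h27
      · rw [d6 c hc, c3 _ _ (by omega), h7 c hc]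

/-- One trial: prune the candidates at random columns, and record a word that is left. -/
def trial : Cmd := .block [
  prune,
  .assign 25 0,
  .loop 24 vN₂ (.block [
    .ftest 26 (vR₃ + .var 24) 0,
    .ite 26 (.assign 25 (vR₃ + .var 24)) .skip]),
  .ite 25 record .skip]

theorem wp_trial (hP : P.Valid) (hg : Glob P E) (hcnt : E.nat 22 + 1 ≤ P.Z)
    {S V : Submodule F (ℕ → F)} (hS : rowSpan P.W E.mem P.R₂ P.N₂ = S)
    (hV : V = S ⊓ ⨅ i : Fin P.w,
      colZero F P.p (sample P.n (fun l => ω (E.pos + ((i : ℕ) * P.q + l))) P.q))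
    {r : ℕ → F} (hr : ∀ k, E.mem 0 (k + 1) = r k)
    (hQ : ∀ E', (∀ x < 24, x ≠ 22 → E'.nat x = E.nat x) → E'.pos = E.pos + P.w * P.q →
      (∀ c, E'.mem 0 c = E.mem 0 c) → rowSpan P.W E'.mem P.R₂ P.N₂ = S →
      (∀ k < E.nat 22, ∀ c < P.N, P.out E'.mem k c = P.out E.mem k c) →
      (E'.nat 22 = E.nat 22 ∧ (∀ x ∈ V, x 0 = 1 → V ≤ Submodule.span F {x} →
        colWeight P.p P.n (fun k => x (1 + k)) ≤ P.thr →
          ∃ k < E.nat 22, ∀ c < P.N, P.out E.mem k c = x (1 + c) + r c) ∨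
      E'.nat 22 = E.nat 22 + 1 ∧ ∃ v ∈ V, v 0 ≠ 0 ∧
        colWeight P.p P.n (fun k => v (1 + k) * (v 0)⁻¹) ≤ P.thr ∧
        (∀ k < E.nat 22, ¬ ∀ c < P.N, P.out E.mem k c = v (1 + c) * (v 0)⁻¹ + r c) ∧
        ∀ c < P.N, P.out E'.mem (E.nat 22) c = v (1 + c) * (v 0)⁻¹ + r c) → Q E') :
    wp P.W P.Z ω trial Q E := by
  have hW := hP.W_ge
  have hw := hP.w_le_N
  have hw' := hP.w_ge
  have hwN := hP.wN_ge
  have hRZ := hP.rows_le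
  have e17 : 8 + P.N₁ = P.R₂ := rfl
  have e19 : P.R₂ + P.N₂ = P.R₃ := rfl
  have e20 : P.R₃ + P.N₂ = P.R₄ := rfl
  have hwN2 : 16 * P.N ≤ P.w * P.N := Nat.mul_le_mul_right _ hw'
  rw [trial, wp_block_cons]
  refine wp_prune hP hg fun E₁ a1 a2 a3 a4 => ?_
  have hspan : rowSpan P.W E₁.mem P.R₃ P.N₂ = V := by
    ext x
    rw [a4, hS, hV, Submodule.mem_inf, Submodule.mem_iInf]
    exact and_congr_right fun _ => ⟨fun h i => h i i.2, fun h i hi => h ⟨i, hi⟩⟩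
  have hg1 : Glob P E₁ := hg.frame fun x hx => a1 x (by omega)
  have ho1 : ∀ k c, P.out E₁.mem k c = P.out E.mem k c := fun k c => by
    have := Nat.le_add_right P.R₄ (k / (P.w + 3))
    exact a3 _ _ (by omega) (by omega) (by omega)
  have hS1 : rowSpan P.W E₁.mem P.R₂ P.N₂ = S := by
    rw [← hS]
    exact rowSpan_congr fun ρ hρ c _ => a3 _ _ (by omega) (by omega) (by omega)
  rw [wp_block_cons, wp_assign, wp_block_cons]
  refine ⟨by simp, ?_⟩
  refine wp_loop (fun k E' => (∀ x < 24, E'.nat x = E.nat x) ∧ E'.pos = E₁.pos ∧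
    E'.mem = E₁.mem ∧ (E'.nat 25 = 0 ∧ (∀ ρ < k, E₁.mem (P.R₃ + ρ) 0 = 0) ∨
      ∃ ρ < P.N₂, E'.nat 25 = P.R₃ + ρ ∧ E₁.mem (P.R₃ + ρ) 0 ≠ 0)) ?_ ?_ ?_ ?_
  · simp only [Expr.eval_var, Env.nat_set, Nat.reduceEqDiff, reduceIte, hg1.N₂]; omega
  · refine ⟨fun x hx => ?_, rfl, rfl, Or.inl ⟨by simp [Env.nat_set], fun ρ hρ => by omega⟩⟩
    rw [Env.nat_set, if_neg (by omega), a1 x hx]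
  · rintro k hk E' ⟨g1, g2, g3, g4⟩
    have hk' : k < P.N₂ := by simpa [Env.nat_set, hg1.N₂] using hk
    have hgE : Glob P E' := hg.frame fun x hx => g1 x (by omega)
    simp only [wp_block_cons, wp_block_nil, wp_ite, wp_skip, wp_assign, wp_ftest, Expr.eval_var,
      Expr.eval_add, Expr.eval_ofNat, Env.nat_set, Env.mem_set, Env.pos_set,
      Nat.reduceEqDiff, reduceIte, hgE.R₃, g3]
    refine ⟨by omega, fun h => ⟨by omega, fun x hx => ?_, g2, trivial, Or.inr ⟨k, hk', rfl, ?_⟩⟩,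
      fun h => ⟨fun x hx => ?_, g2, trivial, ?_⟩⟩
    · rw [if_neg (by omega), if_neg (by omega), if_neg (by omega), g1 x hx]
    · simpa using h
    · rw [if_neg (by omega), if_neg (by omega), g1 x hx]
    · rcases g4 with ⟨h1, h2⟩ | h1
      · refine Or.inl ⟨h1, fun ρ hρ => ?_⟩
        rcases Nat.lt_succ_iff_lt_or_eq.1 hρ with hρ | rfl
        · exact h2 ρ hρ
        · by_contra h'
          simp [h'] at h
      · exact Or.inr h1
  rintro E₂ ⟨b1, b2, b3, b4⟩
  simp only [Expr.eval_var, Env.nat_set, Nat.reduceEqDiff, reduceIte, hg1.N₂] at b4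
  have hg2 : Glob P E₂ := hg.frame fun x hx => b1 x (by omega)
  simp only [wp_block_cons, wp_block_nil, wp_ite, wp_skip]
  have hmem0 : ∀ c, E₂.mem 0 c = E.mem 0 c := fun c => by
    rw [b3, a3 _ _ (by omega) (by omega) (by omega)]
  constructor
  · intro h25
    obtain ⟨ρ, hρ, h1, h2⟩ : ∃ ρ < P.N₂, E₂.nat 25 = P.R₃ + ρ ∧ E₁.mem (P.R₃ + ρ) 0 ≠ 0 := by
      rcases b4 with h | h
      · exact absurd h.1 h25
      · exact h
    set v := row P.W E₁.mem (P.R₃ + ρ) with hv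
    have hvV : v ∈ V := hspan ▸ row_mem_rowSpan P.W E₁.mem P.R₃ hρ
    have hv0 : v 0 ≠ 0 := by rwa [hv, row_apply _ _ _ (by omega)]
    have b22 := b1 22 (by omega)
    refine wp_record hP hg2 (v := v) (by omega) (by omega) (fun c hc => ?_)
      fun E₃ c1 c2 c3 c4 c5 => ?_
    · rw [b3, h1, hv, row_apply _ _ _ hc]
    have ho2 : ∀ k c, P.out E₂.mem k c = P.out E.mem k c := fun k c => by rw [b3, ho1]
    simp only [b22, ho2, hmem0, hr] at c4 c5
    refine hQ E₃ (fun x hx hx' => by rw [c1 x hx hx', b1 x hx]) (by rw [c2, b2, a2])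
      (fun c => by rw [c3 _ _ (by omega) (by omega) (by omega) (by omega), hmem0]) ?_ c4 ?_
    · rw [← hS1, ← b3]
      exact rowSpan_congr fun ρ hρ c _ => c3 _ _ (by omega) (by omega) (by omega) (by omega)
    · rcases c5 with ⟨h3, h4⟩ | ⟨h3, h4, h5, h6⟩
      · refine Or.inl ⟨h3, fun x hx hx0 hline hwt => ?_⟩
        obtain ⟨z, hz⟩ := Submodule.mem_span_singleton.1 (hline hvV)
        have hz0 : v 0 = z := by rw [← hz, Pi.smul_apply, hx0, smul_eq_mul, mul_one]
        have hvx : ∀ c, v (1 + c) * (v 0)⁻¹ = x (1 + c) := fun c => by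
          rw [← hz] at hv0
          simp only [Pi.smul_apply, hx0, smul_eq_mul, mul_one] at hv0
          rw [hz0, ← hz, Pi.smul_apply, smul_eq_mul]
          field_simp
        simp only [hvx] at h4
        rcases h4 with h4 | h4
        · omega
        · exact h4
      · exact Or.inr ⟨h3, v, hvV, hv0, h4, h5, h6⟩
  · intro h25
    refine hQ E₂ (fun x hx _ => b1 x hx) (by rw [b2, a2]) hmem0 (by rw [b3, hS1])
      (fun k _ c _ => by rw [b3, ho1]) (Or.inl ⟨b1 22 (by omega), fun x hx hx0 _ _ => ?_⟩)
    have h0 : ∀ ρ < P.N₂, E₁.mem (P.R₃ + ρ) 0 = 0 := by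
      rcases b4 with h | ⟨ρ, hρ, h, _⟩
      · exact h.2
      · omega
    have : V ≤ LinearMap.ker (LinearMap.proj 0 : (ℕ → F) →ₗ[F] F) := by
      rw [← hspan, rowSpan, Submodule.span_le]
      rintro _ ⟨ρ, hρ, rfl⟩
      change row _ _ _ 0 = 0
      rw [row_apply _ _ _ (by omega)]
      exact h0 ρ hρ
    have hx0' : x 0 = 0 := this hx
    rw [hx0'] at hx0
    exact absurd hx0 zero_ne_one

end Output

/-! ### Final states and independence of the coins -/

section Run

variable {F : Type*} [Field F] [DecidableEq F]

/-- The final state of a computation in the structured language. -/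
def Cmd.run (ω : ℕ → Bool) : Cmd → Env F → Env F
  | .skip, E => E
  | .assign i e, E => E.set i (e.eval E.nat)
  | .coin i, E => (E.set i (if ω E.pos then 1 else 0)).step
  | .fop o r₁ c₁ r₂ c₂ r₃ c₃, E =>
    E.write (r₁.eval E.nat) (c₁.eval E.nat) (o.eval (E.mem (r₂.eval E.nat) (c₂.eval E.nat))
      (E.mem (r₃.eval E.nat) (c₃.eval E.nat)))
  | .ftest i r c, E => E.set i (if E.mem (r.eval E.nat) (c.eval E.nat) = 0 then 0 else 1)
  | .seq a b, E => b.run ω (a.run ω E)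
  | .ite i a b, E => if E.nat i = 0 then b.run ω E else a.run ω E
  | .loop i n a, E => Nat.rec E (fun k E' => a.run ω (E'.set i k)) (n.eval E.nat)

/-- The predicate transformer describes the final state. -/
theorem wp_run {W Z : ℕ} {ω : ℕ → Bool} (a : Cmd) : ∀ {Q : Env F → Prop} {E : Env F},
    wp W Z ω a Q E → wp W Z ω a (fun E' => E' = a.run ω E ∧ Q E') E := by
  induction a with
  | skip => exact fun h => ⟨rfl, h⟩
  | assign i e => exact fun h => ⟨h.1, rfl, h.2⟩
  | coin i => exact fun h => ⟨rfl, h⟩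
  | fop o r₁ c₁ r₂ c₂ r₃ c₃ => exact fun h => ⟨h.1, rfl, h.2⟩
  | ftest i r c => exact fun h => ⟨h.1, rfl, h.2⟩
  | seq a b iha ihb =>
    intro Q E h
    refine wp_mono a ?_ (iha h)
    rintro E' ⟨rfl, h'⟩
    exact ihb h'
  | ite i a b iha ihb =>
    intro Q E h
    refine ⟨fun h0 => ?_, fun h0 => ?_⟩
    · rw [Cmd.run, if_neg h0]
      exact iha (h.1 h0)
    · rw [Cmd.run, if_pos h0]
      exact ihb (h.2 h0)
  | loop i n a iha =>
    rintro Q E ⟨h1, I, h2, h3, h4⟩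
    refine ⟨h1, fun k E' => E' = Nat.rec E (fun k E' => a.run ω (E'.set i k)) k ∧ I k E',
      ⟨rfl, h2⟩, ?_, ?_⟩
    · rintro k hk E' ⟨rfl, hI⟩
      exact iha (h3 k hk _ hI)
    · rintro E' ⟨hE, hI⟩
      exact ⟨hE, h4 E' hI⟩

/-- The final state satisfies every postcondition that `wp` establishes. -/
theorem run_of_wp {W Z : ℕ} {ω : ℕ → Bool} (a : Cmd) : ∀ {Q : Env F → Prop} {E : Env F},
    wp W Z ω a Q E → Q (a.run ω E) := by
  induction a with
  | skip => exact fun h => h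
  | assign i e => exact fun h => h.2
  | coin i => exact fun h => h
  | fop o r₁ c₁ r₂ c₂ r₃ c₃ => exact fun h => h.2
  | ftest i r c => exact fun h => h.2
  | seq a b iha ihb => exact fun h => ihb (iha h)
  | ite i a b iha ihb =>
    intro Q E h
    rw [Cmd.run]
    split_ifs with h0
    · exact ihb (h.2 h0)
    · exact iha (h.1 h0)
  | loop i n a iha =>
    rintro Q E ⟨-, I, h2, h3, h4⟩
    refine h4 _ ?_
    have : ∀ k ≤ n.eval E.nat, I k (Nat.rec E (fun k E' => a.run ω (E'.set i k)) k) := by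
      intro k
      induction k with
      | zero => exact fun _ => h2
      | succ k ih => exact fun hk => iha (h3 k hk _ (ih (Nat.le_of_succ_le hk)))
    exact this _ le_rfl

/-- A command that tosses no coins. -/
def Cmd.coinFree : Cmd → Bool
  | .coin _ => false
  | .seq a b => a.coinFree && b.coinFree
  | .ite _ a b => a.coinFree && b.coinFree
  | .loop _ _ a => a.coinFree
  | _ => true

theorem Cmd.run_eq_of_coinFree (ω ω' : ℕ → Bool) (a : Cmd) (ha : a.coinFree = true) :
    (a.run ω : Env F → Env F) = a.run ω' := by
  induction a with
  | skip | assign | fop | ftest => rfl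
  | coin i => simp [coinFree] at ha
  | seq a b iha ihb =>
    simp only [coinFree, Bool.and_eq_true] at ha
    ext1 E
    rw [run, run, iha ha.1, ihb ha.2]
  | ite i a b iha ihb =>
    simp only [coinFree, Bool.and_eq_true] at ha
    ext1 E
    rw [run, run, iha ha.1, ihb ha.2]
  | loop i n a iha =>
    ext1 E
    simp only [run, iha ha]

end Run

/-! ### The decoder -/

section Decoder

variable {F : Type*} [Field F] [DecidableEq F] {ω : ℕ → Bool} {Q : Env F → Prop}
  {E : Env F} {P : Params}

/-- The computations before the first trial. -/
def prepare : Cmd := .block [setup, recurrence, candidates]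

theorem wp_prepare (hP : P.Valid) (h0 : E.nat 0 = P.p) (h1 : E.nat 1 = P.q) (h2 : E.nat 2 = P.s)
    (h3 : E.nat 3 = P.t) (h4 : E.nat 4 = P.thr) (h5 : E.nat 5 = P.e) (h6 : E.nat 6 = P.la)
    {γ : Fˣ} [CharP F P.p] (hγ : orderOf γ = P.n) (hpn : Nat.Coprime P.p P.n)
    (hγ0 : E.mem 0 0 = γ) (hz : ∀ ρ c, 8 ≤ ρ → c < P.W → E.mem ρ c = 0)
    (hQ : ∀ E', Glob P E' → E'.nat 22 = 0 → E'.pos = E.pos → (∀ c, E'.mem 0 c = E.mem 0 c) →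
      (∃ a₀ a, IsRecurrence γ (fun k => E.mem 0 (k + 1)) P.p P.n P.w P.E₀ P.T₀ P.D P.D' a₀ a ∧
        rowSpan P.W E'.mem P.R₂ P.N₂ = candSpace γ (fun k => E.mem 0 (k + 1)) a P.p P.N P.w P.E₀
          P.s P.t ⊓ recZero F P.p P.N P.E₀) → Q E') :
    wp P.W P.Z ω prepare Q E := by
  simp only [prepare, wp_block_cons]
  refine wp_setup hP h0 h1 h2 h3 h4 h5 h6 fun E₁ a1 a2 a3 a4 => ?_
  refine wp_recurrence (γ := γ) hP a1 hγ hpn (by rw [a4, hγ0])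
    (fun ρ c hρ hc => by rw [a4, hz ρ c hρ hc]) fun E₂ b1 b2 b3 b4 b5 b6 b7 b8 b9 b10 => ?_
  obtain ⟨a₀, a, ha, hA⟩ := b10
  rw [a4] at ha
  have hg2 : Glob P E₂ := a1.frame b1
  refine wp_candidates (γ := γ) (a := a) hP hg2 b5 b6 b8 b9 hA b7 fun E₃ c1 c2 c3 c4 => ?_
  refine hQ E₃ (hg2.frame fun x hx => c1 x (by omega)) (by rw [c1 22 (by omega), b2, a2])
    (by rw [c2, b3, a3]) (fun c => by rw [c3, b4, a4]) ⟨a₀, a, ha, ?_⟩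
  rw [c4]
  simp only [b4, a4]

/-- Repeat the trial and describe the output. -/
def search : Cmd := .block [
  .loop 23 vM trial,
  .assign 0 vCnt,
  .assign 1 (vR₄ * vW)]

/-- What is left of the space `S` of candidates in trial `τ`. -/
def Params.pruned (P : Params) (S : Submodule F (ℕ → F)) (ω : ℕ → Bool) (τ : ℕ) :
    Submodule F (ℕ → F) :=
  S ⊓ ⨅ i : Fin P.w, colZero F P.p (sample P.n (fun l => ω ((τ * P.w + i) * P.q + l)) P.q)

/-- The words `o 0, …, o (N - 1)` come from elements of `S` of small weight, are different from each
other, and contain each word that is found in one of the first `M` trials. -/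
structure Params.Found (P : Params) (S : Submodule F (ℕ → F)) (r : ℕ → F) (ω : ℕ → Bool)
    (M N : ℕ) (o : ℕ → ℕ → F) : Prop where
  sound : ∀ k < N, ∃ v ∈ S, v 0 ≠ 0 ∧
    colWeight P.p P.n (fun k => v (1 + k) * (v 0)⁻¹) ≤ P.thr ∧
    ∀ c < P.N, o k c = v (1 + c) * (v 0)⁻¹ + r c
  distinct : ∀ k k', k < k' → k' < N → ¬ ∀ c < P.N, o k c = o k' c
  complete : ∀ τ < M, ∀ x ∈ P.pruned S ω τ, x 0 = 1 → P.pruned S ω τ ≤ Submodule.span F {x} →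
    colWeight P.p P.n (fun k => x (1 + k)) ≤ P.thr → ∃ k < N, ∀ c < P.N, o k c = x (1 + c) + r c

theorem Params.Found.congr {S : Submodule F (ℕ → F)} {r : ℕ → F} {M N : ℕ} {o o' : ℕ → ℕ → F}
    (h : P.Found S r ω M N o) (ho : ∀ k < N, ∀ c < P.N, o' k c = o k c) :
    P.Found S r ω M N o' where
  sound k hk := by
    obtain ⟨v, h1, h2, h3, h4⟩ := h.sound k hk
    exact ⟨v, h1, h2, h3, fun c hc => by rw [ho k hk c hc, h4 c hc]⟩
  distinct k k' hk hk' hcon := h.distinct k k' hk hk' fun c hc => by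
    rw [← ho k (hk.trans hk') c hc, ← ho k' hk' c hc, hcon c hc]
  complete τ hτ x hx h0 hline hw := by
    obtain ⟨k, hk, h1⟩ := h.complete τ hτ x hx h0 hline hw
    exact ⟨k, hk, fun c hc => by rw [ho k hk c hc, h1 c hc]⟩

theorem wp_search (hP : P.Valid) (hg : Glob P E) (h22 : E.nat 22 = 0) (hpos : E.pos = 0)
    {S : Submodule F (ℕ → F)} (hS : rowSpan P.W E.mem P.R₂ P.N₂ = S) {r : ℕ → F}
    (hr : ∀ k, E.mem 0 (k + 1) = r k)
    (hQ : ∀ E', E'.nat 1 = P.R₄ * P.W → P.Found S r ω P.M (E'.nat 0) (P.out E'.mem) → Q E') :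
    wp P.W P.Z ω search Q E := by
  have hMZ : P.M ≤ P.Z := by unfold Params.Z; omega
  rw [search, wp_block_cons]
  refine wp_loop (fun τ E' => Glob P E' ∧ E'.nat 22 ≤ τ ∧ E'.pos = τ * (P.w * P.q) ∧
    (∀ c, E'.mem 0 c = E.mem 0 c) ∧ rowSpan P.W E'.mem P.R₂ P.N₂ = S ∧
    P.Found S r ω τ (E'.nat 22) (P.out E'.mem)) ?_ ?_ ?_ ?_
  · simpa only [Expr.eval_var, hg.M] using hMZ
  · refine ⟨hg, h22.le, by rw [hpos, zero_mul], fun _ => rfl, hS, ?_⟩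
    rw [h22]
    exact ⟨fun k hk => by omega, fun k k' hk hk' => by omega, fun τ hτ => by omega⟩
  · rintro τ hτ E' ⟨g1, g2, g3, g4, g5, g6⟩
    have hτ' : τ < P.M := by simpa [hg.M] using hτ
    have hg' : Glob P (E'.set 23 τ) := g1.frame fun x hx => by
      rw [Env.nat_set, if_neg (by omega)]
    have h22' : (E'.set 23 τ).nat 22 = E'.nat 22 := by simp [Env.nat_set]
    refine wp_trial (S := S) (V := P.pruned S ω τ) (r := r) hP hg' (by omega) g5 ?_ ?_ ?_
    · rw [Params.pruned]
      congr 1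
      refine iInf_congr fun i => ?_
      congr 2
      ext l
      rw [Env.pos_set, g3]
      congr 1
      ring
    · exact fun k => by rw [Env.mem_set, g4, hr]
    intro E'' f1 f2 f3 f4 f5 f6
    rw [h22'] at f5 f6
    rw [Env.mem_set] at f5 f6
    have hold := g6.congr f5
    refine ⟨hg'.frame fun x hx => f1 x (by omega) (by omega), by omega, ?_,
      fun c => by rw [f3, Env.mem_set, g4], f4, ?_⟩
    · rw [f2, Env.pos_set, g3]
      ring
    · rcases f6 with ⟨h1, h2⟩ | ⟨h1, v, hvV, hv0, hwt, hnew, hlast⟩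
      · rw [h1]
        refine ⟨hold.sound, hold.distinct, fun τ' hτ' x hx h0 hline hwt => ?_⟩
        rcases Nat.lt_succ_iff_lt_or_eq.1 hτ' with hτ' | rfl
        · exact hold.complete τ' hτ' x hx h0 hline hwt
        · obtain ⟨k, hk, h3⟩ := h2 x hx h0 hline hwt
          exact ⟨k, hk, fun c hc => by rw [f5 k hk c hc, h3 c hc]⟩
      · rw [h1]
        refine ⟨fun k hk => ?_, fun k k' hk hk' => ?_, fun τ' hτ' x hx h0 hline hwt' => ?_⟩
        · rcases Nat.lt_succ_iff_lt_or_eq.1 hk with hk | rfl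
          · exact hold.sound k hk
          · exact ⟨v, hvV.1, hv0, hwt, hlast⟩
        · rcases Nat.lt_succ_iff_lt_or_eq.1 hk' with hk' | rfl
          · exact hold.distinct k k' hk hk'
          · intro hcon
            refine hnew k hk fun c hc => ?_
            rw [← f5 k hk c hc, hcon c hc, hlast c hc]
        · rcases Nat.lt_succ_iff_lt_or_eq.1 hτ' with hτ' | rfl
          · obtain ⟨k, hk, h3⟩ := hold.complete τ' hτ' x hx h0 hline hwt'
            exact ⟨k, by omega, h3⟩
          · refine ⟨E'.nat 22, by omega, fun c hc => ?_⟩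
            obtain ⟨z, hz⟩ := Submodule.mem_span_singleton.1 (hline hvV)
            rw [hlast c hc, ← hz]
            rw [← hz] at hv0
            simp only [Pi.smul_apply, h0, smul_eq_mul, mul_one] at hv0 ⊢
            field_simp
  · rintro E' ⟨g1, g2, g3, g4, g5, g6⟩
    simp only [Expr.eval_var, hg.M] at g2 g6
    simp only [wp_block_cons, wp_block_nil, wp_assign, Expr.eval_var, Expr.eval_mul, Env.nat_set,
      Nat.reduceEqDiff, reduceIte, g1.R₄, g1.W]
    refine ⟨by omega, hP.mul_le le_rfl le_rfl, hQ _ (by simp [Env.nat_set]) ?_⟩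
    simpa [Env.nat_set] using g6

/-- The list decoder. The number of columns of the matrix is computed first. -/
def decoder : Program :=
  .seq ((((16 * vE * vE + 3) * ((vQ - 1) * vP) : Expr)).compile 100)
    ((Cmd.block [prepare, search]).compile 101)

/-- A bound for the running time of the decoder, in terms of the bound for its numbers. -/
def decoderTime (Z : ℕ) : ℕ :=
  (((16 * vE * vE + 3) * ((vQ - 1) * vP) : Expr)).timeBound Z +
    (Cmd.block [prepare, search]).timeBound Z

theorem polyBdd_decoderTime : PolyBdd decoderTime :=
  (Expr.polyBdd_timeBound _).add (Cmd.polyBdd_timeBound _)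

/-- The word of a matrix, column by column. -/
def flatten {p n : ℕ} (γ : F) (r : Fin n → Fin p → F) (k : ℕ) : F :=
  (State.input [] γ r).fld (k + 1)

/-- For one space `S` of candidates that does not depend on the coins, every run of the decoder is
within its time bound and outputs words as described by `Params.Found`. -/
theorem decoder_runs (hP : P.Valid) {γ : Fˣ} [CharP F P.p] (hγ : orderOf γ = P.n)
    (hpn : Nat.Coprime P.p P.n) (r : Fin P.n → Fin P.p → F) :
    ∃ S : Submodule F (ℕ → F), (∃ a₀ a, IsRecurrence γ (flatten (γ : F) r) P.p P.n P.w P.E₀ P.T₀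
        P.D P.D' a₀ a ∧
      S = candSpace γ (flatten (γ : F) r) a P.p P.N P.w P.E₀ P.s P.t ⊓ recZero F P.p P.N P.E₀) ∧
    ∀ ω, ∃ τ, Runs ω decoder (State.input [P.p, P.q, P.s, P.t, P.thr, P.e, P.la] (γ : F) r)
        (decoderTime P.Z) τ ∧ ∃ N o, P.Found S (flatten (γ : F) r) ω P.M N o ∧
          τ.output P.p P.n = (List.range N).map fun k (j : Fin P.n) (i : Fin P.p) =>
            o k ((j : ℕ) * P.p + (i : ℕ)) := by
  set σ := State.input [P.p, P.q, P.s, P.t, P.thr, P.e, P.la] (γ : F) r with hσ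
  have hw := hP.w_ge
  have hp := hP.p_ge
  have hN := hP.N_ge
  have hn := hP.n_le_N
  have hn0 := hP.n_pos
  have hW := hP.W_ge
  have hWZ := hP.W_le
  set E : Env F := ⟨σ.nat, fun ρ c => σ.fld (ρ * P.W + c), 0⟩ with hE
  have hnat : ∀ i < 100, σ.nat i ≤ P.Z := by
    have h1 := hP.design.rows
    have h2 := hP.design.rows_le
    have h3 := hP.design.cols
    have h4 := hP.design.cols_le
    have h5 := hP.design.t_pos
    have h6 : P.e ≤ P.w := by unfold Params.w; nlinarith [hP.e_pos]
    have h7 : P.T₀ = P.n - P.thr := rfl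
    have h8 : P.q ≤ P.Z := by unfold Params.Z; omega
    have h9 : P.la ≤ P.Z := by unfold Params.Z; omega
    intro i hi
    change [P.p, P.q, P.s, P.t, P.thr, P.e, P.la].getD i 0 ≤ _
    rcases lt_or_ge i 7 with h | h
    · interval_cases i <;> simp only [List.getD_cons_zero, List.getD_cons_succ] <;> omega
    · rw [List.getD_eq_default _ _ (by simpa using h)]
      omega
  have hr : ∀ k, E.mem 0 (k + 1) = flatten (γ : F) r k := fun k => by
    simp only [hE, zero_mul, zero_add]
    rfl
  have hz : ∀ ρ c, 8 ≤ ρ → c < P.W → E.mem ρ c = 0 := by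
    intro ρ c hρ hc
    have h1 : 8 * P.W ≤ ρ * P.W := Nat.mul_le_mul_right _ hρ
    change (if _ then _ else if _ : _ ∧ _ then _ else _) = _
    rw [if_neg (by omega), dif_neg]
    rintro ⟨h2, -⟩
    rw [Nat.div_lt_iff_lt_mul (by omega)] at h2
    have : P.n * P.p = P.N := rfl
    omega
  have hpre := fun ω => wp_prepare (ω := ω) (E := E) (γ := γ) hP rfl rfl rfl rfl rfl rfl rfl hγ hpn
    (by simp [hE, hσ, State.input]) hz fun E' h1 h2 h3 h4 h5 => (⟨h1, h2, h3, h4, h5⟩ :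
      Glob P E' ∧ E'.nat 22 = 0 ∧ E'.pos = E.pos ∧ (∀ c, E'.mem 0 c = E.mem 0 c) ∧
      ∃ a₀ a, IsRecurrence γ (fun k => E.mem 0 (k + 1)) P.p P.n P.w P.E₀ P.T₀ P.D P.D' a₀ a ∧
        rowSpan P.W E'.mem P.R₂ P.N₂ = candSpace γ (fun k => E.mem 0 (k + 1)) a P.p P.N P.w P.E₀
          P.s P.t ⊓ recZero F P.p P.N P.E₀)
  -- no coins have been tossed so far, so that the recurrence does not depend on them
  set E₁ := prepare.run (fun _ => false) E with hE₁
  obtain ⟨b1, b2, b3, b4, a₀, a, b5, b6⟩ := run_of_wp _ (hpre fun _ => false)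
  rw [← hE₁] at b1 b2 b3 b4 b6
  rw [funext hr] at b5 b6
  refine ⟨rowSpan P.W E₁.mem P.R₂ P.N₂, ⟨a₀, a, b5, b6⟩, fun ω => ?_⟩
  obtain ⟨σ₁, c1, c2, c3, c4, c5⟩ := Expr.runs_compile ω (Z := P.Z)
    (((16 * vE * vE + 3) * ((vQ - 1) * vP) : Expr)) (by decide) 100 σ le_rfl hnat
  have hwp : wp P.W P.Z ω (.block [prepare, search]) (fun E' => E'.nat 1 = P.R₄ * P.W ∧
      P.Found (rowSpan P.W E₁.mem P.R₂ P.N₂) (flatten (γ : F) r) ω P.M (E'.nat 0) (P.out E'.mem)) E := by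
    rw [wp_block_cons]
    refine wp_mono _ ?_ (wp_run _ (hpre ω))
    rintro E' ⟨hE', -⟩
    rw [Cmd.run_eq_of_coinFree ω (fun _ => false) prepare (by decide), ← hE₁] at hE'
    subst hE'
    rw [wp_block_cons]
    exact wp_search hP b1 b2 b3 rfl (fun k => by rw [b4, hr]) fun E' h1 h2 => ⟨h1, h2⟩
  obtain ⟨τ, E', d1, d2, ⟨d3, d4⟩, -⟩ := Cmd.sound ω hWZ (show 1 ≤ P.Z by omega)
    (.block [prepare, search]) (by decide) 101 le_rfl _ E σ₁ hwp {
      nat := fun i hi => c3 i hi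
      le := hnat
      width := by
        rw [c2]
        rfl
      mem := fun ρ c _ => by rw [c4]
      pos := by rw [c5]; rfl }
  refine ⟨τ, c1.seq d1, E'.nat 0, P.out E'.mem, d4, ?_⟩
  rw [State.output, d2.nat 0 (by omega), d2.nat 1 (by omega), d3]
  refine List.map_congr_left fun k _ => ?_
  ext j i
  have hc : (j : ℕ) * P.p + i < P.N := pos_lt j.2 i.2
  have := d2.mem (P.R₄ + k / (P.w + 3)) (k % (P.w + 3) * P.N + (j * P.p + i))
    (out_column_lt k hc)
  rw [Params.out, ← this]
  congr 1
  have h1 := pos_eta (P.w + 3) k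
  have h2 : P.W = (P.w + 3) * P.N := rfl
  have h3 : k * P.N = k / (P.w + 3) * ((P.w + 3) * P.N) + k % (P.w + 3) * P.N := by
    conv_lhs => rw [← h1]
    ring
  have h4 : P.n * P.p = P.N := rfl
  rw [h4, h3, ← h2]
  ring

end Decoder

/-! ### Codewords as words along the orbit -/

section CodeWords

variable {F : Type*} [Field F]

theorem affine_one_pow (k : ℕ) (x : F) : ((affine (1 : Fˣ) (1 : F)) ^ k) x = x + k := by
  induction k generalizing x with
  | zero => simp
  | succ k ih =>
    rw [pow_succ', Equiv.Perm.mul_apply, ih, affine_apply]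
    push_cast
    ring

theorem affine_zero_pow (γ : Fˣ) (k : ℕ) (x : F) : ((affine γ (0 : F)) ^ k) x = (γ : F) ^ k * x := by
  induction k generalizing x with
  | zero => simp
  | succ k ih =>
    rw [pow_succ', Equiv.Perm.mul_apply, ih, affine_apply]
    ring

theorem isInstance_affine {p n : ℕ} (hp : p.Prime) [CharP F p] {γ : Fˣ} (hγ : orderOf γ = n)
    (hn : n ≠ 1) (hpn : Nat.Coprime p n) :
    IsInstance (1 : Fˣ) (1 : F) γ (0 : F) (0 : F) (1 : F) p n where
  order₁ := by
    have : Fact p.Prime := ⟨hp⟩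
    refine orderOf_eq_prime ?_ fun h => ?_
    · ext x
      rw [affine_one_pow, CharP.cast_eq_zero, add_zero]
      rfl
    · have := congrArg (fun σ : Equiv.Perm F => σ 0) h
      simp [affine_apply] at this
  order₂ := by
    rw [← hγ]
    refine orderOf_eq_orderOf_iff.2 fun k => ⟨fun h => ?_, fun h => ?_⟩
    · have := congrArg (fun σ : Equiv.Perm F => σ 1) h
      simp only [affine_zero_pow, mul_one, Equiv.Perm.one_apply] at this
      exact Units.ext (by simpa using this)
    · ext x
      rw [affine_zero_pow, ← Units.val_pow_eq_pow_val, h, Units.val_one, one_mul]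
      rfl
  coprime := hpn
  not_fixed₁ := by simp [affine_apply]
  not_fixed₂ := by
    rw [affine_apply, mul_one, add_zero]
    intro h
    refine hn ?_
    rw [← hγ, orderOf_eq_one_iff]
    exact Units.ext h

/-- The codewords are the beginnings of the words of the orbit. -/
theorem mem_code_iff {γ : Fˣ} {p n s t : ℕ} (hs : 0 < s) (ht : 0 < t) {c : Fin n → Fin p → F} :
    c ∈ code (affine 1 1) (affine γ 0) 0 1 p n s t ↔
      ∃ v ∈ words γ s t, ∀ j i, c j i = v ((j : ℕ) * p + (i : ℕ)) := by
  have hpt : ∀ k : ℕ, ![((affine (1 : Fˣ) (1 : F)) ^ k) 0, ((affine γ (0 : F)) ^ k) 1] =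
      ![(k : F), (γ : F) ^ k] := fun k => by
    rw [affine_one_pow, affine_zero_pow, zero_add, mul_one]
  constructor
  · rintro ⟨f, hf0, hf1, rfl⟩
    refine ⟨∑ d ∈ f.support, f.coeff d • monoWord γ (d 0) (d 1), ?_, fun j i => ?_⟩
    · refine Submodule.sum_mem _ fun d hd => Submodule.smul_mem _ _ (monoWord_mem γ ?_ ?_)
      · exact (MvPolynomial.monomial_le_degreeOf 0 hd).trans_lt hf0
      · exact (MvPolynomial.monomial_le_degreeOf 1 hd).trans_lt hf1
    · rw [ev, hpt, MvPolynomial.eval_eq', Finset.sum_apply]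
      refine Finset.sum_congr rfl fun d _ => ?_
      rw [Pi.smul_apply, monoWord_apply, Fin.prod_univ_two]
      simp
  · rintro ⟨v, hv, hc⟩
    let S : Submodule F (ℕ → F) :=
      { carrier := {v | ∃ f : MvPolynomial (Fin 2) F, (∀ d ∈ f.support, d 0 < s ∧ d 1 < t) ∧
          ∀ k : ℕ, v k = MvPolynomial.eval ![(k : F), (γ : F) ^ k] f}
        add_mem' := by
          classical
          rintro v v' ⟨f, h1, h2⟩ ⟨f', h1', h2'⟩
          refine ⟨f + f', fun d hd => ?_, fun k => by rw [Pi.add_apply, h2, h2', map_add]⟩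
          rcases Finset.mem_union.1 (MvPolynomial.support_add hd) with h | h
          · exact h1 d h
          · exact h1' d h
        zero_mem' := ⟨0, by simp, by simp⟩
        smul_mem' := by
          rintro z v ⟨f, h1, h2⟩
          refine ⟨z • f, fun d hd => h1 d (MvPolynomial.support_smul hd), fun k => ?_⟩
          rw [Pi.smul_apply, h2, MvPolynomial.smul_eval, smul_eq_mul] }
    have hS : words γ s t ≤ S := by
      refine words_le fun e he e' he' => ?_
      refine ⟨MvPolynomial.monomial (Finsupp.single 0 e + Finsupp.single 1 e') 1, fun d hd => ?_,
        fun k => ?_⟩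
      · have := Finset.mem_singleton.1 (MvPolynomial.support_monomial_subset hd)
        subst this
        simp [he, he']
      · rw [MvPolynomial.eval_monomial, monoWord_apply, one_mul,
          Finsupp.prod_fintype _ _ (by simp), Fin.prod_univ_two]
        simp
    obtain ⟨f, h1, h2⟩ := hS hv
    refine ⟨f, (MvPolynomial.degreeOf_lt_iff hs).2 fun d hd => (h1 d hd).1,
      (MvPolynomial.degreeOf_lt_iff ht).2 fun d hd => (h1 d hd).2, ?_⟩
    ext j i
    rw [hc, h2, ev, hpt]

/-- A code has as many words as there are polynomials. -/
theorem ncard_code [Fintype F] {γ : Fˣ} {p n s t : ℕ} [CharP F p] (hγ : orderOf γ = n)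
    (hpn : Nat.Coprime p n) (hs : 0 < s) (hsp : s ≤ p) (ht : 0 < t) (htn : t ≤ n) :
    (code (affine 1 1) (affine γ (0 : F)) 0 1 p n s t).ncard = Fintype.card F ^ (s * t) := by
  let φ : words γ s t → (Fin n → Fin p → F) := fun v j i => (v : ℕ → F) ((j : ℕ) * p + (i : ℕ))
  have hφ : Function.Injective φ := by
    intro v v' h
    have h1 : (v : ℕ → F) - v' = 0 := by
      refine words_eq_zero hγ hpn hsp (J := Finset.range n) (fun j hj => Finset.mem_range.1 hj)
        (by rwa [Finset.card_range]) (Submodule.sub_mem _ v.2 v'.2) fun j hj i hi => ?_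
      have := congrFun (congrFun h ⟨j, Finset.mem_range.1 hj⟩) ⟨i, hi.trans_le hsp⟩
      exact sub_eq_zero.2 this
    exact Subtype.ext (sub_eq_zero.1 h1)
  have hrange : code (affine 1 1) (affine γ (0 : F)) 0 1 p n s t = Set.range φ := by
    ext c
    rw [mem_code_iff hs ht]
    constructor
    · rintro ⟨v, hv, hc⟩
      exact ⟨⟨v, hv⟩, by ext j i; exact (hc j i).symm⟩
    · rintro ⟨v, rfl⟩
      exact ⟨v, v.2, fun j i => rfl⟩
  rw [hrange, ← Nat.card_coe_set_eq, Nat.card_range_of_injective hφ,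
    Module.natCard_eq_pow_finrank (K := F), finrank_words hγ hpn hsp htn, Nat.card_eq_fintype_card]

/-- The rate of a code. -/
theorem rate_code [Fintype F] {γ : Fˣ} {p n s t : ℕ} [CharP F p] (hγ : orderOf γ = n)
    (hpn : Nat.Coprime p n) (hs : 0 < s) (hsp : s ≤ p) (ht : 0 < t) (htn : t ≤ n) :
    rate (code (affine 1 1) (affine γ (0 : F)) 0 1 p n s t) = s * t / (p * n) := by
  have h1 : (1 : ℝ) < Fintype.card F := by exact_mod_cast Fintype.one_lt_card
  have hp : (p : ℝ) ≠ 0 := by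
    have : 0 < p := by omega
    positivity
  rw [rate, ncard_code hγ hpn hs hsp ht htn, Nat.card_eq_fintype_card, Fintype.card_fun,
    Fintype.card_fin]
  push_cast
  rw [Real.logb, Real.log_pow, Real.log_pow]
  have h2 := Real.log_pos h1
  push_cast
  field_simp

variable [DecidableEq F]

theorem flatten_apply {p n : ℕ} (γ : F) (r : Fin n → Fin p → F) (j : Fin n) (i : Fin p) :
    flatten γ r ((j : ℕ) * p + (i : ℕ)) = r j i := by
  have h1 : ((j : ℕ) * p + i) / p = j := pos_div i.2
  have h2 : ((j : ℕ) * p + i) % p = i := pos_mod i.2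
  have h3 : ((j : ℕ) * p + i + 1 - 1) / p < n ∧ ((j : ℕ) * p + i + 1 - 1) % p < p := by
    rw [Nat.add_sub_cancel, h1, h2]
    exact ⟨j.2, i.2⟩
  rw [flatten, State.input]
  simp only [if_neg (Nat.succ_ne_zero _), dif_pos h3]
  simp only [Nat.add_sub_cancel, h1, h2, Fin.eta]

theorem hammingDist_eq_colWeight {p n : ℕ} {c r : Fin n → Fin p → F} {d : ℕ → F}
    (hd : ∀ (j : Fin n) (i : Fin p), d ((j : ℕ) * p + (i : ℕ)) = c j i - r j i) :
    hammingDist c r = colWeight p n d := by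
  classical
  have : ∀ j : Fin n, c j ≠ r j ↔ ∃ i < p, d ((j : ℕ) * p + i) ≠ 0 := by
    intro j
    rw [Function.ne_iff]
    constructor
    · rintro ⟨i, hi⟩
      exact ⟨i, i.2, by rw [hd]; exact sub_ne_zero.2 hi⟩
    · rintro ⟨i, hi, h⟩
      exact ⟨⟨i, hi⟩, sub_ne_zero.1 (by rw [← hd]; exact h)⟩
  rw [hammingDist, colWeight]
  refine Finset.card_bij (fun j _ => (j : ℕ)) (fun j hj => ?_) (fun _ _ _ _ h => Fin.ext h)
    fun j hj => ?_
  · simp only [Finset.mem_filter, Finset.mem_univ, true_and] at hj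
    simpa using (this j).1 hj
  · simp only [Finset.mem_filter, Finset.mem_range] at hj
    exact ⟨⟨j, hj.1⟩, by simpa using (this ⟨j, hj.1⟩).2 hj.2, rfl⟩

end CodeWords

/-! ### Close codewords and the list size -/

section Close

variable {F : Type*} [Field F] [DecidableEq F] {γ : Fˣ} {p n s t w E₀ T₀ D D' : ℕ} [CharP F p]
  {r : Fin n → Fin p → F} {a₀ : ℕ → F} {a : ℕ → ℕ → F}

/-- The space of candidates that satisfy the recurrence. -/
def solSpace (γ : Fˣ) (r : ℕ → F) (a : ℕ → ℕ → F) (p n w E₀ s t : ℕ) : Submodule F (ℕ → F) :=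
  candSpace γ r a p (n * p) w E₀ s t ⊓ recZero F p (n * p) E₀

instance (r : ℕ → F) : FiniteDimensional F (solSpace γ r a p n w E₀ s t) :=
  Submodule.finiteDimensional_inf_left _ _

theorem card_zero_columns (x : ℕ → F) :
    colWeight p n x + ((Finset.range n).filter fun j => ∀ i < p, x (j * p + i) = 0).card = n := by
  have := Finset.card_filter_add_card_filter_not (s := Finset.range n)
    (fun j => ∀ i < p, x (j * p + i) = 0)
  rw [Finset.card_range] at this
  rw [colWeight, add_comm]
  convert this using 4
  push Not
  rfl

/-- A codeword that is close to the received word satisfies the recurrence. -/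
theorem IsRecurrence.exists_mem (hγ : orderOf γ = n) (hpn : Nat.Coprime p n)
    (hd : Design p n s t w E₀ T₀ D D')
    (hr : IsRecurrence γ (flatten (γ : F) r) p n w E₀ T₀ D D' a₀ a) {c : Fin n → Fin p → F}
    (hc : c ∈ code (affine 1 1) (affine γ 0) 0 1 p n s t) (hdist : hammingDist c r + T₀ ≤ n) :
    ∃ x ∈ solSpace γ (flatten (γ : F) r) a p n w E₀ s t, x 0 = 1 ∧
      ∀ (j : Fin n) (i : Fin p), x (1 + ((j : ℕ) * p + (i : ℕ))) = c j i - r j i := by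
  obtain ⟨f, hf, hfc⟩ := (mem_code_iff hd.s_pos hd.t_pos).1 hc
  have hx : ∀ k < n * p, candVec (flatten (γ : F) r) a p (n * p) w E₀ (1, f) (1 + k) =
      f k - flatten (γ : F) r k := fun k hk => by rw [candVec_word _ _ _ _ _ hk, one_mul]
  refine ⟨candVec (flatten (γ : F) r) a p (n * p) w E₀ (1, f),
    ⟨⟨(1, f), ⟨trivial, hf⟩, rfl⟩, fun k hk hkE => ?_⟩, rfl, fun j i => ?_⟩
  · rw [candVec_rec _ _ _ _ _ hk hkE]
    simp only [one_mul]
    have hw := hammingDist_eq_colWeight (c := c) (r := r) (d := fun k => f k - flatten (γ : F) r k)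
      fun j i => by rw [flatten_apply, hfc]
    have hcount := card_zero_columns (p := p) (n := n) fun k => f k - flatten (γ : F) r k
    refine hr.apply_close hγ hpn hd hf (J := (Finset.range n).filter fun j =>
      ∀ i < p, f (j * p + i) - flatten (γ : F) r (j * p + i) = 0) ?_ ?_ ?_ hk hkE
    · intro j hj
      exact Finset.mem_range.1 (Finset.mem_filter.1 hj).1
    · omega
    · intro j hj i hi
      exact sub_eq_zero.1 ((Finset.mem_filter.1 hj).2 i hi)
  · rw [hx _ (pos_lt j.2 i.2), flatten_apply, hfc]

/-- Every candidate with a nonzero multiple yields a codeword. -/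
theorem mem_code_of_mem_solSpace (hs : 0 < s) (ht : 0 < t) {v : ℕ → F}
    (hv : v ∈ solSpace γ (flatten (γ : F) r) a p n w E₀ s t) (h0 : v 0 ≠ 0)
    {c : Fin n → Fin p → F}
    (hc : ∀ (j : Fin n) (i : Fin p), c j i = v (1 + ((j : ℕ) * p + i)) * (v 0)⁻¹ + r j i) :
    c ∈ code (affine 1 1) (affine γ 0) 0 1 p n s t := by
  obtain ⟨⟨⟨z, f⟩, ⟨-, hf⟩, rfl⟩, -⟩ := hv
  rw [candVec_zero] at h0 hc
  refine (mem_code_iff hs ht).2 ⟨z⁻¹ • f, Submodule.smul_mem _ _ hf, fun j i => ?_⟩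
  rw [hc, candVec_word _ _ _ _ _ (pos_lt j.2 i.2), flatten_apply, Pi.smul_apply, smul_eq_mul]
  simp only at h0 ⊢
  field_simp
  ring

/-- If `κ` takes each of the `n` columns at least `μ` times, at least `(D' μ) ^ w` of the `w`-tuples
of arguments single out the vector of a codeword that is close to the received word. -/
theorem IsRecurrence.pow_le_card [Fintype F] (hγ : orderOf γ = n) (hcard : Fintype.card F = n + 1)
    (hn : 0 < n) (hpn : Nat.Coprime p n) (hd : Design p n s t w E₀ T₀ D D')
    (hr : IsRecurrence γ (flatten (γ : F) r) p n w E₀ T₀ D D' a₀ a) {c : Fin n → Fin p → F}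
    (hdist : hammingDist c r + T₀ ≤ n) {x : ℕ → F}
    (hx : x ∈ solSpace γ (flatten (γ : F) r) a p n w E₀ s t) (hx0 : x 0 = 1)
    (hxc : ∀ (j : Fin n) (i : Fin p), x (1 + ((j : ℕ) * p + (i : ℕ))) = c j i - r j i)
    {B : Type*} [Fintype B] (κ : B → ℕ) {μ : ℕ}
    (hμ : ∀ j : Fin n, μ ≤ Nat.card {b // κ b = j}) :
    (D' * μ) ^ w ≤ Nat.card {bs : Fin w → B // (∀ i, x ∈ colZero F p (κ (bs i))) ∧
      solSpace γ (flatten (γ : F) r) a p n w E₀ s t ⊓ ⨅ i, colZero F p (κ (bs i)) ≤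
        Submodule.span F {x}} := by
  classical
  have hxne : x ≠ 0 := by
    rintro rfl
    simp at hx0
  have hsp : s ≤ p := by
    have := hd.rows
    have := hd.window
    have := hd.w_pos
    omega
  have hdim := hr.finrank_le hγ hcard hn hpn hd
  refine pow_le_card_prune (fun b => colZero F p (κ b)) x hxne
    (solSpace γ (flatten (γ : F) r) a p n w E₀ s t) (D' * μ) ?_ w _ le_rfl hx (by
      rw [solSpace]
      omega)
  intro U hU hxU
  set J := (Finset.range n).filter fun j => ∀ i < p, x (1 + (j * p + i)) = 0 with hJ
  have hJcard : T₀ ≤ J.card := by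
    have h1 := hammingDist_eq_colWeight (d := fun k => x (1 + k)) hxc
    have h2 := card_zero_columns (p := p) (n := n) fun k => x (1 + k)
    rw [← hJ] at h2
    omega
  have hJn : ∀ j ∈ J, j < n := fun j hj => Finset.mem_range.1 (Finset.mem_filter.1 hj).1
  -- the columns that are useful for cutting down `U`
  set G := J.filter fun j => U ≤ Submodule.span F {x} ∨ ¬ U ≤ colZero F p j with hG
  have hGcard : D' ≤ G.card := by
    have h1 := hd.cols
    by_cases hline : U ≤ Submodule.span F {x}
    · have : G = J := Finset.filter_true_of_mem fun _ _ => Or.inl hline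
      rw [this]
      omega
    · have h2 := card_columns_lt (J := J.filter fun j => U ≤ colZero F p j) hγ hpn hsp
        (hU.trans inf_le_left) hxU hx0 hline (fun j hj => hJn j (Finset.mem_filter.1 hj).1)
        fun j hj => (Finset.mem_filter.1 hj).2
      have h3 := Finset.card_filter_add_card_filter_not (s := J) (fun j => U ≤ colZero F p j)
      have h4 : G = J.filter fun j => ¬ U ≤ colZero F p j :=
        Finset.filter_congr fun j _ => by simp [hline]
      rw [h4]
      omega
  rw [Nat.card_eq_fintype_card, Fintype.card_subtype]
  calc D' * μ ≤ G.card * μ := Nat.mul_le_mul_right _ hGcard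
    _ = μ * G.card := mul_comm _ _
    _ ≤ (Finset.univ.filter fun b => κ b ∈ G).card := by
      refine Finset.mul_card_image_le_card_of_maps_to
        (fun b hb => (Finset.mem_filter.1 hb).2) μ fun j hj => ?_
      refine (hμ ⟨j, hJn j (Finset.mem_filter.1 hj).1⟩).trans ?_
      rw [Nat.card_eq_fintype_card, Fintype.card_subtype]
      refine Finset.card_le_card fun b hb => ?_
      have hb' := (Finset.mem_filter.1 hb).2
      simp only at hb'
      simp [hb', hj]
    _ ≤ _ := by
      refine Finset.card_le_card fun b hb => ?_
      simp only [Finset.mem_filter, Finset.mem_univ, true_and, hG, hJ] at hb ⊢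
      exact ⟨mem_colZero.2 hb.1.2, hb.2⟩

/-- At most `(n / D') ^ w` codewords are close to the received word. -/
theorem IsRecurrence.card_mul_le [Fintype F] (hγ : orderOf γ = n) (hcard : Fintype.card F = n + 1)
    (hn : 0 < n) (hpn : Nat.Coprime p n) (hd : Design p n s t w E₀ T₀ D D')
    (hr : IsRecurrence γ (flatten (γ : F) r) p n w E₀ T₀ D D' a₀ a)
    {L : Finset (Fin n → Fin p → F)}
    (hL : ∀ c ∈ L, c ∈ code (affine 1 1) (affine γ 0) 0 1 p n s t ∧ hammingDist c r + T₀ ≤ n) :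
    L.card * D' ^ w ≤ n ^ w := by
  classical
  have hex := fun c (hc : c ∈ L) => hr.exists_mem hγ hpn hd (hL c hc).1 (hL c hc).2
  choose! x hx hx0 hxc using hex
  set A : (Fin n → Fin p → F) → Finset (Fin w → Fin n) := fun c =>
    Finset.univ.filter fun bs => (∀ i, x c ∈ colZero F p (bs i)) ∧
      solSpace γ (flatten (γ : F) r) a p n w E₀ s t ⊓ ⨅ i, colZero F p (bs i) ≤
        Submodule.span F {x c} with hA
  have h1 : ∀ c ∈ L, D' ^ w ≤ (A c).card := by
    intro c hc
    have := hr.pow_le_card hγ hcard hn hpn hd (hL c hc).2 (hx c hc) (hx0 c hc) (hxc c hc)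
      (fun j : Fin n => (j : ℕ)) (μ := 1) (fun j => by
        rw [Nat.succ_le_iff, Nat.card_pos_iff]
        exact ⟨⟨⟨j, rfl⟩⟩, inferInstance⟩)
    rw [mul_one, Nat.card_eq_fintype_card, Fintype.card_subtype] at this
    exact this
  have h2 : (L : Set (Fin n → Fin p → F)).PairwiseDisjoint A := by
    intro c hc c' hc' hne
    refine Finset.disjoint_left.2 fun bs hbs hbs' => hne ?_
    simp only [hA, Finset.mem_filter, Finset.mem_univ, true_and] at hbs hbs'
    have h3 : x c' ∈ solSpace γ (flatten (γ : F) r) a p n w E₀ s t ⊓ ⨅ i, colZero F p (bs i) :=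
      ⟨hx c' hc', (Submodule.mem_iInf _).2 hbs'.1⟩
    obtain ⟨z, hz⟩ := Submodule.mem_span_singleton.1 (hbs.2 h3)
    have h4 : z = 1 := by
      have := congrFun hz 0
      rwa [Pi.smul_apply, hx0 c hc, hx0 c' hc', smul_eq_mul, mul_one] at this
    rw [h4, one_smul] at hz
    ext j i
    have := hxc c hc j i
    rw [hz, hxc c' hc' j i] at this
    exact (sub_left_inj.1 this).symm
  calc L.card * D' ^ w ≤ ∑ c ∈ L, (A c).card := by
        rw [← smul_eq_mul]
        exact Finset.card_nsmul_le_sum _ _ _ h1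
    _ = (L.biUnion A).card := (Finset.card_biUnion h2).symm
    _ ≤ Fintype.card (Fin w → Fin n) := Finset.card_le_univ _
    _ = n ^ w := by simp

end Close

/-! ### The success probability -/

section Correct

variable {F : Type*} [Field F] [DecidableEq F] {P : Params}

theorem one_sub_pow_le {δ : ℝ} (h1 : δ ≤ 1) (M : ℕ) : (1 - δ) ^ M ≤ Real.exp (-(δ * M)) := by
  have h2 : 1 - δ ≤ Real.exp (-δ) := by
    have := Real.add_one_le_exp (-δ)
    linarith
  calc (1 - δ) ^ M ≤ Real.exp (-δ) ^ M := pow_le_pow_left₀ (by linarith) h2 M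
    _ = Real.exp (-(δ * M)) := by
      rw [← Real.exp_nat_mul]
      ring_nf

/-- The failure probability of all trials together, over all words of the list. -/
theorem card_mul_failure_le {e w la : ℕ} (he : 0 < e) {l α : ℝ} (hl : l ≤ (2 * e) ^ w) (hα : 0 < α)
    (hla : Real.logb 2 (1 / α) ≤ la) :
    l * (1 - 1 / (4 * e) ^ w) ^ ((la + 4 * e * w) * (4 * e) ^ w) ≤ α := by
  have he' : (0 : ℝ) < (4 * e) ^ w := by positivity
  have he1 : (1 : ℝ) ≤ e := by exact_mod_cast he
  have h1 : (1 : ℝ) / (4 * e) ^ w ≤ 1 := by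
    rw [div_le_one he']
    exact one_le_pow₀ (by linarith)
  have h2 := one_sub_pow_le h1 ((la + 4 * e * w) * (4 * e) ^ w)
  have h3 : (1 : ℝ) / (4 * e) ^ w * ((la + 4 * e * w) * (4 * e) ^ w : ℕ) = la + 4 * e * w := by
    push_cast
    field_simp
  rw [h3] at h2
  have h4 : ((2 : ℝ) * e) ^ w ≤ Real.exp (4 * e * w) := by
    have : (2 : ℝ) * e ≤ Real.exp (4 * e) := by
      have := Real.add_one_le_exp (4 * (e : ℝ))
      linarith
    calc ((2 : ℝ) * e) ^ w ≤ Real.exp (4 * e) ^ w := pow_le_pow_left₀ (by positivity) this w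
      _ = _ := by
        rw [← Real.exp_nat_mul]
        ring_nf
  have h5 : Real.exp (-la) ≤ α := by
    have h6 : Real.log (1 / α) ≤ la := by
      have h7 : Real.logb 2 (1 / α) * Real.log 2 = Real.log (1 / α) := by
        rw [Real.logb]
        field_simp
      rw [← h7]
      have h8 : Real.log 2 < 1 := by linarith [Real.log_two_lt_d9]
      have h9 : 0 < Real.log 2 := Real.log_pos one_lt_two
      have : (0 : ℝ) ≤ la := by positivity
      nlinarith
    rw [one_div, Real.log_inv] at h6
    rw [← Real.le_log_iff_exp_le hα]
    linarith
  have h0 : (0 : ℝ) ≤ (1 - 1 / (4 * e) ^ w) ^ ((la + 4 * e * w) * (4 * e) ^ w) :=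
    pow_nonneg (by linarith) _
  calc _ ≤ (2 * (e : ℝ)) ^ w * (1 - 1 / (4 * e) ^ w) ^ ((la + 4 * e * w) * (4 * e) ^ w) :=
        mul_le_mul_of_nonneg_right hl h0
    _ ≤ Real.exp (4 * e * w) * Real.exp (-(la + 4 * e * w)) :=
        mul_le_mul h4 h2 h0 (Real.exp_pos _).le
    _ = Real.exp (-la) := by
        rw [← Real.exp_add]
        ring_nf
    _ ≤ α := h5

/-- The trials of the algorithm, for a sequence of coins that singles out every close codeword in
some trial, produce the list of all close codewords. -/
theorem output_of_found (hP : P.Valid) {γ : Fˣ} [CharP F P.p]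
    {r : Fin P.n → Fin P.p → F} {a : ℕ → ℕ → F}
    {C : Set (Fin P.n → Fin P.p → F)}
    (hC : C = code (affine 1 1) (affine γ 0) 0 1 P.p P.n P.s P.t)
    {ω : ℕ → Bool} {N : ℕ} {o : ℕ → ℕ → F}
    (ho : P.Found (solSpace γ (flatten (γ : F) r) a P.p P.n P.w P.E₀ P.s P.t)
      (flatten (γ : F) r) ω P.M N o)
    (hall : ∀ c ∈ C, hammingDist c r ≤ P.thr → ∃ x : ℕ → F, x 0 = 1 ∧
      (∀ (j : Fin P.n) (i : Fin P.p), x (1 + ((j : ℕ) * P.p + (i : ℕ))) = c j i - r j i) ∧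
      ∃ τ < P.M, x ∈ P.pruned (solSpace γ (flatten (γ : F) r) a P.p P.n P.w P.E₀ P.s P.t) ω τ ∧
        P.pruned (solSpace γ (flatten (γ : F) r) a P.p P.n P.w P.E₀ P.s P.t) ω τ ≤
          Submodule.span F {x})
    {l : List (Fin P.n → Fin P.p → F)}
    (hl : l = (List.range N).map fun k (j : Fin P.n) (i : Fin P.p) => o k ((j : ℕ) * P.p + i)) :
    l.Nodup ∧ ∀ c, c ∈ l ↔ c ∈ C ∧ hammingDist c r ≤ P.thr := by
  have hN : P.n * P.p = P.N := rfl
  have hp : 0 < P.p := by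
    have := hP.design.rows
    have := hP.design.window
    have := hP.design.s_pos
    have := hP.design.w_pos
    omega
  subst hl
  constructor
  · refine List.Nodup.map_on (fun k hk k' hk' h => ?_) List.nodup_range
    rw [List.mem_range] at hk hk'
    have hsame : ∀ c < P.N, o k c = o k' c := by
      intro c hc
      have hj : c / P.p < P.n := Nat.div_lt_of_lt_mul (by rwa [mul_comm])
      have := congrFun (congrFun h ⟨c / P.p, hj⟩) ⟨c % P.p, Nat.mod_lt _ hp⟩
      simpa only [pos_eta] using this
    rcases lt_trichotomy k k' with h1 | h1 | h1
    · exact absurd hsame (ho.distinct k k' h1 hk')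
    · exact h1
    · exact absurd (fun c hc => (hsame c hc).symm) (ho.distinct k' k h1 hk)
  · intro c
    simp only [List.mem_map, List.mem_range]
    constructor
    · rintro ⟨k, hk, rfl⟩
      obtain ⟨v, hv, hv0, hwt, hok⟩ := ho.sound k hk
      constructor
      · rw [hC]
        exact mem_code_of_mem_solSpace hP.design.s_pos hP.design.t_pos hv hv0 (r := r)
          fun j i => by rw [hok _ (pos_lt j.2 i.2), flatten_apply]
      · rw [hammingDist_eq_colWeight (d := fun k => v (1 + k) * (v 0)⁻¹)]
        · exact hwt
        · intro j i
          rw [hok _ (pos_lt j.2 i.2), flatten_apply, add_sub_cancel_right]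
    · rintro ⟨hc, hdist⟩
      obtain ⟨x, hx0, hxc, τ, hτ, hxτ, hline⟩ := hall c hc hdist
      rw [hammingDist_eq_colWeight (d := fun k => x (1 + k)) hxc] at hdist
      obtain ⟨k, hk, hok⟩ := ho.complete τ hτ x hxτ hx0 hline hdist
      refine ⟨k, hk, ?_⟩
      ext j i
      rw [hok _ (pos_lt j.2 i.2), hxc, flatten_apply, sub_add_cancel]

/-- The decoder finds all close codewords with the required probability, if `D'` is at least `n / 2e`
and `la` bounds the logarithm of the reciprocal of the failure probability. -/
theorem listDecodesWithin_decoder [Fintype F] (hP : P.Valid) {γ : Fˣ} [CharP F P.p]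
    (hγ : orderOf γ = P.n) (hcard : Fintype.card F = P.n + 1) (hpn : Nat.Coprime P.p P.n)
    (hthr : P.thr ≤ P.n) (hD' : P.n ≤ 2 * P.e * P.D') {ρ α : ℝ}
    (hρ : ∀ d : ℕ, (d : ℝ) ≤ ρ * P.n ↔ d ≤ P.thr) (hα : 0 < α)
    (hla : Real.logb 2 (1 / α) ≤ P.la) :
    ListDecodesWithin decoder [P.p, P.q, P.s, P.t, P.thr, P.e, P.la] (γ : F)
      (code (affine 1 1) (affine γ 0) 0 1 P.p P.n P.s P.t) ρ α
      (decoderTime P.Z + P.M * P.w * P.q) := by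
  classical
  intro r
  set T := decoderTime P.Z + P.M * P.w * P.q with hT
  set C := code (affine (1 : Fˣ) (1 : F)) (affine γ 0) 0 1 P.p P.n P.s P.t with hC
  have hn : 0 < P.n := hP.n_pos
  have he := hP.e_pos
  obtain ⟨S, ⟨a₀, a, hrec, hS⟩, hruns⟩ := decoder_runs hP hγ hpn r
  have hS' : S = solSpace γ (flatten (γ : F) r) a P.p P.n P.w P.E₀ P.s P.t := hS
  subst hS'
  refine ⟨fun b => ?_, ?_⟩
  · obtain ⟨τ, ⟨U, hU, hex⟩, -⟩ := hruns (tape b)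
    exact ⟨τ, U, by omega, hex⟩
  set L : Finset (Fin P.n → Fin P.p → F) := Finset.univ.filter fun c =>
    c ∈ C ∧ hammingDist c r ≤ P.thr with hL
  have hLmem : ∀ c, c ∈ L ↔ c ∈ C ∧ hammingDist c r ≤ P.thr := fun c => by simp [hL]
  have hT₀ : P.T₀ = P.n - P.thr := rfl
  have hLT : ∀ c ∈ L, c ∈ C ∧ hammingDist c r + P.T₀ ≤ P.n := fun c hc =>
    ⟨((hLmem c).1 hc).1, by have := ((hLmem c).1 hc).2; omega⟩
  have hex := fun c (hc : c ∈ L) =>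
    hrec.exists_mem hγ hpn hP.design (hLT c hc).1 (hLT c hc).2
  choose! x hx hx0 hxc using hex
  have hD'pos : 0 < P.D' := by
    rcases Nat.eq_zero_or_pos P.D' with h | h
    · rw [h] at hD'
      omega
    · exact h
  have hLcard : (L.card : ℝ) ≤ (2 * P.e) ^ P.w := by
    have h1 := hrec.card_mul_le hγ hcard hn hpn hP.design hLT
    have h2 : L.card * P.D' ^ P.w ≤ (2 * P.e) ^ P.w * P.D' ^ P.w := by
      rw [← mul_pow]
      exact h1.trans (Nat.pow_le_pow_left hD' _)
    exact_mod_cast Nat.le_of_mul_le_mul_right h2 (by positivity)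
  set G : (Fin P.n → Fin P.p → F) → Set (Fin P.w → Fin P.q → Bool) := fun c =>
    {bs | (∀ i, x c ∈ colZero F P.p (sample P.n (tape (bs i)) P.q)) ∧
      solSpace γ (flatten (γ : F) r) a P.p P.n P.w P.E₀ P.s P.t ⊓
        ⨅ i, colZero F P.p (sample P.n (tape (bs i)) P.q) ≤ Submodule.span F {x c}} with hG
  have hGcard : ∀ c ∈ L, (1 / (4 * P.e) ^ P.w : ℝ) * 2 ^ (P.w * P.q) ≤ Nat.card (G c) := by
    intro c hc
    have h1 := hrec.pow_le_card hγ hcard hn hpn hP.design (hLT c hc).2 (hx c hc) (hx0 c hc)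
      (hxc c hc) (fun b : Fin P.q → Bool => sample P.n (tape b) P.q) (le_card_sample P.n P.q)
    have h2 : ((P.D' * (2 ^ P.q / P.n) : ℕ) : ℝ) ^ P.w ≤ Nat.card (G c) := by exact_mod_cast h1
    refine le_trans ?_ h2
    have h3 : 2 ^ P.q ≤ 4 * P.e * (P.D' * (2 ^ P.q / P.n)) := by
      have h4 : P.n ≤ 2 ^ P.q := by
        have : P.n = P.q - 1 := rfl
        have := P.q.lt_two_pow_self
        omega
      have h5 := Nat.div_add_mod (2 ^ P.q) P.n
      have h6 := Nat.mod_lt (2 ^ P.q) hn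
      have h7 : 1 ≤ 2 ^ P.q / P.n := Nat.div_pos h4 hn
      set Q := 2 ^ P.q / P.n
      have h8 : 2 ^ P.q ≤ 2 * (P.n * Q) := by nlinarith
      calc 2 ^ P.q ≤ 2 * (P.n * Q) := h8
        _ ≤ 2 * (2 * P.e * P.D' * Q) := by gcongr
        _ = _ := by ring
    have h3' : (2 : ℝ) ^ P.q ≤ 4 * P.e * (P.D' * (2 ^ P.q / P.n) : ℕ) := by exact_mod_cast h3
    rw [mul_comm P.w, pow_mul, one_div_mul_eq_div, ← div_pow]
    refine pow_le_pow_left₀ (by positivity) ?_ _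
    rw [div_le_iff₀ (by positivity)]
    linarith
  have hprob := le_card_trials (T := T) (M := P.M) (w := P.w) (q := P.q) (by omega) L G _ hGcard
  have hfail := card_mul_failure_le he hLcard hα hla
  have hM : P.M = (P.la + 4 * P.e * P.w) * (4 * P.e) ^ P.w := rfl
  rw [← hM] at hfail
  refine le_trans (mul_le_mul_of_nonneg_right (by linarith) (by positivity)) (hprob.trans ?_)
  refine Nat.cast_le.2 (Nat.card_le_card_of_injective
    (Subtype.map id fun b hb => ?_) (Subtype.map_injective _ Function.injective_id))
  obtain ⟨τ, ⟨U, hU, hex⟩, N, o, ho, hout⟩ := hruns (tape b)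
  have := output_of_found hP hC ho (fun c hc hdist => ?_) hout
  · refine ⟨τ, U, hex, this.1, fun c => (this.2 c).trans ?_⟩
    rw [closeWords, Set.mem_ofPred_eq, hρ]
  · have hcL := (hLmem c).2 ⟨hc, hdist⟩
    obtain ⟨t, ht, hb1, hb2⟩ := hb c hcL
    have hs : ∀ i : Fin P.w, sample P.n (tape (trialCoins P.w P.q b t i)) P.q =
        sample P.n (fun l => tape b ((t * P.w + i) * P.q + l)) P.q := fun i =>
      sample_congr fun l hl => by rw [tape, dif_pos hl]; rfl
    simp only [hs] at hb1 hb2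
    exact ⟨x c, hx0 c hcL, hxc c hcL, t, ht,
      ⟨hx c hcL, (Submodule.mem_iInf _).2 hb1⟩, hb2⟩

end Correct

/-! ### Choice of the parameters -/

section Estimates

/-- For `p` of order at least `1 / ε ^ 3` there are degree bounds with the required rate for which
interpolation is possible. -/
theorem exists_design {R ε : ℝ} (hR : 0 < R) (hε : 0 < ε) (hε2 : ε < 1 / 2) (hεR : ε < 1 - R)
    {p n e thr : ℕ} (hp : 1024 / ε ^ 3 ≤ p) (hpn : p ≤ n + 1) (he : e = ⌈1 / ε⌉₊)
    (hthr : thr = ⌊(1 - R - ε) * n⌋₊) :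
    ∃ s t : ℕ, s ≤ p ∧ Design p n s t (16 * e * e) (p + 1 - 16 * e * e) (n - thr)
      (p + 1 - 16 * e * e - s) (n - thr - t) ∧ thr ≤ n ∧ n ≤ 2 * e * (n - thr - t) ∧
      R ≤ (s : ℝ) * t / (p * n) ∧ (s : ℝ) * t / (p * n) < R + 1 / n := by
  have hε1 : 2 < 1 / ε := by rw [lt_div_iff₀ hε]; linarith
  have he1 : 1 / ε ≤ e := he ▸ Nat.le_ceil _
  have he2 : (e : ℝ) ≤ 2 / ε := by
    have : (e : ℝ) < 1 / ε + 1 := he ▸ Nat.ceil_lt_add_one (by positivity)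
    have h2 : 2 / ε = 1 / ε + 1 / ε := by ring
    linarith
  have heε : 1 ≤ e * ε := by rwa [div_le_iff₀ hε] at he1
  have heε2 : e * ε ≤ 2 := by rwa [le_div_iff₀ hε] at he2
  have hpε : 1024 ≤ p * ε ^ 3 := by rwa [div_le_iff₀ (by positivity)] at hp
  have hp0 : (0 : ℝ) < p := lt_of_lt_of_le (by positivity) hp
  have hpε1 : 2048 ≤ p * ε := by
    have : (p : ℝ) * ε ^ 3 ≤ p * ε * (1 / 4) := by
      have : ε ^ 2 ≤ (1 / 2) ^ 2 := pow_le_pow_left₀ hε.le hε2.le 2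
      have := mul_le_mul_of_nonneg_left this (mul_pos hp0 hε).le
      linarith
    linarith
  have hnp : (p : ℝ) ≤ n + 1 := by exact_mod_cast hpn
  have hnε : 8 ≤ n * ε := by
    have := mul_le_mul_of_nonneg_right hnp hε.le
    linarith
  have hn0 : (0 : ℝ) < n := by
    rcases Nat.eq_zero_or_pos n with h | h
    · rw [h] at hnε
      norm_num at hnε
    · exact_mod_cast h
  -- `w` lies between `16 / ε ^ 2` and `ε p / 16`
  set w := 16 * e * e with hw
  have hwR : (w : ℝ) = 16 * e * e := by rw [hw]; push_cast; ring
  have hw1 : 16 ≤ w * ε ^ 2 := by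
    have : 1 ≤ (e * ε) ^ 2 := one_le_pow₀ heε
    rw [hwR]
    linarith
  have hw2 : w ≤ ε * p / 16 := by
    have h1 : w * ε ^ 2 ≤ 64 := by
      have : (e * ε) ^ 2 ≤ 2 ^ 2 := pow_le_pow_left₀ (by positivity) heε2 2
      rw [hwR]
      linarith
    have h2 : w * ε ^ 2 ≤ ε * p / 16 * ε ^ 2 := by linarith
    exact le_of_mul_le_mul_right h2 (by positivity)
  have hεp : ε * p ≤ 1 / 2 * p := mul_le_mul_of_nonneg_right hε2.le hp0.le
  have hwp : w ≤ p := by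
    have : (w : ℝ) ≤ p := by linarith
    exact_mod_cast this
  have hw0 : 0 < w := by
    rcases Nat.eq_zero_or_pos w with h | h
    · rw [h] at hw1
      norm_num at hw1
    · exact h
  -- the degree bound of the coefficients of the recurrence
  set D := ⌈ε * p / 8⌉₊ with hD
  have hD1 : ε * p / 8 ≤ D := Nat.le_ceil _
  have hD2 : (D : ℝ) < ε * p / 8 + 1 := Nat.ceil_lt_add_one (by positivity)
  have hDs : D + w < p + 1 := by
    have : (D : ℝ) + w < p + 1 := by linarith
    exact_mod_cast this
  obtain ⟨s, hs⟩ : ∃ s, s = p + 1 - w - D := ⟨_, rfl⟩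
  have hsR : (s : ℝ) = p + 1 - w - D := by
    have : s + w + D = p + 1 := by omega
    have : (s : ℝ) + w + D = p + 1 := by exact_mod_cast this
    linarith
  have hs1 : p * (1 - 3 / 16 * ε) ≤ s := by rw [hsR]; linarith
  have hs0 : (0 : ℝ) < s := lt_of_lt_of_le (mul_pos hp0 (by linarith)) hs1
  have hsp : (s : ℝ) ≤ p := by
    have : s ≤ p := by omega
    exact_mod_cast this
  -- the rate determines the degree in `y`
  set t := ⌈R * p * n / s⌉₊ with ht
  have ht1 : R * p * n / s ≤ t := Nat.le_ceil _
  have ht2 : (t : ℝ) < R * p * n / s + 1 := Nat.ceil_lt_add_one (by positivity)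
  have ht3 : R * p * n / s ≤ R * n + 3 / 8 * ε * n := by
    rw [div_le_iff₀ hs0]
    have h1 : p ≤ (1 + 3 / 8 * ε) * s := by
      have : (1 : ℝ) ≤ (1 + 3 / 8 * ε) * (1 - 3 / 16 * ε) := by
        have : 0 ≤ ε * (1 - 3 / 8 * ε) := mul_nonneg hε.le (by linarith)
        linarith
      calc (p : ℝ) ≤ p * ((1 + 3 / 8 * ε) * (1 - 3 / 16 * ε)) := le_mul_of_one_le_right hp0.le this
        _ = (1 + 3 / 8 * ε) * (p * (1 - 3 / 16 * ε)) := by ring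
        _ ≤ _ := mul_le_mul_of_nonneg_left hs1 (by positivity)
    calc R * p * n ≤ R * ((1 + 3 / 8 * ε) * s) * n := by gcongr
      _ = (R * n + 3 / 8 * ε * (n * R)) * s := by ring
      _ ≤ _ := by
        have : (n : ℝ) * R ≤ n := mul_le_of_le_one_right hn0.le (by linarith)
        have : 3 / 8 * ε * (n * R) ≤ 3 / 8 * ε * n := mul_le_mul_of_nonneg_left this (by positivity)
        exact mul_le_mul_of_nonneg_right (by linarith) hs0.le
  have hthr0 : 0 ≤ (1 - R - ε) * n := mul_nonneg (by linarith) hn0.le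
  have hthr1 : (thr : ℝ) ≤ (1 - R - ε) * n := hthr ▸ Nat.floor_le hthr0
  have hthr3 : (thr : ℝ) < n := by
    have : 0 < (R + ε) * n := by positivity
    linarith
  have hthr2 : thr ≤ n := by
    exact_mod_cast (hthr3.le : (thr : ℝ) ≤ n)
  have hD'1 : ε * n / 2 ≤ n - thr - t := by linarith
  have hD'0 : t ≤ n - thr := by
    have : 0 ≤ ε * n / 2 := by positivity
    have : (t : ℝ) + thr ≤ n := by linarith
    have : t + thr ≤ n := by exact_mod_cast this
    omega
  have hD'R : ((n - thr - t : ℕ) : ℝ) = n - thr - t := by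
    rw [Nat.cast_sub hD'0, Nat.cast_sub hthr2]
  rw [← hD'R] at hD'1
  set D' := n - thr - t with hD'
  have hDE : p + 1 - w - s = D := by omega
  refine ⟨s, t, by exact_mod_cast hsp, ⟨by exact_mod_cast hs0, ?_, hw0, by omega, by omega,
    by omega, by omega, ?_⟩, hthr2, ?_, ?_, ?_⟩
  · exact Nat.ceil_pos.2 (by positivity)
  · rw [hDE]
    have h1 : (n : ℝ) * p ≤ w * (D * D') := by
      have h2 : ε * p / 8 * (ε * n / 2) ≤ D * D' := by gcongr
      calc (n : ℝ) * p ≤ (w * ε ^ 2) / 16 * (n * p) := by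
            exact le_mul_of_one_le_left (by positivity) (by linarith)
        _ = w * (ε * p / 8 * (ε * n / 2)) := by ring
        _ ≤ _ := by gcongr
    have h3 : (thr : ℝ) * (p + 1 - w : ℕ) < w * (D * D') := by
      refine lt_of_lt_of_le ?_ h1
      have h4 : ((p + 1 - w : ℕ) : ℝ) ≤ p := by
        have : p + 1 - w ≤ p := by omega
        exact_mod_cast this
      exact (mul_le_mul_of_nonneg_left h4 (by positivity)).trans_lt
        (mul_lt_mul_of_pos_right hthr3 hp0)
    have h7 : thr * (p + 1 - w) < w * (D * D') := by exact_mod_cast h3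
    have h8 : n = (n - thr) + thr := by omega
    calc n * (p + 1 - w) = (p + 1 - w) * (n - thr) + thr * (p + 1 - w) := by
          conv_lhs => rw [h8]
          ring
      _ < _ := Nat.add_lt_add_left h7 _
  · have h1 : (n : ℝ) ≤ 2 * e * D' := by
      calc (n : ℝ) ≤ (e * ε) * n := le_mul_of_one_le_left hn0.le heε
        _ = 2 * e * (ε * n / 2) := by ring
        _ ≤ _ := by gcongr
    exact_mod_cast h1
  · rw [le_div_iff₀ (by positivity)]
    rw [div_le_iff₀ hs0] at ht1
    linarith
  · have h1 : s * (t : ℝ) < R * p * n + s := by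
      calc s * (t : ℝ) < s * (R * p * n / s + 1) := by gcongr
        _ = _ := by field_simp
    rw [div_lt_iff₀ (by positivity)]
    have h2 : (R + 1 / n) * (p * n) = R * p * n + p := by field_simp
    rw [h2]
    linarith

/-- The reciprocal of the lower bound for the success probability of one trial is at most the bound
for the list size. -/
theorem four_mul_pow_le {ε : ℝ} (hε : 0 < ε) (hε2 : ε < 1 / 2) {e : ℕ} (he : e = ⌈1 / ε⌉₊) :
    (4 * e : ℝ) ^ (16 * e * e) ≤ (1 / ε) ^ (256 / ε ^ 2) ∧ (e : ℝ) ≤ 2 * (1 / ε) := by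
  have hε1 : 2 < 1 / ε := by rw [lt_div_iff₀ hε]; linarith
  have he2 : (e : ℝ) ≤ 2 * (1 / ε) := by
    have : (e : ℝ) < 1 / ε + 1 := he ▸ Nat.ceil_lt_add_one (by positivity)
    linarith
  refine ⟨?_, he2⟩
  set y := 1 / ε with hy
  have h1 : 256 / ε ^ 2 = 4 * (64 * y ^ 2) := by rw [hy]; ring
  rw [h1, Real.rpow_mul (by positivity), ← Real.rpow_natCast]
  have h2 : (1 : ℝ) ≤ y ^ (4 : ℝ) := Real.one_le_rpow (by linarith) (by norm_num)
  have h3 : (4 * e : ℝ) ≤ y ^ (4 : ℝ) := by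
    rw [show (4 : ℝ) = (4 : ℕ) by norm_num, Real.rpow_natCast]
    have : 8 * y ≤ y ^ 4 := by
      have : 8 ≤ y ^ 3 := by
        calc (8 : ℝ) = 2 ^ 3 := by norm_num
          _ ≤ y ^ 3 := by gcongr
      nlinarith
    push_cast
    linarith
  calc (4 * e : ℝ) ^ ((16 * e * e : ℕ) : ℝ) ≤ (y ^ (4 : ℝ)) ^ ((16 * e * e : ℕ) : ℝ) :=
        Real.rpow_le_rpow (by positivity) h3 (by positivity)
    _ ≤ (y ^ (4 : ℝ)) ^ (64 * y ^ 2) := by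
        refine Real.rpow_le_rpow_of_exponent_le h2 ?_
        push_cast
        have : (0 : ℝ) ≤ e := by positivity
        nlinarith

/-- The running time is polynomial in any `X` that bounds the input numbers and the number of trials
needed for constant failure probability. -/
theorem time_le (P : Params) {K₀ d₀ : ℕ} (hK : ∀ Z, decoderTime Z ≤ K₀ * (Z + 1) ^ d₀) {X : ℝ}
    (hX : 1 ≤ X) (hp : (P.p : ℝ) ≤ X) (hq : (P.q : ℝ) ≤ X) (he : (P.e : ℝ) ≤ 2 * X)
    (hla : (P.la : ℝ) ≤ 2 * X) (hL : (4 * P.e : ℝ) ^ P.w ≤ X) :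
    ((decoderTime P.Z + P.M * P.w * P.q : ℕ) : ℝ) ≤
      (K₀ * 6001 ^ d₀ + 33000 : ℝ) * X ^ (8 * d₀ + 8) := by
  have hX0 : 0 ≤ X := by linarith
  have hmono : ∀ {i j : ℕ}, i ≤ j → X ^ i ≤ X ^ j := fun h => pow_le_pow_right₀ hX h
  have h2 := hmono (show 2 ≤ 4 by omega)
  have h3 := hmono (show 3 ≤ 4 by omega)
  have h0 := hmono (show 0 ≤ 4 by omega)
  have h1 := hmono (show 1 ≤ 8 by omega)
  have h4 := hmono (show 4 ≤ 8 by omega)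
  have h08 := hmono (show 0 ≤ 8 by omega)
  rw [pow_zero] at h0 h08
  rw [pow_one] at h1
  have hw : (P.w : ℝ) ≤ 64 * X ^ 2 := by
    rw [Params.w]
    push_cast
    calc (16 * P.e * P.e : ℝ) ≤ 16 * (2 * X) * (2 * X) := by gcongr
      _ = _ := by ring
  have hN : (P.N : ℝ) ≤ X ^ 2 := by
    rw [Params.N, Params.n]
    push_cast
    calc ((P.q - 1 : ℕ) : ℝ) * P.p ≤ X * X := by
          gcongr
          exact le_trans (by exact_mod_cast Nat.sub_le _ _) hq
      _ = _ := by ring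
  have hM : (P.M : ℝ) ≤ 514 * X ^ 4 := by
    rw [Params.M]
    push_cast
    calc ((P.la + 4 * P.e * P.w) * (4 * P.e) ^ P.w : ℝ)
        ≤ (2 * X + 4 * (2 * X) * (64 * X ^ 2)) * X := by gcongr
      _ = 2 * X ^ 2 + 512 * X ^ 4 := by ring
      _ ≤ _ := by linarith
  have hR : (P.R₄ : ℝ) ≤ 77 * X ^ 4 := by
    rw [Params.R₄, Params.R₃, Params.R₂, Params.N₂, Params.N₁]
    push_cast
    calc (8 + (P.w + 1) * P.N + (P.N + 1) + (P.N + 1) : ℝ)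
        ≤ 8 + (64 * X ^ 2 + 1) * X ^ 2 + (X ^ 2 + 1) + (X ^ 2 + 1) := by gcongr
      _ = 10 + 3 * X ^ 2 + 64 * X ^ 4 := by ring
      _ ≤ _ := by linarith
  have hW : (P.W : ℝ) ≤ 67 * X ^ 4 := by
    rw [Params.W]
    push_cast
    calc ((P.w + 3) * P.N : ℝ) ≤ (64 * X ^ 2 + 3) * X ^ 2 := by gcongr
      _ = 3 * X ^ 2 + 64 * X ^ 4 := by ring
      _ ≤ _ := by linarith
  have hZ : (P.Z : ℝ) + 1 ≤ 6001 * X ^ 8 := by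
    rw [Params.Z]
    push_cast
    calc (P.R₄ * P.W + P.M + P.q + P.la + 1 : ℝ)
        ≤ 77 * X ^ 4 * (67 * X ^ 4) + 514 * X ^ 4 + X + 2 * X + 1 := by gcongr
      _ = 5159 * X ^ 8 + 514 * X ^ 4 + 3 * X + 1 := by ring
      _ ≤ _ := by linarith
  have hT1 : (decoderTime P.Z : ℝ) ≤ K₀ * 6001 ^ d₀ * X ^ (8 * d₀ + 8) := by
    calc (decoderTime P.Z : ℝ) ≤ K₀ * ((P.Z : ℝ) + 1) ^ d₀ := by exact_mod_cast hK P.Z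
      _ ≤ K₀ * (6001 * X ^ 8) ^ d₀ := by gcongr
      _ = K₀ * 6001 ^ d₀ * X ^ (8 * d₀) := by
        rw [mul_pow, ← pow_mul]
        ring
      _ ≤ _ := by
        gcongr
        omega
  have hT2 : (P.M * P.w * P.q : ℝ) ≤ 33000 * X ^ (8 * d₀ + 8) := by
    calc (P.M * P.w * P.q : ℝ) ≤ 514 * X ^ 4 * (64 * X ^ 2) * X := by gcongr
      _ = 32896 * X ^ 7 := by ring
      _ ≤ 33000 * X ^ 7 := by gcongr; norm_num
      _ ≤ _ := by
        gcongr
        omega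
  push_cast
  linarith

end Estimates

theorem charP_of_card {F : Type*} [Field F] [Fintype F] {p a : ℕ} (hp : p.Prime)
    (h : Fintype.card F = p ^ a) : CharP F p := by
  obtain ⟨p', hp'⟩ := CharP.exists F
  obtain ⟨k, hk, hk'⟩ := FiniteField.card F p'
  have : p' = p := by
    have h1 : p' ∣ p ^ a := by
      rw [← h, hk']
      exact dvd_pow_self _ k.ne_zero
    exact (Nat.prime_dvd_prime_iff_eq hk hp).1 (hk.dvd_of_dvd_pow h1)
  rwa [← this]

end PPC

theorem theorem3 :
    -- absolute constants, and one program for all parameters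
    ∃ (c₁ c K : ℝ) (d : ℕ) (P : PPC.Program), 0 < c₁ ∧ 0 < c ∧ 0 < K ∧
    ∀ c₂ : ℝ, ∀ R : ℝ, 0 < R → R < 1 → ∃ ε₀ : ℝ, 0 < ε₀ ∧ ∀ ε : ℝ, 0 < ε → ε < ε₀ →
    -- all powers `q = |F|` of a prime `p` of order `1 / ε ^ 3`
    ∀ p : ℕ, p.Prime → c₁ / ε ^ 3 ≤ p → p ≤ c₂ / ε ^ 3 →
    ∀ (F : Type*) [Field F] [Fintype F] [DecidableEq F] (a q : ℕ),
      q = p ^ a → Fintype.card F = q →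
    -- `ℓ₁ = x + 1` and `ℓ₂ = γ x` for any primitive element `γ`, with the base points `0` and `1`
    ∀ γ : Fˣ, orderOf γ = q - 1 →
    PPC.IsInstance (1 : Fˣ) (1 : F) γ (0 : F) (0 : F) (1 : F) p (q - 1) ∧
    ∃ s t : ℕ, 0 < s ∧ s ≤ p ∧ 0 < t ∧ t ≤ q - 1 ∧
    ∃ C : Set (Fin (q - 1) → Fin p → F),
      C = PPC.code (PPC.affine 1 1) (PPC.affine γ 0) 0 1 p (q - 1) s t ∧
      -- the alphabet size
      (Nat.card (Fin p → F) : ℝ) ≤ (q : ℝ) ^ (c₂ / ε ^ 3) ∧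
      -- the rate
      R ≤ PPC.rate C ∧ PPC.rate C < R + 1 / ((q : ℝ) - 1) ∧
      -- the list size `L = (1 / ε) ^ (c / ε ^ 2)`
      PPC.ListDecodable C (1 - R - ε) ((1 / ε) ^ (c / ε ^ 2)) ∧
      -- the decoder, for every failure probability `α`
      ∀ α : ℝ, 0 < α → α < 1 →
        ∃ T : ℕ,
          (T : ℝ) ≤ K * (Real.log (1 / α) + 1 / ε + q + (1 / ε) ^ (c / ε ^ 2)) ^ d ∧
          PPC.ListDecodesWithin P
            [p, q, s, t, ⌊(1 - R - ε) * ((q : ℝ) - 1)⌋₊, ⌈1 / ε⌉₊, ⌈Real.logb 2 (1 / α)⌉₊]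
            (γ : F) C (1 - R - ε) α T := by
  obtain ⟨K₀, d₀, hK⟩ := PPC.polyBdd_decoderTime
  refine ⟨1024, 256, K₀ * 6001 ^ d₀ + 33000, 8 * d₀ + 8, PPC.decoder, by norm_num, by norm_num,
    by positivity, fun c₂ R hR hR1 => ⟨min (1 / 2) (1 - R), lt_min (by norm_num) (by linarith), ?_⟩⟩
  intro ε hε hεmin p hp hp1 hp2 F _ _ _ a q hq hcard γ hγ
  have hε2 : ε < 1 / 2 := hεmin.trans_le (min_le_left _ _)
  have hεR : ε < 1 - R := hεmin.trans_le (min_le_right _ _)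
  have hchar : CharP F p := PPC.charP_of_card hp (hcard.trans hq)
  have hq1 : 1 < q := hcard ▸ Fintype.one_lt_card
  have ha : a ≠ 0 := by
    rintro rfl
    rw [pow_zero] at hq
    omega
  have hpq : p ≤ q := hq ▸ Nat.le_self_pow ha p
  have hp3 : 3 < p := by
    have h1 : (1024 : ℝ) ≤ 1024 / ε ^ 3 := by
      rw [le_div_iff₀ (by positivity)]
      have : ε ^ 3 ≤ 1 := pow_le_one₀ hε.le (by linarith)
      linarith
    have h2 : (1024 : ℝ) ≤ p := h1.trans hp1
    have h3 : 1024 ≤ p := by exact_mod_cast h2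
    omega
  have hcop : Nat.Coprime p (q - 1) := by
    refine (hp.coprime_iff_not_dvd).2 fun hdvd => ?_
    have h1 : p ∣ q := hq ▸ dvd_pow_self p ha
    have h2 : p ∣ q - (q - 1) := Nat.dvd_sub h1 hdvd
    rw [show q - (q - 1) = 1 by omega] at h2
    exact hp.one_lt.ne' (Nat.dvd_one.1 h2)
  have hcast : ((q - 1 : ℕ) : ℝ) = (q : ℝ) - 1 := by
    rw [Nat.cast_sub hq1.le, Nat.cast_one]
  have hcard' : Fintype.card F = (q - 1) + 1 := by omega
  refine ⟨PPC.isInstance_affine hp hγ (by omega) hcop, ?_⟩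
  rw [← hcast]
  obtain ⟨s, t, hsp, hd, hthr, hD', hrate1, hrate2⟩ := PPC.exists_design hR hε hε2 hεR hp1
    (n := q - 1) (by omega) rfl rfl
  set e := ⌈1 / ε⌉₊ with he
  set thr := ⌊(1 - R - ε) * ((q - 1 : ℕ) : ℝ)⌋₊ with hthr'
  have hn0 : 0 < q - 1 := by omega
  have he0 : 0 < e := Nat.ceil_pos.2 (by positivity)
  have htn : t ≤ q - 1 := by
    have := hd.cols
    have := hd.cols_le
    omega
  have hrate := PPC.rate_code hγ hcop hd.s_pos hsp hd.t_pos htn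
  have hρ : ∀ d : ℕ, (d : ℝ) ≤ (1 - R - ε) * ((q - 1 : ℕ) : ℝ) ↔ d ≤ thr := fun d =>
    (Nat.le_floor_iff (mul_nonneg (by linarith) (by positivity))).symm
  have hvalid : ∀ la, (⟨p, q, s, t, thr, e, la⟩ : PPC.Params).Valid := fun la => ⟨he0, hq1, hd⟩
  obtain ⟨hL, he2⟩ := PPC.four_mul_pow_le hε hε2 he
  refine ⟨s, t, hd.s_pos, hsp, hd.t_pos, htn, _, rfl, ?_, ?_, ?_, ?_, ?_⟩
  · rw [Nat.card_eq_fintype_card, Fintype.card_fun, Fintype.card_fin, hcard]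
    push_cast
    rw [← Real.rpow_natCast]
    exact Real.rpow_le_rpow_of_exponent_le (by exact_mod_cast hq1.le) hp2
  · rw [hrate]
    exact hrate1
  · rw [hrate]
    exact hrate2
  · intro r
    refine le_trans ?_ hL
    obtain ⟨-, ⟨a₀, b, hrec, -⟩, -⟩ := PPC.decoder_runs (hvalid 0) hγ hcop r
    rw [Set.ncard_eq_toFinset_card _ (Set.toFinite _)]
    have h1 := PPC.IsRecurrence.card_mul_le (r := r) hγ hcard' hn0 hcop hd hrec
      (L := (Set.toFinite (PPC.closeWords (PPC.code (PPC.affine 1 1) (PPC.affine γ 0) 0 1 p (q - 1)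
        s t) (1 - R - ε) r)).toFinset) fun c hc => by
          obtain ⟨h2, h3⟩ := (Set.Finite.mem_toFinset _).1 hc
          have := (hρ _).1 h3
          exact ⟨h2, by omega⟩
    have hD'0 : 0 < q - 1 - thr - t := by
      rcases Nat.eq_zero_or_pos (q - 1 - thr - t) with h | h
      · rw [h] at hD'
        omega
      · exact h
    have h2 := Nat.le_of_mul_le_mul_right (h1.trans ((Nat.pow_le_pow_left hD' _).trans_eq
      (mul_pow _ _ _))) (by positivity)
    have h3 : (2 * e) ^ (16 * e * e) ≤ (4 * e) ^ (16 * e * e) :=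
      Nat.pow_le_pow_left (by omega) _
    exact_mod_cast h2.trans h3
  · intro α hα hα1
    set la := ⌈Real.logb 2 (1 / α)⌉₊ with hla
    have hlog : 0 ≤ Real.log (1 / α) := Real.log_nonneg ((one_le_div hα).2 hα1.le)
    have hlogb : Real.logb 2 (1 / α) ≤ 2 * Real.log (1 / α) := by
      rw [Real.logb, div_le_iff₀ (Real.log_pos one_lt_two)]
      have := Real.log_two_gt_d9
      nlinarith
    have hlogb0 : 0 ≤ Real.logb 2 (1 / α) :=
      Real.logb_nonneg one_lt_two ((one_le_div hα).2 hα1.le)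
    have hla1 := Nat.ceil_lt_add_one hlogb0
    rw [← hla] at hla1
    have hpow : (0 : ℝ) < (1 / ε) ^ (256 / ε ^ 2) := by positivity
    have hε0 : 0 < 1 / ε := by positivity
    have hqR : (1 : ℝ) ≤ q := by exact_mod_cast hq1.le
    have hpqR : (p : ℝ) ≤ q := by exact_mod_cast hpq
    refine ⟨_, ?_, PPC.listDecodesWithin_decoder (hvalid la) hγ hcard' hcop hthr hD' hρ hα
      (Nat.le_ceil _)⟩
    refine PPC.time_le ⟨p, q, s, t, thr, e, la⟩ hK ?_ ?_ ?_ ?_ ?_ ?_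
    · linarith
    · change (p : ℝ) ≤ _
      linarith
    · change (q : ℝ) ≤ _
      linarith
    · change (e : ℝ) ≤ _
      linarith
    · change (la : ℝ) ≤ _
      linarith
    · refine hL.trans ?_
      linarith
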